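/- Let $n\ge 2$, $N\ge 1$, let $\Omega\subset\mathbb R^n$ be bounded and open, $T>0$, $\Omega_T:=\Omega\times(0,T)$, and write $\boldsymbol u^m:=|u|^{m-1}u$ for $u\in\mathbb R^N$ and $D=D_x$ for the (weak) derivative in the spatial variables. Let $\mathbf A\colon\Omega_T\times\mathbb R^N\times\mathbb R^{Nn}\to\mathbb R^{Nn}$ be a Carathéodory function (measurable in $(x,t)$ for all $(u,\xi)$ and continuous in $(u,\xi)$ for a.e. $(x,t)$) such that, for some constants $0<\nu\le L<\infty$ and $\mu>0$, for a.e. $(x,t)\in\Omega_T$ and all $(u,\xi),(v,\eta)\in\mathbb R^N\times\mathbb R^{Nn}$, $$\mathbf A(x,t,u,\xi)\cdot\xi\ge\nu|\xi|^2,\qquad |\mathbf A(x,t,u,\xi)|\le L|\xi|,\qquad \big(\mathbf A(x,t,u,\xi)-\mathbf A(x,t,v,\eta)\big)\cdot(\xi-\eta)\ge\mu|\xi-\eta|^2 .$$ For $m>0$, a measurable map $u\colon\Omega_T\to\mathbb R^N$ is called a weak solution with exponent $m$ if $\boldsymbol u^m\in L^2_{\rm loc}(0,T;W^{1,2}_{\rm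 loc}(\Omega,\mathbb R^N))$, in case $m<1$ also $u\in L^{m+1}_{\rm loc}(\Omega_T,\mathbb R^N)$, and $$\iint_{\Omega_T}\big[-u\cdot\partial_t\varphi+\mathbf A(x,t,u,D\boldsymbol u^m)\cdot D\varphi\big]\,dx\,dt=0\qquad\text{for all }\varphi\in C_0^\infty(\Omega_T,\mathbb R^N).$$ Let $m_c:=\frac{(n-2)_+}{n+2}$, and let $(m_i)_{i\in\mathbb N}$ be a sequence in $(m_c,\infty)$ with $m_i\to m\in(m_c,\infty)$. For each $i$ let $u_i$ be a weak solution with exponent $m_i$. Assume that there is a measurable $u\colon\Omega_T\to\mathbb R^N$ with $$\boldsymbol u_i^{m_i}\rightharpoonup\boldsymbol u^m\quad\text{weakly in }L^2_{\rm loc}(\Omega_T,\mathbb R^N),$$ and, if $m<1$, assume in addition that $\boldsymbol u_i^{m_i+1}$ is bounded in $L^1_{\rm loc}(\Omega_T,\mathbb R^N)$, i.e. $\sup_{i}\iint_K|u_i|^{m_i+1}\,dx\,dt<\infty$ for every compact $K\subset\Omega_T$. Then $\boldsymbol u^m\in L^2_{\rm loc}(0,T;W^{1,2}_{\rm loc}(\Omega,\mathbb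 R^N))$, $$\boldsymbol u_i^{m_i}\longrightarrow\boldsymbol u^m\quad\text{strongly in }L^2_{\rm loc}(0,T;W^{1,2}_{\rm loc}(\Omega,\mathbb R^N)),$$ and $u$ is a weak solution with exponent $m$. -/

import Mathlib

open MeasureTheory Filter Topology Set
open scoped ContDiff ENNReal NNReal

noncomputable section

namespace PorousMedium

/-- Points `(x, t)` of space-time `ℝⁿ × ℝ`. -/
abbrev SpaceTime (n : ℕ) : Type := EuclideanSpace ℝ (Fin n) × ℝ

/-- The target space `ℝᴺ`. -/
abbrev Vec (N : ℕ) : Type := EuclideanSpace ℝ (Fin N)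

/-- The space `ℝᴺⁿ` of `N × n` matrices with the Euclidean (Frobenius) scalar product; the entry
`(k, j)` of a spatial derivative is the `j`-th spatial derivative of the `k`-th component. -/
abbrev Grad (N n : ℕ) : Type := EuclideanSpace ℝ (Fin N × Fin n)

/-- The cylinder `Ω_T = Ω × (0,T)`. -/
def cylinder {n : ℕ} (Ω : Set (EuclideanSpace ℝ (Fin n))) (T : ℝ) : Set (SpaceTime n) :=
  Ω ×ˢ Ioo (0 : ℝ) T

/-- The power `|u|^(m-1) u` of a vector `u`. -/
def vpow {N : ℕ} (m : ℝ) (u : Vec N) : Vec N := ‖u‖ ^ (m - 1) • u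

/-- The critical exponent `m_c = (n-2)₊ / (n+2)`. -/
def criticalExponent (n : ℕ) : ℝ := max ((n : ℝ) - 2) 0 / ((n : ℝ) + 2)

/-- `f ∈ L^p_loc(U)` for an open set `U` of space-time. -/
def MemLpLoc {n : ℕ} {F : Type*} [NormedAddCommGroup F] (U : Set (SpaceTime n)) (p : ℝ≥0∞)
    (f : SpaceTime n → F) : Prop :=
  ∀ K : Set (SpaceTime n), IsCompact K → K ⊆ U → MemLp f p (volume.restrict K)

/-- `φ ∈ C₀^∞(U, F)`. -/
def IsTestFunction {n : ℕ} {F : Type*} [NormedAddCommGroup F] [NormedSpace ℝ F]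
    (U : Set (SpaceTime n)) (φ : SpaceTime n → F) : Prop :=
  ContDiff ℝ ∞ φ ∧ HasCompactSupport φ ∧ tsupport φ ⊆ U

/-- The classical time derivative `∂_t φ`. -/
def timeDeriv {n : ℕ} {F : Type*} [NormedAddCommGroup F] [NormedSpace ℝ F]
    (φ : SpaceTime n → F) (z : SpaceTime n) : F :=
  fderiv ℝ φ z (0, 1)

/-- The classical spatial partial derivative `∂_{x_j} φ`. -/
def spaceDeriv {n : ℕ} {F : Type*} [NormedAddCommGroup F] [NormedSpace ℝ F]
    (j : Fin n) (φ : SpaceTime n → F) (z : SpaceTime n) : F :=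
  fderiv ℝ φ z (EuclideanSpace.single j 1, 0)

/-- The classical spatial derivative `Dφ` of a vector-valued function. -/
def spaceGrad {n N : ℕ} (φ : SpaceTime n → Vec N) (z : SpaceTime n) : Grad N n :=
  WithLp.toLp 2 fun q : Fin N × Fin n => spaceDeriv q.2 φ z q.1

/-- `v ∈ L²_loc(0,T; W^{1,2}_loc(Ω, ℝᴺ))` and `Dv = G`: both `v` and `G` are in `L²_loc(Ω_T)`, and
`G` is the weak derivative of `v` with respect to the spatial variables. -/
structure HasWeakGrad {n N : ℕ} (Ω : Set (EuclideanSpace ℝ (Fin n))) (T : ℝ)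
    (v : SpaceTime n → Vec N) (G : SpaceTime n → Grad N n) : Prop where
  memLp : MemLpLoc (cylinder Ω T) 2 v
  grad_memLp : MemLpLoc (cylinder Ω T) 2 G
  integral_eq : ∀ φ : SpaceTime n → ℝ, IsTestFunction (cylinder Ω T) φ →
    ∀ (k : Fin N) (j : Fin n),
      ∫ z in cylinder Ω T, v z k * spaceDeriv j φ z = -∫ z in cylinder Ω T, G z (k, j) * φ z

/-- `v ∈ L²_loc(0,T; W^{1,2}_loc(Ω, ℝᴺ))`. -/
def MemL2W12Loc {n N : ℕ} (Ω : Set (EuclideanSpace ℝ (Fin n))) (T : ℝ)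
    (v : SpaceTime n → Vec N) : Prop :=
  ∃ G : SpaceTime n → Grad N n, HasWeakGrad Ω T v G

/-- Strong convergence `vᵢ → v` in `L²_loc(0,T; W^{1,2}_loc(Ω, ℝᴺ))`: functions and weak spatial
derivatives (which are unique up to null sets) converge in `L²` on compact subsets of `Ω_T`. -/
def TendstoL2W12Loc {n N : ℕ} (Ω : Set (EuclideanSpace ℝ (Fin n))) (T : ℝ)
    (vs : ℕ → SpaceTime n → Vec N) (v : SpaceTime n → Vec N) : Prop :=
  ∃ (Gs : ℕ → SpaceTime n → Grad N n) (G : SpaceTime n → Grad N n),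
    (∀ i, HasWeakGrad Ω T (vs i) (Gs i)) ∧ HasWeakGrad Ω T v G ∧
    ∀ K : Set (SpaceTime n), IsCompact K → K ⊆ cylinder Ω T →
      Tendsto (fun i => eLpNorm (fun z => vs i z - v z) 2 (volume.restrict K)) atTop (𝓝 0) ∧
      Tendsto (fun i => eLpNorm (fun z => Gs i z - G z) 2 (volume.restrict K)) atTop (𝓝 0)

/-- Weak convergence `vᵢ ⇀ v` in `L²_loc(U, ℝᴺ)`, that is, weakly in `L²(K, ℝᴺ)` for every compact
`K ⊆ U`. -/
def TendstoWeaklyL2Loc {n N : ℕ} (U : Set (SpaceTime n))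
    (vs : ℕ → SpaceTime n → Vec N) (v : SpaceTime n → Vec N) : Prop :=
  (∀ i, MemLpLoc U 2 (vs i)) ∧ MemLpLoc U 2 v ∧
  ∀ K : Set (SpaceTime n), IsCompact K → K ⊆ U →
    ∀ ψ : SpaceTime n → Vec N, MemLp ψ 2 (volume.restrict K) →
      Tendsto (fun i => ∫ z in K, inner ℝ (vs i z) (ψ z)) atTop (𝓝 (∫ z in K, inner ℝ (v z) (ψ z)))

/-- The sequence `fᵢ` is bounded in `L¹_loc(U)`. -/
def BoundedL1Loc {n N : ℕ} (U : Set (SpaceTime n)) (fs : ℕ → SpaceTime n → Vec N) : Prop :=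
  ∀ K : Set (SpaceTime n), IsCompact K → K ⊆ U →
    ∃ C : ℝ≥0, ∀ i, eLpNorm (fs i) 1 (volume.restrict K) ≤ C

/-- `A` is a Carathéodory function on `Ω_T × ℝᴺ × ℝᴺⁿ` which satisfies the growth conditions with
`ν`, `L` and the monotonicity condition with `μ`. -/
structure IsAdmissibleField {n N : ℕ} (Ω : Set (EuclideanSpace ℝ (Fin n))) (T ν L μ : ℝ)
    (A : SpaceTime n → Vec N → Grad N n → Grad N n) : Prop where
  measurable : ∀ (u : Vec N) (ξ : Grad N n),
    AEMeasurable (fun z => A z u ξ) (volume.restrict (cylinder Ω T))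
  continuous : ∀ᵐ z ∂(volume.restrict (cylinder Ω T)),
    Continuous fun p : Vec N × Grad N n => A z p.1 p.2
  coercive : ∀ᵐ z ∂(volume.restrict (cylinder Ω T)), ∀ (u : Vec N) (ξ : Grad N n),
    ν * ‖ξ‖ ^ 2 ≤ inner ℝ (A z u ξ) ξ
  growth : ∀ᵐ z ∂(volume.restrict (cylinder Ω T)), ∀ (u : Vec N) (ξ : Grad N n),
    ‖A z u ξ‖ ≤ L * ‖ξ‖
  monotone : ∀ᵐ z ∂(volume.restrict (cylinder Ω T)), ∀ (u v : Vec N) (ξ η : Grad N n),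
    μ * ‖ξ - η‖ ^ 2 ≤ inner ℝ (A z u ξ - A z v η) (ξ - η)

/-- `u` is a (local) weak solution of `∂_t u - div A(x, t, u, D(|u|^(m-1) u)) = 0` in `Ω_T`. -/
def IsWeakSolution {n N : ℕ} (Ω : Set (EuclideanSpace ℝ (Fin n))) (T : ℝ)
    (A : SpaceTime n → Vec N → Grad N n → Grad N n) (m : ℝ) (u : SpaceTime n → Vec N) : Prop :=
  AEMeasurable u (volume.restrict (cylinder Ω T)) ∧
  (m < 1 → MemLpLoc (cylinder Ω T) (ENNReal.ofReal (m + 1)) u) ∧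
  ∃ G : SpaceTime n → Grad N n,
    HasWeakGrad Ω T (fun z => vpow m (u z)) G ∧
    ∀ φ : SpaceTime n → Vec N, IsTestFunction (cylinder Ω T) φ →
      ∫ z in cylinder Ω T,
        (-inner ℝ (u z) (timeDeriv φ z) + inner ℝ (A z (u z) (G z)) (spaceGrad φ z)) = 0

end PorousMedium

end

open scoped Convolution Pointwise

namespace PorousMedium

/-! ### Powers of vectors -/

/-! Write `vᵢ = vpow mᵢ uᵢ` and `αᵢ = 1 / mᵢ`, so that `uᵢ = vpow αᵢ vᵢ`; all estimates concern
`vᵢ`, which carries the spatial gradient. Monotonicity for arbitrary `u, v` forces the field to be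
independent of `u` (`IsAdmissibleField.ae_eq`), so the flux is a function of `(z, Dvᵢ)` alone.

Energy. `u` has no time derivative that could be paired with `ζ v`. Instead, the equation makes
`Γ(h) = ∫ u · (ζ v)(· - (0, h))` differentiable at `h = 0` with derivative `-∫ F · D(ζ v)`. By
convexity (`inner_vpow_sub_le`), `α/(1+α) ∫ |v|^(1+α) ζ(· - (0, h)) - Γ(h)` is minimal at `h = 0`,
so the two derivatives agree there. This is an exact energy identity (`LocalSol.energy`). It yields
a Caccioppoli inequality and a bound on time slices, and a parabolic Gagliardo-Nirenberg inequality
turns these into a bound in `L^s` with `s > 2` and `s > 1 + α`; there is room for such an `s`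
because `m > m_c` (`exists_exponents`). The estimates start from local bounds of `vᵢ` in `L²` and
`L^(1+αᵢ)`: the former follows from weak convergence by Banach-Steinhaus, the latter is the extra
hypothesis if `m < 1` and comes from absorption if `m ≥ 1` (`exists_bounds`).

Compactness. The nonnegative quantity `∫ ζ (vpow αᵢ vᵢ - vpow αᵢ v) · (vᵢ - v)` controls `vᵢ - v` in
`L¹`. Its first part vanishes in the limit because `w ↦ ∫ uᵢ · (ζ (vᵢ - v))(· - w)` is
equicontinuous: time shifts are controlled by the equation, space shifts by the gradients. So `ζ (vᵢ
- v)` may be replaced by a mollification, which tends to zero pointwise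
(`LocalLim.tendsto_integral_u`). The second part vanishes by weak convergence and truncation. The
uniform `L^s` bound upgrades this to strong convergence in `L²` and of all lower order terms.

Gradients. Monotonicity bounds `μ ∫ ζ |Gᵢ - G|²` by the energy of `vᵢ` minus `∫ Fᵢ · D(ζ v)` plus
vanishing terms. The needed lower bound for `∫ Fᵢ · D(ζ v)` comes from pairing the equation of `uᵢ`
with a small time difference of `ζ v` and using convexity for the limit
(`LocalLim.eventually_flux_ge`), so no equation for the limit is required. With strongly convergent
gradients the equation passes to the limit. -/

theorem vpow_zero_right {N : ℕ} (α : ℝ) : vpow α (0 : Vec N) = 0 := by simp [vpow]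

theorem norm_vpow {N : ℕ} {α : ℝ} (hα : 0 < α) (v : Vec N) : ‖vpow α v‖ = ‖v‖ ^ α := by
  rcases eq_or_ne v 0 with rfl | hv
  · simp [vpow, Real.zero_rpow hα.ne']
  · have h : 0 < ‖v‖ := norm_pos_iff.2 hv
    rw [vpow, norm_smul, Real.norm_of_nonneg (by positivity), Real.rpow_sub_one h.ne',
      div_mul_cancel₀ _ h.ne']

theorem vpow_vpow {N : ℕ} {α β : ℝ} (hα : 0 < α) (hαβ : α * β = 1) (v : Vec N) :
    vpow β (vpow α v) = v := by
  rcases eq_or_ne v 0 with rfl | hv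
  · simp [vpow]
  · have h : 0 < ‖v‖ := norm_pos_iff.2 hv
    rw [vpow, norm_vpow hα, vpow, smul_smul, ← Real.rpow_mul h.le, ← Real.rpow_add h]
    have : α * (β - 1) + (α - 1) = 0 := by linarith
    rw [this, Real.rpow_zero, one_smul]

/-- Joint continuity in exponent and vector is what the compactness arguments over a range of
exponents require. At the zero vector the scalar factor may blow up, but the norm is `‖v‖ ^ α`,
which is jointly continuous there since `α > 0`. -/
theorem continuousOn_vpow {N : ℕ} :
    ContinuousOn (fun x : ℝ × Vec N => vpow x.1 x.2) (Ioi 0 ×ˢ univ) := by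
  rintro ⟨α, v⟩ ⟨hα, -⟩
  have hα : 0 < α := hα
  apply ContinuousAt.continuousWithinAt
  rcases eq_or_ne v 0 with rfl | hv
  · rw [ContinuousAt, vpow_zero_right, tendsto_zero_iff_norm_tendsto_zero]
    have h1 : Tendsto (fun x : ℝ × Vec N => ‖x.2‖ ^ x.1) (𝓝 (α, 0)) (𝓝 0) := by
      have h2 : ContinuousAt (fun x : ℝ × Vec N => ‖x.2‖ ^ x.1) (α, 0) :=
        continuous_snd.norm.continuousAt.rpow continuous_fst.continuousAt (Or.inr hα)
      simpa [ContinuousAt, Real.zero_rpow hα.ne'] using h2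
    refine h1.congr' ?_
    have h3 : ∀ᶠ x : ℝ × Vec N in 𝓝 (α, 0), 0 < x.1 :=
      continuous_fst.continuousAt.eventually (lt_mem_nhds hα)
    filter_upwards [h3] with x hx
    rw [norm_vpow hx]
  · refine ContinuousAt.smul (f := fun x : ℝ × Vec N => ‖x.2‖ ^ (x.1 - 1)) (g := Prod.snd) ?_
      continuous_snd.continuousAt
    exact (ContinuousAt.rpow (f := fun x : ℝ × Vec N => ‖x.2‖) (g := fun x : ℝ × Vec N => x.1 - 1)
      (by fun_prop) (by fun_prop) (Or.inl (norm_ne_zero_iff.2 hv)))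

theorem continuous_vpow {N : ℕ} {α : ℝ} (hα : 0 < α) :
    Continuous (fun v : Vec N => vpow α v) := by
  rw [← continuousOn_univ]
  exact continuousOn_vpow.comp (f := fun v : Vec N => (α, v)) (by fun_prop)
    fun v _ => ⟨hα, mem_univ _⟩

theorem inner_vpow_self {N : ℕ} {α : ℝ} (hα : 0 < α) (v : Vec N) :
    inner ℝ (vpow α v) v = ‖v‖ ^ (1 + α) := by
  rcases eq_or_ne v 0 with rfl | hv
  · simp [vpow, Real.zero_rpow (by positivity : (1 + α) ≠ 0)]
  · have h : 0 < ‖v‖ := norm_pos_iff.2 hv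
    rw [vpow, inner_smul_left, real_inner_self_eq_norm_sq]
    simp only [conj_trivial]
    rw [← Real.rpow_two, ← Real.rpow_add h]
    congr 1; ring

/-- Subgradient inequality for the convex function `b ↦ α/(1+α) |b|^(1+1/α)`, whose gradient at
`vpow α v` is `v`; it amounts to Young's inequality with exponents `1 + 1/α` and `1 + α`. It
replaces the chain rule in time. -/
theorem inner_vpow_sub_le {N : ℕ} {α : ℝ} (hα : 0 < α) (v w : Vec N) :
    inner ℝ (vpow α w - vpow α v) v ≤ α / (1 + α) * (‖w‖ ^ (1 + α) - ‖v‖ ^ (1 + α)) := by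
  rw [inner_sub_left, inner_vpow_self hα]
  have h1 : inner ℝ (vpow α w) v ≤ ‖w‖ ^ α * ‖v‖ := by
    rw [← norm_vpow hα]; exact real_inner_le_norm _ _
  have hc : (1 + 1 / α).HolderConjugate (1 + α) := by
    rw [Real.holderConjugate_iff]
    refine ⟨by have : 0 < 1 / α := by positivity
               linarith, ?_⟩
    field_simp
    ring
  have h2 := Real.young_inequality_of_nonneg (a := ‖w‖ ^ α) (b := ‖v‖) (by positivity)
    (by positivity) hc
  rw [← Real.rpow_mul (norm_nonneg _)] at h2
  have e1 : α * (1 + 1 / α) = 1 + α := by field_simp; ring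
  rw [e1] at h2
  have e2 : ‖w‖ ^ (1 + α) / (1 + 1 / α) = α / (1 + α) * ‖w‖ ^ (1 + α) := by field_simp; ring
  have e3 : ‖v‖ ^ (1 + α) / (1 + α) = ‖v‖ ^ (1 + α) - α / (1 + α) * ‖v‖ ^ (1 + α) := by
    field_simp; ring
  linarith

/-- Adding the two subgradient inequalities with `a` and `c` exchanged cancels the right-hand sides.
-/
theorem vpow_monotone_aux {N : ℕ} {α : ℝ} (hα : 0 < α) (a c : Vec N) :
    0 ≤ inner ℝ (vpow α a - vpow α c) (a - c) := by
  have h1 := inner_vpow_sub_le hα a c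
  have h2 := inner_vpow_sub_le hα c a
  have : inner ℝ (vpow α a - vpow α c) (a - c) =
      - inner ℝ (vpow α c - vpow α a) a - inner ℝ (vpow α a - vpow α c) c := by
    simp only [inner_sub_left, inner_sub_right]; ring
  linarith

/-- Cauchy-Schwarz reduces to the norms, where strict monotonicity of the scalar power gives `‖a‖ =
‖c‖`; then the difference of the powers is a positive multiple of `a - c`. -/
theorem eq_of_inner_vpow_sub_eq_zero {N : ℕ} {α : ℝ} (hα : 0 < α) {a c : Vec N}
    (h : inner ℝ (vpow α a - vpow α c) (a - c) = 0) : a = c := by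
  have key : ∀ x y : Vec N, inner ℝ (vpow α x) y ≤ ‖x‖ ^ α * ‖y‖ := fun x y => by
    rw [← norm_vpow hα]; exact real_inner_le_norm _ _
  have hs : ∀ x : Vec N, ‖x‖ ^ (1 + α) = ‖x‖ ^ α * ‖x‖ := fun x => by
    rw [← inner_vpow_self hα, vpow, inner_smul_left, real_inner_self_eq_norm_sq]
    simp only [conj_trivial]
    rw [← norm_vpow hα, vpow, norm_smul, Real.norm_of_nonneg (by positivity)]; ring
  have h1 : (‖a‖ ^ α - ‖c‖ ^ α) * (‖a‖ - ‖c‖) ≤ 0 := by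
    have := key a c
    have := key c a
    simp only [inner_sub_left, inner_sub_right, inner_vpow_self hα, hs] at h
    nlinarith
  have h2 : ‖a‖ = ‖c‖ := by
    rcases lt_trichotomy ‖a‖ ‖c‖ with h3 | h3 | h3
    · have := Real.rpow_lt_rpow (norm_nonneg a) h3 hα
      nlinarith
    · exact h3
    · have := Real.rpow_lt_rpow (norm_nonneg c) h3 hα
      nlinarith
  rcases eq_or_ne c 0 with rfl | hc
  · simpa using h2
  · have h3 : vpow α a - vpow α c = ‖c‖ ^ (α - 1) • (a - c) := by
      simp [vpow, h2, smul_sub]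
    rw [h3, inner_smul_left, real_inner_self_eq_norm_sq] at h
    have h4 : 0 < ‖c‖ ^ (α - 1) := Real.rpow_pos_of_pos (norm_pos_iff.2 hc) _
    simp only [conj_trivial, mul_eq_zero, h4.ne', false_or] at h
    simpa [sub_eq_zero] using h

/-! ### Pointwise inequalities by compactness -/

/-- For large `‖x‖` the lower growth exponent `σ < s` is absorbed by `ε ‖x‖ ^ s`. On the compact
remainder, `Q` is positive on the set where `P ≥ ε`, hence bounded below there, and `C = max P / min
Q` works. All pointwise inequalities below, uniform in the exponent, are instances. -/
theorem exists_le_add_mul {X : Type*} [NormedAddCommGroup X] [ProperSpace X] {Λ : Set ℝ}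
    (hΛ : IsCompact Λ) {P Q : ℝ × X → ℝ} (hP : ContinuousOn P (Λ ×ˢ univ))
    (hQ : ContinuousOn Q (Λ ×ˢ univ)) (hQ0 : ∀ l ∈ Λ, ∀ x, 0 ≤ Q (l, x))
    (hPQ : ∀ l ∈ Λ, ∀ x, Q (l, x) = 0 → P (l, x) ≤ 0) {σ s C₀ : ℝ} (hσ : 0 ≤ σ) (hσs : σ < s)
    (hC₀ : 0 ≤ C₀) (hgr : ∀ l ∈ Λ, ∀ x, P (l, x) ≤ C₀ * (1 + ‖x‖ ^ σ)) {ε : ℝ} (hε : 0 < ε) :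
    ∃ C, 0 ≤ C ∧ ∀ l ∈ Λ, ∀ x, P (l, x) ≤ ε * (1 + ‖x‖ ^ s) + C * Q (l, x) := by
  -- Beyond radius `k` one has `1 ≤ ‖x‖ ^ σ`, so `P ≤ 2 C₀ ‖x‖ ^ σ ≤ ε ‖x‖ ^ s`.
  obtain ⟨k, hk⟩ : ∃ k : ℝ, ∀ r ≥ k, 1 ≤ r ∧ 2 * C₀ / ε ≤ r ^ (s - σ) := by
    have h1 := (tendsto_rpow_atTop (sub_pos.2 hσs)).eventually_ge_atTop (2 * C₀ / ε)
    exact eventually_atTop.1 ((eventually_ge_atTop 1).and h1)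
  have hlarge : ∀ l ∈ Λ, ∀ x : X, k ≤ ‖x‖ → P (l, x) ≤ ε * (1 + ‖x‖ ^ s) := by
    intro l hl x hx
    obtain ⟨h1, h2⟩ := hk _ hx
    have h3 : (1 : ℝ) ≤ ‖x‖ ^ σ := Real.one_le_rpow h1 hσ
    have h4 : ‖x‖ ^ s = ‖x‖ ^ (s - σ) * ‖x‖ ^ σ := by
      rw [← Real.rpow_add (by linarith)]; congr 1; ring
    rw [div_le_iff₀ hε] at h2
    have := hgr l hl x
    nlinarith
  have hsub : Λ ×ˢ Metric.closedBall (0 : X) k ⊆ Λ ×ˢ univ :=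
    prod_mono_right (subset_univ _)
  have hcomp : IsCompact (Λ ×ˢ Metric.closedBall (0 : X) k) :=
    hΛ.prod (isCompact_closedBall _ _)
  set S := (Λ ×ˢ Metric.closedBall (0 : X) k) ∩ P ⁻¹' Ici ε with hS
  have hScomp : IsCompact S :=
    hcomp.of_isClosed_subset ((hP.mono hsub).preimage_isClosed_of_isClosed hcomp.isClosed
      isClosed_Ici) inter_subset_left
  have hSsub : S ⊆ Λ ×ˢ univ := inter_subset_left.trans hsub
  have hnotS : ∀ l ∈ Λ, ∀ x : X, (l, x) ∉ S → P (l, x) ≤ ε * (1 + ‖x‖ ^ s) := by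
    intro l hl x hx
    rcases le_total k ‖x‖ with h | h
    · exact hlarge l hl x h
    · have h2 : ¬ ε ≤ P (l, x) := fun h3 => hx ⟨⟨hl, by simpa using h⟩, h3⟩
      have : 0 ≤ ‖x‖ ^ s := by positivity
      nlinarith
  rcases S.eq_empty_or_nonempty with hempty | hne
  · refine ⟨0, le_rfl, fun l hl x => ?_⟩
    simpa using hnotS l hl x (by simp [hempty])
  obtain ⟨y, hy, hymin⟩ := hScomp.exists_isMinOn hne (hQ.mono hSsub)
  obtain ⟨w, hw, hwmax⟩ := hScomp.exists_isMaxOn hne (hP.mono hSsub)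
  have hQy : 0 < Q y := by
    refine lt_of_le_of_ne (hQ0 y.1 (hSsub hy).1 y.2) fun h => ?_
    have h1 := hPQ y.1 (hSsub hy).1 y.2 h.symm
    have h2 : ε ≤ P y := hy.2
    have h3 : P y ≤ 0 := h1
    linarith
  have hPw : 0 < P w := lt_of_lt_of_le hε hw.2
  refine ⟨P w / Q y, by positivity, fun l hl x => ?_⟩
  by_cases hx : (l, x) ∈ S
  · have h1 : Q y ≤ Q (l, x) := hymin hx
    have h2 : P (l, x) ≤ P w := hwmax hx
    have h3 : P w ≤ P w / Q y * Q (l, x) := by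
      rw [div_mul_eq_mul_div, le_div_iff₀ hQy]; gcongr
    have : 0 ≤ ‖x‖ ^ s := by positivity
    nlinarith
  · have := hnotS l hl x hx
    have : 0 ≤ P w / Q y * Q (l, x) := by have := hQ0 l hl x; positivity
    linarith

theorem norm_prod_rpow_le {E F : Type*} [NormedAddCommGroup E] [NormedAddCommGroup F] (x : E × F)
    (s : ℝ) : ‖x‖ ^ s ≤ ‖x.1‖ ^ s + ‖x.2‖ ^ s := by
  have h1 : 0 ≤ ‖x.1‖ ^ s := by positivity
  have h2 : 0 ≤ ‖x.2‖ ^ s := by positivity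
  rcases max_choice ‖x.1‖ ‖x.2‖ with h | h <;> rw [Prod.norm_def, h] <;> linarith

theorem rpow_le_one_add_rpow {a σ s : ℝ} (ha : 0 ≤ a) (hσ : 0 ≤ σ) (hσs : σ ≤ s) :
    a ^ σ ≤ 1 + a ^ s := by
  have h1 : 0 ≤ a ^ s := by positivity
  rcases le_total a 1 with h | h
  · have := Real.rpow_le_one ha h hσ; linarith
  · have := Real.rpow_le_rpow_of_exponent_le h hσs; linarith

/-- The case where `Q` is the distance of `(l, a)` from `(α, c)`, whose zeros are exactly the points
where the difference of the values of `H` vanishes trivially. Serves to pass to the limit when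
exponent and argument vary together. -/
theorem exists_norm_sub_le {E F : Type*} [NormedAddCommGroup E] [NormedAddCommGroup F]
    [ProperSpace E] {Λ : Set ℝ} (hΛ : IsCompact Λ) {H : ℝ × E → F}
    (hH : ContinuousOn H (Λ ×ˢ univ)) {α : ℝ} (hα : α ∈ Λ) {σ s C₀ : ℝ} (hσ : 0 ≤ σ)
    (hσs : σ < s) (hC₀ : 0 ≤ C₀) (hgr : ∀ l ∈ Λ, ∀ x, ‖H (l, x)‖ ≤ C₀ * (1 + ‖x‖ ^ σ))
    {ε : ℝ} (hε : 0 < ε) :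
    ∃ C, 0 ≤ C ∧ ∀ l ∈ Λ, ∀ a c, ‖H (l, a) - H (α, c)‖ ≤
      ε * (1 + ‖a‖ ^ s + ‖c‖ ^ s) + C * (‖a - c‖ + |l - α|) := by
  refine (exists_le_add_mul (X := E × E) hΛ
    (P := fun y => ‖H (y.1, y.2.1) - H (α, y.2.2)‖) (Q := fun y => ‖y.2.1 - y.2.2‖ + |y.1 - α|)
    (σ := σ) (s := s) (C₀ := 2 * C₀) ?_ ?_ ?_ ?_ hσ hσs (by positivity) ?_ hε).elim ?_
  · refine (ContinuousOn.sub ?_ ?_).norm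
    · exact hH.comp (f := fun y : ℝ × E × E => (y.1, y.2.1)) (by fun_prop) fun y hy => ⟨hy.1, trivial⟩
    · exact hH.comp (f := fun y : ℝ × E × E => (α, y.2.2)) (by fun_prop) fun y hy => ⟨hα, trivial⟩
  · fun_prop
  · intro l _ x; positivity
  · intro l _ x hx
    have h1 := norm_nonneg (x.1 - x.2)
    have h2 := abs_nonneg (l - α)
    dsimp only at hx
    have h3 : x.1 = x.2 := by rw [← sub_eq_zero, ← norm_eq_zero]; linarith
    have h4 : l = α := by rw [← sub_eq_zero, ← abs_eq_zero]; linarith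
    simp [h3, h4]
  · intro l hl x
    have h1 := hgr l hl x.1
    have h2 := hgr α hα x.2
    have h3 : ‖x.1‖ ^ σ ≤ ‖x‖ ^ σ := Real.rpow_le_rpow (norm_nonneg _) (norm_fst_le x) hσ
    have h4 : ‖x.2‖ ^ σ ≤ ‖x‖ ^ σ := Real.rpow_le_rpow (norm_nonneg _) (norm_snd_le x) hσ
    have := norm_sub_le (H (l, x.1)) (H (α, x.2))
    dsimp only
    nlinarith
  · rintro C ⟨hC, h⟩
    refine ⟨C, hC, fun l hl a c => (h l hl (a, c)).trans ?_⟩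
    have := norm_prod_rpow_le (a, c) s
    dsimp only at this ⊢
    nlinarith

/-- Quantitative strict monotonicity, uniform in the exponent: the zeros of the monotonicity gap lie
on the diagonal. It turns a vanishing gap into convergence in `L¹`. -/
theorem exists_norm_sub_le_vpow {N : ℕ} {lo hi s : ℝ} (hlo : 0 < lo) (hs : 1 < s)
    {ε : ℝ} (hε : 0 < ε) :
    ∃ C, 0 ≤ C ∧ ∀ l ∈ Icc lo hi, ∀ a c : Vec N, ‖a - c‖ ≤
      ε * (1 + ‖a‖ ^ s + ‖c‖ ^ s) + C * inner ℝ (vpow l a - vpow l c) (a - c) := by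
  refine (exists_le_add_mul (X := Vec N × Vec N) (isCompact_Icc (a := lo) (b := hi))
    (P := fun y => ‖y.2.1 - y.2.2‖)
    (Q := fun y => inner ℝ (vpow y.1 y.2.1 - vpow y.1 y.2.2) (y.2.1 - y.2.2))
    (σ := 1) (s := s) (C₀ := 2) ?_ ?_ ?_ ?_ zero_le_one hs (by positivity) ?_ hε).elim ?_
  · fun_prop
  · refine ContinuousOn.inner (ContinuousOn.sub ?_ ?_) (by fun_prop)
    · exact continuousOn_vpow.comp (f := fun y : ℝ × Vec N × Vec N => (y.1, y.2.1)) (by fun_prop)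
        fun y hy => ⟨hlo.trans_le hy.1.1, trivial⟩
    · exact continuousOn_vpow.comp (f := fun y : ℝ × Vec N × Vec N => (y.1, y.2.2)) (by fun_prop)
        fun y hy => ⟨hlo.trans_le hy.1.1, trivial⟩
  · exact fun l hl x => vpow_monotone_aux (hlo.trans_le hl.1) _ _
  · intro l hl x hx
    have h1 : x.1 = x.2 := eq_of_inner_vpow_sub_eq_zero (hlo.trans_le hl.1) hx
    simp [h1]
  · intro l hl x
    have := norm_sub_le x.1 x.2
    have := norm_fst_le x
    have := norm_snd_le x
    rw [Real.rpow_one]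
    dsimp only
    linarith
  · rintro C ⟨hC, h⟩
    refine ⟨C, hC, fun l hl a c => (h l hl (a, c)).trans ?_⟩
    have := norm_prod_rpow_le (a, c) s
    dsimp only at this ⊢
    nlinarith

/-- Here `Q` is the second factor and the product grows at most with exponent `1 + hi < s`. It
controls pairings of `vpow l v` with functions that are small in `L¹` and bounded in `L^s`. -/
theorem exists_rpow_mul_le {lo hi s : ℝ} (hlo : 0 < lo) (hs : 1 + hi < s)
    {ε : ℝ} (hε : 0 < ε) :
    ∃ C, 0 ≤ C ∧ ∀ l ∈ Icc lo hi, ∀ a b : ℝ, 0 ≤ a → 0 ≤ b → a ^ l * b ≤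
      ε * (1 + a ^ s + b ^ s) + C * b := by
  rcases lt_or_ge hi lo with hlt | hge
  · exact ⟨0, le_rfl, fun l hl => absurd (hl.1.trans hl.2) (not_le.2 hlt)⟩
  refine (exists_le_add_mul (X := ℝ × ℝ) (isCompact_Icc (a := lo) (b := hi))
    (P := fun y => |y.2.1| ^ y.1 * |y.2.2|) (Q := fun y => |y.2.2|)
    (σ := 1 + hi) (s := s) (C₀ := 2) ?_ ?_ ?_ ?_ (by linarith) hs (by positivity) ?_ hε).elim ?_
  · refine ContinuousOn.mul (ContinuousOn.rpow (by fun_prop) (by fun_prop) ?_) (by fun_prop)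
    exact fun y hy => Or.inr (hlo.trans_le hy.1.1)
  · fun_prop
  · exact fun l _ x => abs_nonneg _
  · intro l hl x hx
    dsimp only at hx ⊢
    rw [hx, mul_zero]
  · intro l hl x
    have hl0 : 0 < l := hlo.trans_le hl.1
    have h1 : |x.1| ≤ ‖x‖ := norm_fst_le x
    have h2 : |x.2| ≤ ‖x‖ := norm_snd_le x
    have h3 : |x.1| ^ l * |x.2| ≤ ‖x‖ ^ l * ‖x‖ := by gcongr
    have h4 : ‖x‖ ^ l * ‖x‖ = ‖x‖ ^ (1 + l) := by
      rcases (norm_nonneg x).eq_or_lt with h | h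
      · rw [← h, Real.zero_rpow (by positivity : 1 + l ≠ 0), mul_zero]
      · rw [add_comm, Real.rpow_add_one h.ne']
    have h5 : ‖x‖ ^ (1 + l) ≤ 1 + ‖x‖ ^ (1 + hi) :=
      rpow_le_one_add_rpow (norm_nonneg _) (by positivity) (by linarith [hl.2])
    have : 0 ≤ ‖x‖ ^ (1 + hi) := by positivity
    dsimp only
    linarith
  · rintro C ⟨hC, h⟩
    refine ⟨C, hC, fun l hl a b ha hb => ?_⟩
    have h1 := h l hl (a, b)
    have := norm_prod_rpow_le (a, b) s
    simp only [Real.norm_eq_abs, abs_of_nonneg ha, abs_of_nonneg hb] at this h1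
    nlinarith

instance instIsAddHaarMeasureSpaceTime (n : ℕ) :
    (volume : Measure (SpaceTime n)).IsAddHaarMeasure :=
  inferInstanceAs ((volume : Measure (EuclideanSpace ℝ (Fin n))).prod
    (volume : Measure ℝ)).IsAddHaarMeasure

/-! ### Translations and mollification -/

section Translation

variable {V : Type*} [NormedAddCommGroup V] [MeasurableSpace V] [BorelSpace V] {μ : Measure V}
  [μ.IsAddHaarMeasure] {W : Type*} [NormedAddCommGroup W]

theorem memLp_translate {f : V → W} {p : ℝ≥0∞} (hf : MemLp f p μ) (w : V) :
    MemLp (fun z => f (z - w)) p μ :=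
  hf.comp_measurePreserving (measurePreserving_sub_right μ w)

variable [NormedSpace ℝ V] [FiniteDimensional ℝ V]

theorem continuous_toLp_translate {f : V → W} {p : ℝ≥0∞} [Fact (1 ≤ p)] (hp : p ≠ ⊤)
    (hf : MemLp f p μ) : Continuous fun w : V => (memLp_translate hf w).toLp _ := by
  let g : C(V, C(V, V)) := (ContinuousMap.mk (fun a : V × V => a.2 - a.1) (by fun_prop)).curry
  have h := (continuous_const (y := hf.toLp f)).compMeasurePreservingLp (f := fun _ : V => hf.toLp f)
    (g := g) g.continuous (fun w => measurePreserving_sub_right μ w) hp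
  refine h.congr fun w => ?_
  exact Lp.toLp_compMeasurePreserving hf _

theorem tendsto_eLpNorm_translate {f : V → W} {p : ℝ≥0∞} [Fact (1 ≤ p)] (hp : p ≠ ⊤)
    (hf : MemLp f p μ) :
    Tendsto (fun w : V => eLpNorm (fun z => f (z - w) - f z) p μ) (𝓝 0) (𝓝 0) := by
  have h := (continuous_toLp_translate hp hf).tendsto 0
  have h2 : (memLp_translate hf 0).toLp _ = hf.toLp f := by simp
  rw [h2] at h
  exact (Lp.tendsto_Lp_iff_tendsto_eLpNorm'' _ (fun w => memLp_translate hf w) _ hf).1 h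

variable {W : Type*} [NormedAddCommGroup W] [InnerProductSpace ℝ W]

theorem continuous_integral_inner_translate {u f : V → W} {p q : ℝ≥0∞} [Fact (1 ≤ p)]
    [Fact (1 ≤ q)] [p.HolderConjugate q] (hp : p ≠ ⊤) (hf : MemLp f p μ) (hu : MemLp u q μ) :
    Continuous fun w : V => ∫ z, inner ℝ (u z) (f (z - w)) ∂μ := by
  have h1 : Continuous fun w : V =>
      (innerSL ℝ (E := W)).lpPairing μ q p (hu.toLp u) ((memLp_translate hf w).toLp _) :=
    (ContinuousLinearMap.continuous _).comp (continuous_toLp_translate hp hf)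
  refine h1.congr fun w => ?_
  rw [ContinuousLinearMap.lpPairing_eq_integral]
  refine integral_congr_ae ?_
  filter_upwards [hu.coeFn_toLp, (memLp_translate hf w).coeFn_toLp] with z h1 h2
  rw [h1, h2, innerSL_apply_apply]

/-- Up to swapping the variables this is the convolution integrand of `u` and the reflected,
translated `f`. -/
theorem integrable_prod_inner_translate {u f : V → W} (hu : Integrable u μ) (hf : Integrable f μ)
    (w : V) : Integrable (fun a : V × V => inner ℝ (u a.1) (f (a.1 - w - a.2))) (μ.prod μ) := by
  have hf' : Integrable (fun a => f (-(a + w))) μ :=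
    (hf.comp_neg).comp_add_right w
  have h := (hu.convolution_integrand (innerSL ℝ (E := W)) hf').swap
  refine h.congr (ae_of_all _ fun a => ?_)
  have h1 : -(a.2 - a.1 + w) = a.1 - w - a.2 := by abel
  change inner ℝ (u a.1) (f (-(a.2 - a.1 + w))) = _
  rw [h1]

/-- Fubini moves the mollifier from `f` to the function `w ↦ ∫ u · f(· - w)`. Since that function is
continuous, mollifications of `f` can be used as test functions and removed afterwards. -/
theorem integral_inner_mollify_translate {u f : V → W} [CompleteSpace W] (hu : Integrable u μ)
    (hf : Integrable f μ) (ρ : ContDiffBump (0 : V)) (w : V) :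
    ∫ z, inner ℝ (u z) ((ρ.normed μ ⋆[ContinuousLinearMap.lsmul ℝ ℝ, μ] f) (z - w)) ∂μ =
      (ρ.normed μ ⋆[ContinuousLinearMap.lsmul ℝ ℝ, μ]
        fun w => ∫ z, inner ℝ (u z) (f (z - w)) ∂μ) w := by
  have hρc : Continuous (ρ.normed μ) := (ρ.contDiff_normed (n := 0)).continuous
  obtain ⟨B, hB⟩ := (ρ.hasCompactSupport_normed (μ := μ)).exists_bound_of_continuous hρc
  have hprod : Integrable (fun a : V × V => ρ.normed μ a.2 * inner ℝ (u a.1) (f (a.1 - w - a.2)))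
      (μ.prod μ) :=
    (integrable_prod_inner_translate hu hf w).bdd_mul
      (hρc.comp continuous_snd).aestronglyMeasurable (ae_of_all _ fun a => hB a.2)
  have hL : ∀ z, inner ℝ (u z) ((ρ.normed μ ⋆[ContinuousLinearMap.lsmul ℝ ℝ, μ] f) (z - w)) =
      ∫ y, ρ.normed μ y * inner ℝ (u z) (f (z - w - y)) ∂μ := by
    intro z
    have hc := ρ.hasCompactSupport_normed.convolutionExists_left (μ := μ)
      (ContinuousLinearMap.lsmul ℝ ℝ) hρc hf.locallyIntegrable (z - w)
    have h1 := (innerSL ℝ (u z)).integral_comp_comm hc.integrable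
    simp only [innerSL_apply_apply] at h1
    rw [convolution_def, ← h1]
    simp [inner_smul_right]
  simp_rw [hL]
  -- The swap produces the value at `w + y`; the bump is even, so `y ↦ -y` gives the convolution at
  -- `w`.
  rw [integral_integral_swap hprod, convolution_lsmul, ← integral_neg_eq_self]
  refine integral_congr_ae (ae_of_all _ fun y => ?_)
  simp only [ContDiffBump.normed_neg, smul_eq_mul]
  rw [integral_const_mul]
  congr 2 with z
  congr 2
  abel

/-- Jensen's inequality for mollifications. -/
theorem enorm_mollify_rpow_le {f : V → W} (hf : AEStronglyMeasurable f μ)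
    (ρ : ContDiffBump (0 : V)) {p : ℝ} (hp : 1 ≤ p) (x : V) :
    ‖(ρ.normed μ ⋆[ContinuousLinearMap.lsmul ℝ ℝ, μ] f) x‖ₑ ^ p ≤
      ∫⁻ y, ENNReal.ofReal (ρ.normed μ y) * ‖f (x - y)‖ₑ ^ p ∂μ := by
  have hρc : Continuous (ρ.normed μ) := (ρ.contDiff_normed (n := 0)).continuous
  have hρm : AEMeasurable (fun y => ENNReal.ofReal (ρ.normed μ y)) μ :=
    (hρc.measurable.ennreal_ofReal).aemeasurable
  have hρ1 : ∫⁻ y, ENNReal.ofReal (ρ.normed μ y) ∂μ = 1 := by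
    rw [← ofReal_integral_eq_lintegral_ofReal ρ.integrable_normed
      (ae_of_all _ ρ.nonneg_normed), ρ.integral_normed, ENNReal.ofReal_one]
  have hfm : AEMeasurable (fun y => ‖f (x - y)‖ₑ) μ :=
    (hf.comp_quasiMeasurePreserving
      (quasiMeasurePreserving_sub_left μ x)).enorm
  have h1 : ‖(ρ.normed μ ⋆[ContinuousLinearMap.lsmul ℝ ℝ, μ] f) x‖ₑ ≤
      ∫⁻ y, ENNReal.ofReal (ρ.normed μ y) * ‖f (x - y)‖ₑ ∂μ := by
    rw [convolution_lsmul]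
    refine (enorm_integral_le_lintegral_enorm _).trans (le_of_eq ?_)
    refine lintegral_congr fun y => ?_
    rw [enorm_smul, Real.enorm_eq_ofReal (ρ.nonneg_normed y)]
  refine (ENNReal.rpow_le_rpow h1 (by linarith)).trans ?_
  rcases hp.eq_or_lt with rfl | hp1
  · simp
  have hc := (Real.HolderConjugate.conjExponent hp1)
  -- Hölder with the weight split as `ρ = ρ^(1/p) ρ^(1/p')`; the second factor contributes `∫ ρ =
  -- 1`.
  have h2 := ENNReal.lintegral_mul_le_Lp_mul_Lq μ hc
    (f := fun y => ENNReal.ofReal (ρ.normed μ y) ^ (1 / p) * ‖f (x - y)‖ₑ)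
    (g := fun y => ENNReal.ofReal (ρ.normed μ y) ^ (1 / p.conjExponent))
    ((hρm.pow_const _).mul hfm) (hρm.pow_const _)
  have h3 : ∀ y, ENNReal.ofReal (ρ.normed μ y) * ‖f (x - y)‖ₑ =
      ((fun y => ENNReal.ofReal (ρ.normed μ y) ^ (1 / p) * ‖f (x - y)‖ₑ) *
      (fun y => ENNReal.ofReal (ρ.normed μ y) ^ (1 / p.conjExponent))) y := by
    intro y
    have := hc.inv_add_inv_eq_one
    have hp' := hc.symm.pos
    rw [Pi.mul_apply, mul_right_comm, ← ENNReal.rpow_add_of_nonneg _ _ (by positivity)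
      (by positivity), one_div, one_div, this, ENNReal.rpow_one]
  simp_rw [h3]
  refine (ENNReal.rpow_le_rpow h2 (by linarith)).trans ?_
  have h4 : ∀ y, (ENNReal.ofReal (ρ.normed μ y) ^ (1 / p.conjExponent)) ^ p.conjExponent =
      ENNReal.ofReal (ρ.normed μ y) := fun y => by
    rw [← ENNReal.rpow_mul, one_div_mul_cancel hc.symm.pos.ne', ENNReal.rpow_one]
  have h5 : ∀ y, (ENNReal.ofReal (ρ.normed μ y) ^ (1 / p) * ‖f (x - y)‖ₑ) ^ p =
      ENNReal.ofReal (ρ.normed μ y) * ‖f (x - y)‖ₑ ^ p := fun y => by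
    rw [ENNReal.mul_rpow_of_nonneg _ _ (by linarith), ← ENNReal.rpow_mul,
      one_div_mul_cancel (by linarith), ENNReal.rpow_one]
  simp_rw [h4, h5, hρ1, ENNReal.one_rpow, mul_one]
  rw [← ENNReal.rpow_mul, one_div_mul_cancel (by linarith), ENNReal.rpow_one]

theorem lintegral_mollify_rpow_le {f : V → W} (hf : AEStronglyMeasurable f μ)
    (ρ : ContDiffBump (0 : V)) {p : ℝ} (hp : 1 ≤ p) :
    ∫⁻ x, ‖(ρ.normed μ ⋆[ContinuousLinearMap.lsmul ℝ ℝ, μ] f) x‖ₑ ^ p ∂μ ≤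
      ∫⁻ x, ‖f x‖ₑ ^ p ∂μ := by
  have hρc : Continuous (ρ.normed μ) := (ρ.contDiff_normed (n := 0)).continuous
  have hρ1 : ∫⁻ y, ENNReal.ofReal (ρ.normed μ y) ∂μ = 1 := by
    rw [← ofReal_integral_eq_lintegral_ofReal ρ.integrable_normed
      (ae_of_all _ ρ.nonneg_normed), ρ.integral_normed, ENNReal.ofReal_one]
  refine (lintegral_mono fun x => enorm_mollify_rpow_le hf ρ hp x).trans ?_
  rw [lintegral_lintegral_swap]
  · have : ∀ y, ∫⁻ x, ENNReal.ofReal (ρ.normed μ y) * ‖f (x - y)‖ₑ ^ p ∂μ =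
        ENNReal.ofReal (ρ.normed μ y) * ∫⁻ x, ‖f x‖ₑ ^ p ∂μ := by
      intro y
      rw [lintegral_const_mul' _ _ ENNReal.ofReal_ne_top,
        lintegral_sub_right_eq_self (fun x => ‖f x‖ₑ ^ p) y]
    simp_rw [this]
    rw [lintegral_mul_const _ hρc.measurable.ennreal_ofReal, hρ1, one_mul]
  · refine AEMeasurable.mul ?_ ?_
    · exact (hρc.measurable.ennreal_ofReal.comp measurable_snd).aemeasurable
    · have : AEStronglyMeasurable (fun a : V × V => f (a.1 - a.2)) (μ.prod μ) :=
        hf.comp_quasiMeasurePreserving (quasiMeasurePreserving_sub_of_right_invariant μ μ)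
      exact this.enorm.pow_const _

end Translation

variable {n N : ℕ}

/-! ### Weak spatial gradients and weak equations on the whole space -/

/-- `g` is the weak spatial gradient of `f` on the whole space-time. -/
def HasSpaceGrad (f : SpaceTime n → Vec N) (g : SpaceTime n → Grad N n) : Prop :=
  ∀ φ : SpaceTime n → ℝ, ContDiff ℝ ∞ φ → HasCompactSupport φ → ∀ (k : Fin N) (j : Fin n),
    ∫ z, f z k * spaceDeriv j φ z = -∫ z, g z (k, j) * φ z

/-- `∂_t u = div F` in the sense of distributions on `U`. -/
def WeakEq (U : Set (SpaceTime n)) (u : SpaceTime n → Vec N) (F : SpaceTime n → Grad N n) : Prop :=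
  ∀ φ : SpaceTime n → Vec N, IsTestFunction U φ →
    ∫ z, inner ℝ (u z) (timeDeriv φ z) = ∫ z, inner ℝ (F z) (spaceGrad φ z)

theorem timeDeriv_translate (φ : SpaceTime n → Vec N) (w z : SpaceTime n) :
    timeDeriv (fun z => φ (z - w)) z = timeDeriv φ (z - w) := by
  simp only [timeDeriv, fderiv_comp_sub]

theorem spaceGrad_translate (φ : SpaceTime n → Vec N) (w z : SpaceTime n) :
    spaceGrad (fun z => φ (z - w)) z = spaceGrad φ (z - w) := by
  simp only [spaceGrad, spaceDeriv, fderiv_comp_sub]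

/-- The Frobenius norm dominates the operator norm, by Cauchy-Schwarz in each row. -/
theorem norm_fderiv_space_le (φ : SpaceTime n → Vec N) (z : SpaceTime n)
    (y : EuclideanSpace ℝ (Fin n)) :
    ‖fderiv ℝ φ z (y, 0)‖ ≤ ‖spaceGrad φ z‖ * ‖y‖ := by
  have h1 : (y, (0 : ℝ)) = ∑ j, y j • ((EuclideanSpace.single j 1, 0) : SpaceTime n) := by
    refine Prod.ext ?_ ?_
    · ext i
      simp [Prod.fst_sum, Finset.sum_apply, Pi.single_apply]
    · simp [Prod.snd_sum]
  have h2 : ∀ k, fderiv ℝ φ z (y, 0) k = ∑ j, y j * spaceGrad φ z (k, j) := by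
    intro k
    rw [h1, map_sum]
    simp_rw [map_smul]
    simp [spaceGrad, spaceDeriv, -Prod.smul_mk]
  rw [EuclideanSpace.norm_eq, EuclideanSpace.norm_eq, EuclideanSpace.norm_eq,
    ← Real.sqrt_mul (by positivity)]
  refine Real.sqrt_le_sqrt ?_
  rw [Fintype.sum_prod_type, Finset.sum_mul]
  refine Finset.sum_le_sum fun k _ => ?_
  rw [h2, Real.norm_eq_abs, sq_abs, mul_comm]
  have := Finset.sum_mul_sq_le_sq_mul_sq Finset.univ (fun j => y j) fun j => spaceGrad φ z (k, j)
  simpa using this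

/-! ### Mollification of functions and of their weak spatial gradients. -/

section Mollify

variable {f : SpaceTime n → Vec N} {g : SpaceTime n → Grad N n} (ρ : ContDiffBump (0 : SpaceTime n))

/-- The mollification of a function on space-time by a normalised bump function. -/
noncomputable def mollify {W : Type*} [NormedAddCommGroup W] [NormedSpace ℝ W]
    (ρ : ContDiffBump (0 : SpaceTime n)) (f : SpaceTime n → W) : SpaceTime n → W :=
  ρ.normed volume ⋆[ContinuousLinearMap.lsmul ℝ ℝ, volume] f

theorem contDiff_mollify {W : Type*} [NormedAddCommGroup W] [NormedSpace ℝ W] [CompleteSpace W]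
    {f : SpaceTime n → W}
    (hf : Integrable f) : ContDiff ℝ ∞ (mollify ρ f) :=
  (ρ.hasCompactSupport_normed (μ := volume)).contDiff_convolution_left _ ρ.contDiff_normed
    hf.locallyIntegrable

theorem mollify_eq_zero {W : Type*} [NormedAddCommGroup W] [NormedSpace ℝ W]
    {f : SpaceTime n → W} {K : Set (SpaceTime n)}
    (hK : ∀ z ∉ K, f z = 0) {z : SpaceTime n} (hz : z ∉ Metric.closedBall 0 ρ.rOut + K) :
    mollify ρ f z = 0 := by
  by_contra h
  have h1 := support_convolution_subset (L := ContinuousLinearMap.lsmul ℝ ℝ) (μ := volume)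
    (f := ρ.normed volume) (g := f) h
  refine hz (add_subset_add ?_ ?_ h1)
  · rw [ρ.support_normed_eq]; exact Metric.ball_subset_closedBall
  · exact fun x hx => by_contra fun h2 => hx (hK x h2)

/-- The derivative falls on the kernel, and `y ↦ ρ(z - y)` is an admissible test function for the
weak gradient; the sign from reflecting the kernel cancels the one from integration by parts. -/
theorem spaceGrad_mollify (hfg : HasSpaceGrad f g) (hf : Integrable f) (hg : Integrable g)
    (z : SpaceTime n) : spaceGrad (mollify ρ f) z = mollify ρ g z := by
  have hρ : ContDiff ℝ ∞ (ρ.normed volume) := ρ.contDiff_normed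
  have hρ1 : ContDiff ℝ 1 (ρ.normed volume) := ρ.contDiff_normed (n := 1)
  have hρs : HasCompactSupport (ρ.normed volume) := ρ.hasCompactSupport_normed
  ext ⟨k, j⟩
  have hgk : mollify ρ g z (k, j) = ∫ y, ρ.normed volume (z - y) * g y (k, j) := by
    have hc := hρs.convolutionExists_left (μ := volume)
      (ContinuousLinearMap.lsmul ℝ ℝ) hρ.continuous hg.locallyIntegrable z
    have h1 := (EuclideanSpace.proj (𝕜 := ℝ) (k, j)).integral_comp_comm hc.integrable_swap
    rw [mollify, convolution_lsmul_swap]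
    simpa using h1.symm
  have hfk : spaceDeriv j (mollify ρ f) z k =
      ∫ y, spaceDeriv j (ρ.normed volume) (z - y) * f y k := by
    have hd := hρs.hasFDerivAt_convolution_left (μ := volume) (ContinuousLinearMap.lsmul ℝ ℝ)
      hρ1 hf.locallyIntegrable z
    have hc := (hρs.fderiv ℝ).convolutionExists_left (μ := volume)
      ((ContinuousLinearMap.lsmul ℝ ℝ).precompL (SpaceTime n)) (hρ1.continuous_fderiv one_ne_zero)
      hf.locallyIntegrable z
    rw [spaceDeriv, mollify, hd.fderiv, convolution_eq_swap,
      ContinuousLinearMap.integral_apply hc.integrable_swap]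
    have h2 := (hc.integrable_swap).apply_continuousLinearMap (EuclideanSpace.single j 1, 0)
    have h1 := (EuclideanSpace.proj (𝕜 := ℝ) k).integral_comp_comm h2
    simpa [spaceDeriv] using h1.symm
  have hφ : ContDiff ℝ ∞ (fun y => ρ.normed volume (z - y)) := hρ.comp (by fun_prop)
  have hφs : HasCompactSupport (fun y => ρ.normed volume (z - y)) :=
    hρs.comp_homeomorph (Homeomorph.subLeft z)
  have hdφ : ∀ y, spaceDeriv j (fun y => ρ.normed volume (z - y)) y =
      -spaceDeriv j (ρ.normed volume) (z - y) := by
    intro y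
    have h1 : HasFDerivAt (fun y => ρ.normed volume (z - y))
        ((fderiv ℝ (ρ.normed volume) (z - y)).comp (-ContinuousLinearMap.id ℝ (SpaceTime n))) y :=
      ((hρ1.differentiable one_ne_zero) (z - y)).hasFDerivAt.comp y
        ((hasFDerivAt_id y).const_sub z)
    simp [spaceDeriv, h1.fderiv]
  have hmain := hfg _ hφ hφs k j
  simp_rw [hdφ, mul_neg, integral_neg, neg_inj] at hmain
  change spaceDeriv j (mollify ρ f) z k = _
  rw [hfk, hgk]
  simp_rw [mul_comm (spaceDeriv j _ _), mul_comm (ρ.normed volume _)]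
  exact hmain

end Mollify

/-! ### Time shifts of weak solutions -/

theorem hasDerivAt_integral_inner_shift {W : Type*} [NormedAddCommGroup W] [InnerProductSpace ℝ W]
    {u φ : SpaceTime n → W} (hu : Integrable u) (hφ : ContDiff ℝ ∞ φ) (hs : HasCompactSupport φ)
    (h : ℝ) :
    HasDerivAt (fun h : ℝ => ∫ z, inner ℝ (u z) (φ (z - (0, h))))
      (-∫ z, inner ℝ (u z) (timeDeriv φ (z - (0, h)))) h := by
  have hdc : Continuous (timeDeriv φ) := by
    have := hφ.continuous_fderiv (by simp)
    unfold timeDeriv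
    fun_prop
  have hds : HasCompactSupport (timeDeriv φ) :=
    (hs.fderiv ℝ).comp_left (g := fun l : SpaceTime n →L[ℝ] W => l (0, 1)) rfl
  obtain ⟨B, hB⟩ := hds.exists_bound_of_continuous hdc
  obtain ⟨B', hB'⟩ := hs.exists_bound_of_continuous hφ.continuous
  rw [← integral_neg]
  have hmeas : ∀ ψ : SpaceTime n → W, Continuous ψ → ∀ x : ℝ,
      AEStronglyMeasurable (fun z => inner ℝ (u z) (ψ (z - (0, x)))) volume := fun ψ hψ x =>
    hu.aestronglyMeasurable.inner (hψ.comp (by fun_prop)).aestronglyMeasurable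
  refine (hasDerivAt_integral_of_dominated_loc_of_deriv_le (bound := fun z => ‖u z‖ * B)
    (F' := fun x z => -inner ℝ (u z) (timeDeriv φ (z - (0, x)))) (s := univ) univ_mem
    ?_ ?_ ?_ ?_ ?_ ?_).2
  · exact Eventually.of_forall fun x => hmeas φ hφ.continuous x
  · refine (hu.norm.mul_const B').mono' (hmeas φ hφ.continuous h) (ae_of_all _ fun z => ?_)
    exact (norm_inner_le_norm _ _).trans (by gcongr; exact hB' _)
  · exact (hmeas _ hdc h).neg
  · refine ae_of_all _ fun z x _ => ?_
    rw [norm_neg]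
    exact (norm_inner_le_norm _ _).trans (by gcongr; exact hB _)
  · exact hu.norm.mul_const B
  · refine ae_of_all _ fun z x _ => ?_
    have h1 : HasDerivAt (fun x : ℝ => z - ((0, x) : SpaceTime n)) (-(0, 1)) x := by
      have h2 : HasDerivAt (fun x : ℝ => ((0, x) : SpaceTime n)) (0, 1) x :=
        (hasDerivAt_const x _).prodMk (hasDerivAt_id x)
      exact h2.const_sub z
    have h3 : HasDerivAt (fun x : ℝ => φ (z - (0, x))) (-timeDeriv φ (z - (0, x))) x := by
      have h4 := ((hφ.differentiable (by simp)) (z - (0, x))).hasFDerivAt.comp_hasDerivAt x h1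
      rw [map_neg] at h4
      exact h4
    have h5 := (hasDerivAt_const x (u z)).inner ℝ h3
    simpa [inner_neg_right] using h5

theorem isTestFunction_mollify_translate {f : SpaceTime n → Vec N} {U K : Set (SpaceTime n)}
    {r : ℝ} (hf : Integrable f) (hK : IsCompact K) (hfK : ∀ z ∉ K, f z = 0)
    (hKU : K + Metric.closedBall 0 r ⊆ U) (ρ : ContDiffBump (0 : SpaceTime n)) {w : SpaceTime n}
    (hw : ρ.rOut + ‖w‖ ≤ r) : IsTestFunction U fun z => mollify ρ f (z - w) := by
  have hsub : tsupport (fun z => mollify ρ f (z - w)) ⊆ K + Metric.closedBall 0 r := by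
    refine closure_minimal (fun z hz => ?_) (hK.add (isCompact_closedBall _ _)).isClosed
    by_contra h
    refine hz (mollify_eq_zero ρ hfK fun h2 => h ?_)
    obtain ⟨a, ha, b, hb, hab⟩ := h2
    refine ⟨b, hb, a + w, ?_, ?_⟩
    · rw [mem_closedBall_zero_iff] at ha ⊢
      exact (norm_add_le _ _).trans (by linarith)
    · simp only at hab ⊢
      rw [add_comm a w, ← add_assoc, add_comm b w, add_assoc, add_comm b a, hab]; abel
  refine ⟨(contDiff_mollify ρ hf).comp (by fun_prop), ?_, hsub.trans hKU⟩
  exact (hK.add (isCompact_closedBall _ _)).of_isClosed_subset (isClosed_tsupport _) hsub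

/-- If `∂_t u = div F` and the scalar products of `F` with the small translates of the gradient `g`
of `f` are close to `c`, then a small time shift of `f` changes the scalar product with `u` by about
`-c` times the shift. -/
theorem WeakEq.abs_shift_le {U K : Set (SpaceTime n)} {u f : SpaceTime n → Vec N}
    {F g : SpaceTime n → Grad N n} {p q : ℝ≥0∞} [Fact (1 ≤ p)] [Fact (1 ≤ q)]
    [p.HolderConjugate q] (hp : p ≠ ⊤) (huF : WeakEq U u F) (hfg : HasSpaceGrad f g)
    (hu : Integrable u) (hup : MemLp u q) (hf : Integrable f) (hfp : MemLp f p)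
    (hF : Integrable F) (hF2 : MemLp F 2) (hg : Integrable g) (hg2 : MemLp g 2)
    (hK : IsCompact K) (hfK : ∀ z ∉ K, f z = 0) {r : ℝ}
    (hKU : K + Metric.closedBall 0 r ⊆ U) {c M : ℝ}
    (hM : ∀ w : SpaceTime n, ‖w‖ < r → |(∫ z, inner ℝ (F z) (g (z - w))) - c| ≤ M) {h : ℝ}
    (hh : |h| < r) :
    |(∫ z, inner ℝ (u z) (f (z - (0, h)))) - (∫ z, inner ℝ (u z) (f z)) + h * c| ≤ M * |h| := by
  set Γ : SpaceTime n → ℝ := fun w => ∫ z, inner ℝ (u z) (f (z - w)) with hΓ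
  set Λ : SpaceTime n → ℝ := fun w => ∫ z, inner ℝ (F z) (g (z - w)) with hΛ
  have hΓc : Continuous Γ := continuous_integral_inner_translate hp hfp hup
  have : Fact ((1 : ℝ≥0∞) ≤ 2) := ⟨by norm_num⟩
  have hΛc : Continuous Λ := continuous_integral_inner_translate (by norm_num) hg2 hF2
  have hM0 : 0 ≤ M := by
    refine (abs_nonneg _).trans (hM 0 ?_)
    rw [norm_zero]; exact (abs_nonneg h).trans_lt hh
  have hnorm : ∀ x : ℝ, ‖((0, x) : SpaceTime n)‖ = |x| := fun x => by simp [Prod.norm_def]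
  -- A mollified `f` is a legitimate test function, so `x ↦ Γ_ρ(0, x) + x c` has derivative `c -
  -- Λ_ρ(0, x)`. This is an average of `c - Λ(w)` over `‖w‖ < r`, hence bounded by `M`, and the mean
  -- value inequality applies.
  have key : ∀ ρ : ContDiffBump (0 : SpaceTime n), ρ.rOut + |h| ≤ r →
      |mollify ρ Γ (0, h) - mollify ρ Γ 0 + h * c| ≤ M * |h| := by
    intro ρ hρ
    have hmol : ∀ x : ℝ, mollify ρ Γ (0, x) =
        ∫ z, inner ℝ (u z) (mollify ρ f (z - (0, x))) := fun x =>
      (integral_inner_mollify_translate hu hf ρ (0, x)).symm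
    have htest := fun (x : ℝ) (hx : |x| ≤ |h|) =>
      isTestFunction_mollify_translate (w := (0, x)) hf hK hfK hKU ρ (by rw [hnorm]; linarith)
    have htest0 := htest 0 (by simp)
    simp only [Prod.mk_zero_zero, sub_zero] at htest0
    have hder : ∀ x ∈ Icc (-|h|) |h|, HasDerivWithinAt
        (fun x => mollify ρ Γ (0, x) + x * c) (-mollify ρ Λ (0, x) + c) (Icc (-|h|) |h|) x := by
      intro x hx
      have h1 := hasDerivAt_integral_inner_shift hu htest0.1 htest0.2.1 x
      have h2 := huF _ (htest x (abs_le.2 hx))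
      simp_rw [timeDeriv_translate, spaceGrad_translate, spaceGrad_mollify ρ hfg hf hg] at h2
      rw [h2] at h1
      have h3 := integral_inner_mollify_translate hF hg ρ (0, x)
      change _ = mollify ρ Λ (0, x) at h3
      have h4 : ∫ z, inner ℝ (F z) (mollify ρ g (z - (0, x))) = mollify ρ Λ (0, x) := h3
      rw [h4] at h1
      simp_rw [← hmol] at h1
      refine (h1.add ?_).hasDerivWithinAt
      simpa using (hasDerivAt_id x).mul_const c
    have hbound : ∀ x ∈ Icc (-|h|) |h|, ‖-mollify ρ Λ (0, x) + c‖ ≤ M := by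
      intro x hx
      have h1 := dist_convolution_le (μ := (volume : Measure (SpaceTime n))) (x₀ := (0, x))
        (g := Λ) (z₀ := c) hM0 ρ.support_normed_eq.subset ρ.nonneg_normed ρ.integral_normed
        hΛc.aestronglyMeasurable fun y hy => hM y ?_
      · rw [Real.dist_eq] at h1
        rw [Real.norm_eq_abs, neg_add_eq_sub, abs_sub_comm]
        exact h1
      · rw [mem_ball_iff_norm] at hy
        calc ‖y‖ = ‖(y - (0, x)) + (0, x)‖ := by rw [sub_add_cancel]
          _ ≤ ‖y - (0, x)‖ + |x| := by rw [← hnorm]; exact norm_add_le _ _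
          _ < r := by have := abs_le.2 hx; linarith
    have hmvt := (convex_Icc (-|h|) |h|).norm_image_sub_le_of_norm_hasDerivWithin_le hder hbound
      (x := 0) (y := h) (by simp) ⟨neg_abs_le h, le_abs_self h⟩
    simp only [zero_mul, add_zero, sub_zero, Real.norm_eq_abs, Prod.mk_zero_zero] at hmvt
    convert! hmvt using 2
    ring
  -- Bumps of radius at most `δ < r - |h|` keep the shifted supports inside `U`.
  obtain ⟨δ, hδ, hδ2⟩ := exists_between (sub_pos.2 hh)
  let ρ : ℕ → ContDiffBump (0 : SpaceTime n) := fun i =>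
    ⟨δ / (i + 1) / 2, δ / (i + 1), by positivity, half_lt_self (by positivity)⟩
  have hρ : Tendsto (fun i => (ρ i).rOut) atTop (𝓝 0) := by
    have := (tendsto_one_div_add_atTop_nhds_zero_nat (𝕜 := ℝ)).const_mul δ
    simpa [ρ, div_eq_mul_inv] using this
  have ht : ∀ w, Tendsto (fun i => mollify (ρ i) Γ w) atTop (𝓝 (Γ w)) := fun w =>
    ContDiffBump.convolution_tendsto_right_of_continuous hρ hΓc w
  have h0 : ∫ z, inner ℝ (u z) (f z) = Γ 0 := by simp [hΓ]
  rw [h0]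
  change |Γ (0, h) - Γ 0 + h * c| ≤ _
  refine le_of_tendsto (((ht (0, h)).sub (ht 0)).add_const (h * c)).abs
    (Eventually.of_forall fun i => key (ρ i) ?_)
  have : δ / (i + 1) ≤ δ := div_le_self hδ.le (by linarith [(Nat.cast_nonneg i : (0 : ℝ) ≤ i)])
  change δ / (i + 1) + |h| ≤ r
  linarith

/-- Bump functions on space-time with support shrinking to the origin. -/
noncomputable def bumpSeq (i : ℕ) : ContDiffBump (0 : SpaceTime n) :=
  ⟨1 / ((i : ℝ) + 1) / 2, 1 / ((i : ℝ) + 1), by positivity, half_lt_self (by positivity)⟩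

theorem tendsto_rOut_bumpSeq :
    Tendsto (fun i => (bumpSeq i : ContDiffBump (0 : SpaceTime n)).rOut) atTop (𝓝 0) :=
  tendsto_one_div_add_atTop_nhds_zero_nat (𝕜 := ℝ)

theorem rOut_bumpSeq_le (i : ℕ) : (bumpSeq i : ContDiffBump (0 : SpaceTime n)).rOut ≤ 1 := by
  have : (0 : ℝ) ≤ i := Nat.cast_nonneg i
  change 1 / ((i : ℝ) + 1) ≤ 1
  rw [div_le_one (by positivity)]
  linarith

theorem ae_tendsto_mollify {W : Type*} [NormedAddCommGroup W] [NormedSpace ℝ W] [CompleteSpace W]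
    {f : SpaceTime n → W} (hf : Integrable f) :
    ∀ᵐ z, Tendsto (fun i => mollify (bumpSeq i) f z) atTop (𝓝 (f z)) := by
  refine ContDiffBump.ae_convolution_tendsto_right_of_locallyIntegrable (K := 2)
    tendsto_rOut_bumpSeq (Eventually.of_forall fun i => ?_) hf.locallyIntegrable
  change 1 / ((i : ℝ) + 1) ≤ 2 * (1 / ((i : ℝ) + 1) / 2)
  linarith

theorem lintegral_le_of_tendsto {X : Type*} [MeasurableSpace X] {μ : Measure X}
    {h : ℕ → X → ℝ≥0∞} {h₀ : X → ℝ≥0∞} {C : ℝ≥0∞} (hm : ∀ i, AEMeasurable (h i) μ)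
    (ht : ∀ᵐ x ∂μ, Tendsto (fun i => h i x) atTop (𝓝 (h₀ x))) (hC : ∀ i, ∫⁻ x, h i x ∂μ ≤ C) :
    ∫⁻ x, h₀ x ∂μ ≤ C := by
  calc ∫⁻ x, h₀ x ∂μ = ∫⁻ x, liminf (fun i => h i x) atTop ∂μ := by
        refine lintegral_congr_ae ?_
        filter_upwards [ht] with x hx
        exact hx.liminf_eq.symm
    _ ≤ liminf (fun i => ∫⁻ x, h i x ∂μ) atTop := lintegral_liminf_le' hm
    _ ≤ C := liminf_le_of_frequently_le' (Frequently.of_forall hC)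

/-! ### Spatial translations in `L¹` -/

/-- Fundamental theorem of calculus along the segment from `z` to `z - (y, 0)`, then Tonelli and
translation invariance. Only the spatial gradient enters since the shift has no time component. -/
theorem lintegral_translate_space_le_of_contDiff {φ : SpaceTime n → Vec N} (hφ : ContDiff ℝ ∞ φ)
    (y : EuclideanSpace ℝ (Fin n)) :
    ∫⁻ z, ‖φ (z - (y, 0)) - φ z‖ₑ ≤ ‖y‖ₑ * ∫⁻ z, ‖spaceGrad φ z‖ₑ := by
  have hgc : Continuous (spaceGrad φ) := by
    have := hφ.continuous_fderiv (by simp)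
    unfold spaceGrad spaceDeriv
    fun_prop
  have hw : ∀ z, ‖φ (z - (y, 0)) - φ z‖ₑ ≤
      ∫⁻ s in Ioc (0 : ℝ) 1, ‖spaceGrad φ (z - s • (y, 0))‖ₑ * ‖y‖ₑ := by
    intro z
    have hd : ∀ s ∈ uIcc (0 : ℝ) 1, HasDerivAt (fun s : ℝ => φ (z - s • (y, 0)))
        (fderiv ℝ φ (z - s • (y, 0)) (-(y, 0))) s := by
      intro s _
      have h1 : HasDerivAt (fun s : ℝ => z - s • ((y, 0) : SpaceTime n)) (-(y, 0)) s := by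
        simpa using ((hasDerivAt_id s).smul_const ((y, 0) : SpaceTime n)).const_sub z
      exact ((hφ.differentiable (by simp)) _).hasFDerivAt.comp_hasDerivAt s h1
    have hc : Continuous fun s : ℝ => fderiv ℝ φ (z - s • (y, 0)) (-(y, 0)) := by
      have := hφ.continuous_fderiv (by simp)
      fun_prop
    have h1 := intervalIntegral.integral_eq_sub_of_hasDerivAt hd (hc.intervalIntegrable 0 1)
    simp only [one_smul, zero_smul, sub_zero] at h1
    rw [← h1, intervalIntegral.integral_of_le zero_le_one]
    refine (enorm_integral_le_lintegral_enorm _).trans (lintegral_mono fun s => ?_)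
    rw [map_neg, enorm_neg, ← ofReal_norm, ← ofReal_norm, ← ofReal_norm,
      ← ENNReal.ofReal_mul (norm_nonneg _)]
    exact ENNReal.ofReal_le_ofReal (norm_fderiv_space_le φ _ y)
  refine (lintegral_mono hw).trans ?_
  rw [lintegral_lintegral_swap]
  · have h1 : ∀ s : ℝ, ∫⁻ z, ‖spaceGrad φ (z - s • (y, 0))‖ₑ * ‖y‖ₑ =
        ‖y‖ₑ * ∫⁻ z, ‖spaceGrad φ z‖ₑ := by
      intro s
      rw [lintegral_mul_const' _ _ enorm_ne_top, mul_comm,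
        lintegral_sub_right_eq_self (fun z => ‖spaceGrad φ z‖ₑ)]
    simp_rw [h1]
    simp
  · refine Measurable.aemeasurable (Continuous.measurable ?_)
    simp only [Function.uncurry_def]
    refine ENNReal.continuous_mul_const enorm_ne_top |>.comp ?_
    fun_prop

/-- Mollification commutes with the weak gradient and does not increase its `L¹` norm; Fatou removes
it. -/
theorem HasSpaceGrad.lintegral_translate_space_le {f : SpaceTime n → Vec N}
    {g : SpaceTime n → Grad N n} (hfg : HasSpaceGrad f g) (hf : Integrable f) (hg : Integrable g)
    (y : EuclideanSpace ℝ (Fin n)) :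
    ∫⁻ z, ‖f (z - (y, 0)) - f z‖ₑ ≤ ‖y‖ₑ * ∫⁻ z, ‖g z‖ₑ := by
  have hc : ∀ i, Continuous (mollify (bumpSeq i) f) := fun i => (contDiff_mollify _ hf).continuous
  refine lintegral_le_of_tendsto (h := fun i z =>
    ‖mollify (bumpSeq i) f (z - (y, 0)) - mollify (bumpSeq i) f z‖ₑ) (fun i => ?_) ?_ fun i => ?_
  · have := hc i
    exact Continuous.aemeasurable (by fun_prop)
  · have h1 := ae_tendsto_mollify hf
    have h2 := (measurePreserving_sub_right (volume : Measure (SpaceTime n))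
      (y, 0)).quasiMeasurePreserving.ae h1
    filter_upwards [h1, h2] with z h3 h4
    exact (continuous_enorm.tendsto _).comp (h4.sub h3)
  · refine (lintegral_translate_space_le_of_contDiff (contDiff_mollify _ hf) y).trans ?_
    simp_rw [spaceGrad_mollify _ hfg hf hg]
    refine mul_le_mul' le_rfl ?_
    have := lintegral_mollify_rpow_le hg.aestronglyMeasurable (bumpSeq i) le_rfl
    simpa [mollify] using this

/-! ### A parabolic Gagliardo-Nirenberg inequality -/

/-- The gradient exponent `2` is not subcritical when `n = 2`, so the Sobolev inequality is used
with `p = 1 / min 1 (1/q + 1/n)`. The strict condition on `q` gives `p < 2 ≤ n`, and `1/p - 1/n ≤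
1/q`; Hölder on the ball then replaces `L^p` by `L²`. -/
theorem exists_sobolev (hn : 2 ≤ n) {q : ℝ} (hq : 2 < q) (hqn : 1 / 2 - 1 / (n : ℝ) < 1 / q)
    (R : ℝ) : ∃ C : ℝ≥0, ∀ ψ : EuclideanSpace ℝ (Fin n) → Vec N, ContDiff ℝ 1 ψ →
      Function.support ψ ⊆ Metric.closedBall 0 R →
      (∫⁻ x, ‖ψ x‖ₑ ^ q) ^ (2 / q) ≤ C * ∫⁻ x, ‖fderiv ℝ ψ x‖ₑ ^ (2 : ℝ) := by
  have hn0 : (0 : ℝ) < n := by positivity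
  have hn2 : (2 : ℝ) ≤ n := by exact_mod_cast hn
  set a : ℝ := min 1 (1 / q + 1 / n) with ha
  have ha2 : 1 / 2 < a := lt_min (by norm_num) (by linarith)
  have ha1 : a ≤ 1 := min_le_left _ _
  let p : ℝ≥0 := ⟨a⁻¹, by positivity⟩
  let q' : ℝ≥0 := ⟨q, by linarith⟩
  have hp1 : 1 ≤ p := by
    change (1 : ℝ) ≤ a⁻¹
    exact (one_le_inv₀ (by linarith)).2 ha1
  have hp2' : a⁻¹ < 2 := by
    rw [inv_lt_comm₀ (by linarith) (by norm_num)]; linarith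
  have hp2 : (p : ℝ≥0∞) ≤ 2 := by
    have : p ≤ 2 := hp2'.le
    exact_mod_cast this
  set s := Metric.closedBall (0 : EuclideanSpace ℝ (Fin n)) R
  set V : ℝ≥0∞ := volume s ^ (1 / (p : ℝ≥0∞).toReal - 1 / (2 : ℝ≥0∞).toReal) with hV
  have hVtop : V ≠ ⊤ := by
    refine ENNReal.rpow_ne_top_of_nonneg ?_ (isCompact_closedBall _ _).measure_lt_top.ne
    change 0 ≤ 1 / a⁻¹ - 1 / 2
    rw [one_div, inv_inv]; linarith
  set C₀ := eLpNormLESNormFDerivOfLeConst (Vec N) (volume : Measure (EuclideanSpace ℝ (Fin n))) s p q'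
  refine ⟨(C₀ * V.toNNReal) ^ 2, fun ψ hψ hs => ?_⟩
  have h1 := eLpNorm_le_eLpNorm_fderiv_of_le (volume : Measure (EuclideanSpace ℝ (Fin n)))
    hψ hs (p := p) (q := q') hp1 ?_ ?_ Metric.isBounded_closedBall
  · have hts : tsupport ψ ⊆ s := closure_minimal hs Metric.isClosed_closedBall
    have h2 : eLpNorm (fderiv ℝ ψ) p volume ≤ eLpNorm (fderiv ℝ ψ) 2 volume * V := by
      have hsub : Function.support (fderiv ℝ ψ) ⊆ s := (support_fderiv_subset ℝ).trans hts
      have := eLpNorm_le_eLpNorm_mul_rpow_measure_univ (μ := volume.restrict s) hp2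
        (hψ.continuous_fderiv one_ne_zero).aestronglyMeasurable
      have e : ∀ r : ℝ≥0∞, eLpNorm (fderiv ℝ ψ) r (volume.restrict s) =
          eLpNorm (fderiv ℝ ψ) r volume := fun r => by
        rw [← eLpNorm_norm, ← eLpNorm_norm (μ := volume)]
        exact eLpNorm_restrict_eq_of_support_subset
          (Function.support_subset_iff'.2 fun x hx => by
            simp [Function.notMem_support.1 fun h => hx (hsub h)])
      rwa [Measure.restrict_apply_univ, e, e] at this
    have h3 : eLpNorm ψ q' volume ≤ C₀ * V * eLpNorm (fderiv ℝ ψ) 2 volume := by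
      refine h1.trans ?_
      rw [mul_assoc, mul_comm V]
      gcongr
    have hq'0 : q' ≠ 0 := fun h => by
      have : q = 0 := congrArg NNReal.toReal h
      linarith
    have h4 : (∫⁻ x, ‖ψ x‖ₑ ^ q) ^ (2 / q) = eLpNorm ψ q' volume ^ (2 : ℝ) := by
      rw [eLpNorm_nnreal_eq_lintegral hq'0, ← ENNReal.rpow_mul]
      congr 1
      change 2 / q = 1 / q * 2
      ring
    have h5 : ∫⁻ x, ‖fderiv ℝ ψ x‖ₑ ^ (2 : ℝ) = eLpNorm (fderiv ℝ ψ) 2 volume ^ (2 : ℝ) := by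
      have := eLpNorm_nnreal_pow_eq_lintegral (μ := volume) (f := fderiv ℝ ψ) (p := 2) two_ne_zero
      exact this.symm
    rw [h4, h5]
    refine (ENNReal.rpow_le_rpow h3 (by norm_num)).trans (le_of_eq ?_)
    rw [ENNReal.mul_rpow_of_nonneg _ _ (by norm_num)]
    congr 1
    rw [ENNReal.rpow_two]
    push_cast
    rw [ENNReal.coe_toNNReal hVtop]
  · rw [finrank_euclideanSpace, Fintype.card_fin]
    rw [← NNReal.coe_lt_coe]
    change a⁻¹ < ((n : ℝ≥0) : ℝ)
    push_cast
    linarith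
  · rw [finrank_euclideanSpace, Fintype.card_fin]
    change (((p⁻¹ : ℝ≥0)) : ℝ) - (n : ℝ)⁻¹ ≤ q⁻¹
    rw [NNReal.coe_inv]
    change (a⁻¹)⁻¹ - (n : ℝ)⁻¹ ≤ q⁻¹
    rw [inv_inv]
    have h4 : a ≤ 1 / q + 1 / (n : ℝ) := min_le_right _ _
    rw [one_div, one_div] at h4
    linarith

/-- Hölder with weights `2/q` and `1 - 2/q`, using `q · (2/q) = 2`. -/
theorem slice_interpolation {X : Type*} [MeasurableSpace X] {μ : Measure X} {h : X → ℝ≥0∞}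
    (hm : AEMeasurable h μ) {q p : ℝ} (hq : 2 < q) (hp : 1 ≤ p) :
    ∫⁻ x, h x ^ (2 + p * (1 - 2 / q)) ∂μ ≤
      (∫⁻ x, h x ^ q ∂μ) ^ (2 / q) * (∫⁻ x, h x ^ p ∂μ) ^ (1 - 2 / q) := by
  have hq0 : 0 < q := by linarith
  have h2q : 0 ≤ 1 - 2 / q := by
    rw [sub_nonneg, div_le_one hq0]; exact hq.le
  have := ENNReal.lintegral_mul_norm_pow_le (μ := μ) (hm.pow_const q) (hm.pow_const p)
    (p := 2 / q) (q := 1 - 2 / q) (by positivity) h2q (by ring)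
  refine le_trans (le_of_eq (lintegral_congr fun x => ?_)) this
  rw [← ENNReal.rpow_mul, ← ENNReal.rpow_mul, mul_div_cancel₀ _ hq0.ne',
    ENNReal.rpow_add_of_nonneg _ _ (by norm_num) (by positivity)]

/-- On each time slice interpolate, bound the `L^q` factor by Sobolev and the `L^p` factor by `E`;
the gradient then occurs to the power two exactly, so that integration in time closes the estimate.
The constant is independent of `p`. -/
theorem exists_gagliardo_nirenberg_smooth (hn : 2 ≤ n) {q : ℝ} (hq : 2 < q)
    (hqn : 1 / 2 - 1 / (n : ℝ) < 1 / q) (R : ℝ) :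
    ∃ C : ℝ≥0, ∀ φ : SpaceTime n → Vec N, ContDiff ℝ ∞ φ → (∀ z, R < ‖z‖ → φ z = 0) →
      ∀ p : ℝ, 1 ≤ p → ∀ E : ℝ≥0∞, (∀ t, ∫⁻ x, ‖φ (x, t)‖ₑ ^ p ≤ E) →
      ∫⁻ z, ‖φ z‖ₑ ^ (2 + p * (1 - 2 / q)) ≤
        C * E ^ (1 - 2 / q) * ∫⁻ z, ‖spaceGrad φ z‖ₑ ^ (2 : ℝ) := by
  obtain ⟨C, hC⟩ := exists_sobolev (N := N) hn hq hqn R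
  refine ⟨C, fun φ hφ hR p hp E hE => ?_⟩
  have hgc : Continuous (spaceGrad φ) := by
    have := hφ.continuous_fderiv (by simp)
    unfold spaceGrad spaceDeriv
    fun_prop
  have hφc := hφ.continuous
  have h2q : 0 ≤ 1 - 2 / q := by
    rw [sub_nonneg, div_le_one (by linarith)]; exact hq.le
  have hslice : ∀ t, ∫⁻ x, ‖φ (x, t)‖ₑ ^ (2 + p * (1 - 2 / q)) ≤
      C * E ^ (1 - 2 / q) * ∫⁻ x, ‖spaceGrad φ (x, t)‖ₑ ^ (2 : ℝ) := by
    intro t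
    have hm : AEMeasurable (fun x => ‖φ (x, t)‖ₑ) volume :=
      Continuous.aemeasurable (by fun_prop)
    refine (slice_interpolation hm hq hp).trans ?_
    have h1 := hC (fun x => φ (x, t)) ((hφ.of_le (by simp)).comp (by fun_prop)) fun x hx => by
      rw [mem_closedBall_zero_iff]
      by_contra h
      refine hx (hR _ ((not_le.1 h).trans_le ?_))
      exact norm_fst_le ((x, t) : SpaceTime n)
    have h2 : ∀ x, ‖fderiv ℝ (fun x => φ (x, t)) x‖ₑ ≤ ‖spaceGrad φ (x, t)‖ₑ := by
      intro x
      rw [← ofReal_norm, ← ofReal_norm]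
      refine ENNReal.ofReal_le_ofReal (ContinuousLinearMap.opNorm_le_bound _ (norm_nonneg _) ?_)
      intro y
      have h3 : HasFDerivAt (fun x => φ (x, t)) ((fderiv ℝ φ (x, t)).comp
          (ContinuousLinearMap.inl ℝ _ ℝ)) x :=
        ((hφ.differentiable (by simp)) (x, t)).hasFDerivAt.comp x (hasFDerivAt_prodMk_left x t)
      rw [h3.fderiv]
      exact norm_fderiv_space_le φ (x, t) y
    calc _ ≤ (C * ∫⁻ x, ‖fderiv ℝ (fun x => φ (x, t)) x‖ₑ ^ (2 : ℝ)) * E ^ (1 - 2 / q) := by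
          gcongr
          exact hE t
      _ ≤ (C * ∫⁻ x, ‖spaceGrad φ (x, t)‖ₑ ^ (2 : ℝ)) * E ^ (1 - 2 / q) := by
          gcongr with x
          exact h2 x
      _ = _ := by ring
  rw [Measure.volume_eq_prod, lintegral_prod_symm _ (Continuous.aemeasurable (by fun_prop)),
    lintegral_prod_symm _ (Continuous.aemeasurable (by fun_prop))]
  refine (lintegral_mono hslice).trans (le_of_eq ?_)
  refine lintegral_const_mul _ ?_
  refine Measurable.lintegral_prod_left' (f := fun z : EuclideanSpace ℝ (Fin n) × ℝ =>
    ‖spaceGrad φ z‖ₑ ^ (2 : ℝ)) (Continuous.measurable (by fun_prop))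

/-- By Jensen a slice of the mollification is controlled by an average of slices of `f`; thus a
bound for almost every time becomes a bound at every time. -/
theorem lintegral_slice_mollify_le {f : SpaceTime n → Vec N} (hf : StronglyMeasurable f)
    (ρ : ContDiffBump (0 : SpaceTime n)) {p : ℝ} (hp : 1 ≤ p) {E : ℝ≥0∞}
    (hE : ∀ᵐ t : ℝ, ∫⁻ x, ‖f (x, t)‖ₑ ^ p ≤ E) (t : ℝ) :
    ∫⁻ x, ‖mollify ρ f (x, t)‖ₑ ^ p ≤ E := by
  have hρc : Continuous (ρ.normed volume) := (ρ.contDiff_normed (n := 0)).continuous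
  have hρ1 : ∫⁻ y, ENNReal.ofReal (ρ.normed volume y) = 1 := by
    rw [← ofReal_integral_eq_lintegral_ofReal ρ.integrable_normed
      (ae_of_all _ ρ.nonneg_normed), ρ.integral_normed, ENNReal.ofReal_one]
  refine (lintegral_mono fun x =>
    enorm_mollify_rpow_le hf.aestronglyMeasurable ρ hp (x, t)).trans ?_
  rw [lintegral_lintegral_swap]
  · have h1 : ∀ᵐ y : SpaceTime n,
        ∫⁻ x, ENNReal.ofReal (ρ.normed volume y) * ‖f ((x, t) - y)‖ₑ ^ p ≤
          ENNReal.ofReal (ρ.normed volume y) * E := by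
      have hq : Measure.QuasiMeasurePreserving (fun y : SpaceTime n => t - y.2) volume volume :=
        (quasiMeasurePreserving_sub_left (volume : Measure ℝ) t).comp
          Measure.quasiMeasurePreserving_snd
      filter_upwards [hq.ae hE] with y hy
      rw [lintegral_const_mul' _ _ ENNReal.ofReal_ne_top]
      gcongr
      refine le_trans (le_of_eq ?_) hy
      exact lintegral_sub_right_eq_self (fun x => ‖f (x, t - y.2)‖ₑ ^ p) y.1
    refine (lintegral_mono_ae h1).trans ?_
    rw [lintegral_mul_const _ hρc.measurable.ennreal_ofReal, hρ1, one_mul]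
  · refine Measurable.aemeasurable ?_
    simp only [Function.uncurry_def]
    refine Measurable.mul (hρc.measurable.ennreal_ofReal.comp measurable_snd) ?_
    exact (hf.measurable.enorm.comp (by fun_prop)).pow_const p

theorem exists_gagliardo_nirenberg (hn : 2 ≤ n) {q : ℝ} (hq : 2 < q)
    (hqn : 1 / 2 - 1 / (n : ℝ) < 1 / q) (R : ℝ) :
    ∃ C : ℝ≥0, ∀ (f : SpaceTime n → Vec N) (g : SpaceTime n → Grad N n), HasSpaceGrad f g →
      Integrable f → Integrable g → (∀ z, R < ‖z‖ → f z = 0) →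
      ∀ p : ℝ, 1 ≤ p → ∀ E : ℝ≥0∞, (∀ᵐ t : ℝ, ∫⁻ x, ‖f (x, t)‖ₑ ^ p ≤ E) →
      ∫⁻ z, ‖f z‖ₑ ^ (2 + p * (1 - 2 / q)) ≤
        C * E ^ (1 - 2 / q) * ∫⁻ z, ‖g z‖ₑ ^ (2 : ℝ) := by
  -- Bumps of radius at most one enlarge the support radius from `R` to `1 + R`.
  obtain ⟨C, hC⟩ := exists_gagliardo_nirenberg_smooth (N := N) hn hq hqn (1 + R)
  refine ⟨C, fun f g hfg hf hg hR p hp E hE => ?_⟩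
  have hsm := hf.aestronglyMeasurable.stronglyMeasurable_mk
  have hae := hf.aestronglyMeasurable.ae_eq_mk
  have hE' : ∀ᵐ t : ℝ, ∫⁻ x, ‖hf.aestronglyMeasurable.mk f (x, t)‖ₑ ^ p ≤ E := by
    have h1 : ∀ᵐ a : ℝ × EuclideanSpace ℝ (Fin n) ∂(volume.prod volume),
        f a.swap = hf.aestronglyMeasurable.mk f a.swap :=
      (Measure.measurePreserving_swap (μ := (volume : Measure ℝ))
        (ν := (volume : Measure (EuclideanSpace ℝ (Fin n))))).quasiMeasurePreserving.ae hae
    filter_upwards [Measure.ae_ae_of_ae_prod h1, hE] with t h2 h3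
    refine le_trans (le_of_eq (lintegral_congr_ae ?_)) h3
    filter_upwards [h2] with x hx
    change f (x, t) = _ at hx
    rw [hx]; rfl
  -- Slices need a strongly measurable representative; changing `f` on a null set does not alter its
  -- mollifications.
  have hmol : ∀ i, mollify (bumpSeq i) (hf.aestronglyMeasurable.mk f) = mollify (bumpSeq i) f :=
    fun i => convolution_congr _ (EventuallyEq.refl _ _) hae.symm
  refine lintegral_le_of_tendsto (h := fun i z =>
    ‖mollify (bumpSeq i) f z‖ₑ ^ (2 + p * (1 - 2 / q))) (fun i => ?_) ?_ fun i => ?_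
  · have := (contDiff_mollify (bumpSeq i) hf).continuous
    exact Continuous.aemeasurable (by fun_prop)
  · filter_upwards [ae_tendsto_mollify hf] with z hz
    exact ((ENNReal.continuous_rpow_const.comp continuous_enorm).tendsto _).comp hz
  · refine (hC (mollify (bumpSeq i) f) (contDiff_mollify _ hf) (fun z hz => ?_) p hp E ?_).trans ?_
    · refine mollify_eq_zero (bumpSeq i) (K := Metric.closedBall 0 R) (fun y hy => hR y ?_) ?_
      · simpa using hy
      · rintro ⟨a, ha, b, hb, rfl⟩
        rw [mem_closedBall_zero_iff] at ha hb
        have := norm_add_le a b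
        have := rOut_bumpSeq_le (n := n) i
        dsimp only at hz
        linarith
    · intro t
      rw [← hmol]
      exact lintegral_slice_mollify_le hsm _ hp hE' t
    · simp_rw [spaceGrad_mollify _ hfg hf hg]
      refine mul_le_mul' le_rfl ?_
      exact lintegral_mollify_rpow_le hg.aestronglyMeasurable (bumpSeq i) (by norm_num)

/-! ### Cut-off functions -/

/-- The classical spatial gradient of a scalar function. -/
noncomputable def scalarGrad (ζ : SpaceTime n → ℝ) (z : SpaceTime n) : EuclideanSpace ℝ (Fin n) :=
  WithLp.toLp 2 fun j => spaceDeriv j ζ z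

/-- The tensor product `v ⊗ a`. -/
noncomputable def tens (v : Vec N) (a : EuclideanSpace ℝ (Fin n)) : Grad N n :=
  WithLp.toLp 2 fun q => v q.1 * a q.2

theorem norm_tens (v : Vec N) (a : EuclideanSpace ℝ (Fin n)) : ‖tens v a‖ = ‖v‖ * ‖a‖ := by
  rw [EuclideanSpace.norm_eq, EuclideanSpace.norm_eq, EuclideanSpace.norm_eq,
    ← Real.sqrt_mul (by positivity), Fintype.sum_prod_type, Finset.sum_mul_sum]
  simp [tens, mul_pow]

theorem tens_smul (v : Vec N) (c : ℝ) (a : EuclideanSpace ℝ (Fin n)) :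
    tens v (c • a) = c • tens v a := by
  ext q; simp [tens]; ring

theorem tens_sub (v w : Vec N) (a : EuclideanSpace ℝ (Fin n)) :
    tens (v - w) a = tens v a - tens w a := by
  ext q; simp [tens]; ring

theorem continuous_tens :
    Continuous fun x : Vec N × EuclideanSpace ℝ (Fin n) => tens x.1 x.2 := by
  unfold tens; fun_prop

theorem IsTestFunction.continuous {F : Type*} [NormedAddCommGroup F] [NormedSpace ℝ F]
    {U : Set (SpaceTime n)} {φ : SpaceTime n → F} (h : IsTestFunction U φ) : Continuous φ :=
  h.1.continuous

theorem IsTestFunction.continuous_timeDeriv {F : Type*} [NormedAddCommGroup F] [NormedSpace ℝ F]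
    {U : Set (SpaceTime n)} {φ : SpaceTime n → F} (h : IsTestFunction U φ) :
    Continuous (timeDeriv φ) := by
  have := h.1.continuous_fderiv (by simp)
  unfold timeDeriv
  fun_prop

theorem IsTestFunction.continuous_spaceDeriv {F : Type*} [NormedAddCommGroup F] [NormedSpace ℝ F]
    {U : Set (SpaceTime n)} {φ : SpaceTime n → F} (h : IsTestFunction U φ) (j : Fin n) :
    Continuous (spaceDeriv j φ) := by
  have := h.1.continuous_fderiv (by simp)
  unfold spaceDeriv
  fun_prop

theorem IsTestFunction.continuous_scalarGrad {U : Set (SpaceTime n)} {φ : SpaceTime n → ℝ}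
    (h : IsTestFunction U φ) : Continuous (scalarGrad φ) := by
  have := fun j => h.continuous_spaceDeriv j
  unfold scalarGrad
  fun_prop

theorem fderiv_eq_zero_of_notMem_tsupport {F : Type*} [NormedAddCommGroup F] [NormedSpace ℝ F]
    {φ : SpaceTime n → F} {z : SpaceTime n} (hz : z ∉ tsupport φ) : fderiv ℝ φ z = 0 :=
  Function.notMem_support.1 fun h => hz (support_fderiv_subset ℝ h)

theorem timeDeriv_eq_zero {F : Type*} [NormedAddCommGroup F] [NormedSpace ℝ F]
    {φ : SpaceTime n → F} {z : SpaceTime n} (hz : z ∉ tsupport φ) : timeDeriv φ z = 0 := by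
  simp [timeDeriv, fderiv_eq_zero_of_notMem_tsupport hz]

theorem scalarGrad_eq_zero {φ : SpaceTime n → ℝ} {z : SpaceTime n} (hz : z ∉ tsupport φ) :
    scalarGrad φ z = 0 := by
  ext j; simp [scalarGrad, spaceDeriv, fderiv_eq_zero_of_notMem_tsupport hz]

theorem IsTestFunction.exists_bound {U : Set (SpaceTime n)} {φ : SpaceTime n → ℝ}
    (h : IsTestFunction U φ) :
    ∃ B, 0 ≤ B ∧ ∀ z, |φ z| ≤ B ∧ |timeDeriv φ z| ≤ B ∧ ‖scalarGrad φ z‖ ≤ B := by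
  have hc2 : HasCompactSupport (timeDeriv φ) :=
    HasCompactSupport.intro h.2.1 fun z hz => timeDeriv_eq_zero hz
  have hc3 : HasCompactSupport (scalarGrad φ) :=
    HasCompactSupport.intro h.2.1 fun z hz => scalarGrad_eq_zero hz
  obtain ⟨B₁, h₁⟩ := h.2.1.exists_bound_of_continuous h.continuous
  obtain ⟨B₂, h₂⟩ := hc2.exists_bound_of_continuous h.continuous_timeDeriv
  obtain ⟨B₃, h₃⟩ := hc3.exists_bound_of_continuous h.continuous_scalarGrad
  refine ⟨max B₁ (max B₂ B₃), ?_, fun z => ⟨?_, ?_, ?_⟩⟩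
  · exact (norm_nonneg (φ 0)).trans ((h₁ 0).trans (le_max_left _ _))
  · exact (h₁ z).trans (le_max_left _ _)
  · exact (h₂ z).trans ((le_max_left _ _).trans (le_max_right _ _))
  · exact (h₃ z).trans ((le_max_right _ _).trans (le_max_right _ _))

theorem IsTestFunction.mul {U : Set (SpaceTime n)} {ζ φ : SpaceTime n → ℝ}
    (hζ : IsTestFunction U ζ) (hφ : ContDiff ℝ ∞ φ) : IsTestFunction U fun z => ζ z * φ z :=
  ⟨hζ.1.mul hφ, hζ.2.1.mul_right, tsupport_mul_subset_left.trans hζ.2.2⟩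

theorem memLp_bdd_smul {X W : Type*} [MeasurableSpace X] {μ : Measure X} [NormedAddCommGroup W]
    [NormedSpace ℝ W] {φ : X → ℝ} {f : X → W} {p : ℝ≥0∞} {B : ℝ}
    (hφ : AEStronglyMeasurable φ μ) (hB : ∀ x, |φ x| ≤ B) (hf : MemLp f p μ) :
    MemLp (fun x => φ x • f x) p μ := by
  refine hf.of_le_mul (c := B) (hφ.smul hf.1) (ae_of_all _ fun x => ?_)
  rw [norm_smul]
  gcongr
  exact hB x

theorem integrable_inner_of_memLp {X W : Type*} [MeasurableSpace X] {μ : Measure X}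
    [NormedAddCommGroup W] [InnerProductSpace ℝ W] {u f : X → W} {p q : ℝ≥0∞}
    [p.HolderConjugate q] (hu : MemLp u p μ) (hf : MemLp f q μ) :
    Integrable (fun x => inner ℝ (u x) (f x)) μ :=
  (hu.norm.integrable_mul hf.norm).mono' (hu.1.inner hf.1)
    (ae_of_all _ fun x => norm_inner_le_norm (u x) (f x))

theorem memLp_tens {X : Type*} [MeasurableSpace X] {μ : Measure X} {v : X → Vec N}
    {a : X → EuclideanSpace ℝ (Fin n)} {p : ℝ≥0∞} {B : ℝ} (hv : MemLp v p μ)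
    (ha : AEStronglyMeasurable a μ) (hB : ∀ x, ‖a x‖ ≤ B) :
    MemLp (fun x => tens (v x) (a x)) p μ := by
  refine hv.of_le_mul (c := B) ?_ (ae_of_all _ fun x => ?_)
  · exact continuous_tens.comp_aestronglyMeasurable (hv.1.prodMk ha)
  · rw [norm_tens, mul_comm]
    gcongr
    exact hB x

/-- `G` is the weak spatial gradient of `v` in `U`. -/
def LocGrad (U : Set (SpaceTime n)) (v : SpaceTime n → Vec N) (G : SpaceTime n → Grad N n) :
    Prop :=
  ∀ φ : SpaceTime n → ℝ, IsTestFunction U φ → ∀ (k : Fin N) (j : Fin n),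
    ∫ z, v z k * spaceDeriv j φ z = -∫ z, G z (k, j) * φ z

/-- The gradient of `ζ v`. -/
noncomputable def cutGrad (ζ : SpaceTime n → ℝ) (v : SpaceTime n → Vec N)
    (G : SpaceTime n → Grad N n) (z : SpaceTime n) : Grad N n :=
  ζ z • G z + tens (v z) (scalarGrad ζ z)

theorem memLp_cutGrad {U : Set (SpaceTime n)} {v : SpaceTime n → Vec N} {G : SpaceTime n → Grad N n}
    {p : ℝ≥0∞} {ζ : SpaceTime n → ℝ} (hζ : IsTestFunction U ζ) (hv : MemLp v p) (hG : MemLp G p) :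
    MemLp (cutGrad ζ v G) p := by
  obtain ⟨B, -, hB⟩ := hζ.exists_bound
  exact (memLp_bdd_smul hζ.continuous.aestronglyMeasurable (fun z => (hB z).1) hG).add
    (memLp_tens hv hζ.continuous_scalarGrad.aestronglyMeasurable fun z => (hB z).2.2)

theorem integrable_apply {ι X : Type*} [Fintype ι] [MeasurableSpace X] {μ : Measure X}
    {f : X → EuclideanSpace ℝ ι} (hf : Integrable f μ) (k : ι) : Integrable (fun x => f x k) μ :=
  (EuclideanSpace.proj (𝕜 := ℝ) k).integrable_comp hf

/-- Product rule, tested with `ζ φ`: the cut-off turns a local gradient into one on the whole space.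
-/
theorem LocGrad.hasSpaceGrad {U : Set (SpaceTime n)} {v : SpaceTime n → Vec N}
    {G : SpaceTime n → Grad N n} (h : LocGrad U v G) (hv : Integrable v) (hG : Integrable G)
    {ζ : SpaceTime n → ℝ} (hζ : IsTestFunction U ζ) :
    HasSpaceGrad (fun z => ζ z • v z) (cutGrad ζ v G) := by
  intro φ hφ hφs k j
  have hφt : IsTestFunction univ φ := ⟨hφ, hφs, subset_univ _⟩
  obtain ⟨B, hB0, hB⟩ := hζ.exists_bound
  obtain ⟨B', hB0', hB'⟩ := hφt.exists_bound
  have hd : ∀ z, spaceDeriv j (fun z => ζ z * φ z) z =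
      ζ z * spaceDeriv j φ z + spaceDeriv j ζ z * φ z := by
    intro z
    have h1 : HasFDerivAt (fun z => ζ z * φ z) _ z :=
      ((hζ.1.differentiable (by simp)) z).hasFDerivAt.mul
        ((hφ.differentiable (by simp)) z).hasFDerivAt
    simp only [spaceDeriv]
    rw [h1.fderiv]
    simp [mul_comm]
  have hcoord : ∀ (ψ : SpaceTime n → ℝ) (z : SpaceTime n), |spaceDeriv j ψ z| ≤ ‖scalarGrad ψ z‖ :=
    fun ψ z => PiLp.norm_apply_le (scalarGrad ψ z) j
  have hi1 : Integrable (fun z => v z k * (ζ z * spaceDeriv j φ z)) := by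
    refine (integrable_apply hv k).mul_bdd (c := B * B') ?_ (ae_of_all _ fun z => ?_)
    · exact (hζ.continuous.mul (hφt.continuous_spaceDeriv j)).aestronglyMeasurable
    · rw [Real.norm_eq_abs, abs_mul]
      have := (hcoord φ z).trans (hB' z).2.2
      gcongr
      exact (hB z).1
  have hi2 : Integrable (fun z => v z k * (spaceDeriv j ζ z * φ z)) := by
    refine (integrable_apply hv k).mul_bdd (c := B * B') ?_ (ae_of_all _ fun z => ?_)
    · exact ((hζ.continuous_spaceDeriv j).mul hφt.continuous).aestronglyMeasurable
    · rw [Real.norm_eq_abs, abs_mul]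
      have := (hcoord ζ z).trans (hB z).2.2
      gcongr
      exact (hB' z).1
  have hi3 : Integrable (fun z => G z (k, j) * (ζ z * φ z)) := by
    refine (integrable_apply hG (k, j)).mul_bdd (c := B * B') ?_ (ae_of_all _ fun z => ?_)
    · exact (hζ.continuous.mul hφt.continuous).aestronglyMeasurable
    · rw [Real.norm_eq_abs, abs_mul]
      gcongr
      exacts [(hB z).1, (hB' z).1]
  have h1 := h _ (hζ.mul hφ) k j
  simp_rw [hd, mul_add] at h1
  rw [integral_add hi1 hi2] at h1
  have e1 : ∀ z, (ζ z • v z) k * spaceDeriv j φ z = v z k * (ζ z * spaceDeriv j φ z) := fun z => by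
    simp; ring
  have e2 : ∀ z, cutGrad ζ v G z (k, j) * φ z =
      G z (k, j) * (ζ z * φ z) + v z k * (spaceDeriv j ζ z * φ z) := fun z => by
    simp [cutGrad, tens, scalarGrad]; ring
  simp_rw [e1, e2]
  rw [integral_add hi3 hi2]
  linarith

theorem exists_thickening {K U : Set (SpaceTime n)} (hK : IsCompact K) (hU : IsOpen U)
    (hKU : K ⊆ U) : ∃ r, 0 < r ∧ K + Metric.closedBall 0 r ⊆ U := by
  obtain ⟨r, hr, h⟩ := hK.exists_cthickening_subset_open hU hKU
  refine ⟨r, hr, fun z hz => h ?_⟩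
  obtain ⟨a, ha, b, hb, rfl⟩ := hz
  refine Metric.mem_cthickening_of_dist_le _ a r K ha ?_
  simpa using hb

/-! ### The energy identity -/

/-- Apply `WeakEq.abs_shift_le` with `c = ∫ F · g`: by continuity of translations in `L²` the error
`M` is as small as desired for short shifts. Neither `u` nor `f` needs a time derivative. -/
theorem WeakEq.hasDerivAt_shift {U K : Set (SpaceTime n)} {u f : SpaceTime n → Vec N}
    {F g : SpaceTime n → Grad N n} {p q : ℝ≥0∞} [Fact (1 ≤ p)] [Fact (1 ≤ q)]
    [p.HolderConjugate q] (hp : p ≠ ⊤) (huF : WeakEq U u F) (hfg : HasSpaceGrad f g)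
    (hu : Integrable u) (hup : MemLp u q) (hf : Integrable f) (hfp : MemLp f p)
    (hF : Integrable F) (hF2 : MemLp F 2) (hg : Integrable g) (hg2 : MemLp g 2)
    (hU : IsOpen U) (hK : IsCompact K) (hKU : K ⊆ U) (hfK : ∀ z ∉ K, f z = 0) :
    HasDerivAt (fun h : ℝ => ∫ z, inner ℝ (u z) (f (z - (0, h))))
      (-∫ z, inner ℝ (F z) (g z)) 0 := by
  obtain ⟨r, hr, hrU⟩ := exists_thickening hK hU hKU
  have : Fact ((1 : ℝ≥0∞) ≤ 2) := ⟨by norm_num⟩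
  have hΛc := continuous_integral_inner_translate (by norm_num) hg2 hF2
  rw [hasDerivAt_iff_isLittleO, Asymptotics.isLittleO_iff]
  intro ε hε
  obtain ⟨δ, hδ, hδ2⟩ := Metric.continuousAt_iff.1 hΛc.continuousAt ε hε
  have hδ3 : ∀ w : SpaceTime n, ‖w‖ < δ →
      |(∫ z, inner ℝ (F z) (g (z - w))) - ∫ z, inner ℝ (F z) (g z)| ≤ ε := by
    intro w hw
    have h1 := hδ2 (x := w) (by rwa [dist_zero_right])
    rw [Real.dist_eq] at h1
    simpa only [sub_zero] using h1.le
  have hball : Metric.ball (0 : ℝ) (min δ r) ∈ 𝓝 0 := Metric.ball_mem_nhds _ (lt_min hδ hr)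
  filter_upwards [hball] with h hh
  rw [mem_ball_zero_iff, Real.norm_eq_abs] at hh
  have hsub : K + Metric.closedBall (0 : SpaceTime n) (min δ r) ⊆ U :=
    (add_subset_add_left (Metric.closedBall_subset_closedBall (min_le_right _ _))).trans hrU
  have := huF.abs_shift_le hp hfg hu hup hf hfp hF hF2 hg hg2 hK hfK hsub
    (c := ∫ z, inner ℝ (F z) (g z)) (M := ε)
    (fun w hw => hδ3 w (hw.trans_le (min_le_left _ _))) hh
  simp only [Prod.mk_zero_zero, sub_zero, smul_eq_mul, mul_neg, sub_neg_eq_add, Real.norm_eq_abs]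
  exact this

/-- After the change of variables `z ↦ z + w` this is `inner_vpow_sub_le` between `v(z)` and `v(z +
w)`, weighted by `ζ ≥ 0` and integrated. -/
theorem shift_inner_vpow_le {α : ℝ} (hα : 0 < α) {v : SpaceTime n → Vec N} {ζ : SpaceTime n → ℝ}
    (hvp : MemLp v (ENNReal.ofReal (1 + α)))
    (hup : MemLp (fun z => vpow α (v z)) (ENNReal.ofReal (1 + 1 / α)))
    (hζc : Continuous ζ) (hζ0 : ∀ z, 0 ≤ ζ z) {B : ℝ} (hB : ∀ z, |ζ z| ≤ B) (w : SpaceTime n) :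
    (∫ z, inner ℝ (vpow α (v z)) (ζ (z - w) • v (z - w))) -
        (∫ z, inner ℝ (vpow α (v z)) (ζ z • v z)) ≤
      α / (1 + α) * ((∫ z, ‖v z‖ ^ (1 + α) * ζ (z - w)) - ∫ z, ‖v z‖ ^ (1 + α) * ζ z) := by
  have hc : (1 + 1 / α).HolderConjugate (1 + α) := by
    rw [Real.holderConjugate_iff]
    refine ⟨by have : 0 < 1 / α := by positivity
               linarith, ?_⟩
    field_simp
    ring
  have := hc.ennrealOfReal
  have hfp : MemLp (fun z => ζ z • v z) (ENNReal.ofReal (1 + α)) :=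
    memLp_bdd_smul hζc.aestronglyMeasurable hB hvp
  have hvi : Integrable (fun z => ‖v z‖ ^ (1 + α)) := by
    have := hvp.integrable_norm_rpow (by simp; linarith) ENNReal.ofReal_ne_top
    rwa [ENNReal.toReal_ofReal (by linarith)] at this
  have hui : Integrable (fun z => ‖v (z + w)‖ ^ (1 + α) * ζ z) :=
    (hvi.comp_add_right w).mul_bdd hζc.aestronglyMeasurable (ae_of_all _ hB)
  have hui0 : Integrable (fun z => ‖v z‖ ^ (1 + α) * ζ z) :=
    hvi.mul_bdd hζc.aestronglyMeasurable (ae_of_all _ hB)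
  have hupw : MemLp (fun z => vpow α (v (z + w))) (ENNReal.ofReal (1 + 1 / α)) := by
    have := memLp_translate hup (-w)
    simpa using this
  have e1 : ∫ z, inner ℝ (vpow α (v z)) (ζ (z - w) • v (z - w)) =
      ∫ z, inner ℝ (vpow α (v (z + w))) (ζ z • v z) := by
    rw [← integral_add_right_eq_self _ w]
    simp
  have e2 : ∫ z, ‖v z‖ ^ (1 + α) * ζ (z - w) = ∫ z, ‖v (z + w)‖ ^ (1 + α) * ζ z := by
    rw [← integral_add_right_eq_self _ w]
    simp
  have hi1 := integrable_inner_of_memLp hupw hfp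
  have hi0 := integrable_inner_of_memLp hup hfp
  rw [e1, e2, ← integral_sub hi1 hi0, ← integral_sub hui hui0, ← integral_const_mul]
  refine integral_mono (hi1.sub hi0) ((hui.sub hui0).const_mul _) fun z => ?_
  have h1 := inner_vpow_sub_le hα (v z) (v (z + w))
  have h2 := mul_le_mul_of_nonneg_left h1 (hζ0 z)
  simp only [inner_smul_right]
  rw [inner_sub_left] at h2
  linarith

theorem hasDerivAt_integral_mul_shift {w ζ : SpaceTime n → ℝ} {U : Set (SpaceTime n)}
    (hw : Integrable w) (hζ : IsTestFunction U ζ) :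
    HasDerivAt (fun h : ℝ => ∫ z, w z * ζ (z - (0, h))) (-∫ z, w z * timeDeriv ζ z) 0 := by
  have := hasDerivAt_integral_inner_shift hw hζ.1 hζ.2.1 0
  simp only [Prod.mk_zero_zero, sub_zero] at this
  simpa [mul_comm] using this

/-- A weak solution, localised to `U` and extended by zero outside the compact set `K`: `v` is the
power `u^m` with `α = 1 / m`, so that `u = v^α`; `G` is the gradient of `v` and `F` the flux. -/
structure LocalSol (K U : Set (SpaceTime n)) (ν L α : ℝ) (v : SpaceTime n → Vec N)
    (G F : SpaceTime n → Grad N n) : Prop where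
  isCompact : IsCompact K
  isOpen : IsOpen U
  v_eq_zero : ∀ z ∉ K, v z = 0
  G_eq_zero : ∀ z ∉ K, G z = 0
  F_eq_zero : ∀ z ∉ K, F z = 0
  v_memLp : MemLp v 2
  v_memLp' : MemLp v (ENNReal.ofReal (1 + α))
  G_memLp : MemLp G 2
  F_memLp : MemLp F 2
  grad : LocGrad U v G
  eqn : WeakEq U (fun z => vpow α (v z)) F
  coercive : ∀ᵐ z, ν * ‖G z‖ ^ 2 ≤ inner ℝ (F z) (G z)
  growth : ∀ᵐ z, ‖F z‖ ≤ L * ‖G z‖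

theorem integrable_of_memLp {W : Type*} [NormedAddCommGroup W] {K : Set (SpaceTime n)}
    {f : SpaceTime n → W} {p : ℝ≥0∞} (hp : 1 ≤ p) (hK : IsCompact K) (hf : MemLp f p)
    (h0 : ∀ z ∉ K, f z = 0) : Integrable f :=
  memLp_one_iff_integrable.1
    (hf.mono_exponent_of_measure_support_ne_top h0 hK.measure_lt_top.ne hp)

theorem memLp_vpow {α : ℝ} (hα : 0 < α) {X : Type*} [MeasurableSpace X] {μ : Measure X}
    {v : X → Vec N} (hv : MemLp v (ENNReal.ofReal (1 + α)) μ) :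
    MemLp (fun z => vpow α (v z)) (ENNReal.ofReal (1 + 1 / α)) μ := by
  have h := hv.norm_rpow_div (ENNReal.ofReal α)
  have e : ENNReal.ofReal (1 + α) / ENNReal.ofReal α = ENNReal.ofReal (1 + 1 / α) := by
    rw [← ENNReal.ofReal_div_of_pos hα]
    congr 1
    field_simp
    ring
  rw [e, ENNReal.toReal_ofReal hα.le] at h
  refine h.of_le ((continuous_vpow hα).comp_aestronglyMeasurable hv.1) (ae_of_all _ fun z => ?_)
  rw [norm_vpow hα, Real.norm_of_nonneg (by positivity)]

/-- Both sides of the convexity inequality `shift_inner_vpow_le` along time shifts are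
differentiable at zero, where equality holds. As shifts of both signs are allowed, the derivatives
coincide. -/
theorem LocalSol.energy {K U : Set (SpaceTime n)} {ν L α : ℝ} {v : SpaceTime n → Vec N}
    {G F : SpaceTime n → Grad N n} (h : LocalSol K U ν L α v G F) (hα : 0 < α)
    {ζ : SpaceTime n → ℝ} (hζ : IsTestFunction U ζ) (hζ0 : ∀ z, 0 ≤ ζ z) :
    ∫ z, inner ℝ (F z) (cutGrad ζ v G z) =
      α / (1 + α) * ∫ z, ‖v z‖ ^ (1 + α) * timeDeriv ζ z := by
  obtain ⟨B, -, hB⟩ := hζ.exists_bound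
  have hc : (1 + α).HolderConjugate (1 + 1 / α) := by
    rw [Real.holderConjugate_iff]
    exact ⟨by linarith, by field_simp; ring⟩
  have hc' := hc.ennrealOfReal
  have : Fact (1 ≤ ENNReal.ofReal (1 + α)) := ⟨by simp; linarith⟩
  have : Fact (1 ≤ ENNReal.ofReal (1 + 1 / α)) := ⟨by
    simp; positivity⟩
  have hv1 := integrable_of_memLp (by norm_num) h.isCompact h.v_memLp h.v_eq_zero
  have hG1 := integrable_of_memLp (by norm_num) h.isCompact h.G_memLp h.G_eq_zero
  have hF1 := integrable_of_memLp (by norm_num) h.isCompact h.F_memLp h.F_eq_zero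
  have hup := memLp_vpow hα h.v_memLp'
  have hu1 : Integrable (fun z => vpow α (v z)) :=
    integrable_of_memLp Fact.out h.isCompact hup fun z hz => by
      rw [h.v_eq_zero z hz, vpow_zero_right]
  have hfp : MemLp (fun z => ζ z • v z) (ENNReal.ofReal (1 + α)) :=
    memLp_bdd_smul hζ.continuous.aestronglyMeasurable (fun z => (hB z).1) h.v_memLp'
  have hf1 : Integrable (fun z => ζ z • v z) := memLp_one_iff_integrable.1
    (memLp_bdd_smul hζ.continuous.aestronglyMeasurable (fun z => (hB z).1)
      (memLp_one_iff_integrable.2 hv1))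
  have hg1 : Integrable (cutGrad ζ v G) := memLp_one_iff_integrable.1
    (memLp_cutGrad hζ (memLp_one_iff_integrable.2 hv1) (memLp_one_iff_integrable.2 hG1))
  have hΓ := h.eqn.hasDerivAt_shift (K := tsupport ζ) ENNReal.ofReal_ne_top
    (h.grad.hasSpaceGrad hv1 hG1 hζ)
    hu1 hup hf1 hfp hF1 h.F_memLp hg1 (memLp_cutGrad hζ h.v_memLp h.G_memLp) h.isOpen hζ.2.1 hζ.2.2
    fun z hz => by simp [image_eq_zero_of_notMem_tsupport hz]
  have hvi : Integrable (fun z => ‖v z‖ ^ (1 + α)) := by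
    have := h.v_memLp'.integrable_norm_rpow (by simp; linarith) ENNReal.ofReal_ne_top
    rwa [ENNReal.toReal_ofReal (by linarith)] at this
  have hJ := hasDerivAt_integral_mul_shift hvi hζ
  have hD := (hJ.const_mul (α / (1 + α))).sub hΓ
  -- The difference of the two sides is least at zero shift, so its derivative vanishes there.
  have hmin : IsLocalMin ((fun h : ℝ => α / (1 + α) * ∫ z, ‖v z‖ ^ (1 + α) * ζ (z - (0, h))) -
      fun h : ℝ => ∫ z, inner ℝ (vpow α (v z)) (ζ (z - (0, h)) • v (z - (0, h)))) 0 := by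
    refine Eventually.of_forall fun x => ?_
    have := shift_inner_vpow_le hα h.v_memLp' hup hζ.continuous hζ0 (fun z => (hB z).1) (0, x)
    simp only [Pi.sub_apply, Prod.mk_zero_zero, sub_zero]
    linarith
  have := hmin.hasDerivAt_eq_zero hD
  linarith

/-! ### Energy estimates -/

/-- The weights used for testing are `χ⁴` times a time profile. The fourth power leaves `χ³` in the
cross term, which Young's inequality splits into `χ⁴ |G|²` and `χ² |v|²`. -/
theorem fderiv_pow_mul {χ : SpaceTime n → ℝ} (hχ : ContDiff ℝ ∞ χ) {θ : ℝ → ℝ}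
    (hθ : ContDiff ℝ ∞ θ) (z y : SpaceTime n) :
    fderiv ℝ (fun z => χ z ^ 4 * θ z.2) z y =
      4 * χ z ^ 3 * θ z.2 * fderiv ℝ χ z y + χ z ^ 4 * deriv θ z.2 * y.2 := by
  have h1 := ((hχ.differentiable (by simp)) z).hasFDerivAt.pow 4
  have h2 : HasFDerivAt (fun z : SpaceTime n => θ z.2)
      (deriv θ z.2 • ContinuousLinearMap.snd ℝ (EuclideanSpace ℝ (Fin n)) ℝ) z :=
    ((hθ.differentiable (by simp)) z.2).hasDerivAt.comp_hasFDerivAt z hasFDerivAt_snd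
  have h3 : HasFDerivAt (fun z : SpaceTime n => χ z ^ 4 * θ z.2) _ z := h1.mul h2
  rw [h3.fderiv]
  simp
  ring

theorem scalarGrad_pow_mul {χ : SpaceTime n → ℝ} (hχ : ContDiff ℝ ∞ χ) {θ : ℝ → ℝ}
    (hθ : ContDiff ℝ ∞ θ) (z : SpaceTime n) : scalarGrad (fun z => χ z ^ 4 * θ z.2) z =
      (4 * χ z ^ 3 * θ z.2) • scalarGrad χ z := by
  ext j
  simp only [scalarGrad, spaceDeriv]
  rw [fderiv_pow_mul hχ hθ]
  simp

theorem isTestFunction_pow_mul {U : Set (SpaceTime n)} {χ : SpaceTime n → ℝ}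
    (hχ : IsTestFunction U χ) {θ : ℝ → ℝ} (hθ : ContDiff ℝ ∞ θ) :
    IsTestFunction U fun z => χ z ^ 4 * θ z.2 := by
  have h := hχ.mul (φ := fun z => χ z ^ 3 * θ z.2) ((hχ.1.pow 3).mul (hθ.comp contDiff_snd))
  convert h using 2
  ring

/-- The quantity which controls the energy of a solution on the set where the cut-off function is
one. -/
noncomputable def locEnergy (α : ℝ) (χ : SpaceTime n → ℝ) (v : SpaceTime n → Vec N) : ℝ :=
  ∫ z, χ z ^ 2 * (‖v z‖ ^ 2 + ‖v z‖ ^ (1 + α))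

/-- A cut-off function with values in `[0, 1]` and derivatives bounded by `Λ`. -/
structure IsCutoff (U : Set (SpaceTime n)) (Λ : ℝ) (χ : SpaceTime n → ℝ) : Prop where
  test : IsTestFunction U χ
  nonneg : ∀ z, 0 ≤ χ z
  le_one : ∀ z, χ z ≤ 1
  timeDeriv_le : ∀ z, |timeDeriv χ z| ≤ Λ
  grad_le : ∀ z, ‖scalarGrad χ z‖ ≤ Λ

section

variable {K U : Set (SpaceTime n)} {ν L α Λ : ℝ} {v : SpaceTime n → Vec N}
  {G F : SpaceTime n → Grad N n} {χ : SpaceTime n → ℝ}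

theorem IsCutoff.pow_le_one (hχ : IsCutoff U Λ χ) (k : ℕ) (z : SpaceTime n) : |χ z ^ k| ≤ 1 := by
  rw [abs_of_nonneg (pow_nonneg (hχ.nonneg z) k)]
  exact pow_le_one₀ (hχ.nonneg z) (hχ.le_one z)

theorem IsCutoff.integrable_pow_mul (hχ : IsCutoff U Λ χ) {w : SpaceTime n → ℝ} (k : ℕ)
    (hw : Integrable w) : Integrable fun z => χ z ^ k * w z :=
  hw.bdd_mul (hχ.test.continuous.pow k).aestronglyMeasurable (ae_of_all _ (hχ.pow_le_one k))

theorem LocalSol.integrable_rpow (h : LocalSol K U ν L α v G F) (hα : 0 < α) :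
    Integrable fun z => ‖v z‖ ^ (1 + α) := by
  have := h.v_memLp'.integrable_norm_rpow (by simp; linarith) ENNReal.ofReal_ne_top
  rwa [ENNReal.toReal_ofReal (by linarith)] at this

theorem integrable_norm_sq {W X : Type*} [NormedAddCommGroup W] [MeasurableSpace X] {μ : Measure X}
    {f : X → W} (hf : MemLp f 2 μ) : Integrable (fun z => ‖f z‖ ^ 2) μ := hf.norm.integrable_sq

theorem LocalSol.integrable_locEnergy (h : LocalSol K U ν L α v G F) (hα : 0 < α)
    (hχ : IsCutoff U Λ χ) : Integrable fun z => χ z ^ 2 * (‖v z‖ ^ 2 + ‖v z‖ ^ (1 + α)) :=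
  hχ.integrable_pow_mul 2 ((integrable_norm_sq h.v_memLp).add (h.integrable_rpow hα))

theorem locEnergy_nonneg : 0 ≤ locEnergy α χ v :=
  integral_nonneg fun z => by positivity

/-- The cross term of the energy identity. -/
theorem abs_inner_tens_le {F : Grad N n} {G : Grad N n} {v : Vec N} {a : EuclideanSpace ℝ (Fin n)}
    (hF : ‖F‖ ≤ L * ‖G‖) (ha : ‖a‖ ≤ Λ) : |inner ℝ F (tens v a)| ≤ L * ‖G‖ * (‖v‖ * Λ) := by
  refine (abs_real_inner_le_norm _ _).trans ?_
  rw [norm_tens]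
  have : 0 ≤ L * ‖G‖ := (norm_nonneg F).trans hF
  gcongr

theorem integral_mono_of_nonneg_right {X : Type*} [MeasurableSpace X] {μ : Measure X} {f g : X → ℝ}
    (hg : Integrable g μ) (hg0 : ∀ x, 0 ≤ g x) (hfg : ∀ᵐ x ∂μ, f x ≤ g x) :
    ∫ x, f x ∂μ ≤ ∫ x, g x ∂μ := by
  by_cases hf : Integrable f μ
  · exact integral_mono_ae hf hg hfg
  · rw [integral_undef hf]
    exact integral_nonneg hg0

theorem LocalSol.energy_cutoff (h : LocalSol K U ν L α v G F) (hα : 0 < α) (hχ : IsCutoff U Λ χ)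
    {θ : ℝ → ℝ} (hθ : ContDiff ℝ ∞ θ) (hθ0 : ∀ z, χ z ≠ 0 → 0 ≤ θ z.2) :
    ∫ z, θ z.2 * (χ z ^ 4 * inner ℝ (F z) (G z) +
        4 * χ z ^ 3 * inner ℝ (F z) (tens (v z) (scalarGrad χ z))) =
      α / (1 + α) * ∫ z, ‖v z‖ ^ (1 + α) *
        (4 * χ z ^ 3 * θ z.2 * timeDeriv χ z + χ z ^ 4 * deriv θ z.2) := by
  have h1 := h.energy hα (isTestFunction_pow_mul hχ.test hθ) fun z => by
    by_cases hz : χ z = 0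
    · simp [hz]
    · have := hθ0 z hz
      positivity
  have h2 : ∀ z, timeDeriv (fun z => χ z ^ 4 * θ z.2) z =
      4 * χ z ^ 3 * θ z.2 * timeDeriv χ z + χ z ^ 4 * deriv θ z.2 := fun z => by
    simp only [timeDeriv]
    rw [fderiv_pow_mul hχ.test.1 hθ]
    simp
  have h3 := scalarGrad_pow_mul hχ.test.1 hθ
  simp_rw [h2] at h1
  rw [← h1]
  refine integral_congr_ae (ae_of_all _ fun z => ?_)
  simp only [cutGrad, h3, tens_smul, inner_add_right, inner_smul_right]
  ring

/-- Energy identity with constant time profile: coercivity produces the left side, Young absorbs the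
cross term, and the time derivative only falls on the cut-off. -/
theorem LocalSol.caccioppoli (h : LocalSol K U ν L α v G F) (hα : 0 < α) (hν : 0 < ν)
    (hΛ : 0 ≤ Λ) (hχ : IsCutoff U Λ χ) :
    ∫ z, χ z ^ 4 * ‖G z‖ ^ 2 ≤
      2 / ν * (8 * L ^ 2 * Λ ^ 2 / ν + 4 * Λ) * locEnergy α χ v := by
  have h1 := h.energy_cutoff hα hχ (θ := fun _ => 1) contDiff_const fun _ _ => zero_le_one
  simp only [one_mul, mul_one, deriv_const, mul_zero, add_zero] at h1
  have hiE := h.integrable_locEnergy hα hχ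
  have hiG := hχ.integrable_pow_mul 4 (integrable_norm_sq h.G_memLp)
  have hi1 : Integrable fun z => χ z ^ 4 * inner ℝ (F z) (G z) +
      4 * χ z ^ 3 * inner ℝ (F z) (tens (v z) (scalarGrad χ z)) := by
    refine (hχ.integrable_pow_mul 4 (integrable_inner_of_memLp h.F_memLp h.G_memLp)).add ?_
    have := (hχ.integrable_pow_mul 3 (integrable_inner_of_memLp h.F_memLp
      (memLp_tens h.v_memLp hχ.test.continuous_scalarGrad.aestronglyMeasurable
      hχ.grad_le))).const_mul 4
    simpa [mul_assoc] using this
  have hlow : ∫ z, (ν / 2 * (χ z ^ 4 * ‖G z‖ ^ 2) - 8 * L ^ 2 * Λ ^ 2 / ν *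
      (χ z ^ 2 * (‖v z‖ ^ 2 + ‖v z‖ ^ (1 + α)))) ≤ ∫ z, (χ z ^ 4 * inner ℝ (F z) (G z) +
      4 * χ z ^ 3 * inner ℝ (F z) (tens (v z) (scalarGrad χ z))) := by
    refine integral_mono_ae ((hiG.const_mul _).sub (hiE.const_mul _)) hi1 ?_
    filter_upwards [h.coercive, h.growth] with z hc hg
    have hχ0 := hχ.nonneg z
    have e1 := (abs_le.1 (abs_inner_tens_le (v := v z) hg (hχ.grad_le z))).1
    have e2 : 4 * χ z ^ 3 * -(L * ‖G z‖ * (‖v z‖ * Λ)) ≤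
        4 * χ z ^ 3 * inner ℝ (F z) (tens (v z) (scalarGrad χ z)) := by gcongr
    have e3 := mul_le_mul_of_nonneg_left hc (pow_nonneg hχ0 4)
    -- Young's inequality as a completed square, weighted so that half of the coercive term
    -- survives.
    have e4 : 4 * χ z ^ 3 * (L * ‖G z‖ * (‖v z‖ * Λ)) ≤
        ν / 2 * (χ z ^ 4 * ‖G z‖ ^ 2) + 8 * L ^ 2 * Λ ^ 2 / ν * (χ z ^ 2 * ‖v z‖ ^ 2) := by
      have : 0 ≤ (ν * χ z ^ 2 * ‖G z‖ - 4 * L * Λ * χ z * ‖v z‖) ^ 2 / (2 * ν) := by positivity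
      have e5 : (ν * χ z ^ 2 * ‖G z‖ - 4 * L * Λ * χ z * ‖v z‖) ^ 2 / (2 * ν) =
          ν / 2 * (χ z ^ 4 * ‖G z‖ ^ 2) + 8 * L ^ 2 * Λ ^ 2 / ν * (χ z ^ 2 * ‖v z‖ ^ 2) -
          4 * χ z ^ 3 * (L * ‖G z‖ * (‖v z‖ * Λ)) := by
        field_simp
        ring
      linarith
    have e6 : 8 * L ^ 2 * Λ ^ 2 / ν * (χ z ^ 2 * ‖v z‖ ^ 2) ≤ 8 * L ^ 2 * Λ ^ 2 / ν *
        (χ z ^ 2 * (‖v z‖ ^ 2 + ‖v z‖ ^ (1 + α))) := by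
      gcongr
      have : 0 ≤ ‖v z‖ ^ (1 + α) := by positivity
      linarith
    linarith
  have hup : ∫ z, ‖v z‖ ^ (1 + α) * (4 * χ z ^ 3 * timeDeriv χ z) ≤
      ∫ z, 4 * Λ * (χ z ^ 2 * (‖v z‖ ^ 2 + ‖v z‖ ^ (1 + α))) := by
    refine integral_mono ?_ (hiE.const_mul _) fun z => ?_
    · refine (h.integrable_rpow hα).mul_bdd (c := 4 * Λ) ?_ (ae_of_all _ fun z => ?_)
      · exact ((continuous_const.mul (hχ.test.continuous.pow 3)).mul
          hχ.test.continuous_timeDeriv).aestronglyMeasurable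
      · have := hχ.pow_le_one 3 z
        have := hχ.timeDeriv_le z
        rw [Real.norm_eq_abs, abs_mul, abs_mul, abs_of_pos (by norm_num : (0 : ℝ) < 4)]
        nlinarith [abs_nonneg (χ z ^ 3), abs_nonneg (timeDeriv χ z)]
    · have hχ0 := hχ.nonneg z
      have hχ1 := hχ.le_one z
      have e1 := (le_abs_self _).trans (hχ.timeDeriv_le z)
      have e2 : χ z ^ 3 ≤ χ z ^ 2 := pow_le_pow_of_le_one hχ0 hχ1 (by norm_num)
      calc ‖v z‖ ^ (1 + α) * (4 * χ z ^ 3 * timeDeriv χ z)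
          ≤ ‖v z‖ ^ (1 + α) * (4 * χ z ^ 3 * Λ) := by gcongr
        _ ≤ ‖v z‖ ^ (1 + α) * (4 * χ z ^ 2 * Λ) := by gcongr
        _ = 4 * Λ * (χ z ^ 2 * ‖v z‖ ^ (1 + α)) := by ring
        _ ≤ _ := by
          gcongr
          have : 0 ≤ ‖v z‖ ^ 2 := by positivity
          linarith
  rw [integral_sub (hiG.const_mul _) (hiE.const_mul _), integral_const_mul, integral_const_mul,
    h1] at hlow
  rw [integral_const_mul] at hup
  have hE := locEnergy_nonneg (α := α) (χ := χ) (v := v)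
  change _ ≤ 4 * Λ * locEnergy α χ v at hup
  change _ - _ * locEnergy α χ v ≤ _ at hlow
  have hα1 : α / (1 + α) ≤ 1 := by rw [div_le_one (by linarith)]; linarith
  have hα0 : 0 ≤ α / (1 + α) := by positivity
  have h3 : α / (1 + α) * ∫ z, ‖v z‖ ^ (1 + α) * (4 * χ z ^ 3 * timeDeriv χ z) ≤
      4 * Λ * locEnergy α χ v := by
    refine (mul_le_mul_of_nonneg_left hup hα0).trans ?_
    have : 0 ≤ 4 * Λ * locEnergy α χ v := by positivity
    nlinarith
  have h4 : ν / 2 * ∫ z, χ z ^ 4 * ‖G z‖ ^ 2 ≤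
      (8 * L ^ 2 * Λ ^ 2 / ν + 4 * Λ) * locEnergy α χ v := by linarith
  calc ∫ z, χ z ^ 4 * ‖G z‖ ^ 2 = 2 / ν * (ν / 2 * ∫ z, χ z ^ 4 * ‖G z‖ ^ 2) := by
        field_simp
    _ ≤ 2 / ν * ((8 * L ^ 2 * Λ ^ 2 / ν + 4 * Λ) * locEnergy α χ v) := by gcongr
    _ = _ := by ring

/-- The energy identity with a time profile `θ`, kept in terms of `deriv θ`: letting `deriv θ`
approximate a Dirac mass at `t` gives the bound on the slice at time `t`. The profile only needs to
lie in `[0, 1]` on the support of `χ`. -/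
theorem LocalSol.sup_estimate (h : LocalSol K U ν L α v G F) (hα : 0 < α)
    (hL : 0 ≤ L) (hΛ : 0 ≤ Λ) (hχ : IsCutoff U Λ χ) {M : ℝ}
    (hM : ∫ z, χ z ^ 4 * ‖G z‖ ^ 2 ≤ M)
    {θ : ℝ → ℝ} (hθ : ContDiff ℝ ∞ θ) (hθ0 : ∀ z, χ z ≠ 0 → 0 ≤ θ z.2 ∧ θ z.2 ≤ 1)
    (hψ : ∃ B, ∀ t, |deriv θ t| ≤ B) :
    ∫ z, χ z ^ 4 * ‖v z‖ ^ (1 + α) * deriv θ z.2 ≤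
      (1 + α) / α * ((L + 2 * L * Λ) * M + 2 * L * Λ * locEnergy α χ v) +
        4 * Λ * locEnergy α χ v := by
  obtain ⟨B, hB⟩ := hψ
  have h1 := h.energy_cutoff hα hχ hθ fun z hz => (hθ0 z hz).1
  have hiE := h.integrable_locEnergy hα hχ
  have hiG := hχ.integrable_pow_mul 4 (integrable_norm_sq h.G_memLp)
  have hdc : Continuous (deriv θ) := hθ.continuous_deriv (by simp)
  have hχc := hχ.test.continuous
  have hθc := hθ.continuous
  have htc := hχ.test.continuous_timeDeriv
  have hi2 : Integrable fun z => χ z ^ 4 * ‖v z‖ ^ (1 + α) * deriv θ z.2 := by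
    refine (hχ.integrable_pow_mul 4 (h.integrable_rpow hα)).mul_bdd (c := B) ?_
      (ae_of_all _ fun z => hB _)
    exact (hdc.comp continuous_snd).aestronglyMeasurable
  have hθχ : ∀ z, |χ z ^ 3 * θ z.2| ≤ χ z ^ 3 := by
    intro z
    have h3 := pow_nonneg (hχ.nonneg z) 3
    rw [abs_mul, abs_of_nonneg h3]
    by_cases hz : χ z = 0
    · simp [hz]
    · obtain ⟨h4, h5⟩ := hθ0 z hz
      rw [abs_of_nonneg h4]
      nlinarith
  have hi3 : Integrable fun z => ‖v z‖ ^ (1 + α) * (4 * χ z ^ 3 * θ z.2 * timeDeriv χ z) := by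
    refine (h.integrable_rpow hα).mul_bdd (c := 4 * Λ) ?_ (ae_of_all _ fun z => ?_)
    · exact Continuous.aestronglyMeasurable (by fun_prop)
    · have h3 := (hθχ z).trans ((le_abs_self _).trans (hχ.pow_le_one 3 z))
      have := hχ.timeDeriv_le z
      rw [Real.norm_eq_abs, abs_mul, mul_assoc, abs_mul 4, abs_of_pos (by norm_num : (0 : ℝ) < 4)]
      nlinarith [abs_nonneg (χ z ^ 3 * θ z.2), abs_nonneg (timeDeriv χ z)]
  have hsplit : ∫ z, ‖v z‖ ^ (1 + α) *
        (4 * χ z ^ 3 * θ z.2 * timeDeriv χ z + χ z ^ 4 * deriv θ z.2) =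
      (∫ z, ‖v z‖ ^ (1 + α) * (4 * χ z ^ 3 * θ z.2 * timeDeriv χ z)) +
        ∫ z, χ z ^ 4 * ‖v z‖ ^ (1 + α) * deriv θ z.2 := by
    rw [← integral_add hi3 hi2]
    congr 1 with z
    ring
  have hb1 : -(4 * Λ * locEnergy α χ v) ≤
      ∫ z, ‖v z‖ ^ (1 + α) * (4 * χ z ^ 3 * θ z.2 * timeDeriv χ z) := by
    rw [locEnergy, ← integral_const_mul, ← integral_neg]
    refine integral_mono (hiE.const_mul _).neg hi3 fun z => ?_
    have e1 : |4 * χ z ^ 3 * θ z.2 * timeDeriv χ z| ≤ 4 * χ z ^ 2 * Λ := by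
      have e2 : χ z ^ 3 ≤ χ z ^ 2 :=
        pow_le_pow_of_le_one (hχ.nonneg z) (hχ.le_one z) (by norm_num)
      have := hχ.timeDeriv_le z
      have := hθχ z
      rw [abs_mul, mul_assoc, abs_mul 4, abs_of_pos (by norm_num : (0 : ℝ) < 4)]
      have : |χ z ^ 3 * θ z.2| * |timeDeriv χ z| ≤ χ z ^ 2 * Λ := by
        gcongr
        linarith
      linarith
    have e3 := (abs_le.1 e1).1
    have e4 : 0 ≤ ‖v z‖ ^ (1 + α) := by positivity
    have e5 : 0 ≤ 4 * Λ * (χ z ^ 2 * ‖v z‖ ^ 2) := by positivity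
    have e6 := mul_le_mul_of_nonneg_left e3 e4
    dsimp only
    linarith
  have hb2 : ∫ z, θ z.2 * (χ z ^ 4 * inner ℝ (F z) (G z) +
        4 * χ z ^ 3 * inner ℝ (F z) (tens (v z) (scalarGrad χ z))) ≤
      (L + 2 * L * Λ) * M + 2 * L * Λ * locEnergy α χ v := by
    have hi4 : Integrable fun z => (L + 2 * L * Λ) * (χ z ^ 4 * ‖G z‖ ^ 2) +
        2 * L * Λ * (χ z ^ 2 * (‖v z‖ ^ 2 + ‖v z‖ ^ (1 + α))) :=
      (hiG.const_mul _).add (hiE.const_mul _)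
    have hle : ∫ z, θ z.2 * (χ z ^ 4 * inner ℝ (F z) (G z) +
        4 * χ z ^ 3 * inner ℝ (F z) (tens (v z) (scalarGrad χ z))) ≤
        ∫ z, ((L + 2 * L * Λ) * (χ z ^ 4 * ‖G z‖ ^ 2) +
        2 * L * Λ * (χ z ^ 2 * (‖v z‖ ^ 2 + ‖v z‖ ^ (1 + α)))) := by
      refine integral_mono_of_nonneg_right hi4 (fun z => by positivity) ?_
      filter_upwards [h.growth] with z hg
      have hχ0 := hχ.nonneg z
      by_cases hz : χ z = 0
      · simp [hz]
      obtain ⟨h4, h5⟩ := hθ0 z hz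
      have e1 := (abs_le.1 (abs_inner_tens_le (v := v z) hg (hχ.grad_le z))).2
      have e0 : inner ℝ (F z) (G z) ≤ L * ‖G z‖ ^ 2 := by
        refine (real_inner_le_norm _ _).trans ?_
        have := mul_le_mul_of_nonneg_right hg (norm_nonneg (G z))
        linarith
      have e2 : 4 * χ z ^ 3 * inner ℝ (F z) (tens (v z) (scalarGrad χ z)) ≤
        4 * χ z ^ 3 * (L * ‖G z‖ * (‖v z‖ * Λ)) := by gcongr
      have e3 := mul_le_mul_of_nonneg_left e0 (pow_nonneg hχ0 4)
      have e4 : 4 * χ z ^ 3 * (L * ‖G z‖ * (‖v z‖ * Λ)) ≤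
          2 * L * Λ * (χ z ^ 4 * ‖G z‖ ^ 2 + χ z ^ 2 * ‖v z‖ ^ 2) := by
        have : 0 ≤ 2 * L * Λ * (χ z ^ 2 * ‖G z‖ - χ z * ‖v z‖) ^ 2 := by positivity
        nlinarith
      have e5 : 0 ≤ 2 * L * Λ * (χ z ^ 2 * ‖v z‖ ^ (1 + α)) := by positivity
      have e6 : χ z ^ 4 * inner ℝ (F z) (G z) +
          4 * χ z ^ 3 * inner ℝ (F z) (tens (v z) (scalarGrad χ z)) ≤
          (L + 2 * L * Λ) * (χ z ^ 4 * ‖G z‖ ^ 2) +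
          2 * L * Λ * (χ z ^ 2 * (‖v z‖ ^ 2 + ‖v z‖ ^ (1 + α))) := by linarith
      have e7 : 0 ≤ (L + 2 * L * Λ) * (χ z ^ 4 * ‖G z‖ ^ 2) +
          2 * L * Λ * (χ z ^ 2 * (‖v z‖ ^ 2 + ‖v z‖ ^ (1 + α))) := by positivity
      have e8 := mul_le_mul_of_nonneg_left e6 h4
      have e9 := mul_le_mul_of_nonneg_right h5 e7
      linarith
    refine hle.trans ?_
    rw [integral_add (hiG.const_mul _) (hiE.const_mul _), integral_const_mul, integral_const_mul]
    change _ + _ * locEnergy α χ v ≤ _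
    have : 0 ≤ L + 2 * L * Λ := by positivity
    gcongr
  rw [h1, hsplit] at hb2
  have e1 : α / (1 + α) * ((∫ z, ‖v z‖ ^ (1 + α) * (4 * χ z ^ 3 * θ z.2 * timeDeriv χ z)) +
      ∫ z, χ z ^ 4 * ‖v z‖ ^ (1 + α) * deriv θ z.2) * ((1 + α) / α) =
      (∫ z, ‖v z‖ ^ (1 + α) * (4 * χ z ^ 3 * θ z.2 * timeDeriv χ z)) +
      ∫ z, χ z ^ 4 * ‖v z‖ ^ (1 + α) * deriv θ z.2 := by
    rw [mul_right_comm, div_mul_div_comm, mul_comm (1 + α) α, div_self (by positivity), one_mul]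
  have e2 := mul_le_mul_of_nonneg_right hb2 (by positivity : 0 ≤ (1 + α) / α)
  rw [e1] at e2
  linarith

end

/-! ### Higher integrability -/

/-- Take for `θ` the primitive, from `-R` on, of a normalised bump around `t`. It lies in `[0, 1]`
on `[-R, R]`, and the hypothesis bounds the mollified slice integral at `t` by `S`; almost every `t`
is a Lebesgue point. -/
theorem ae_slice_le {w : SpaceTime n → ℝ} (hw : Integrable w) (hw0 : ∀ z, 0 ≤ w z) {R S : ℝ}
    (hS : ∀ θ : ℝ → ℝ, ContDiff ℝ ∞ θ → (∀ t, |t| ≤ R → 0 ≤ θ t ∧ θ t ≤ 1) →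
      (∃ B, ∀ t, |deriv θ t| ≤ B) → ∫ z, w z * deriv θ z.2 ≤ S) :
    ∀ᵐ t : ℝ, ∫⁻ x, ENNReal.ofReal (w (x, t)) ≤ ENNReal.ofReal S := by
  have hwp : Integrable w ((volume : Measure (EuclideanSpace ℝ (Fin n))).prod
    (volume : Measure ℝ)) := hw
  have he : Integrable fun t : ℝ => ∫ x, w (x, t) := hwp.integral_prod_right
  let ρ : ℕ → ContDiffBump (0 : ℝ) := fun i =>
    ⟨1 / ((i : ℝ) + 1) / 2, 1 / ((i : ℝ) + 1), by positivity, half_lt_self (by positivity)⟩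
  have hlim := ContDiffBump.ae_convolution_tendsto_right_of_locallyIntegrable (μ := volume) (K := 2)
    (φ := ρ) (l := atTop) (tendsto_one_div_add_atTop_nhds_zero_nat (𝕜 := ℝ))
    (Eventually.of_forall fun i => by
      change 1 / ((i : ℝ) + 1) ≤ 2 * (1 / ((i : ℝ) + 1) / 2)
      linarith) he.locallyIntegrable
  have hbound : ∀ i t, ((ρ i).normed volume ⋆[ContinuousLinearMap.lsmul ℝ ℝ, volume]
      fun t : ℝ => ∫ x, w (x, t)) t ≤ S := by
    intro i t
    set ψ : ℝ → ℝ := fun s => (ρ i).normed volume (t - s) with hψ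
    have hψs : ContDiff ℝ ∞ ψ :=
      ((ρ i).contDiff_normed (μ := volume) : ContDiff ℝ ∞ _).comp (by fun_prop)
    have hψ0 : ∀ s, 0 ≤ ψ s := fun s => (ρ i).nonneg_normed _
    have hψi : Integrable ψ := ((ρ i).integrable_normed (μ := volume)).comp_sub_left t
    have hψ1 : ∫ s, ψ s = 1 := by
      rw [hψ, integral_sub_left_eq_self (fun s => (ρ i).normed volume s)]
      exact (ρ i).integral_normed
    obtain ⟨B, hB⟩ := ((ρ i).hasCompactSupport_normed (μ := volume)).exists_bound_of_continuous
      ((ρ i).contDiff_normed (n := 0)).continuous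
    have hder : ∀ s, HasDerivAt (fun s => ∫ r in (-R)..s, ψ r) (ψ s) s := fun s =>
      hψs.continuous.integral_hasStrictDerivAt (-R) s |>.hasDerivAt
    have hderiv : deriv (fun s => ∫ r in (-R)..s, ψ r) = ψ := funext fun s => (hder s).deriv
    have h1 := hS (fun s => ∫ r in (-R)..s, ψ r) ?_ ?_ ?_
    · rw [hderiv] at h1
      rw [convolution_lsmul_swap]
      refine le_trans (le_of_eq ?_) h1
      have hi : Integrable (fun z : EuclideanSpace ℝ (Fin n) × ℝ => w z * ψ z.2)
          ((volume : Measure (EuclideanSpace ℝ (Fin n))).prod (volume : Measure ℝ)) :=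
        hw.mul_bdd (c := B) (hψs.continuous.comp continuous_snd).aestronglyMeasurable
          (ae_of_all _ fun z => hB _)
      rw [Measure.volume_eq_prod, integral_prod_symm _ hi]
      refine integral_congr_ae (ae_of_all _ fun s => ?_)
      simp only [smul_eq_mul]
      rw [integral_mul_const, mul_comm]
    · rw [contDiff_infty_iff_deriv, hderiv]
      exact ⟨fun s => (hder s).differentiableAt, hψs⟩
    · intro s hs
      have hs' := abs_le.1 hs
      refine ⟨intervalIntegral.integral_nonneg hs'.1 fun r _ => hψ0 r, ?_⟩
      rw [intervalIntegral.integral_of_le hs'.1, ← hψ1]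
      exact setIntegral_le_integral hψi (ae_of_all _ hψ0)
    · exact ⟨B, fun s => by rw [hderiv]; exact hB _⟩
  have hslice := hwp.swap.prod_right_ae
  filter_upwards [hlim, hslice] with t ht hi
  have h1 : ∫ x, w (x, t) ≤ S := le_of_tendsto ht (Eventually.of_forall fun i => hbound i t)
  have hi' : Integrable (fun x => w (x, t)) := hi
  rw [← ofReal_integral_eq_lintegral_ofReal hi' (ae_of_all _ fun x => hw0 _)]
  exact ENNReal.ofReal_le_ofReal h1

/-- Gagliardo-Nirenberg for `χ⁴ v`, with the slice bound from `sup_estimate` to the power `1 - 2/q`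
and the gradient bound from `caccioppoli` to the power one; hence the total power `2 - 2/q` of the
energy. The constant depends on `α` only through its lower bound `lo`. -/
theorem exists_uniform_estimate (hn : 2 ≤ n) {q ν L Λ lo : ℝ} (hq : 2 < q)
    (hqn : 1 / 2 - 1 / (n : ℝ) < 1 / q) (hν : 0 < ν) (hL : 0 ≤ L) (hΛ : 0 ≤ Λ) (hlo : 0 < lo)
    {U : Set (SpaceTime n)} {χ : SpaceTime n → ℝ} (hχ : IsCutoff U Λ χ) :
    ∃ C : ℝ, 0 ≤ C ∧ ∀ (α : ℝ) (K : Set (SpaceTime n)) (v : SpaceTime n → Vec N)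
      (G F : SpaceTime n → Grad N n), lo ≤ α → LocalSol K U ν L α v G F →
      ∫ z, χ z ^ 4 * ‖G z‖ ^ 2 ≤ C * locEnergy α χ v ∧
      ∫⁻ z, ‖χ z ^ 4 • v z‖ₑ ^ (2 + (1 + α) * (1 - 2 / q)) ≤
        ENNReal.ofReal (C * locEnergy α χ v ^ (2 - 2 / q)) := by
  obtain ⟨R, hR, hRχ⟩ : ∃ R : ℝ, 0 ≤ R ∧ ∀ z, χ z ≠ 0 → ‖z‖ ≤ R := by
    obtain ⟨R, hR⟩ := hχ.test.2.1.isBounded.exists_norm_le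
    exact ⟨max R 0, le_max_right _ _, fun z hz =>
      (hR z (subset_tsupport _ hz)).trans (le_max_left _ _)⟩
  obtain ⟨D, hD⟩ := exists_gagliardo_nirenberg (N := N) hn hq hqn R
  -- `C₁` is the Caccioppoli constant, `C₃` bounds the time slices and `C₅` the squared gradient of
  -- `χ⁴ v`, each as a multiple of the local energy.
  set C₁ := 2 / ν * (8 * L ^ 2 * Λ ^ 2 / ν + 4 * Λ) with hC₁
  set C₃ := (1 + 1 / lo) * ((L + 2 * L * Λ) * C₁ + 2 * L * Λ) + 4 * Λ with hC₃
  set C₅ := 2 * C₁ + 32 * Λ ^ 2 with hC₅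
  have hC₁0 : 0 ≤ C₁ := by positivity
  have hC₃0 : 0 ≤ C₃ := by positivity
  have h2q : 0 < 1 - 2 / q := by
    rw [sub_pos, div_lt_one (by linarith)]; exact hq
  refine ⟨max C₁ (D * C₃ ^ (1 - 2 / q) * C₅), le_max_of_le_left hC₁0, ?_⟩
  intro α K v G F hα h
  have hα0 : 0 < α := hlo.trans_le hα
  set E := locEnergy α χ v with hE
  have hE0 : 0 ≤ E := locEnergy_nonneg
  have hcac := h.caccioppoli hα0 hν hΛ hχ
  rw [← hC₁, ← hE] at hcac
  refine ⟨hcac.trans (by gcongr; exact le_max_left _ _), ?_⟩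
  have hv1 := integrable_of_memLp (by norm_num) h.isCompact h.v_memLp h.v_eq_zero
  have hG1 := integrable_of_memLp (by norm_num) h.isCompact h.G_memLp h.G_eq_zero
  have hone : ContDiff ℝ ∞ (fun _ : ℝ => (1 : ℝ)) := contDiff_const
  have htest : IsTestFunction U fun z => χ z ^ 4 := by
    simpa using isTestFunction_pow_mul hχ.test hone
  have hgrad := h.grad.hasSpaceGrad hv1 hG1 htest
  have hsg : ∀ z, scalarGrad (fun z => χ z ^ 4) z = (4 * χ z ^ 3) • scalarGrad χ z := by
    simpa using scalarGrad_pow_mul hχ.test.1 hone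
  obtain ⟨B, -, hB⟩ := htest.exists_bound
  have hslice : ∀ᵐ t : ℝ, ∫⁻ x, ‖χ (x, t) ^ 4 • v (x, t)‖ₑ ^ (1 + α) ≤
      ENNReal.ofReal (C₃ * E) := by
    have h1 := ae_slice_le (w := fun z => χ z ^ 4 * ‖v z‖ ^ (1 + α)) (S := C₃ * E)
      (hχ.integrable_pow_mul 4 (h.integrable_rpow hα0)) (fun z => by positivity) (R := R) ?_
    · filter_upwards [h1] with t ht
      refine le_trans (lintegral_mono fun x => ?_) ht
      have hχ0 := hχ.nonneg (x, t)
      rw [← ofReal_norm, ENNReal.ofReal_rpow_of_nonneg (norm_nonneg _) (by linarith)]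
      refine ENNReal.ofReal_le_ofReal ?_
      rw [norm_smul, Real.norm_of_nonneg (by positivity),
        Real.mul_rpow (by positivity) (norm_nonneg _)]
      gcongr
      have h2 : χ (x, t) ^ 4 ≤ 1 := pow_le_one₀ hχ0 (hχ.le_one _)
      calc (χ (x, t) ^ 4) ^ (1 + α) ≤ (χ (x, t) ^ 4) ^ (1 : ℝ) :=
            Real.rpow_le_rpow_of_exponent_ge' (by positivity) h2 zero_le_one (by linarith)
        _ = _ := Real.rpow_one _
    · intro θ hθ hθ1 hθB
      have h2 := h.sup_estimate hα0 hL hΛ hχ hcac hθ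
        (fun z hz => hθ1 z.2 ((norm_snd_le z).trans (hRχ z hz))) hθB
      refine h2.trans ?_
      rw [← hE]
      -- This factor of the slice bound is made uniform by the lower bound on the exponents.
      have h3 : (1 + α) / α ≤ 1 + 1 / lo := by
        rw [add_div, div_self hα0.ne', add_comm]
        gcongr
      have h4 : 0 ≤ (L + 2 * L * Λ) * (C₁ * E) + 2 * L * Λ * E := by positivity
      have h5 := mul_le_mul_of_nonneg_right h3 h4
      rw [hC₃]
      linarith
  have hg2 : ∫⁻ z, ‖cutGrad (fun z => χ z ^ 4) v G z‖ₑ ^ (2 : ℝ) ≤ ENNReal.ofReal (C₅ * E) := by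
    have hiE := h.integrable_locEnergy hα0 hχ
    have hiG := hχ.integrable_pow_mul 4 (integrable_norm_sq h.G_memLp)
    have hle : ∀ z, ‖cutGrad (fun z => χ z ^ 4) v G z‖ₑ ^ (2 : ℝ) ≤
        ENNReal.ofReal (2 * (χ z ^ 4 * ‖G z‖ ^ 2) +
          32 * Λ ^ 2 * (χ z ^ 2 * (‖v z‖ ^ 2 + ‖v z‖ ^ (1 + α)))) := by
      intro z
      have hχ0 := hχ.nonneg z
      have hχ1 := hχ.le_one z
      rw [← ofReal_norm, ENNReal.ofReal_rpow_of_nonneg (norm_nonneg _) (by norm_num),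
        Real.rpow_two]
      refine ENNReal.ofReal_le_ofReal ?_
      have h1 : ‖cutGrad (fun z => χ z ^ 4) v G z‖ ≤ χ z ^ 4 * ‖G z‖ + 4 * χ z ^ 3 * Λ * ‖v z‖ := by
        rw [cutGrad, hsg, tens_smul]
        refine (norm_add_le _ _).trans ?_
        rw [norm_smul, norm_smul, norm_tens, Real.norm_of_nonneg (by positivity),
          Real.norm_of_nonneg (by positivity)]
        have := mul_le_mul_of_nonneg_left (hχ.grad_le z)
          (by positivity : 0 ≤ 4 * χ z ^ 3 * ‖v z‖)
        linarith
      have h2 : ‖cutGrad (fun z => χ z ^ 4) v G z‖ ^ 2 ≤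
          (χ z ^ 4 * ‖G z‖ + 4 * χ z ^ 3 * Λ * ‖v z‖) ^ 2 := by gcongr
      have h3 : (χ z ^ 4 * ‖G z‖ + 4 * χ z ^ 3 * Λ * ‖v z‖) ^ 2 ≤
          2 * (χ z ^ 8 * ‖G z‖ ^ 2) + 32 * Λ ^ 2 * (χ z ^ 6 * ‖v z‖ ^ 2) := by
        have := sq_nonneg (χ z ^ 4 * ‖G z‖ - 4 * χ z ^ 3 * Λ * ‖v z‖)
        nlinarith
      have h4 : χ z ^ 8 ≤ χ z ^ 4 := pow_le_pow_of_le_one hχ0 hχ1 (by norm_num)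
      have h5 : χ z ^ 6 ≤ χ z ^ 2 := pow_le_pow_of_le_one hχ0 hχ1 (by norm_num)
      refine h2.trans (h3.trans ?_)
      have h6 : ‖v z‖ ^ 2 ≤ ‖v z‖ ^ 2 + ‖v z‖ ^ (1 + α) := by
        have : 0 ≤ ‖v z‖ ^ (1 + α) := by positivity
        linarith
      gcongr
    refine (lintegral_mono hle).trans ?_
    have hi5 : Integrable fun z => 2 * (χ z ^ 4 * ‖G z‖ ^ 2) +
        32 * Λ ^ 2 * (χ z ^ 2 * (‖v z‖ ^ 2 + ‖v z‖ ^ (1 + α))) :=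
      (hiG.const_mul _).add (hiE.const_mul _)
    rw [← ofReal_integral_eq_lintegral_ofReal hi5 (ae_of_all _ fun z => by positivity)]
    refine ENNReal.ofReal_le_ofReal ?_
    rw [integral_add (hiG.const_mul _) (hiE.const_mul _), integral_const_mul, integral_const_mul]
    change _ + _ * E ≤ _
    rw [hC₅]
    linarith
  have hmain := hD (fun z => χ z ^ 4 • v z) (cutGrad (fun z => χ z ^ 4) v G) hgrad ?_ ?_ ?_
    (1 + α) (by linarith) _ hslice
  · refine hmain.trans ?_
    calc (D : ℝ≥0∞) * ENNReal.ofReal (C₃ * E) ^ (1 - 2 / q) *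
          ∫⁻ z, ‖cutGrad (fun z => χ z ^ 4) v G z‖ₑ ^ (2 : ℝ)
        ≤ (D : ℝ≥0∞) * ENNReal.ofReal (C₃ * E) ^ (1 - 2 / q) * ENNReal.ofReal (C₅ * E) := by
          gcongr
      _ = ENNReal.ofReal (D * C₃ ^ (1 - 2 / q) * C₅ * E ^ (2 - 2 / q)) := by
          rw [ENNReal.ofReal_rpow_of_nonneg (by positivity) h2q.le, ← ENNReal.ofReal_coe_nnreal,
            ← ENNReal.ofReal_mul (by positivity), ← ENNReal.ofReal_mul (by positivity),
            Real.mul_rpow hC₃0 hE0]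
          congr 1
          have : E ^ (2 - 2 / q) = E ^ (1 - 2 / q) * E := by
            rw [← Real.rpow_add_one' hE0 (by linarith)]
            congr 1
            ring
          rw [this]
          ring
      _ ≤ _ := by
          refine ENNReal.ofReal_le_ofReal ?_
          gcongr
          exact le_max_right _ _
  · exact memLp_one_iff_integrable.1 (memLp_bdd_smul htest.continuous.aestronglyMeasurable
      (fun z => (hB z).1) (memLp_one_iff_integrable.2 hv1))
  · exact memLp_one_iff_integrable.1 (memLp_cutGrad htest (memLp_one_iff_integrable.2 hv1)
      (memLp_one_iff_integrable.2 hG1))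
  · intro z hz
    have : χ z = 0 := by
      by_contra h0
      exact absurd (hRχ z h0) (not_le.2 hz)
    simp [this]

/-! ### Cutoff functions and local bounds -/

theorem exists_isCutoff {K U : Set (SpaceTime n)} (hK : IsCompact K) (hU : IsOpen U) (hKU : K ⊆ U) :
    ∃ (Λ : ℝ) (χ : SpaceTime n → ℝ), 0 ≤ Λ ∧ IsCutoff U Λ χ ∧ ∀ z ∈ K, χ z = 1 := by
  obtain ⟨K₁, hK₁, hKK₁, hK₁U⟩ := exists_compact_between hK hU hKU
  obtain ⟨f, hf0, hf1, hf⟩ := exists_contMDiffMap_zero_one_of_isClosed (n := ⊤)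
    (modelWithCornersSelf ℝ (SpaceTime n)) (isOpen_interior (s := K₁)).isClosed_compl hK.isClosed
    (disjoint_compl_left_iff_subset.2 hKK₁)
  have hsub : tsupport f ⊆ K₁ := by
    refine closure_minimal (fun z hz => ?_) hK₁.isClosed
    by_contra h
    exact hz (hf0 fun h2 => h (interior_subset h2))
  have ht : IsTestFunction U f :=
    ⟨f.contMDiff.contDiff, HasCompactSupport.of_support_subset_isCompact hK₁
      ((subset_tsupport _).trans hsub), hsub.trans hK₁U⟩
  obtain ⟨B, hB, hB'⟩ := ht.exists_bound
  exact ⟨B, f, hB, ⟨ht, fun z => (hf z).1, fun z => (hf z).2, fun z => (hB' z).2.1,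
    fun z => (hB' z).2.2⟩, fun z hz => hf1 hz⟩

/-- If `E ≥ 1` then `E ^ κ ≤ √E`, and the inequality becomes a quadratic one for `√E`. -/
theorem le_of_le_add_mul_rpow {E a b κ : ℝ} (hE : 0 ≤ E) (ha : 0 ≤ a) (hb : 0 ≤ b)
    (hκ : κ ≤ 1 / 2) (h : E ≤ a + b * E ^ κ) : E ≤ 1 + (a + b) ^ 2 := by
  rcases le_total E 1 with h1 | h1
  · have := sq_nonneg (a + b); linarith
  · have h2 : E ^ κ ≤ Real.sqrt E := by
      rw [Real.sqrt_eq_rpow]; exact Real.rpow_le_rpow_of_exponent_le h1 hκ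
    have h3 : 1 ≤ Real.sqrt E := by rw [← Real.sqrt_one]; exact Real.sqrt_le_sqrt h1
    have h4 : E ≤ (a + b) * Real.sqrt E := by nlinarith
    have h5 := Real.mul_self_sqrt hE
    have h6 : Real.sqrt E ≤ a + b := by nlinarith
    nlinarith

/-- Absorption: near the exponent `1` the energy is controlled by the `L²` norm alone. -/
theorem exists_locEnergy_le (hn : 2 ≤ n) {q ν L Λ lo : ℝ} (hq : 2 < q)
    (hqn : 1 / 2 - 1 / (n : ℝ) < 1 / q) (hν : 0 < ν) (hL : 0 ≤ L) (hΛ : 0 ≤ Λ) (hlo : 0 < lo)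
    {U : Set (SpaceTime n)} {χ : SpaceTime n → ℝ} (hχ : IsCutoff U Λ χ) (M : ℝ) :
    ∃ C : ℝ, 0 ≤ C ∧ ∀ (α : ℝ) (K : Set (SpaceTime n)) (v : SpaceTime n → Vec N)
      (G F : SpaceTime n → Grad N n), lo ≤ α → α ≤ 2 → 1 + α ≤ 2 + (1 + lo) * (1 - 2 / q) / 16 →
      LocalSol K U ν L α v G F → ∫ z, ‖v z‖ ^ 2 ≤ M → locEnergy α χ v ≤ C := by
  obtain ⟨D, hD0, hD⟩ := exists_uniform_estimate (N := N) hn hq hqn hν hL hΛ hlo hχ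
  have hχ2 : Integrable fun z => χ z ^ 2 := by
    have := hχ.test.continuous
    refine Continuous.integrable_of_hasCompactSupport (by fun_prop) ?_
    exact hχ.test.2.1.comp_left (g := fun x => x ^ 2) (by simp)
  set a := M + ∫ z, χ z ^ 2 with ha
  have hI0 : 0 ≤ ∫ z, χ z ^ 2 := integral_nonneg fun z => by positivity
  refine ⟨1 + (max a 0 + max M 0 ^ (15 / 16 : ℝ) * D ^ (1 / 16 : ℝ)) ^ 2, by positivity, ?_⟩
  intro α K v G F hα hα2 hαq h hM
  have hα0 : 0 < α := hlo.trans_le hα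
  have hM0 : 0 ≤ M := (integral_nonneg fun z => by positivity).trans hM
  obtain ⟨-, hX⟩ := hD α K v G F hα h
  set E := locEnergy α χ v with hE
  have hE0 : 0 ≤ E := locEnergy_nonneg
  have h2q : 0 < 1 - 2 / q := by
    rw [sub_pos, div_lt_one (by linarith)]; exact hq
  have h2q1 : 1 - 2 / q ≤ 1 := by
    have : 0 < 2 / q := by positivity
    linarith
  set s := 2 + (1 + α) * (1 - 2 / q) with hs
  have hs5 : s ≤ 5 := by nlinarith
  have hs2 : 2 ≤ s := by
    have : 0 ≤ (1 + α) * (1 - 2 / q) := by positivity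
    linarith
  -- `1 + α` stays below `2 + (s - 2)/16`. Hölder with weights `15/16` and `1/16` between the `L²`
  -- bound and the `L^s` estimate therefore leaves the energy on the right only to the power `(2 -
  -- 2/q)/16`, which can be absorbed.
  have hps : 1 + α ≤ 2 * (15 / 16) + s * (1 / 16) := by
    have : (1 + lo) * (1 - 2 / q) ≤ (1 + α) * (1 - 2 / q) := by gcongr
    linarith
  refine le_of_le_add_mul_rpow hE0 (le_max_right _ _) (by positivity)
    (κ := (2 - 2 / q) * (1 / 16)) (by linarith) ?_
  have hiv := integrable_norm_sq h.v_memLp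
  have hiw : Integrable fun z => χ z ^ 2 * ‖v z‖ ^ (1 + α) :=
    hχ.integrable_pow_mul 2 (h.integrable_rpow hα0)
  have hpt : ∀ z, χ z ^ 2 * ‖v z‖ ^ (1 + α) ≤
      χ z ^ 2 + (‖v z‖ ^ 2) ^ (15 / 16 : ℝ) * (‖χ z ^ 4 • v z‖ ^ s) ^ (1 / 16 : ℝ) := by
    intro z
    have hχ0 := hχ.nonneg z
    have hχ1 := hχ.le_one z
    have h1 := rpow_le_one_add_rpow (norm_nonneg (v z)) (by linarith) hps
    -- This needs `4 s / 16 ≤ 2`, which `s ≤ 5` ensures, so the cut-off in the higher integrability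
    -- estimate is strong enough.
    have h2 : χ z ^ 2 ≤ ((χ z ^ 4) ^ s) ^ (1 / 16 : ℝ) := by
      rw [← Real.rpow_mul (by positivity), ← Real.rpow_natCast, ← Real.rpow_natCast,
        ← Real.rpow_mul hχ0]
      refine Real.rpow_le_rpow_of_exponent_ge' hχ0 hχ1 (by positivity) ?_
      push_cast
      linarith
    calc χ z ^ 2 * ‖v z‖ ^ (1 + α)
        ≤ χ z ^ 2 * (1 + ‖v z‖ ^ (2 * (15 / 16) + s * (1 / 16))) := by gcongr
      _ = χ z ^ 2 + χ z ^ 2 * ((‖v z‖ ^ 2) ^ (15 / 16 : ℝ) * (‖v z‖ ^ s) ^ (1 / 16 : ℝ)) := by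
        rw [Real.rpow_add_of_nonneg (norm_nonneg _) (by norm_num) (by positivity),
          Real.rpow_mul (norm_nonneg _), Real.rpow_mul (norm_nonneg _), Real.rpow_two]
        ring
      _ ≤ χ z ^ 2 + ((χ z ^ 4) ^ s) ^ (1 / 16 : ℝ) *
          ((‖v z‖ ^ 2) ^ (15 / 16 : ℝ) * (‖v z‖ ^ s) ^ (1 / 16 : ℝ)) := by gcongr
      _ = _ := by
        rw [norm_smul, Real.norm_of_nonneg (by positivity), Real.mul_rpow (by positivity)
          (norm_nonneg _), Real.mul_rpow (by positivity) (by positivity)]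
        ring
  have hXle : ∫⁻ z, ENNReal.ofReal ((‖v z‖ ^ 2) ^ (15 / 16 : ℝ) *
      (‖χ z ^ 4 • v z‖ ^ s) ^ (1 / 16 : ℝ)) ≤
        ENNReal.ofReal (M ^ (15 / 16 : ℝ) * (D * E ^ (2 - 2 / q)) ^ (1 / 16 : ℝ)) := by
    have hm1 : AEMeasurable (fun z => ENNReal.ofReal (‖v z‖ ^ 2)) volume :=
      hiv.1.aemeasurable.ennreal_ofReal
    have hm2 : AEMeasurable (fun z => ‖χ z ^ 4 • v z‖ₑ ^ s) volume := by
      have := hχ.test.continuous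
      exact ((((by fun_prop : Continuous fun z => χ z ^ 4)).aestronglyMeasurable.smul
        h.v_memLp.1).enorm).pow_const _
    have h1 := ENNReal.lintegral_mul_norm_pow_le hm1 hm2 (p := 15 / 16) (q := 1 / 16)
      (by norm_num) (by norm_num) (by norm_num)
    have h2 : ∫⁻ z, ENNReal.ofReal (‖v z‖ ^ 2) ≤ ENNReal.ofReal M := by
      rw [← ofReal_integral_eq_lintegral_ofReal hiv (ae_of_all _ fun z => by positivity)]
      exact ENNReal.ofReal_le_ofReal hM
    calc _ = ∫⁻ z, ENNReal.ofReal (‖v z‖ ^ 2) ^ (15 / 16 : ℝ) *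
          (‖χ z ^ 4 • v z‖ₑ ^ s) ^ (1 / 16 : ℝ) := by
          refine lintegral_congr fun z => ?_
          rw [ENNReal.ofReal_mul (by positivity),
            ← ENNReal.ofReal_rpow_of_nonneg (by positivity) (by norm_num),
            ← ENNReal.ofReal_rpow_of_nonneg (by positivity) (by norm_num),
            ← ENNReal.ofReal_rpow_of_nonneg (by positivity) (by linarith), ofReal_norm]
      _ ≤ ENNReal.ofReal M ^ (15 / 16 : ℝ) *
          ENNReal.ofReal (D * E ^ (2 - 2 / q)) ^ (1 / 16 : ℝ) := by
          refine h1.trans ?_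
          gcongr
      _ = _ := by
          rw [ENNReal.ofReal_rpow_of_nonneg hM0 (by norm_num),
            ENNReal.ofReal_rpow_of_nonneg (by positivity) (by norm_num),
            ← ENNReal.ofReal_mul (by positivity)]
  have hY : ∫ z, χ z ^ 2 * ‖v z‖ ^ (1 + α) ≤ (∫ z, χ z ^ 2) +
      M ^ (15 / 16 : ℝ) * (D * E ^ (2 - 2 / q)) ^ (1 / 16 : ℝ) := by
    have h0 : ∀ z, 0 ≤ χ z ^ 2 * ‖v z‖ ^ (1 + α) := fun z => by positivity
    rw [← ENNReal.ofReal_le_ofReal_iff (by positivity),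
      ofReal_integral_eq_lintegral_ofReal hiw (ae_of_all _ h0),
      ENNReal.ofReal_add hI0 (by positivity),
      ofReal_integral_eq_lintegral_ofReal hχ2 (ae_of_all _ fun z => by positivity)]
    refine le_trans (lintegral_mono fun z => ENNReal.ofReal_le_ofReal (hpt z)) ?_
    calc _ = ∫⁻ z, (ENNReal.ofReal (χ z ^ 2) + ENNReal.ofReal ((‖v z‖ ^ 2) ^ (15 / 16 : ℝ) *
          (‖χ z ^ 4 • v z‖ ^ s) ^ (1 / 16 : ℝ))) :=
          lintegral_congr fun z => ENNReal.ofReal_add (by positivity) (by positivity)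
      _ = _ := lintegral_add_left' hχ2.1.aemeasurable.ennreal_ofReal _
      _ ≤ _ := by gcongr
  have hEe : E = (∫ z, χ z ^ 2 * ‖v z‖ ^ 2) + ∫ z, χ z ^ 2 * ‖v z‖ ^ (1 + α) := by
    rw [hE, locEnergy, ← integral_add (hχ.integrable_pow_mul 2 hiv) hiw]
    simp only [mul_add]
  have hE1 : ∫ z, χ z ^ 2 * ‖v z‖ ^ 2 ≤ M := by
    refine le_trans (integral_mono (hχ.integrable_pow_mul 2 hiv) hiv fun z => ?_) hM
    exact mul_le_of_le_one_left (by positivity) ((le_abs_self _).trans (hχ.pow_le_one 2 z))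
  have hf : (D * E ^ (2 - 2 / q)) ^ (1 / 16 : ℝ) =
      D ^ (1 / 16 : ℝ) * E ^ ((2 - 2 / q) * (1 / 16)) := by
    rw [Real.mul_rpow hD0 (by positivity), ← Real.rpow_mul hE0]
  rw [hf] at hY
  rw [max_eq_left hM0, max_eq_left (by positivity : 0 ≤ a), ha]
  nlinarith

/-- The exponents of the higher integrability estimate. -/
theorem exists_exponents (hn : 2 ≤ n) {m : ℝ} (hm : criticalExponent n < m) :
    ∃ q δ s : ℝ, 2 < q ∧ 1 / 2 - 1 / (n : ℝ) < 1 / q ∧ 0 < δ ∧ δ < 1 / m ∧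
      δ ≤ (1 + (1 / m - δ)) * (1 - 2 / q) / 16 ∧ s = 2 + (1 + (1 / m - δ)) * (1 - 2 / q) ∧
      2 < s ∧ 1 + (1 / m + δ) < s := by
  have hn2 : (2 : ℝ) ≤ n := by exact_mod_cast hn
  have hn0 : (0 : ℝ) < n := by linarith
  rw [criticalExponent, max_eq_left (by linarith), div_lt_iff₀ (by linarith)] at hm
  have hm0 : 0 < m := by
    by_contra h
    nlinarith
  set α := 1 / m with hα
  have hα0 : 0 < α := by positivity
  have hαm : α * m = 1 := by rw [hα]; field_simp
  -- Here `m > m_c` is used: `1/2 - 1/n < 1/(1 + 1/m)` is equivalent to `m (n + 2) > n - 2`. The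
  -- reciprocal `r = 1/q` is then chosen in the gap.
  have hc : 1 / 2 - 1 / (n : ℝ) < min (1 / 2) (1 / (1 + α)) := by
    refine lt_min (by have : 0 < 1 / (n : ℝ) := by positivity
                      linarith) ?_
    have h1 : 1 / (1 + α) = m / (m + 1) := by rw [hα]; field_simp
    have h2 : 1 / 2 - 1 / (n : ℝ) = (n - 2) / (2 * n) := by field_simp
    rw [h1, h2, div_lt_div_iff₀ (by positivity) (by positivity)]
    nlinarith
  obtain ⟨r, hr1, hr2⟩ := exists_between hc
  have hr0 : 0 < r := lt_of_le_of_lt (by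
    rw [sub_nonneg]; exact one_div_le_one_div_of_le (by norm_num) hn2) hr1
  obtain ⟨hr3, hr4⟩ := lt_min_iff.1 hr2
  have hr5 : r * (1 + α) < 1 := by rwa [lt_div_iff₀ (by positivity)] at hr4
  -- All conditions hold strictly at `δ = 0`, the last one because `r (1 + α) < 1`, and persist for
  -- small `δ`.
  have hd : ∀ᶠ δ : ℝ in 𝓝[>] 0, δ < α ∧
      δ < (1 + (α - δ)) * (1 - 2 * r) / 16 ∧ 1 + (α + δ) < 2 + (1 + (α - δ)) * (1 - 2 * r) := by
    refine nhdsWithin_le_nhds ?_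
    have e1 : ∀ᶠ δ : ℝ in 𝓝 0, δ < α := eventually_lt_nhds hα0
    have e3 : ∀ᶠ δ : ℝ in 𝓝 0, δ < (1 + (α - δ)) * (1 - 2 * r) / 16 :=
      ContinuousAt.eventually_lt (by fun_prop) (by fun_prop) (by
        have : 0 < (1 + α) * (1 - 2 * r) := mul_pos (by linarith) (by linarith)
        simpa using this)
    have e4 : ∀ᶠ δ : ℝ in 𝓝 0, 1 + (α + δ) < 2 + (1 + (α - δ)) * (1 - 2 * r) :=
      ContinuousAt.eventually_lt (by fun_prop) (by fun_prop) (by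
        simp only [add_zero, sub_zero]
        nlinarith)
    filter_upwards [e1, e3, e4] with δ h1 h3 h4 using ⟨h1, h3, h4⟩
  obtain ⟨δ, hδ, hδ0⟩ := (hd.and self_mem_nhdsWithin).exists
  have hδ0 : 0 < δ := hδ0
  have hq : 1 - 2 / (1 / r) = 1 - 2 * r := by field_simp
  refine ⟨1 / r, δ, _, ?_, by simpa using hr1, hδ0, hδ.1, ?_, rfl, ?_, ?_⟩
  · rw [lt_div_iff₀ hr0]; linarith
  · rw [hq]; exact hδ.2.1.le
  · rw [hq]
    have : 0 < (1 + (α - δ)) * (1 - 2 * r) := mul_pos (by linarith [hδ.1]) (by linarith)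
    linarith
  · rw [hq]; exact hδ.2.2

/-! ### From weak solutions to local solutions -/

section Field

variable {Ω : Set (EuclideanSpace ℝ (Fin n))} {T ν L μ : ℝ}
  {A : SpaceTime n → Vec N → Grad N n → Grad N n}

/-- Monotonicity forces the field to be independent of `u`. -/
theorem IsAdmissibleField.ae_eq (hA : IsAdmissibleField Ω T ν L μ A) (hμ : 0 < μ) :
    ∀ᵐ z ∂(volume.restrict (cylinder Ω T)), ∀ (u v : Vec N) (ξ : Grad N n), A z u ξ = A z v ξ := by
  filter_upwards [hA.continuous, hA.monotone] with z hc hm u v ξ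
  -- Minty's trick: compare `(u, ξ)` with `(v, ξ - t w)`, divide by `t > 0` and let `t → 0`, using
  -- continuity in the last argument.
  have key : ∀ w : Grad N n, 0 ≤ inner ℝ (A z u ξ - A z v ξ) w := by
    intro w
    have hcont : Continuous fun t : ℝ => inner ℝ (A z u ξ - A z v (ξ - t • w)) w := by
      have h1 : Continuous fun t : ℝ => A z v (ξ - t • w) :=
        hc.comp (by fun_prop : Continuous fun t : ℝ => (v, ξ - t • w))
      fun_prop
    have hlim : Tendsto (fun t : ℝ => inner ℝ (A z u ξ - A z v (ξ - t • w)) w) (𝓝[>] 0)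
        (𝓝 (inner ℝ (A z u ξ - A z v ξ) w)) := by
      have := hcont.tendsto 0
      simp only [zero_smul, sub_zero] at this
      exact this.mono_left nhdsWithin_le_nhds
    refine ge_of_tendsto hlim ?_
    filter_upwards [self_mem_nhdsWithin] with t ht
    have ht : 0 < t := ht
    have h1 := hm u v ξ (ξ - t • w)
    rw [sub_sub_cancel, inner_smul_right] at h1
    have h2 : 0 ≤ μ * ‖t • w‖ ^ 2 := by positivity
    exact nonneg_of_mul_nonneg_right (h2.trans h1) ht
  have h1 := key (-(A z u ξ - A z v ξ))
  rw [inner_neg_right, real_inner_self_eq_norm_sq] at h1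
  have h2 : ‖A z u ξ - A z v ξ‖ = 0 := by
    have := sq_nonneg ‖A z u ξ - A z v ξ‖
    exact pow_eq_zero_iff (two_ne_zero) |>.1 (by linarith)
  exact sub_eq_zero.1 (norm_eq_zero.1 h2)

/-- Carathéodory: for simple functions the composition is a finite sum of indicators, and continuity
in `ξ` passes to the limit. The argument `u` can be frozen at zero because the field does not depend
on it. -/
theorem IsAdmissibleField.aestronglyMeasurable_comp (hA : IsAdmissibleField Ω T ν L μ A)
    {K : Set (SpaceTime n)} (hK : K ⊆ cylinder Ω T) {G : SpaceTime n → Grad N n}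
    (hG : AEStronglyMeasurable G (volume.restrict K)) :
    AEStronglyMeasurable (fun z => A z 0 (G z)) (volume.restrict K) := by
  have hle : volume.restrict K ≤ volume.restrict (cylinder Ω T) := Measure.restrict_mono_set _ hK
  have hsimple : ∀ S : SimpleFunc (SpaceTime n) (Grad N n),
      AEMeasurable (fun z => A z 0 (S z)) (volume.restrict K) := by
    intro S
    have h1 : (fun z => A z 0 (S z)) =
        fun z => ∑ ξ ∈ S.range, (S ⁻¹' {ξ}).indicator (fun z => A z 0 ξ) z := by
      funext z
      rw [Finset.sum_eq_single (S z)]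
      · simp
      · intro ξ _ hξ
        exact indicator_of_notMem (fun h => hξ h.symm) _
      · intro h
        exact absurd (S.mem_range_self z) h
    rw [h1]
    exact Finset.aemeasurable_fun_sum _ fun ξ _ =>
      ((hA.measurable 0 ξ).mono_measure hle).indicator (S.measurableSet_fiber ξ)
  refine (aemeasurable_of_tendsto_metrizable_ae atTop
    (fun j => hsimple (hG.stronglyMeasurable_mk.approx j)) ?_).aestronglyMeasurable
  filter_upwards [ae_mono hle hA.continuous, hG.ae_eq_mk] with z hc hz
  have h1 : Continuous fun ξ => A z 0 ξ := hc.comp (by fun_prop : Continuous fun ξ => ((0 : Vec N), ξ))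
  have h2 := (h1.tendsto _).comp (hG.stronglyMeasurable_mk.tendsto_approx z)
  rw [← hz] at h2
  exact h2

theorem IsAdmissibleField.memLp_indicator (hA : IsAdmissibleField Ω T ν L μ A)
    {K : Set (SpaceTime n)} (hKc : IsCompact K) (hK : K ⊆ cylinder Ω T) {G : SpaceTime n → Grad N n}
    (hG : MemLp G 2 (volume.restrict K)) : MemLp (K.indicator fun z => A z 0 (G z)) 2 := by
  have hle : volume.restrict K ≤ volume.restrict (cylinder Ω T) := Measure.restrict_mono_set _ hK
  rw [memLp_indicator_iff_restrict hKc.measurableSet]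
  refine hG.of_le_mul (c := L) (hA.aestronglyMeasurable_comp hK hG.1) ?_
  filter_upwards [ae_mono hle hA.growth] with z hz using hz _ _

/-- A weak solution together with the gradient of its power. -/
structure IsSolWith (Ω : Set (EuclideanSpace ℝ (Fin n))) (T : ℝ)
    (A : SpaceTime n → Vec N → Grad N n → Grad N n) (m : ℝ) (u : SpaceTime n → Vec N)
    (G : SpaceTime n → Grad N n) : Prop where
  memLp : m < 1 → MemLpLoc (cylinder Ω T) (ENNReal.ofReal (m + 1)) u
  grad : HasWeakGrad Ω T (fun z => vpow m (u z)) G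
  eqn : ∀ φ : SpaceTime n → Vec N, IsTestFunction (cylinder Ω T) φ →
      ∫ z in cylinder Ω T,
        (-inner ℝ (u z) (timeDeriv φ z) + inner ℝ (A z (u z) (G z)) (spaceGrad φ z)) = 0

theorem spaceGrad_eq_zero {φ : SpaceTime n → Vec N} {z : SpaceTime n} (hz : z ∉ tsupport φ) :
    spaceGrad φ z = 0 := by
  ext q; simp [spaceGrad, spaceDeriv, fderiv_eq_zero_of_notMem_tsupport hz]

theorem IsTestFunction.continuous_spaceGrad {U : Set (SpaceTime n)} {φ : SpaceTime n → Vec N}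
    (h : IsTestFunction U φ) : Continuous (spaceGrad φ) := by
  have := fun j => h.continuous_spaceDeriv j
  unfold spaceGrad
  fun_prop

theorem IsTestFunction.memLp_timeDeriv {U : Set (SpaceTime n)} {φ : SpaceTime n → Vec N}
    (h : IsTestFunction U φ) (p : ℝ≥0∞) : MemLp (timeDeriv φ) p :=
  h.continuous_timeDeriv.memLp_of_hasCompactSupport
    (HasCompactSupport.intro h.2.1 fun _ hz => timeDeriv_eq_zero hz)

theorem IsTestFunction.memLp_spaceGrad {U : Set (SpaceTime n)} {φ : SpaceTime n → Vec N}
    (h : IsTestFunction U φ) (p : ℝ≥0∞) : MemLp (spaceGrad φ) p :=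
  h.continuous_spaceGrad.memLp_of_hasCompactSupport
    (HasCompactSupport.intro h.2.1 fun _ hz => spaceGrad_eq_zero hz)

theorem IsTestFunction.mono {F : Type*} [NormedAddCommGroup F] [NormedSpace ℝ F]
    {U V : Set (SpaceTime n)} {φ : SpaceTime n → F} (h : IsTestFunction U φ) (hUV : U ⊆ V) :
    IsTestFunction V φ := ⟨h.1, h.2.1, h.2.2.trans hUV⟩

theorem spaceDeriv_eq_zero {F : Type*} [NormedAddCommGroup F] [NormedSpace ℝ F]
    {φ : SpaceTime n → F} {z : SpaceTime n} (hz : z ∉ tsupport φ) (j : Fin n) :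
    spaceDeriv j φ z = 0 := by
  simp [spaceDeriv, fderiv_eq_zero_of_notMem_tsupport hz]

/-- Test functions supported in the interior of `K` do not see the extension by zero outside `K`. -/
theorem HasWeakGrad.locGrad {v : SpaceTime n → Vec N} {G : SpaceTime n → Grad N n}
    (h : HasWeakGrad Ω T v G) {K : Set (SpaceTime n)} (hK : K ⊆ cylinder Ω T) :
    LocGrad (interior K) (K.indicator v) (K.indicator G) := by
  intro φ hφ k j
  have hsub : interior K ⊆ cylinder Ω T := interior_subset.trans hK
  have h1 := h.integral_eq φ (hφ.mono hsub) k j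
  have hz : ∀ z ∉ K, z ∉ tsupport φ := fun z hz h => hz (interior_subset (hφ.2.2 h))
  rw [setIntegral_eq_integral_of_forall_compl_eq_zero,
    setIntegral_eq_integral_of_forall_compl_eq_zero] at h1
  · convert h1 using 2
    · funext z
      by_cases hzK : z ∈ K
      · simp [hzK]
      · simp [hzK, spaceDeriv_eq_zero (hz z hzK)]
    · congr 1
      funext z
      by_cases hzK : z ∈ K
      · simp [hzK]
      · simp [hzK, image_eq_zero_of_notMem_tsupport (hz z hzK)]
  · intro z hzc
    simp [image_eq_zero_of_notMem_tsupport (hz z fun h => hzc (hK h))]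
  · intro z hzc
    simp [spaceDeriv_eq_zero (hz z fun h => hzc (hK h))]

/-- For `m < 1` this is the integrability `u ∈ L^(m+1)` of the definition; for `m ≥ 1` it follows
from `L²`, as `1 + 1/m ≤ 2`. -/
theorem IsSolWith.memLp_vpow {m : ℝ} (hm : 0 < m) {u : SpaceTime n → Vec N}
    {G : SpaceTime n → Grad N n} (h : IsSolWith Ω T A m u G) {K : Set (SpaceTime n)}
    (hKc : IsCompact K) (hK : K ⊆ cylinder Ω T) :
    MemLp (K.indicator fun z => vpow m (u z)) (ENNReal.ofReal (1 + 1 / m)) := by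
  rw [memLp_indicator_iff_restrict hKc.measurableSet]
  rcases lt_or_ge m 1 with h1 | h1
  · have h2 := h.memLp h1 K hKc hK
    rw [add_comm] at h2
    exact PorousMedium.memLp_vpow hm h2
  · have := isFiniteMeasure_restrict.2 (hKc.measure_lt_top (μ := volume)).ne
    refine (h.grad.memLp K hKc hK).mono_exponent ?_
    rw [show (2 : ℝ≥0∞) = ENNReal.ofReal 2 by simp]
    refine ENNReal.ofReal_le_ofReal ?_
    have : 1 / m ≤ 1 := by rw [div_le_one hm]; exact h1
    linarith

/-- On `K` the function `u` is recovered from its power by `vpow (1 / m)`, and the field is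
evaluated at `u = 0`. Integrability of both parts allows the integral to be split. -/
theorem IsAdmissibleField.setIntegral_eqn_eq (hA : IsAdmissibleField Ω T ν L μ A) (hμ : 0 < μ)
    {m : ℝ} (hm : 0 < m) {u : SpaceTime n → Vec N} {G : SpaceTime n → Grad N n}
    {K : Set (SpaceTime n)} (hKc : IsCompact K) (hK : K ⊆ cylinder Ω T)
    (hvp : MemLp (K.indicator fun z => vpow m (u z)) (ENNReal.ofReal (1 + 1 / m)))
    (hG : MemLp G 2 (volume.restrict K)) {φ : SpaceTime n → Vec N}
    (hφ : IsTestFunction (interior K) φ) :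
    ∫ z in cylinder Ω T,
        (-inner ℝ (u z) (timeDeriv φ z) + inner ℝ (A z (u z) (G z)) (spaceGrad φ z)) =
      -(∫ z, inner ℝ (vpow (1 / m) (K.indicator (fun z => vpow m (u z)) z)) (timeDeriv φ z)) +
        ∫ z, inner ℝ (K.indicator (fun z => A z 0 (G z)) z) (spaceGrad φ z) := by
  have hKm := hKc.measurableSet
  have hle : volume.restrict K ≤ volume.restrict (cylinder Ω T) := Measure.restrict_mono_set _ hK
  have hF := hA.memLp_indicator hKc hK hG
  have hα : 0 < 1 / m := by positivity
  have hz : ∀ z ∉ K, z ∉ tsupport φ := fun z hz h => hz (interior_subset (hφ.2.2 h))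
  have hu1 : MemLp (fun z => vpow (1 / m) (K.indicator (fun z => vpow m (u z)) z)) 1 :=
    memLp_one_iff_integrable.2 (integrable_of_memLp (by
      rw [← ENNReal.ofReal_one]
      exact ENNReal.ofReal_le_ofReal (by linarith [show 0 < 1 / (1 / m) by positivity])) hKc
      (PorousMedium.memLp_vpow hα hvp)
      fun z hz => by rw [indicator_of_notMem hz, vpow_zero_right])
  have hi1 := integrable_inner_of_memLp hu1 (hφ.memLp_timeDeriv ⊤)
  have hi2 := integrable_inner_of_memLp hF (hφ.memLp_spaceGrad 2)
  have h3 := integral_add hi1.neg hi2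
  simp only [Pi.neg_apply] at h3
  rw [← integral_neg, ← h3, setIntegral_eq_integral_of_forall_compl_eq_zero (s := cylinder Ω T)
    (fun z hzc => by
      have := hz z fun h => hzc (hK h)
      simp [timeDeriv_eq_zero this, spaceGrad_eq_zero this])]
  refine integral_congr_ae ?_
  have hAe := (ae_restrict_iff' hKm).1 (ae_mono hle (hA.ae_eq hμ))
  filter_upwards [hAe] with z hAz
  by_cases hzK : z ∈ K
  · rw [indicator_of_mem hzK, indicator_of_mem hzK,
      vpow_vpow hm (mul_one_div_cancel hm.ne'), hAz hzK 0 (u z)]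
  · simp [timeDeriv_eq_zero (hz z hzK), spaceGrad_eq_zero (hz z hzK)]

theorem IsSolWith.localSol (hA : IsAdmissibleField Ω T ν L μ A) (hμ : 0 < μ) {m : ℝ} (hm : 0 < m)
    {u : SpaceTime n → Vec N} {G : SpaceTime n → Grad N n} (h : IsSolWith Ω T A m u G)
    {K : Set (SpaceTime n)} (hKc : IsCompact K) (hK : K ⊆ cylinder Ω T) :
    LocalSol K (interior K) ν L (1 / m) (K.indicator fun z => vpow m (u z)) (K.indicator G)
      (K.indicator fun z => A z 0 (G z)) := by
  have hKm := hKc.measurableSet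
  have hle : volume.restrict K ≤ volume.restrict (cylinder Ω T) := Measure.restrict_mono_set _ hK
  have hGm := h.grad.grad_memLp K hKc hK
  have hF := hA.memLp_indicator hKc hK hGm
  have hF0 : ∀ z ∉ K, K.indicator (fun z => A z 0 (G z)) z = 0 := fun z hz =>
    indicator_of_notMem hz _
  have hv0 : ∀ z ∉ K, K.indicator (fun z => vpow m (u z)) z = 0 := fun z hz =>
    indicator_of_notMem hz _
  have hvp := h.memLp_vpow hm hKc hK
  have hα : 0 < 1 / m := by positivity
  refine ⟨hKc, isOpen_interior, hv0, fun z hz => indicator_of_notMem hz _, hF0, ?_, hvp, ?_, hF,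
    h.grad.locGrad hK, ?_, ?_, ?_⟩
  · rw [memLp_indicator_iff_restrict hKm]; exact h.grad.memLp K hKc hK
  · rwa [memLp_indicator_iff_restrict hKm]
  · intro φ hφ
    have h1 := h.eqn φ (hφ.mono (interior_subset.trans hK))
    rw [hA.setIntegral_eqn_eq hμ hm hKc hK hvp hGm hφ] at h1
    linarith
  · have := (ae_restrict_iff' hKm).1 (ae_mono hle hA.coercive)
    filter_upwards [this] with z hz
    by_cases hzK : z ∈ K
    · simpa [hzK] using hz hzK 0 (G z)
    · simp [hzK]
  · have := (ae_restrict_iff' hKm).1 (ae_mono hle hA.growth)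
    filter_upwards [this] with z hz
    by_cases hzK : z ∈ K
    · simpa [hzK] using hz hzK 0 (G z)
    · simp [hzK]

end Field

/-! ### Uniform local bounds -/

theorem memLp_and_integral_le {X W : Type*} [MeasurableSpace X] {μ : Measure X}
    [NormedAddCommGroup W] {f : X → W} (hf : AEStronglyMeasurable f μ) {s C : ℝ} (hs : 0 < s)
    (hC : 0 ≤ C) (h : ∫⁻ x, ‖f x‖ₑ ^ s ∂μ ≤ ENNReal.ofReal C) :
    MemLp f (ENNReal.ofReal s) μ ∧ ∫ x, ‖f x‖ ^ s ∂μ ≤ C := by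
  have h1 : MemLp f (ENNReal.ofReal s) μ := by
    refine ⟨hf, ?_⟩
    rw [eLpNorm_lt_top_iff_lintegral_rpow_enorm_lt_top (by simpa) ENNReal.ofReal_ne_top,
      ENNReal.toReal_ofReal hs.le]
    exact h.trans_lt ENNReal.ofReal_lt_top
  refine ⟨h1, ?_⟩
  have hi := h1.integrable_norm_rpow (by simpa) ENNReal.ofReal_ne_top
  rw [ENNReal.toReal_ofReal hs.le] at hi
  rw [← ENNReal.ofReal_le_ofReal_iff hC,
    ofReal_integral_eq_lintegral_ofReal hi (ae_of_all _ fun x => by positivity)]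
  refine le_trans (lintegral_mono fun x => ?_) h
  rw [← ENNReal.ofReal_rpow_of_nonneg (norm_nonneg _) hs.le, ofReal_norm]

/-- Once the local energies are bounded, `exists_uniform_estimate` bounds the gradients and the
powers on the set where the cut-off equals one. -/
theorem exists_bounds_of_locEnergy (hn : 2 ≤ n) {Ω : Set (EuclideanSpace ℝ (Fin n))} {T ν L μ : ℝ}
    {A : SpaceTime n → Vec N → Grad N n → Grad N n} (hA : IsAdmissibleField Ω T ν L μ A)
    (hμ : 0 < μ) (hν : 0 < ν) (hL : 0 ≤ L) {q lo s : ℝ} (hq : 2 < q)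
    (hqn : 1 / 2 - 1 / (n : ℝ) < 1 / q) (hlo : 0 < lo) (hs : s = 2 + (1 + lo) * (1 - 2 / q))
    {ms : ℕ → ℝ} {us : ℕ → SpaceTime n → Vec N} {Gs : ℕ → SpaceTime n → Grad N n}
    (hm0 : ∀ i, 0 < ms i) (hms : ∀ i, lo ≤ 1 / ms i)
    (hsol : ∀ i, IsSolWith Ω T A (ms i) (us i) (Gs i))
    {K K₀ : Set (SpaceTime n)} (hKc : IsCompact K) (hK : K ⊆ cylinder Ω T) (hK₀ : IsCompact K₀)
    (hKK : K₀ ⊆ interior K) {Λ M : ℝ} (hΛ : 0 ≤ Λ) {χ : SpaceTime n → ℝ}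
    (hχ : IsCutoff (interior K) Λ χ) (hχ1 : ∀ z ∈ K₀, χ z = 1)
    (hM : ∀ i, locEnergy (1 / ms i) χ (K.indicator fun z => vpow (ms i) (us i z)) ≤ M) :
    ∃ C, 0 ≤ C ∧ ∀ i, MemLp (K₀.indicator fun z => vpow (ms i) (us i z)) (ENNReal.ofReal s) ∧
      ∫ z, ‖K₀.indicator (fun z => vpow (ms i) (us i z)) z‖ ^ s ≤ C ∧
      ∫ z, ‖K₀.indicator (Gs i) z‖ ^ 2 ≤ C := by
  obtain ⟨D, hD0, hD⟩ := exists_uniform_estimate (N := N) hn hq hqn hν hL hΛ hlo hχ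
  have h2q : 0 < 1 - 2 / q := by
    rw [sub_pos, div_lt_one (by linarith)]; exact hq
  have hs0 : 0 < s := by rw [hs]; positivity
  have hM0 : 0 ≤ M := locEnergy_nonneg.trans (hM 0)
  have hvol := (hK₀.measure_lt_top (μ := volume)).ne
  have hKK' : K₀ ⊆ K := hKK.trans interior_subset
  refine ⟨max (D * M) ((volume K₀).toReal + D * M ^ (2 - 2 / q)), by positivity, fun i => ?_⟩
  have hloc := (hsol i).localSol hA hμ (hm0 i) hKc hK
  obtain ⟨hG, hv⟩ := hD _ _ _ _ _ (hms i) hloc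
  have hE0 := locEnergy_nonneg (α := 1 / ms i) (χ := χ)
    (v := K.indicator fun z => vpow (ms i) (us i z))
  have hvm : AEStronglyMeasurable (K₀.indicator fun z => vpow (ms i) (us i z)) volume := by
    rw [aestronglyMeasurable_indicator_iff hK₀.measurableSet]
    exact ((hsol i).grad.memLp K₀ hK₀ (hKK'.trans hK)).1
  have h1 := memLp_and_integral_le hvm hs0
    (C := (volume K₀).toReal + D * M ^ (2 - 2 / q)) (by positivity) ?_
  · refine ⟨h1.1, h1.2.trans (le_max_right _ _), ?_⟩
    refine le_trans ?_ (le_max_left _ _)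
    refine le_trans ?_ (hG.trans (mul_le_mul_of_nonneg_left (hM i) hD0))
    refine integral_mono_of_nonneg (ae_of_all _ fun z => by positivity)
      (hχ.integrable_pow_mul 4 (integrable_norm_sq hloc.G_memLp)) (ae_of_all _ fun z => ?_)
    by_cases hz : z ∈ K₀
    · simp [hz, hKK' hz, hχ1 z hz]
    · have := hχ.nonneg z
      simp only [hz, not_false_eq_true, indicator_of_notMem, norm_zero, ne_eq, OfNat.ofNat_ne_zero,
        zero_pow]
      positivity
  · rw [ENNReal.ofReal_add (by positivity) (by positivity), ENNReal.ofReal_toReal hvol]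
    -- The integrability exponent delivered varies with `i` but is at least `s`; powers of values
    -- below one are paid for by the volume of `K₀`.
    have hle : ∀ z, ‖K₀.indicator (fun z => vpow (ms i) (us i z)) z‖ₑ ^ s ≤
        K₀.indicator 1 z + ‖χ z ^ 4 • K.indicator (fun z => vpow (ms i) (us i z)) z‖ₑ ^
          (2 + (1 + 1 / ms i) * (1 - 2 / q)) := by
      intro z
      by_cases hz : z ∈ K₀
      · simp only [hz, hKK' hz, hχ1 z hz, indicator_of_mem, one_pow, one_smul, Pi.one_apply]
        set a := ‖vpow (ms i) (us i z)‖ₑ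
        have hss : s ≤ 2 + (1 + 1 / ms i) * (1 - 2 / q) := by
          rw [hs]
          have := hms i
          gcongr
        rcases le_total a 1 with ha | ha
        · exact (ENNReal.rpow_le_one ha hs0.le).trans le_self_add
        · exact (ENNReal.rpow_le_rpow_of_exponent_le ha hss).trans le_add_self
      · simp [hz, hs0]
    refine (lintegral_mono hle).trans ?_
    rw [lintegral_add_left (measurable_one.indicator hK₀.measurableSet),
      lintegral_indicator_one hK₀.measurableSet]
    gcongr
    refine hv.trans (ENNReal.ofReal_le_ofReal ?_)
    have h2 : 0 ≤ 2 - 2 / q := by linarith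
    have := hM i
    gcongr

/-- Uniform boundedness principle for the pairings with the sequence, seen as functionals on
`L²(K)`. -/
theorem TendstoWeaklyL2Loc.exists_bound {U : Set (SpaceTime n)} {vs : ℕ → SpaceTime n → Vec N}
    {v : SpaceTime n → Vec N} (h : TendstoWeaklyL2Loc U vs v) {K : Set (SpaceTime n)}
    (hKc : IsCompact K) (hK : K ⊆ U) : ∃ M, ∀ i, ∫ z, ‖K.indicator (vs i) z‖ ^ 2 ≤ M := by
  have hm := fun i => h.1 i K hKc hK
  obtain ⟨C, hC⟩ := banach_steinhaus (g := fun i => innerSL ℝ ((hm i).toLp (vs i))) (by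
    intro ψ
    have h1 := h.2.2 K hKc hK ψ (Lp.memLp ψ)
    obtain ⟨C, hC⟩ := h1.norm.bddAbove_range
    refine ⟨C, fun i => ?_⟩
    refine le_trans (le_of_eq ?_) (hC ⟨i, rfl⟩)
    rw [innerSL_apply_apply, L2.inner_def]
    congr 1
    refine integral_congr_ae ?_
    filter_upwards [(hm i).coeFn_toLp] with z hz
    rw [hz])
  refine ⟨C ^ 2, fun i => ?_⟩
  have h2 := hC i
  rw [innerSL_apply_norm] at h2
  have h3 : ∫ z, ‖K.indicator (vs i) z‖ ^ 2 = ‖(hm i).toLp (vs i)‖ ^ 2 := by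
    rw [← real_inner_self_eq_norm_sq, L2.inner_def, ← integral_indicator hKc.measurableSet]
    have e := (ae_restrict_iff' hKc.measurableSet).1 (hm i).coeFn_toLp
    refine integral_congr_ae ?_
    filter_upwards [e] with z hz
    by_cases hzK : z ∈ K
    · simp only [hzK, indicator_of_mem]
      rw [hz hzK, real_inner_self_eq_norm_sq]
    · simp [hzK]
  rw [h3]
  gcongr

theorem locEnergy_le_of_rpow_bound {K U : Set (SpaceTime n)} {ν L α Λ M₁ M₂ : ℝ}
    {v : SpaceTime n → Vec N} {G F : SpaceTime n → Grad N n} {χ : SpaceTime n → ℝ}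
    (h : LocalSol K U ν L α v G F) (hα : 0 < α) (hχ : IsCutoff U Λ χ)
    (h₁ : ∫ z, ‖v z‖ ^ 2 ≤ M₁) (h₂ : ∫ z, ‖v z‖ ^ (1 + α) ≤ M₂) :
    locEnergy α χ v ≤ M₁ + M₂ := by
  have hi1 := integrable_norm_sq h.v_memLp
  have hi2 := h.integrable_rpow hα
  refine le_trans ?_ (add_le_add h₁ h₂)
  rw [← integral_add hi1 hi2]
  refine integral_mono (h.integrable_locEnergy hα hχ) (hi1.add hi2) fun z => ?_
  exact mul_le_of_le_one_left (by positivity) ((le_abs_self _).trans (hχ.pow_le_one 2 z))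

/-- If `m < 1` the hypothesis on `|uᵢ|^(mᵢ+1) = |vᵢ|^(1+αᵢ)` bounds the local energy directly. If `m
≥ 1` then `1 + αᵢ` exceeds `2` by at most `δ`, and the absorption of `exists_locEnergy_le` applies.
-/
theorem exists_bounds (hn : 2 ≤ n) {Ω : Set (EuclideanSpace ℝ (Fin n))} (hΩ : IsOpen Ω)
    {T ν L μ : ℝ} {A : SpaceTime n → Vec N → Grad N n → Grad N n}
    (hA : IsAdmissibleField Ω T ν L μ A) (hμ : 0 < μ) (hν : 0 < ν) (hL : 0 ≤ L) {q δ s m : ℝ}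
    (hq : 2 < q) (hqn : 1 / 2 - 1 / (n : ℝ) < 1 / q) (hm : 0 < m) (hδ : δ < 1 / m)
    (hδq : δ ≤ (1 + (1 / m - δ)) * (1 - 2 / q) / 16)
    (hs : s = 2 + (1 + (1 / m - δ)) * (1 - 2 / q))
    {ms : ℕ → ℝ} {us : ℕ → SpaceTime n → Vec N} {Gs : ℕ → SpaceTime n → Grad N n}
    (hm0 : ∀ i, 0 < ms i) (hms : ∀ i, |1 / ms i - 1 / m| ≤ δ)
    (hsol : ∀ i, IsSolWith Ω T A (ms i) (us i) (Gs i)) {v : SpaceTime n → Vec N}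
    (hweak : TendstoWeaklyL2Loc (cylinder Ω T) (fun i z => vpow (ms i) (us i z)) v)
    (hbdd : m < 1 → BoundedL1Loc (cylinder Ω T) (fun i z => vpow (ms i + 1) (us i z)))
    {K₀ : Set (SpaceTime n)} (hK₀ : IsCompact K₀) (hK₀U : K₀ ⊆ cylinder Ω T) :
    ∃ C, 0 ≤ C ∧ ∀ i, MemLp (K₀.indicator fun z => vpow (ms i) (us i z)) (ENNReal.ofReal s) ∧
      ∫ z, ‖K₀.indicator (fun z => vpow (ms i) (us i z)) z‖ ^ s ≤ C ∧
      ∫ z, ‖K₀.indicator (Gs i) z‖ ^ 2 ≤ C := by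
  have hU : IsOpen (cylinder Ω T) := hΩ.prod isOpen_Ioo
  obtain ⟨K, hKc, hKK, hK⟩ := exists_compact_between hK₀ hU hK₀U
  obtain ⟨Λ, χ, hΛ, hχ, hχ1⟩ := exists_isCutoff hK₀ isOpen_interior hKK
  obtain ⟨M, hM⟩ := hweak.exists_bound hKc hK
  have hlo : 0 < 1 / m - δ := by linarith
  have hlo' : ∀ i, 1 / m - δ ≤ 1 / ms i := fun i => by linarith [(abs_le.1 (hms i)).1]
  have hloc := fun i => (hsol i).localSol hA hμ (hm0 i) hKc hK
  obtain ⟨M', hM'⟩ : ∃ M', ∀ i,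
      locEnergy (1 / ms i) χ (K.indicator fun z => vpow (ms i) (us i z)) ≤ M' := by
    rcases lt_or_ge m 1 with h1 | h1
    · obtain ⟨C, hC⟩ := hbdd h1 K hKc hK
      refine ⟨M + C, fun i => ?_⟩
      refine locEnergy_le_of_rpow_bound (hloc i) (one_div_pos.2 (hm0 i)) hχ (hM i) ?_
      have e : ∀ z, ‖K.indicator (fun z => vpow (ms i) (us i z)) z‖ ^ (1 + 1 / ms i) =
          K.indicator (fun z => ‖vpow (ms i + 1) (us i z)‖) z := by
        intro z
        have hmi := hm0 i
        by_cases hz : z ∈ K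
        · rw [indicator_of_mem hz, indicator_of_mem hz, norm_vpow hmi, norm_vpow (by linarith),
            ← Real.rpow_mul (norm_nonneg _)]
          congr 1
          field_simp
        · have : 1 + 1 / ms i ≠ 0 := by positivity
          simp [hz, Real.zero_rpow (by simpa using this)]
      simp_rw [e]
      rw [integral_indicator hKc.measurableSet]
      -- Without integrability the integral has the default value zero and the bound is trivial.
      by_cases hi : Integrable (fun z => vpow (ms i + 1) (us i z)) (volume.restrict K)
      · rw [integral_norm_eq_lintegral_enorm hi.1, ← eLpNorm_one_eq_lintegral_enorm]
        exact ENNReal.toReal_le_coe_of_le_coe (hC i)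
      · rw [integral_undef fun h2 => hi ?_]
        · exact C.2
        · have hfin := hC i
          have hm := (memLp_indicator_iff_restrict hKc.measurableSet).1 (hloc i).v_memLp
          have hum : AEStronglyMeasurable (fun z => us i z) (volume.restrict K) := by
            have := (continuous_vpow (N := N) (one_div_pos.2 (hm0 i))).comp_aestronglyMeasurable
              hm.1
            refine this.congr (ae_of_all _ fun z => ?_)
            exact vpow_vpow (hm0 i) (mul_one_div_cancel (hm0 i).ne') _
          exact (integrable_norm_iff ((continuous_vpow (N := N)
            (by linarith [hm0 i] : 0 < ms i + 1)).comp_aestronglyMeasurable hum)).1 h2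
    · obtain ⟨C, -, hC⟩ := exists_locEnergy_le (N := N) hn hq hqn hν hL hΛ hlo hχ M
      have hm1 : 1 / m ≤ 1 := by rw [div_le_one hm]; exact h1
      refine ⟨C, fun i => hC _ _ _ _ _ (hlo' i) ?_ ?_ (hloc i) (hM i)⟩
      · linarith [(abs_le.1 (hms i)).2]
      · linarith [(abs_le.1 (hms i)).2]
  exact exists_bounds_of_locEnergy hn hA hμ hν hL hq hqn hlo hs hm0 hlo' hsol hKc hK hK₀ hKK hΛ hχ
    hχ1 hM'

/-! ### Truncation and weak lower semicontinuity -/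

open Classical in
/-- The vector `x` if `‖x‖ ≤ k`, and zero otherwise. -/
noncomputable def trunc (k : ℕ) (x : Vec N) : Vec N := if ‖x‖ ≤ k then x else 0

theorem norm_trunc_le (k : ℕ) (x : Vec N) : ‖trunc k x‖ ≤ k := by
  unfold trunc; split_ifs with h <;> simp [h]

theorem trunc_zero (k : ℕ) : trunc k (0 : Vec N) = 0 := by simp [trunc]

theorem measurable_trunc (k : ℕ) : Measurable (trunc k : Vec N → Vec N) :=
  Measurable.ite (measurableSet_le measurable_norm measurable_const) measurable_id measurable_const

theorem eventually_trunc_eq (x : Vec N) : ∀ᶠ k : ℕ in atTop, trunc k x = x := by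
  filter_upwards [eventually_ge_atTop ⌈‖x‖⌉₊] with k hk
  exact if_pos (Nat.ceil_le.1 hk)

theorem memLp_of_bounded {W : Type*} [NormedAddCommGroup W] {K : Set (SpaceTime n)}
    (hK : IsCompact K) {f : SpaceTime n → W} (hf : AEStronglyMeasurable f volume)
    (h0 : ∀ z ∉ K, f z = 0) {B : ℝ} (hB : ∀ z, ‖f z‖ ≤ B) (p : ℝ≥0∞) : MemLp f p := by
  have e : f = K.indicator f := by
    funext z
    by_cases hz : z ∈ K <;> simp [hz, h0]
  have := isFiniteMeasure_restrict.2 (hK.measure_lt_top (μ := volume)).ne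
  rw [e, memLp_indicator_iff_restrict hK.measurableSet]
  exact MemLp.of_bound hf.restrict B (ae_of_all _ hB)

/-- Test with `vpow (s - 1)` of the truncated limit, which is bounded and so lies in `L²`. Young's
inequality gives `∫ |T|^s ≤ (s-1)/s ∫ |T|^s + C/s` for the truncation `T`; absorb, and let the
truncation level tend to infinity by Fatou. -/
theorem memLp_of_tendsto_weak {K : Set (SpaceTime n)} (hK : IsCompact K)
    {vs : ℕ → SpaceTime n → Vec N} {v : SpaceTime n → Vec N} {s C : ℝ} (hs : 1 < s)
    (hvs : ∀ i, MemLp (vs i) (ENNReal.ofReal s)) (hvC : ∀ i, ∫ z, ‖vs i z‖ ^ s ≤ C)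
    (hv : AEStronglyMeasurable v volume) (hv0 : ∀ z ∉ K, v z = 0)
    (hw : ∀ ψ : SpaceTime n → Vec N, MemLp ψ 2 →
      Tendsto (fun i => ∫ z, inner ℝ (vs i z) (ψ z)) atTop (𝓝 (∫ z, inner ℝ (v z) (ψ z)))) :
    MemLp v (ENNReal.ofReal s) ∧ ∫ z, ‖v z‖ ^ s ≤ C := by
  have hs0 : 0 < s := by linarith
  have hC : 0 ≤ C := (integral_nonneg fun z => by positivity).trans (hvC 0)
  have hvi : ∀ i, Integrable fun z => ‖vs i z‖ ^ s := fun i => by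
    have := (hvs i).integrable_norm_rpow (by simpa) ENNReal.ofReal_ne_top
    rwa [ENNReal.toReal_ofReal hs0.le] at this
  have htm : ∀ k, AEStronglyMeasurable (fun z => trunc k (v z)) volume := fun k =>
    ((measurable_trunc k).comp_aemeasurable hv.aemeasurable).aestronglyMeasurable
  have ht0 : ∀ k, ∀ z ∉ K, trunc k (v z) = 0 := fun k z hz => by rw [hv0 z hz, trunc_zero]
  have hbound : ∀ k, ∫ z, ‖trunc k (v z)‖ ^ s ≤ C := by
    intro k
    have hs1 : 0 < s - 1 := by linarith
    set ψ : SpaceTime n → Vec N := fun z => vpow (s - 1) (trunc k (v z)) with hψ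
    have hψm : MemLp ψ 2 := by
      refine memLp_of_bounded hK ((continuous_vpow hs1).comp_aestronglyMeasurable (htm k))
        (fun z hz => by simp only [ht0 k z hz, vpow_zero_right]) (B := (k : ℝ) ^ (s - 1))
        (fun z => ?_) 2
      rw [norm_vpow hs1]
      have := norm_trunc_le k (v z)
      gcongr
    have hti : Integrable fun z => ‖trunc k (v z)‖ ^ s := by
      have := (memLp_of_bounded hK (htm k) (ht0 k) (fun z => norm_trunc_le k (v z))
        (ENNReal.ofReal s)).integrable_norm_rpow (by simpa) ENNReal.ofReal_ne_top
      rwa [ENNReal.toReal_ofReal hs0.le] at this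
    -- The truncation is either the vector itself or zero, so pairing its power with `v` is the same
    -- as pairing it with the truncation.
    have e1 : ∫ z, inner ℝ (v z) (ψ z) = ∫ z, ‖trunc k (v z)‖ ^ s := by
      refine integral_congr_ae (ae_of_all _ fun z => ?_)
      have h1 : inner ℝ (v z) (ψ z) = inner ℝ (vpow (s - 1) (trunc k (v z))) (trunc k (v z)) := by
        rw [hψ, real_inner_comm]
        simp only [trunc]
        split_ifs <;> simp [vpow_zero_right]
      simp only [h1, inner_vpow_self hs1]
      congr 1
      ring
    have h2 : ∫ z, inner ℝ (v z) (ψ z) ≤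
        (s - 1) / s * (∫ z, ‖trunc k (v z)‖ ^ s) + 1 / s * C := by
      refine le_of_tendsto (hw ψ hψm) (Eventually.of_forall fun i => ?_)
      calc ∫ z, inner ℝ (vs i z) (ψ z)
          ≤ ∫ z, ((s - 1) / s * ‖trunc k (v z)‖ ^ s + 1 / s * ‖vs i z‖ ^ s) := by
            refine integral_mono_of_nonneg_right ((hti.const_mul _).add ((hvi i).const_mul _))
              (fun z => ?_) (ae_of_all _ fun z => ?_)
            · have : 0 ≤ (s - 1) / s := by positivity
              positivity
            · have h3 := inner_vpow_sub_le hs1 (vs i z) (trunc k (v z))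
              rw [inner_sub_left, inner_vpow_self hs1] at h3
              have e : 1 + (s - 1) = s := by ring
              rw [e] at h3
              rw [real_inner_comm]
              have h4 : (1 : ℝ) / s = 1 - (s - 1) / s := by field_simp; ring
              rw [h4]
              linarith
        _ = (s - 1) / s * (∫ z, ‖trunc k (v z)‖ ^ s) + 1 / s * ∫ z, ‖vs i z‖ ^ s := by
            rw [integral_add (hti.const_mul _) ((hvi i).const_mul _), integral_const_mul,
              integral_const_mul]
        _ ≤ _ := by
            gcongr
            exact hvC i
    rw [e1] at h2
    set X := ∫ z, ‖trunc k (v z)‖ ^ s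
    have h4 : (s - 1) / s * X = X - 1 / s * X := by field_simp
    rw [h4] at h2
    have h5 : 1 / s * X ≤ 1 / s * C := by linarith
    exact le_of_mul_le_mul_left h5 (by positivity)
  refine memLp_and_integral_le hv hs0 hC ?_
  refine lintegral_le_of_tendsto (h := fun k z => ‖trunc k (v z)‖ₑ ^ s)
    (fun k => (htm k).enorm.pow_const _) (ae_of_all _ fun z => ?_) fun k => ?_
  · refine tendsto_const_nhds.congr' ?_
    filter_upwards [eventually_trunc_eq (v z)] with k hk
    rw [hk]
  · have hti : Integrable fun z => ‖trunc k (v z)‖ ^ s := by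
      have := (memLp_of_bounded hK (htm k) (ht0 k) (fun z => norm_trunc_le k (v z))
        (ENNReal.ofReal s)).integrable_norm_rpow (by simpa) ENNReal.ofReal_ne_top
      rwa [ENNReal.toReal_ofReal hs0.le] at this
    refine le_trans (le_of_eq ?_) (ENNReal.ofReal_le_ofReal (hbound k))
    rw [ofReal_integral_eq_lintegral_ofReal hti (ae_of_all _ fun z => by positivity)]
    refine lintegral_congr fun z => ?_
    rw [← ENNReal.ofReal_rpow_of_nonneg (norm_nonneg _) hs0.le, ofReal_norm]

/-! ### Compactness -/

theorem norm_sub_rpow_le {W : Type*} [NormedAddCommGroup W] {s : ℝ} (hs : 0 ≤ s) (a b : W) :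
    ‖a - b‖ ^ s ≤ 2 ^ s * (‖a‖ ^ s + ‖b‖ ^ s) := by
  have h1 : ‖a - b‖ ≤ 2 * max ‖a‖ ‖b‖ := by
    have := norm_sub_le a b
    have h2 := le_max_left ‖a‖ ‖b‖
    have h3 := le_max_right ‖a‖ ‖b‖
    linarith
  have h0 : 0 ≤ max ‖a‖ ‖b‖ := (norm_nonneg a).trans (le_max_left _ _)
  calc ‖a - b‖ ^ s ≤ (2 * max ‖a‖ ‖b‖) ^ s := by gcongr
    _ = 2 ^ s * max ‖a‖ ‖b‖ ^ s := Real.mul_rpow (by norm_num) h0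
    _ ≤ _ := by
      gcongr
      have h2 : 0 ≤ ‖a‖ ^ s := by positivity
      have h3 : 0 ≤ ‖b‖ ^ s := by positivity
      rcases max_choice ‖a‖ ‖b‖ with h | h <;> rw [h] <;> linarith

theorem integrable_norm_rpow_ofReal {X W : Type*} [MeasurableSpace X] {μ : Measure X}
    [NormedAddCommGroup W] {f : X → W} {s : ℝ} (hs : 0 < s) (hf : MemLp f (ENNReal.ofReal s) μ) :
    Integrable (fun x => ‖f x‖ ^ s) μ := by
  have := hf.integrable_norm_rpow (by simpa) ENNReal.ofReal_ne_top
  rwa [ENNReal.toReal_ofReal hs.le] at this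

theorem abs_integral_inner_le {X W : Type*} [MeasurableSpace X] {μ : Measure X}
    [NormedAddCommGroup W] [InnerProductSpace ℝ W] {F g : X → W} (hF : MemLp F 2 μ)
    (hg : MemLp g 2 μ) {l : ℝ} (hl : 0 < l) :
    |∫ z, inner ℝ (F z) (g z) ∂μ| ≤ l * (∫ z, ‖F z‖ ^ 2 ∂μ) + l⁻¹ * ∫ z, ‖g z‖ ^ 2 ∂μ := by
  have hi1 := integrable_norm_sq hF
  have hi2 := integrable_norm_sq hg
  rw [← integral_const_mul, ← integral_const_mul,
    ← integral_add (hi1.const_mul _) (hi2.const_mul _)]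
  have hi3 : Integrable (fun z => l * ‖F z‖ ^ 2 + l⁻¹ * ‖g z‖ ^ 2) μ :=
    (hi1.const_mul _).add (hi2.const_mul _)
  refine (norm_integral_le_integral_norm (fun z => inner ℝ (F z) (g z))).trans
    (integral_mono_of_nonneg_right hi3 (fun z => by positivity) (ae_of_all _ fun z => ?_))
  refine (norm_inner_le_norm _ _).trans ?_
  have h1 : l⁻¹ * l = 1 := inv_mul_cancel₀ hl.ne'
  have h3 : 0 ≤ l⁻¹ := by positivity
  have h2 := mul_nonneg h3 (sq_nonneg (l * ‖F z‖ - ‖g z‖))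
  have e : l⁻¹ * (l * ‖F z‖ - ‖g z‖) ^ 2 =
      (l⁻¹ * l) * (l * ‖F z‖ ^ 2) - 2 * (l⁻¹ * l) * (‖F z‖ * ‖g z‖) + l⁻¹ * ‖g z‖ ^ 2 := by ring
  rw [e, h1] at h2
  have h4 : 0 ≤ ‖F z‖ * ‖g z‖ := by positivity
  linarith

/-- Matches the form of the pointwise inequalities: `ε` multiplies a bounded quantity, the large
constant a vanishing one. -/
theorem tendsto_zero_of_le_mul_add {x y : ℕ → ℝ} {D : ℝ} (hx : ∀ i, 0 ≤ x i)
    (h : ∀ ε > 0, ∃ C, ∀ i, x i ≤ ε * D + C * y i) (hy : Tendsto y atTop (𝓝 0)) :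
    Tendsto x atTop (𝓝 0) := by
  refine tendsto_order.2 ⟨fun a ha => Eventually.of_forall fun i => ha.trans_le (hx i),
    fun a ha => ?_⟩
  obtain ⟨C, hC⟩ := h (a / 2 / (|D| + 1)) (by positivity)
  have h1 : Tendsto (fun i => C * y i) atTop (𝓝 0) := by simpa using hy.const_mul C
  filter_upwards [h1.eventually_lt_const (half_pos ha)] with i hi
  have h2 : a / 2 / (|D| + 1) * D ≤ a / 2 := by
    have hD : D ≤ |D| + 1 := by linarith [le_abs_self D]
    calc a / 2 / (|D| + 1) * D ≤ a / 2 / (|D| + 1) * (|D| + 1) := by gcongr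
      _ = a / 2 := by field_simp
  linarith [hC i]

theorem holderConjugate_one_add {a : ℝ} (ha : 0 < a) :
    (ENNReal.ofReal (1 + a)).HolderConjugate (ENNReal.ofReal (1 + 1 / a)) := by
  have hc : (1 + a).HolderConjugate (1 + 1 / a) := by
    rw [Real.holderConjugate_iff]
    refine ⟨by linarith, ?_⟩
    field_simp
    ring
  exact hc.ennrealOfReal

theorem LocalSol.memLp_u {K U : Set (SpaceTime n)} {ν L a : ℝ} {v : SpaceTime n → Vec N}
    {G F : SpaceTime n → Grad N n} (h : LocalSol K U ν L a v G F) (ha : 0 < a) :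
    MemLp (fun z => vpow a (v z)) (ENNReal.ofReal (1 + 1 / a)) := memLp_vpow ha h.v_memLp'

theorem LocalSol.integrable_u {K U : Set (SpaceTime n)} {ν L a : ℝ} {v : SpaceTime n → Vec N}
    {G F : SpaceTime n → Grad N n} (h : LocalSol K U ν L a v G F) (ha : 0 < a) :
    Integrable fun z => vpow a (v z) := by
  refine integrable_of_memLp ?_ h.isCompact (h.memLp_u ha) fun z hz => by
    rw [h.v_eq_zero z hz, vpow_zero_right]
  rw [← ENNReal.ofReal_one]
  exact ENNReal.ofReal_le_ofReal (by linarith [show 0 < 1 / a by positivity])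

/-- The pairing of `vpow a v` with a small function. -/
theorem integral_norm_vpow_mul_le {K : Set (SpaceTime n)} (hK : IsCompact K) {a s ε C₁ : ℝ}
    (ha : 0 < a) (hs : 0 < s) (hε : 0 ≤ ε) (hC₁ : 0 ≤ C₁)
    (hC : ∀ x y : ℝ, 0 ≤ x → 0 ≤ y → x ^ a * y ≤ ε * (1 + x ^ s + y ^ s) + C₁ * y)
    {v d : SpaceTime n → Vec N} (hv : MemLp v (ENNReal.ofReal s)) (hv0 : ∀ z ∉ K, v z = 0)
    (hd : MemLp d (ENNReal.ofReal s)) (hd1 : Integrable d) :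
    ∫ z, ‖vpow a (v z)‖ * ‖d z‖ ≤
      ε * ((volume K).toReal + (∫ z, ‖v z‖ ^ s) + ∫ z, ‖d z‖ ^ s) + C₁ * ∫ z, ‖d z‖ := by
  have hi1 := integrable_norm_rpow_ofReal hs hv
  have hi2 := integrable_norm_rpow_ofReal hs hd
  have hvol := (hK.measure_lt_top (μ := volume)).ne
  have hi0 : Integrable (K.indicator (1 : SpaceTime n → ℝ)) :=
    (integrable_indicator_iff hK.measurableSet).2 (by
      have := isFiniteMeasure_restrict.2 hvol
      exact integrable_const (1 : ℝ))
  have hvol2 : ∫ z, K.indicator (1 : SpaceTime n → ℝ) z = (volume K).toReal := by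
    rw [integral_indicator_one hK.measurableSet]; rfl
  have hi01 : Integrable fun z => K.indicator (1 : SpaceTime n → ℝ) z + ‖v z‖ ^ s := hi0.add hi1
  have hi012 : Integrable fun z => K.indicator (1 : SpaceTime n → ℝ) z + ‖v z‖ ^ s + ‖d z‖ ^ s :=
    hi01.add hi2
  have hi3 : Integrable fun z => ε * (K.indicator (1 : SpaceTime n → ℝ) z + ‖v z‖ ^ s + ‖d z‖ ^ s) +
      C₁ * ‖d z‖ := (hi012.const_mul ε).add (hd1.norm.const_mul C₁)
  rw [← hvol2, ← integral_add hi0 hi1, ← integral_add hi01 hi2, ← integral_const_mul,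
    ← integral_const_mul, ← integral_add (hi012.const_mul ε) (hd1.norm.const_mul C₁)]
  refine integral_mono_of_nonneg_right hi3 (fun z => ?_) (ae_of_all _ fun z => ?_)
  · have : 0 ≤ K.indicator (1 : SpaceTime n → ℝ) z := indicator_nonneg (fun _ _ => zero_le_one) z
    positivity
  · by_cases hz : z ∈ K
    · have := hC _ _ (norm_nonneg (v z)) (norm_nonneg (d z))
      simpa [hz, norm_vpow ha] using this
    · simp only [hv0 z hz, vpow_zero_right, norm_zero, zero_mul, hz, not_false_eq_true,
        indicator_of_notMem, Real.zero_rpow hs.ne']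
      positivity

theorem norm_integral_inner_le {u d : SpaceTime n → Vec N}
    {p q : ℝ≥0∞} [p.HolderConjugate q] (hu : MemLp u p) (hd : MemLp d q) :
    |∫ z, inner ℝ (u z) (d z)| ≤ ∫ z, ‖u z‖ * ‖d z‖ := by
  have hi : Integrable fun z => ‖u z‖ * ‖d z‖ := hu.norm.integrable_mul hd.norm
  exact (norm_integral_le_integral_norm (fun z => inner ℝ (u z) (d z))).trans
    (integral_mono_of_nonneg_right hi (fun z => by positivity)
      (ae_of_all _ fun z => norm_inner_le_norm _ _))

/-- Equicontinuity of `w ↦ ∫ u · f(· - w)`. -/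
theorem LocalSol.abs_translate_le {K U K' : Set (SpaceTime n)} {ν L a s ε C₁ r M : ℝ}
    {v f : SpaceTime n → Vec N} {G F g : SpaceTime n → Grad N n} (h : LocalSol K U ν L a v G F)
    (ha : 0 < a) (has : 1 + a ≤ s) (hε : 0 ≤ ε) (hC₁ : 0 ≤ C₁)
    (hC : ∀ x y : ℝ, 0 ≤ x → 0 ≤ y → x ^ a * y ≤ ε * (1 + x ^ s + y ^ s) + C₁ * y)
    (hv : MemLp v (ENNReal.ofReal s)) (hf : MemLp f (ENNReal.ofReal s)) (hg : MemLp g 2)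
    (hfg : HasSpaceGrad f g) (hK' : IsCompact K') (hfK : ∀ z ∉ K', f z = 0)
    (hgK : ∀ z ∉ K', g z = 0) (hKU : K' + Metric.closedBall 0 r ⊆ U)
    (hM : (∫ z, ‖F z‖ ^ 2) + ∫ z, ‖g z‖ ^ 2 ≤ M)
    {w : SpaceTime n} (hw : ‖w‖ < r) :
    |(∫ z, inner ℝ (vpow a (v z)) (f (z - w))) - ∫ z, inner ℝ (vpow a (v z)) (f z)| ≤
      M * ‖w‖ + (ε * ((volume K).toReal + (∫ z, ‖v z‖ ^ s) + 2 ^ s * (2 * ∫ z, ‖f z‖ ^ s)) +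
        C₁ * (‖w‖ * ∫ z, ‖g z‖)) := by
  have hs0 : 0 < s := by linarith
  have : Fact ((1 : ℝ≥0∞) ≤ ENNReal.ofReal (1 + a)) :=
    ⟨by rw [← ENNReal.ofReal_one]; exact ENNReal.ofReal_le_ofReal (by linarith)⟩
  have : Fact ((1 : ℝ≥0∞) ≤ ENNReal.ofReal (1 + 1 / a)) :=
    ⟨by rw [← ENNReal.ofReal_one]
        exact ENNReal.ofReal_le_ofReal (by linarith [show 0 < 1 / a by positivity])⟩
  have := holderConjugate_one_add ha
  have h1s : (1 : ℝ≥0∞) ≤ ENNReal.ofReal s := by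
    rw [← ENNReal.ofReal_one]; exact ENNReal.ofReal_le_ofReal (by linarith)
  have hf1 := integrable_of_memLp h1s hK' hf hfK
  have hg1 := integrable_of_memLp (by norm_num) hK' hg hgK
  have hF1 := integrable_of_memLp (by norm_num) h.isCompact h.F_memLp h.F_eq_zero
  have hfp : MemLp f (ENNReal.ofReal (1 + a)) :=
    hf.mono_exponent_of_measure_support_ne_top hfK hK'.measure_lt_top.ne
      (ENNReal.ofReal_le_ofReal has)
  have hup := h.memLp_u ha
  have hM0 : 0 ≤ M := le_trans (add_nonneg (integral_nonneg fun z => by positivity)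
    (integral_nonneg fun z => by positivity)) hM
  have hτ : |w.2| ≤ ‖w‖ := norm_snd_le w
  have hy : ‖w.1‖ ≤ ‖w‖ := norm_fst_le w
  -- The time component of the translation is handled by the equation, with `c = 0` and the product
  -- of flux and gradient merely bounded.
  have htime := h.eqn.abs_shift_le ENNReal.ofReal_ne_top hfg (h.integrable_u ha) hup hf1 hfp hF1
    h.F_memLp hg1 hg hK' hfK hKU (c := 0) (M := M) (fun w' _ => by
      rw [sub_zero]
      refine le_trans ?_ hM
      have := abs_integral_inner_le h.F_memLp (memLp_translate hg w') one_pos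
      rw [one_mul, inv_one, one_mul, integral_sub_right_eq_self (fun z => ‖g z‖ ^ 2) w'] at this
      exact this) (h := w.2) (hτ.trans_lt hw)
  rw [mul_zero, add_zero] at htime
  -- What remains is a purely spatial shift; it is small in `L¹` through the gradient and bounded in
  -- `L^s`, which suffices for pairing with `vpow a v`.
  set d : SpaceTime n → Vec N := fun z => f (z - w) - f (z - (0, w.2)) with hd
  have hdp : MemLp d (ENNReal.ofReal (1 + a)) := (memLp_translate hfp w).sub (memLp_translate hfp _)
  have hds : MemLp d (ENNReal.ofReal s) := (memLp_translate hf w).sub (memLp_translate hf _)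
  have hd1 : Integrable d := (hf1.comp_sub_right w).sub (hf1.comp_sub_right _)
  have hspace : |(∫ z, inner ℝ (vpow a (v z)) (f (z - w))) -
      ∫ z, inner ℝ (vpow a (v z)) (f (z - (0, w.2)))| ≤
      ε * ((volume K).toReal + (∫ z, ‖v z‖ ^ s) + ∫ z, ‖d z‖ ^ s) + C₁ * ∫ z, ‖d z‖ := by
    rw [← integral_sub (integrable_inner_of_memLp hup (memLp_translate hfp w))
      (integrable_inner_of_memLp hup (memLp_translate hfp _))]
    simp_rw [← inner_sub_right]
    exact (norm_integral_inner_le hup hdp).trans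
      (integral_norm_vpow_mul_le h.isCompact ha hs0 hε hC₁ hC hv h.v_eq_zero hds hd1)
  have hdn : ∫ z, ‖d z‖ ≤ ‖w‖ * ∫ z, ‖g z‖ := by
    have h1 := hfg.lintegral_translate_space_le hf1 hg1 w.1
    have e1 : ∫ z, ‖d z‖ = ∫ z, ‖f (z - (w.1, 0)) - f z‖ := by
      rw [← integral_sub_right_eq_self (fun z => ‖f (z - (w.1, 0)) - f z‖) (0, w.2)]
      refine integral_congr_ae (ae_of_all _ fun z => ?_)
      simp only [hd]
      congr 3
      rw [sub_sub]
      congr 1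
      ext <;> simp
    have hi : Integrable fun z => f (z - (w.1, 0)) - f z := (hf1.comp_sub_right _).sub hf1
    rw [e1, integral_norm_eq_lintegral_enorm hi.1]
    calc _ ≤ (‖w.1‖ₑ * ∫⁻ z, ‖g z‖ₑ).toReal :=
          ENNReal.toReal_mono (ENNReal.mul_ne_top enorm_ne_top hg1.2.ne) h1
      _ = ‖w.1‖ * ∫ z, ‖g z‖ := by
          rw [ENNReal.toReal_mul, toReal_enorm, integral_norm_eq_lintegral_enorm hg1.1]
      _ ≤ _ := by
          gcongr
  have hdsn : ∫ z, ‖d z‖ ^ s ≤ 2 ^ s * (2 * ∫ z, ‖f z‖ ^ s) := by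
    have hi := integrable_norm_rpow_ofReal hs0 hf
    have hi1 : Integrable fun z => ‖f (z - w)‖ ^ s := hi.comp_sub_right w
    have hi2 : Integrable fun z => ‖f (z - (0, w.2))‖ ^ s := hi.comp_sub_right _
    calc ∫ z, ‖d z‖ ^ s ≤ ∫ z, 2 ^ s * (‖f (z - w)‖ ^ s + ‖f (z - (0, w.2))‖ ^ s) :=
          integral_mono (integrable_norm_rpow_ofReal hs0 hds) ((hi1.add hi2).const_mul _)
            fun z => norm_sub_rpow_le hs0.le _ _
      _ = _ := by
          rw [integral_const_mul, integral_add hi1 hi2,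
            integral_sub_right_eq_self (fun z => ‖f z‖ ^ s) w,
            integral_sub_right_eq_self (fun z => ‖f z‖ ^ s) (0, w.2)]
          ring
  calc _ ≤ |(∫ z, inner ℝ (vpow a (v z)) (f (z - w))) -
          ∫ z, inner ℝ (vpow a (v z)) (f (z - (0, w.2)))| +
        |(∫ z, inner ℝ (vpow a (v z)) (f (z - (0, w.2)))) -
          ∫ z, inner ℝ (vpow a (v z)) (f z)| := abs_sub_le _ _ _
    _ ≤ (ε * ((volume K).toReal + (∫ z, ‖v z‖ ^ s) + ∫ z, ‖d z‖ ^ s) + C₁ * ∫ z, ‖d z‖) +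
        M * |w.2| := add_le_add hspace htime
    _ ≤ (ε * ((volume K).toReal + (∫ z, ‖v z‖ ^ s) + 2 ^ s * (2 * ∫ z, ‖f z‖ ^ s)) +
        C₁ * (‖w‖ * ∫ z, ‖g z‖)) + M * ‖w‖ := by gcongr
    _ = _ := by ring

theorem tendsto_zero_of_le_add {x : ℕ → ℝ} (hx : ∀ i, 0 ≤ x i)
    (h : ∀ η > 0, ∃ y : ℕ → ℝ, Tendsto y atTop (𝓝 0) ∧ ∀ i, x i ≤ η + y i) :
    Tendsto x atTop (𝓝 0) := by
  refine tendsto_order.2 ⟨fun a ha => Eventually.of_forall fun i => ha.trans_le (hx i),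
    fun a ha => ?_⟩
  obtain ⟨y, hy, hxy⟩ := h (a / 2) (half_pos ha)
  filter_upwards [hy.eventually_lt_const (half_pos ha)] with i hi
  linarith [hxy i]

/-- A sequence of local solutions with uniform bounds, and its weak limit. -/
structure LocalLim (K U : Set (SpaceTime n)) (ν L lo hi s C : ℝ) (αs : ℕ → ℝ) (α : ℝ)
    (vs : ℕ → SpaceTime n → Vec N) (v : SpaceTime n → Vec N) (Gs : ℕ → SpaceTime n → Grad N n)
    (G : SpaceTime n → Grad N n) (Fs : ℕ → SpaceTime n → Grad N n) : Prop where
  sol : ∀ i, LocalSol K U ν L (αs i) (vs i) (Gs i) (Fs i)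
  lo_pos : 0 < lo
  hi_lt : 1 + hi < s
  two_lt : 2 < s
  mem : ∀ i, αs i ∈ Icc lo hi
  lim : Tendsto αs atTop (𝓝 α)
  memLp_s : ∀ i, MemLp (vs i) (ENNReal.ofReal s)
  bound_s : ∀ i, ∫ z, ‖vs i z‖ ^ s ≤ C
  bound_two : ∀ i, ∫ z, ‖vs i z‖ ^ 2 ≤ C
  bound_G : ∀ i, ∫ z, ‖Gs i z‖ ^ 2 ≤ C
  bound_F : ∀ i, ∫ z, ‖Fs i z‖ ^ 2 ≤ C
  v_eq_zero : ∀ z ∉ K, v z = 0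
  G_eq_zero : ∀ z ∉ K, G z = 0
  v_memLp : MemLp v 2
  v_memLp_s : MemLp v (ENNReal.ofReal s)
  G_memLp : MemLp G 2
  v_bound_s : ∫ z, ‖v z‖ ^ s ≤ C
  v_bound_two : ∫ z, ‖v z‖ ^ 2 ≤ C
  G_bound : ∫ z, ‖G z‖ ^ 2 ≤ C
  grad : LocGrad U v G
  weak_v : ∀ ψ : SpaceTime n → Vec N, MemLp ψ 2 →
    Tendsto (fun i => ∫ z, inner ℝ (vs i z) (ψ z)) atTop (𝓝 (∫ z, inner ℝ (v z) (ψ z)))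
  weak_G : ∀ ψ : SpaceTime n → Grad N n, MemLp ψ 2 →
    Tendsto (fun i => ∫ z, inner ℝ (Gs i z) (ψ z)) atTop (𝓝 (∫ z, inner ℝ (G z) (ψ z)))

theorem LocGrad.sub {U : Set (SpaceTime n)} {v w : SpaceTime n → Vec N}
    {G H : SpaceTime n → Grad N n} (hv : LocGrad U v G) (hw : LocGrad U w H)
    (hv1 : Integrable v) (hw1 : Integrable w) (hG1 : Integrable G) (hH1 : Integrable H) :
    LocGrad U (fun z => v z - w z) (fun z => G z - H z) := by
  intro φ hφ k j
  obtain ⟨B, -, hB⟩ := hφ.exists_bound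
  have hm1 : ∀ x : SpaceTime n → Vec N, Integrable x →
      Integrable fun z => x z k * spaceDeriv j φ z := fun x hx =>
    (integrable_apply hx k).mul_bdd (c := B) (hφ.continuous_spaceDeriv j).aestronglyMeasurable
      (ae_of_all _ fun z => (PiLp.norm_apply_le (scalarGrad φ z) j).trans (hB z).2.2)
  have hm2 : ∀ x : SpaceTime n → Grad N n, Integrable x →
      Integrable fun z => x z (k, j) * φ z := fun x hx =>
    (integrable_apply hx (k, j)).mul_bdd (c := B) hφ.continuous.aestronglyMeasurable
      (ae_of_all _ fun z => (hB z).1)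
  simp only [PiLp.sub_apply, sub_mul]
  rw [integral_sub (hm1 v hv1) (hm1 w hw1), integral_sub (hm2 G hG1) (hm2 H hH1), hv φ hφ k j,
    hw φ hφ k j]
  ring

theorem integral_indicator_one_toReal {K : Set (SpaceTime n)} (hK : IsCompact K) :
    Integrable (K.indicator (1 : SpaceTime n → ℝ)) ∧
      ∫ z, K.indicator (1 : SpaceTime n → ℝ) z = (volume K).toReal := by
  refine ⟨(integrable_indicator_iff hK.measurableSet).2 ?_, ?_⟩
  · have := isFiniteMeasure_restrict.2 (hK.measure_lt_top (μ := volume)).ne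
    exact integrable_const (1 : ℝ)
  · rw [integral_indicator_one hK.measurableSet]; rfl

theorem integral_norm_le_of_sq {W : Type*} [NormedAddCommGroup W] {K : Set (SpaceTime n)}
    (hK : IsCompact K) {f : SpaceTime n → W} (hf : MemLp f 2) (h0 : ∀ z ∉ K, f z = 0) :
    ∫ z, ‖f z‖ ≤ (volume K).toReal + ∫ z, ‖f z‖ ^ 2 := by
  obtain ⟨hi0, hvol⟩ := integral_indicator_one_toReal hK
  rw [← hvol, ← integral_add hi0 (integrable_norm_sq hf)]
  refine integral_mono_of_nonneg_right (hi0.add (integrable_norm_sq hf)) (fun z => ?_)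
    (ae_of_all _ fun z => ?_)
  · exact add_nonneg (indicator_nonneg (fun _ _ => zero_le_one) z) (by positivity)
  · by_cases hz : z ∈ K
    · simp only [hz, indicator_of_mem, Pi.one_apply]
      nlinarith [sq_nonneg (‖f z‖ - 1)]
    · simp [hz, h0]

/-! ### Uniform bounds and equicontinuity for a sequence of local solutions. -/

section LocalLim

variable {K U : Set (SpaceTime n)} {ν L lo hi s C α : ℝ} {αs : ℕ → ℝ}
  {vs : ℕ → SpaceTime n → Vec N} {v : SpaceTime n → Vec N} {Gs : ℕ → SpaceTime n → Grad N n}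
  {G : SpaceTime n → Grad N n} {Fs : ℕ → SpaceTime n → Grad N n}

theorem LocalLim.isCompact (h : LocalLim K U ν L lo hi s C αs α vs v Gs G Fs) : IsCompact K :=
  (h.sol 0).isCompact

theorem LocalLim.s_pos (h : LocalLim K U ν L lo hi s C αs α vs v Gs G Fs) : 0 < s := by
  linarith [h.two_lt]

theorem LocalLim.pos (h : LocalLim K U ν L lo hi s C αs α vs v Gs G Fs) (i : ℕ) : 0 < αs i :=
  h.lo_pos.trans_le (h.mem i).1

theorem LocalLim.C_nonneg (h : LocalLim K U ν L lo hi s C αs α vs v Gs G Fs) : 0 ≤ C :=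
  (integral_nonneg fun z => by positivity).trans h.v_bound_two

theorem LocalLim.mem_lim (h : LocalLim K U ν L lo hi s C αs α vs v Gs G Fs) : α ∈ Icc lo hi :=
  isClosed_Icc.mem_of_tendsto h.lim (Eventually.of_forall h.mem)

theorem LocalLim.integrable_vs (h : LocalLim K U ν L lo hi s C αs α vs v Gs G Fs) (i : ℕ) :
    Integrable (vs i) :=
  integrable_of_memLp (by norm_num) h.isCompact (h.sol i).v_memLp (h.sol i).v_eq_zero

theorem LocalLim.integrable_v (h : LocalLim K U ν L lo hi s C αs α vs v Gs G Fs) :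
    Integrable v :=
  integrable_of_memLp (by norm_num) h.isCompact h.v_memLp h.v_eq_zero

theorem LocalLim.memLp_diff_two (h : LocalLim K U ν L lo hi s C αs α vs v Gs G Fs) (i : ℕ) :
    MemLp (fun z => vs i z - v z) 2 := (h.sol i).v_memLp.sub h.v_memLp

theorem LocalLim.memLp_diff_s (h : LocalLim K U ν L lo hi s C αs α vs v Gs G Fs) (i : ℕ) :
    MemLp (fun z => vs i z - v z) (ENNReal.ofReal s) := (h.memLp_s i).sub h.v_memLp_s

theorem LocalLim.diff_eq_zero (h : LocalLim K U ν L lo hi s C αs α vs v Gs G Fs) (i : ℕ)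
    (z : SpaceTime n) (hz : z ∉ K) : vs i z - v z = 0 := by
  rw [(h.sol i).v_eq_zero z hz, h.v_eq_zero z hz, sub_zero]

theorem LocalLim.bound_diff_s (h : LocalLim K U ν L lo hi s C αs α vs v Gs G Fs) (i : ℕ) :
    ∫ z, ‖vs i z - v z‖ ^ s ≤ 2 ^ s * (2 * C) := by
  have hi1 := integrable_norm_rpow_ofReal h.s_pos (h.memLp_s i)
  have hi2 := integrable_norm_rpow_ofReal h.s_pos h.v_memLp_s
  calc ∫ z, ‖vs i z - v z‖ ^ s ≤ ∫ z, 2 ^ s * (‖vs i z‖ ^ s + ‖v z‖ ^ s) :=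
        integral_mono (integrable_norm_rpow_ofReal h.s_pos (h.memLp_diff_s i))
          ((hi1.add hi2).const_mul _) fun z => norm_sub_rpow_le h.s_pos.le _ _
    _ = 2 ^ s * ((∫ z, ‖vs i z‖ ^ s) + ∫ z, ‖v z‖ ^ s) := by
        rw [integral_const_mul, integral_add hi1 hi2]
    _ ≤ _ := by
        have := h.bound_s i
        have := h.v_bound_s
        gcongr
        linarith

theorem integral_sub_sq_le {W X : Type*} [NormedAddCommGroup W] [MeasurableSpace X] {μ : Measure X}
    {f g : X → W} {C : ℝ} (hf : MemLp f 2 μ) (hg : MemLp g 2 μ) (hfC : ∫ x, ‖f x‖ ^ 2 ∂μ ≤ C)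
    (hgC : ∫ x, ‖g x‖ ^ 2 ∂μ ≤ C) : ∫ x, ‖f x - g x‖ ^ 2 ∂μ ≤ 4 * C := by
  have hi1 := integrable_norm_sq hf
  have hi2 := integrable_norm_sq hg
  calc ∫ x, ‖f x - g x‖ ^ 2 ∂μ ≤ ∫ x, 2 * (‖f x‖ ^ 2 + ‖g x‖ ^ 2) ∂μ := by
        refine integral_mono (integrable_norm_sq (hf.sub hg)) ((hi1.add hi2).const_mul _)
          fun x => ?_
        have h1 := norm_sub_le (f x) (g x)
        have h2 : ‖f x - g x‖ ^ 2 ≤ (‖f x‖ + ‖g x‖) ^ 2 := by gcongr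
        simp only
        nlinarith [sq_nonneg (‖f x‖ - ‖g x‖)]
    _ = 2 * ((∫ x, ‖f x‖ ^ 2 ∂μ) + ∫ x, ‖g x‖ ^ 2 ∂μ) := by
        rw [integral_const_mul, integral_add hi1 hi2]
    _ ≤ _ := by linarith

theorem LocalLim.bound_diff_two (h : LocalLim K U ν L lo hi s C αs α vs v Gs G Fs) (i : ℕ) :
    ∫ z, ‖vs i z - v z‖ ^ 2 ≤ 4 * C :=
  integral_sub_sq_le (h.sol i).v_memLp h.v_memLp (h.bound_two i) h.v_bound_two

theorem LocalLim.bound_diff_one (h : LocalLim K U ν L lo hi s C αs α vs v Gs G Fs) (i : ℕ) :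
    ∫ z, ‖vs i z - v z‖ ≤ (volume K).toReal + 4 * C :=
  (integral_norm_le_of_sq h.isCompact (h.memLp_diff_two i) (h.diff_eq_zero i)).trans
    (by linarith [h.bound_diff_two i])

theorem LocalLim.tendsto_weak_diff (h : LocalLim K U ν L lo hi s C αs α vs v Gs G Fs)
    {ψ : SpaceTime n → Vec N} (hψ : MemLp ψ 2) :
    Tendsto (fun i => ∫ z, inner ℝ (ψ z) (vs i z - v z)) atTop (𝓝 0) := by
  have h1 := (h.weak_v ψ hψ).sub_const (∫ z, inner ℝ (v z) (ψ z))
  rw [sub_self] at h1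
  refine h1.congr fun i => ?_
  rw [← integral_sub (integrable_inner_of_memLp (h.sol i).v_memLp hψ)
    (integrable_inner_of_memLp h.v_memLp hψ)]
  refine integral_congr_ae (ae_of_all _ fun z => ?_)
  simp only [← inner_sub_left]
  exact real_inner_comm _ _

/-- The pairings with `ζ (vᵢ - v)` are equicontinuous under translations, uniformly in `i`. -/
theorem LocalLim.exists_translate_le (h : LocalLim K U ν L lo hi s C αs α vs v Gs G Fs)
    {ζ : SpaceTime n → ℝ} (hζ : IsTestFunction U ζ) {η : ℝ} (hη : 0 < η) :
    ∃ r > 0, ∀ i, ∀ w : SpaceTime n, ‖w‖ < r →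
      |(∫ z, inner ℝ (vpow (αs i) (vs i z)) (ζ (z - w) • (vs i (z - w) - v (z - w)))) -
        ∫ z, inner ℝ (vpow (αs i) (vs i z)) (ζ z • (vs i z - v z))| ≤ η := by
  obtain ⟨B, hB0, hB⟩ := hζ.exists_bound
  obtain ⟨r₀, hr₀, hrU⟩ := exists_thickening hζ.2.1 (h.sol 0).isOpen hζ.2.2
  have hC0 := h.C_nonneg
  have hs0 := h.s_pos
  set V := (volume K).toReal with hV
  have hV0 : 0 ≤ V := ENNReal.toReal_nonneg
  set Dg := 2 * B ^ 2 * (8 * C) with hDg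
  have hDg0 : 0 ≤ Dg := by positivity
  set D := V + C + 2 ^ s * (2 * (B ^ s * (2 ^ s * (2 * C)))) with hD
  have hD0 : 0 ≤ D := by positivity
  -- `D` collects the uniform `L^s` bounds and receives one half of `η`. The constant `C₁` then
  -- depends on `η`, and the radius is chosen so that `Q ‖w‖` stays below the other half.
  have hε : 0 < η / (2 * (D + 1)) := by positivity
  obtain ⟨C₁, hC₁, hC₁'⟩ := exists_rpow_mul_le h.lo_pos h.hi_lt hε
  set M := C + Dg with hM
  set Q := M + C₁ * (V + Dg) with hQ
  have hQ0 : 0 ≤ Q := by positivity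
  refine ⟨min r₀ (η / (2 * (Q + 1))), lt_min hr₀ (by positivity), fun i w hw => ?_⟩
  have hw1 : ‖w‖ < r₀ := hw.trans_le (min_le_left _ _)
  have hw2 : ‖w‖ ≤ η / (2 * (Q + 1)) := (hw.trans_le (min_le_right _ _)).le
  have hd2 := h.memLp_diff_two i
  have hGd : MemLp (fun z => Gs i z - G z) 2 := (h.sol i).G_memLp.sub h.G_memLp
  have hGs1 := integrable_of_memLp (by norm_num) h.isCompact (h.sol i).G_memLp (h.sol i).G_eq_zero
  have hG1 := integrable_of_memLp (by norm_num) h.isCompact h.G_memLp h.G_eq_zero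
  have hd1 : Integrable fun z => vs i z - v z := (h.integrable_vs i).sub h.integrable_v
  have hGd1 : Integrable fun z => Gs i z - G z := hGs1.sub hG1
  have hfg := ((h.sol i).grad.sub h.grad (h.integrable_vs i) h.integrable_v hGs1 hG1).hasSpaceGrad
    hd1 hGd1 hζ
  set f : SpaceTime n → Vec N := fun z => ζ z • (vs i z - v z) with hf
  set g := cutGrad ζ (fun z => vs i z - v z) (fun z => Gs i z - G z) with hg
  have hfs : MemLp f (ENNReal.ofReal s) :=
    memLp_bdd_smul hζ.continuous.aestronglyMeasurable (fun z => (hB z).1) (h.memLp_diff_s i)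
  have hg2 : MemLp g 2 := memLp_cutGrad hζ hd2 hGd
  have hg0 : ∀ z ∉ tsupport ζ, g z = 0 := fun z hz => by
    simp [hg, cutGrad, image_eq_zero_of_notMem_tsupport hz, scalarGrad_eq_zero hz, tens]
    rfl
  have hgK : ∀ z ∉ K, g z = 0 := fun z hz => by
    simp only [hg, cutGrad]
    rw [h.diff_eq_zero i z hz, (h.sol i).G_eq_zero z hz, h.G_eq_zero z hz]
    have : tens (0 : Vec N) (scalarGrad ζ z) = 0 := norm_eq_zero.1 (by rw [norm_tens]; simp)
    simp [this]
  have hgC : ∫ z, ‖g z‖ ^ 2 ≤ Dg := by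
    have hi1 := integrable_norm_sq hGd
    have hi2 := integrable_norm_sq hd2
    calc ∫ z, ‖g z‖ ^ 2 ≤ ∫ z, 2 * B ^ 2 * (‖Gs i z - G z‖ ^ 2 + ‖vs i z - v z‖ ^ 2) := by
          refine integral_mono (integrable_norm_sq hg2) ((hi1.add hi2).const_mul _) fun z => ?_
          have h1 : ‖g z‖ ≤ B * ‖Gs i z - G z‖ + ‖vs i z - v z‖ * B := by
            refine (norm_add_le _ _).trans ?_
            rw [norm_smul, norm_tens]
            have := (hB z).1
            have := (hB z).2.2
            gcongr
            assumption
          have h2 : ‖g z‖ ^ 2 ≤ (B * ‖Gs i z - G z‖ + ‖vs i z - v z‖ * B) ^ 2 := by gcongr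
          simp only
          nlinarith [sq_nonneg (B * ‖Gs i z - G z‖ - ‖vs i z - v z‖ * B)]
      _ = 2 * B ^ 2 * ((∫ z, ‖Gs i z - G z‖ ^ 2) + ∫ z, ‖vs i z - v z‖ ^ 2) := by
          rw [integral_const_mul, integral_add hi1 hi2]
      _ ≤ 2 * B ^ 2 * (8 * C) := by
          have h1 := integral_sub_sq_le (h.sol i).G_memLp h.G_memLp (h.bound_G i) h.G_bound
          have h2 := h.bound_diff_two i
          gcongr
          linarith
  have hfC : ∫ z, ‖f z‖ ^ s ≤ B ^ s * (2 ^ s * (2 * C)) := by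
    have hi1 := integrable_norm_rpow_ofReal hs0 (h.memLp_diff_s i)
    calc ∫ z, ‖f z‖ ^ s ≤ ∫ z, B ^ s * ‖vs i z - v z‖ ^ s := by
          refine integral_mono (integrable_norm_rpow_ofReal hs0 hfs) (hi1.const_mul _) fun z => ?_
          simp only [hf]
          rw [norm_smul, Real.mul_rpow (norm_nonneg _) (norm_nonneg _)]
          have := (hB z).1
          rw [Real.norm_eq_abs]
          gcongr
      _ = B ^ s * ∫ z, ‖vs i z - v z‖ ^ s := integral_const_mul _ _
      _ ≤ _ := by
          gcongr
          exact h.bound_diff_s i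
  have hmain := (h.sol i).abs_translate_le (h.pos i) (by linarith [(h.mem i).2, h.hi_lt]) hε.le hC₁
    (hC₁' (αs i) (h.mem i)) (h.memLp_s i) hfs hg2 hfg hζ.2.1
    (fun z hz => by simp [hf, image_eq_zero_of_notMem_tsupport hz]) hg0 hrU (M := M)
    (add_le_add (h.bound_F i) hgC) hw1
  refine hmain.trans ?_
  have hg1 := (integral_norm_le_of_sq h.isCompact hg2 hgK).trans (add_le_add_right hgC V)
  have hvC := h.bound_s i
  calc M * ‖w‖ + (η / (2 * (D + 1)) * (V + (∫ z, ‖vs i z‖ ^ s) + 2 ^ s * (2 * ∫ z, ‖f z‖ ^ s)) +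
        C₁ * (‖w‖ * ∫ z, ‖g z‖))
      ≤ M * ‖w‖ + (η / (2 * (D + 1)) * (V + C + 2 ^ s * (2 * (B ^ s * (2 ^ s * (2 * C))))) +
        C₁ * (‖w‖ * (V + Dg))) := by gcongr
    _ = η / (2 * (D + 1)) * D + Q * ‖w‖ := by rw [hQ, hD]; ring
    _ ≤ η / (2 * (D + 1)) * (D + 1) + (Q + 1) * (η / (2 * (Q + 1))) := by
        gcongr <;> linarith
    _ = η := by field_simp; ring

end LocalLim

theorem tendsto_zero_of_forall_apply {x : ℕ → Vec N}
    (h : ∀ k, Tendsto (fun i => x i k) atTop (𝓝 0)) : Tendsto x atTop (𝓝 0) := by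
  rw [tendsto_zero_iff_norm_tendsto_zero]
  simp_rw [EuclideanSpace.norm_eq]
  have h1 : Tendsto (fun i => ∑ k, ‖x i k‖ ^ 2) atTop (𝓝 (∑ _k : Fin N, (0 : ℝ))) :=
    tendsto_finsetSum _ fun k _ => by simpa using (h k).norm.pow 2
  simpa [Function.comp_def] using (Real.continuous_sqrt.tendsto _).comp h1

theorem mollify_apply_eq {f : SpaceTime n → Vec N} (hf : Integrable f)
    (ρ : ContDiffBump (0 : SpaceTime n)) (z : SpaceTime n) (k : Fin N) :
    mollify ρ f z k = ∫ y, ρ.normed volume (z - y) * f y k := by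
  have hc : Continuous (ρ.normed (volume : Measure (SpaceTime n))) :=
    (ρ.contDiff_normed (n := 0)).continuous
  obtain ⟨B, hB⟩ := (ρ.hasCompactSupport_normed (μ := volume)).exists_bound_of_continuous hc
  have hi : Integrable fun y => ρ.normed volume (z - y) • f y :=
    hf.bdd_smul B (hc.comp (continuous_sub_left z)).aestronglyMeasurable
      (ae_of_all _ fun y => hB _)
  rw [mollify, convolution_lsmul_swap]
  have := (EuclideanSpace.proj (𝕜 := ℝ) k).integral_comp_comm hi
  simpa using this.symm

theorem norm_mollify_le {f : SpaceTime n → Vec N}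
    {ρ : ContDiffBump (0 : SpaceTime n)} {B : ℝ} (hB : ∀ z, ‖ρ.normed volume z‖ ≤ B)
    (hf : Integrable f) (z : SpaceTime n) : ‖mollify ρ f z‖ ≤ B * ∫ y, ‖f y‖ := by
  rw [mollify, convolution_lsmul_swap, ← integral_const_mul]
  refine (norm_integral_le_integral_norm _).trans (integral_mono_of_nonneg_right
    (hf.norm.const_mul B) (fun y => ?_) (ae_of_all _ fun y => ?_))
  · exact mul_nonneg ((norm_nonneg _).trans (hB 0)) (norm_nonneg _)
  · rw [norm_smul]
    gcongr
    exact hB _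

/-! ### The pairing of the solutions with `ζ (vᵢ - v)` vanishes in the limit. -/

section LocalLim

variable {K U : Set (SpaceTime n)} {ν L lo hi s C α : ℝ} {αs : ℕ → ℝ}
  {vs : ℕ → SpaceTime n → Vec N} {v : SpaceTime n → Vec N} {Gs : ℕ → SpaceTime n → Grad N n}
  {G : SpaceTime n → Grad N n} {Fs : ℕ → SpaceTime n → Grad N n} {ζ : SpaceTime n → ℝ}

theorem LocalLim.integrable_cut (h : LocalLim K U ν L lo hi s C αs α vs v Gs G Fs)
    (hζ : IsTestFunction U ζ) (i : ℕ) : Integrable fun z => ζ z • (vs i z - v z) := by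
  obtain ⟨B, hB0, hB⟩ := hζ.exists_bound
  exact ((h.integrable_vs i).sub h.integrable_v).bdd_smul B hζ.continuous.aestronglyMeasurable
    (ae_of_all _ fun z => (hB z).1)

/-- At a fixed point each component of the mollification is a pairing of `vᵢ - v` with a fixed `L²`
function. -/
theorem LocalLim.tendsto_mollify (h : LocalLim K U ν L lo hi s C αs α vs v Gs G Fs)
    (hζ : IsTestFunction U ζ) (ρ : ContDiffBump (0 : SpaceTime n)) (z : SpaceTime n) :
    Tendsto (fun i => mollify ρ (fun z => ζ z • (vs i z - v z)) z) atTop (𝓝 0) := by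
  have hc : Continuous (ρ.normed (volume : Measure (SpaceTime n))) :=
    (ρ.contDiff_normed (n := 0)).continuous
  refine tendsto_zero_of_forall_apply fun k => ?_
  have hψ : MemLp (fun y => (ρ.normed volume (z - y) * ζ y) • EuclideanSpace.single k (1 : ℝ)) 2 := by
    refine Continuous.memLp_of_hasCompactSupport ?_ ?_
    · have := hζ.continuous
      have h2 : Continuous fun y => ρ.normed volume (z - y) := hc.comp (by fun_prop)
      exact (h2.mul this).smul continuous_const
    · exact (hζ.2.1.mul_left).smul_right
  refine (h.tendsto_weak_diff hψ).congr fun i => ?_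
  have hf := h.integrable_cut hζ i
  rw [mollify_apply_eq hf]
  refine integral_congr_ae (ae_of_all _ fun y => ?_)
  simp only [inner_smul_left, EuclideanSpace.inner_single_left]
  simp [mul_assoc]

/-- The mollified differences are bounded uniformly in `i` and vanish pointwise, hence in `L¹(K)`.
Then `exists_rpow_mul_le` handles the pairing with the merely bounded sequence `vpow (αs i) (vs i)`.
-/
theorem LocalLim.tendsto_integral_mollify (h : LocalLim K U ν L lo hi s C αs α vs v Gs G Fs)
    (hζ : IsTestFunction U ζ) (ρ : ContDiffBump (0 : SpaceTime n)) :
    Tendsto (fun i => |∫ z, inner ℝ (vpow (αs i) (vs i z))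
      (mollify ρ (fun z => ζ z • (vs i z - v z)) z)|) atTop (𝓝 0) := by
  obtain ⟨B, hB0, hB⟩ := hζ.exists_bound
  have hc : Continuous (ρ.normed (volume : Measure (SpaceTime n))) :=
    (ρ.contDiff_normed (n := 0)).continuous
  obtain ⟨B', hB'⟩ := (ρ.hasCompactSupport_normed (μ := volume)).exists_bound_of_continuous hc
  have hB'0 : 0 ≤ B' := (norm_nonneg _).trans (hB' 0)
  have hKm := h.isCompact.measurableSet
  have hf := h.integrable_cut hζ
  set V := (volume K).toReal with hV
  have hV0 : 0 ≤ V := ENNReal.toReal_nonneg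
  have hC0 := h.C_nonneg
  set E := B' * (B * (V + 4 * C)) with hE
  have hE0 : 0 ≤ E := by positivity
  have hmE : ∀ i z, ‖mollify ρ (fun z => ζ z • (vs i z - v z)) z‖ ≤ E := by
    intro i z
    refine (norm_mollify_le hB' (hf i) z).trans ?_
    rw [hE]
    gcongr
    calc ∫ y, ‖ζ y • (vs i y - v y)‖ ≤ ∫ y, B * ‖vs i y - v y‖ := by
          refine integral_mono (hf i).norm
            (((h.integrable_vs i).sub h.integrable_v).norm.const_mul B) fun y => ?_
          simp only [norm_smul]
          have := (hB y).1
          gcongr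
          exact this
      _ ≤ _ := by
          rw [integral_const_mul]
          gcongr
          exact h.bound_diff_one i
  -- Cutting to `K` does not change the pairing, since the solutions vanish outside `K`.
  set d : ℕ → SpaceTime n → Vec N := fun i =>
    K.indicator (mollify ρ fun z => ζ z • (vs i z - v z)) with hd
  have hdm : ∀ i, AEStronglyMeasurable (d i) volume := fun i =>
    ((contDiff_mollify ρ (hf i)).continuous.aestronglyMeasurable).indicator hKm
  have hdE : ∀ i z, ‖d i z‖ ≤ E := fun i z => (norm_indicator_le_norm_self _ _).trans (hmE i z)
  have hd0 : ∀ i, ∀ z ∉ K, d i z = 0 := fun i z hz => indicator_of_notMem hz _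
  have hdp : ∀ i p, MemLp (d i) p := fun i p =>
    memLp_of_bounded h.isCompact (hdm i) (hd0 i) (hdE i) p
  obtain ⟨hi0, hvol⟩ := integral_indicator_one_toReal h.isCompact
  have hs0 := h.s_pos
  have hds : ∀ i, ∫ z, ‖d i z‖ ^ s ≤ E ^ s * V := by
    intro i
    rw [hV, ← hvol, ← integral_const_mul]
    refine integral_mono (integrable_norm_rpow_ofReal hs0 (hdp i _)) (hi0.const_mul _) fun z => ?_
    by_cases hz : z ∈ K
    · simp only [hz, indicator_of_mem, Pi.one_apply, mul_one]
      have := hdE i z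
      gcongr
    · simp [hz, hd0, Real.zero_rpow hs0.ne']
  have hlim : Tendsto (fun i => ∫ z, ‖d i z‖) atTop (𝓝 0) := by
    have h1 := tendsto_integral_of_dominated_convergence (F := fun i z => ‖d i z‖)
      (f := fun _ => (0 : ℝ)) (K.indicator fun _ => E) (fun i => (hdm i).norm)
      (by
        have := hi0.const_mul E
        refine this.congr (ae_of_all _ fun z => ?_)
        by_cases hz : z ∈ K <;> simp [hz])
      (fun i => ae_of_all _ fun z => by
        by_cases hz : z ∈ K
        · simpa [hz] using hdE i z
        · simp [hz, hd0])
      (ae_of_all _ fun z => by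
        by_cases hz : z ∈ K
        · simpa [hd, hz] using (h.tendsto_mollify hζ ρ z).norm
        · simp [hz, hd0])
    simpa using h1
  refine tendsto_zero_of_le_mul_add (D := V + C + E ^ s * V) (fun i => abs_nonneg _)
    (fun ε hε => ?_) hlim
  obtain ⟨C₁, hC₁, hC₁'⟩ := exists_rpow_mul_le h.lo_pos h.hi_lt hε
  refine ⟨C₁, fun i => ?_⟩
  have := holderConjugate_one_add (h.pos i)
  have hup := (h.sol i).memLp_u (h.pos i)
  have e1 : ∫ z, inner ℝ (vpow (αs i) (vs i z)) (mollify ρ (fun z => ζ z • (vs i z - v z)) z) =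
      ∫ z, inner ℝ (vpow (αs i) (vs i z)) (d i z) := by
    refine integral_congr_ae (ae_of_all _ fun z => ?_)
    by_cases hz : z ∈ K
    · simp [hd, hz]
    · simp [hz, hd0, (h.sol i).v_eq_zero z hz, vpow_zero_right]
  rw [e1]
  refine (norm_integral_inner_le hup (hdp i (ENNReal.ofReal (1 + αs i)))).trans ?_
  refine (integral_norm_vpow_mul_le h.isCompact (h.pos i) hs0 hε.le hC₁ (hC₁' _ (h.mem i))
    (h.memLp_s i) (h.sol i).v_eq_zero (hdp i _) (memLp_one_iff_integrable.1 (hdp i 1))).trans ?_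
  have := h.bound_s i
  have := hds i
  gcongr

/-- A product of two weakly convergent sequences. Mollifying `ζ (vᵢ - v)` averages the pairing over
translations shorter than `r`, which by equicontinuity costs at most `η` uniformly in `i`; the
mollified pairing tends to zero. -/
theorem LocalLim.tendsto_integral_u (h : LocalLim K U ν L lo hi s C αs α vs v Gs G Fs)
    (hζ : IsTestFunction U ζ) :
    Tendsto (fun i => |∫ z, inner ℝ (vpow (αs i) (vs i z)) (ζ z • (vs i z - v z))|)
      atTop (𝓝 0) := by
  obtain ⟨B, hB0, hB⟩ := hζ.exists_bound
  refine tendsto_zero_of_le_add (fun i => abs_nonneg _) fun η hη => ?_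
  obtain ⟨r, hr, hr'⟩ := h.exists_translate_le hζ hη
  let ρ : ContDiffBump (0 : SpaceTime n) := ⟨r / 2, r, by positivity, by linarith⟩
  refine ⟨_, h.tendsto_integral_mollify hζ ρ, fun i => ?_⟩
  have hf := h.integrable_cut hζ i
  have h1 := integral_inner_mollify_translate ((h.sol i).integrable_u (h.pos i)) hf ρ 0
  simp only [sub_zero] at h1
  have hup := (h.sol i).memLp_u (h.pos i)
  have hfp : MemLp (fun z => ζ z • (vs i z - v z)) (ENNReal.ofReal (1 + αs i)) := by
    refine memLp_bdd_smul hζ.continuous.aestronglyMeasurable (fun z => (hB z).1) ?_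
    exact (h.memLp_diff_s i).mono_exponent_of_measure_support_ne_top (h.diff_eq_zero i)
      h.isCompact.measure_lt_top.ne
      (ENNReal.ofReal_le_ofReal (by linarith [(h.mem i).2, h.hi_lt]))
  have : Fact ((1 : ℝ≥0∞) ≤ ENNReal.ofReal (1 + αs i)) :=
    ⟨by rw [← ENNReal.ofReal_one]; exact ENNReal.ofReal_le_ofReal (by linarith [h.pos i])⟩
  have : Fact ((1 : ℝ≥0∞) ≤ ENNReal.ofReal (1 + 1 / αs i)) :=
    ⟨by rw [← ENNReal.ofReal_one]
        exact ENNReal.ofReal_le_ofReal (by linarith [one_div_pos.2 (h.pos i)])⟩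
  have := holderConjugate_one_add (h.pos i)
  have hcont := continuous_integral_inner_translate ENNReal.ofReal_ne_top hfp hup
  have h2 := ContDiffBump.dist_normed_convolution_le (φ := ρ) (μ := volume) (x₀ := 0)
    (g := fun w => ∫ z, inner ℝ (vpow (αs i) (vs i z)) (ζ (z - w) • (vs i (z - w) - v (z - w))))
    (ε := η) hcont.aestronglyMeasurable (fun w hw => by
      rw [Real.dist_eq]
      simp only [sub_zero]
      refine hr' i w ?_
      simpa using hw)
  rw [Real.dist_eq] at h2
  simp only [sub_zero] at h2
  rw [mollify, h1]
  have h3 := abs_sub_abs_le_abs_sub (∫ z, inner ℝ (vpow (αs i) (vs i z)) (ζ z • (vs i z - v z)))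
    ((ρ.normed volume ⋆[ContinuousLinearMap.lsmul ℝ ℝ, volume] fun w =>
      ∫ z, inner ℝ (vpow (αs i) (vs i z)) (ζ (z - w) • (vs i (z - w) - v (z - w)))) 0)
  rw [abs_sub_comm] at h3
  linarith

end LocalLim

/-! ### Pairing with powers of the weak limit, and strong convergence. -/

section LocalLim

variable {K U : Set (SpaceTime n)} {ν L lo hi s C α : ℝ} {αs : ℕ → ℝ}
  {vs : ℕ → SpaceTime n → Vec N} {v : SpaceTime n → Vec N} {Gs : ℕ → SpaceTime n → Grad N n}
  {G : SpaceTime n → Grad N n} {Fs : ℕ → SpaceTime n → Grad N n} {ζ : SpaceTime n → ℝ}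

theorem exists_vpow_sub_le {l₀ : ℝ} (hlo : 0 < lo) (hs : 1 + hi < s) (hl₀ : l₀ ∈ Icc lo hi)
    {ε : ℝ} (hε : 0 < ε) : ∃ C, 0 ≤ C ∧ ∀ l ∈ Icc lo hi, ∀ x : Vec N,
      ‖vpow l x - vpow l₀ x‖ ≤ ε * (1 + 2 * ‖x‖ ^ s) + C * |l - l₀| := by
  have hhi : 0 ≤ hi := hlo.le.trans (hl₀.1.trans hl₀.2)
  obtain ⟨C, hC, hC'⟩ := exists_norm_sub_le (E := Vec N) (F := Vec N) (isCompact_Icc (a := lo) (b := hi))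
    (H := fun x => vpow x.1 x.2)
    (continuousOn_vpow.mono (prod_mono (fun l hl => hlo.trans_le hl.1) subset_rfl)) hl₀
    (σ := hi) (s := s) (C₀ := 2) hhi (by linarith) (by norm_num) (fun l hl x => by
      have hl0 := hlo.trans_le hl.1
      have h1 := rpow_le_one_add_rpow (norm_nonneg x) hl0.le hl.2
      simp only
      rw [norm_vpow hl0]
      have : 0 ≤ ‖x‖ ^ hi := by positivity
      linarith) hε
  refine ⟨C, hC, fun l hl x => ?_⟩
  have := hC' l hl x x
  rw [sub_self, norm_zero] at this
  linarith

theorem LocalLim.memLp_v_exp (h : LocalLim K U ν L lo hi s C αs α vs v Gs G Fs) {l : ℝ}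
    (hl : l ∈ Icc lo hi) : MemLp v (ENNReal.ofReal (1 + l)) :=
  h.v_memLp_s.mono_exponent_of_measure_support_ne_top h.v_eq_zero h.isCompact.measure_lt_top.ne
    (ENNReal.ofReal_le_ofReal (by linarith [hl.2, h.hi_lt]))

theorem LocalLim.memLp_cut_exp (h : LocalLim K U ν L lo hi s C αs α vs v Gs G Fs) {l : ℝ}
    (hl : l ∈ Icc lo hi) (hζ : IsTestFunction U ζ) (i : ℕ) :
    MemLp (fun z => ζ z • (vs i z - v z)) (ENNReal.ofReal (1 + l)) := by
  obtain ⟨B, hB0, hB⟩ := hζ.exists_bound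
  refine memLp_bdd_smul hζ.continuous.aestronglyMeasurable (fun z => (hB z).1) ?_
  exact (h.memLp_diff_s i).mono_exponent_of_measure_support_ne_top (h.diff_eq_zero i)
    h.isCompact.measure_lt_top.ne (ENNReal.ofReal_le_ofReal (by linarith [hl.2, h.hi_lt]))

theorem LocalLim.integrable_pairing (h : LocalLim K U ν L lo hi s C αs α vs v Gs G Fs) {l : ℝ}
    (hl : l ∈ Icc lo hi) (hζ : IsTestFunction U ζ) (i : ℕ) :
    Integrable fun z => inner ℝ (vpow l (v z)) (ζ z • (vs i z - v z)) := by
  have hl0 := h.lo_pos.trans_le hl.1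
  have := holderConjugate_one_add hl0
  exact integrable_inner_of_memLp (memLp_vpow hl0 (h.memLp_v_exp hl)) (h.memLp_cut_exp hl hζ i)

/-- The power of the truncated limit with fixed exponent `α` is bounded, so weak convergence
applies. Replacing `αs i` by `α` is uniform on the ball of radius `k`. -/
theorem LocalLim.tendsto_integral_trunc (h : LocalLim K U ν L lo hi s C αs α vs v Gs G Fs)
    (hζ : IsTestFunction U ζ) (k : ℕ) :
    Tendsto (fun i => |∫ z, inner ℝ (vpow (αs i) (trunc k (v z))) (ζ z • (vs i z - v z))|)
      atTop (𝓝 0) := by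
  obtain ⟨B, hB0, hB⟩ := hζ.exists_bound
  have htm : AEStronglyMeasurable (fun z => trunc k (v z)) volume :=
    ((measurable_trunc k).comp_aemeasurable h.v_memLp.1.aemeasurable).aestronglyMeasurable
  have hα := h.mem_lim
  have htp : ∀ l ∈ Icc lo hi, MemLp (fun z => vpow l (trunc k (v z))) 2 := by
    intro l hl
    have hl0 := h.lo_pos.trans_le hl.1
    refine memLp_of_bounded h.isCompact ((continuous_vpow hl0).comp_aestronglyMeasurable htm)
      (fun z hz => by simp only [h.v_eq_zero z hz, trunc_zero, vpow_zero_right])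
      (B := (k : ℝ) ^ l) (fun z => ?_) 2
    rw [norm_vpow hl0]
    have := norm_trunc_le k (v z)
    gcongr
  have hcut : ∀ i, MemLp (fun z => ζ z • (vs i z - v z)) 2 := fun i =>
    memLp_bdd_smul hζ.continuous.aestronglyMeasurable (fun z => (hB z).1) (h.memLp_diff_two i)
  have hfix : Tendsto (fun i => |∫ z, inner ℝ (vpow α (trunc k (v z))) (ζ z • (vs i z - v z))|)
      atTop (𝓝 0) := by
    have h1 := (h.tendsto_weak_diff (memLp_bdd_smul hζ.continuous.aestronglyMeasurable
      (fun z => (hB z).1) (htp α hα))).abs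
    rw [abs_zero] at h1
    refine h1.congr fun i => ?_
    simp only [inner_smul_left, inner_smul_right, conj_trivial]
  set V := (volume K).toReal with hV
  have hV0 : 0 ≤ V := ENNReal.toReal_nonneg
  have hC0 := h.C_nonneg
  have hcut1 : ∀ i, ∫ z, ‖ζ z • (vs i z - v z)‖ ≤ B * (V + 4 * C) := by
    intro i
    calc ∫ z, ‖ζ z • (vs i z - v z)‖ ≤ ∫ y, B * ‖vs i y - v y‖ := by
          refine integral_mono (h.integrable_cut hζ i).norm
            (((h.integrable_vs i).sub h.integrable_v).norm.const_mul B) fun y => ?_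
          simp only [norm_smul]
          have := (hB y).1
          gcongr
          exact this
      _ ≤ _ := by
          rw [integral_const_mul]
          gcongr
          exact h.bound_diff_one i
  have hdiff : Tendsto (fun i => |∫ z, inner ℝ (vpow (αs i) (trunc k (v z)) -
      vpow α (trunc k (v z))) (ζ z • (vs i z - v z))|) atTop (𝓝 0) := by
    have hlim : Tendsto (fun i => |αs i - α|) atTop (𝓝 0) := by
      have := (h.lim.sub_const α).abs
      simpa using this
    refine tendsto_zero_of_le_mul_add (D := (1 + 2 * (k : ℝ) ^ s) * (B * (V + 4 * C)))
      (fun i => abs_nonneg _) (fun ε hε => ?_) hlim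
    obtain ⟨C₂, hC₂, hC₂'⟩ := exists_vpow_sub_le (N := N) h.lo_pos h.hi_lt hα hε
    refine ⟨C₂ * (B * (V + 4 * C)), fun i => ?_⟩
    set X := ε * (1 + 2 * (k : ℝ) ^ s) + C₂ * |αs i - α| with hX
    have hX0 : 0 ≤ X := by positivity
    calc _ ≤ ∫ z, X * ‖ζ z • (vs i z - v z)‖ := by
          refine (norm_integral_le_integral_norm (fun z => inner ℝ (vpow (αs i) (trunc k (v z)) -
            vpow α (trunc k (v z))) (ζ z • (vs i z - v z)))).trans
            (integral_mono_of_nonneg_right ((h.integrable_cut hζ i).norm.const_mul X)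
              (fun z => by positivity) (ae_of_all _ fun z => ?_))
          refine (norm_inner_le_norm _ _).trans ?_
          gcongr
          refine (hC₂' _ (h.mem i) _).trans ?_
          have := norm_trunc_le k (v z)
          have := h.s_pos
          rw [hX]
          gcongr
      _ ≤ X * (B * (V + 4 * C)) := by
          rw [integral_const_mul]
          gcongr
          exact hcut1 i
      _ = _ := by rw [hX]; ring
  have hsum := hfix.add hdiff
  rw [add_zero] at hsum
  refine squeeze_zero (fun i => abs_nonneg _) (fun i => ?_) hsum
  have e : ∫ z, inner ℝ (vpow (αs i) (trunc k (v z))) (ζ z • (vs i z - v z)) =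
      (∫ z, inner ℝ (vpow α (trunc k (v z))) (ζ z • (vs i z - v z))) +
      ∫ z, inner ℝ (vpow (αs i) (trunc k (v z)) - vpow α (trunc k (v z)))
        (ζ z • (vs i z - v z)) := by
    have hsub : MemLp (fun z => vpow (αs i) (trunc k (v z)) - vpow α (trunc k (v z))) 2 :=
      (htp _ (h.mem i)).sub (htp α hα)
    rw [← integral_add (integrable_inner_of_memLp (htp α hα) (hcut i))
      (integrable_inner_of_memLp hsub (hcut i))]
    refine integral_congr_ae (ae_of_all _ fun z => ?_)
    simp only [inner_sub_left]
    ring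
  rw [e]
  exact abs_add_le _ _

/-- Truncation at a high level `k` changes the pairing by at most `η`, uniformly in `i`, because of
the bounds in `L^s` and `L²`. -/
theorem LocalLim.tendsto_integral_vpow_limit (h : LocalLim K U ν L lo hi s C αs α vs v Gs G Fs)
    (hζ : IsTestFunction U ζ) :
    Tendsto (fun i => |∫ z, inner ℝ (vpow (αs i) (v z)) (ζ z • (vs i z - v z))|) atTop (𝓝 0) := by
  obtain ⟨B, hB0, hB⟩ := hζ.exists_bound
  have hC0 := h.C_nonneg
  have hs0 := h.s_pos
  set V := (volume K).toReal with hV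
  have hV0 : 0 ≤ V := ENNReal.toReal_nonneg
  set D := B * (V + C + 2 ^ s * (2 * C)) with hD
  have hD0 : 0 ≤ D := by positivity
  obtain ⟨hi0, hvol⟩ := integral_indicator_one_toReal h.isCompact
  refine tendsto_zero_of_le_add (fun i => abs_nonneg _) fun η hη => ?_
  obtain ⟨C₁, hC₁, hC₁'⟩ := exists_rpow_mul_le h.lo_pos h.hi_lt
    (show 0 < η / (2 * (D + 1)) by positivity)
  set ε := η / (2 * (D + 1)) with hε
  have hε0 : 0 < ε := by positivity
  -- Where `|v| > k` one has `|vᵢ - v| ≤ (|vᵢ - v|² + |v|²) / k`, whose integral is at most `5 C /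
  -- k`; the level makes this contribution smaller than `η / 2`.
  obtain ⟨k, hk⟩ := exists_nat_gt (B * C₁ * (5 * C) / (η / 2))
  have hk0 : 0 < (k : ℝ) := lt_of_le_of_lt (by positivity) hk
  refine ⟨_, h.tendsto_integral_trunc hζ k, fun i => ?_⟩
  have hil := h.integrable_pairing (h.mem i) hζ i
  have htm : AEStronglyMeasurable (fun z => trunc k (v z)) volume :=
    ((measurable_trunc k).comp_aemeasurable h.v_memLp.1.aemeasurable).aestronglyMeasurable
  have hα0 := h.pos i
  have := holderConjugate_one_add hα0
  have hit : Integrable fun z => inner ℝ (vpow (αs i) (trunc k (v z))) (ζ z • (vs i z - v z)) :=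
    integrable_inner_of_memLp (memLp_vpow hα0 (memLp_of_bounded h.isCompact htm
      (fun z hz => by simp only [h.v_eq_zero z hz, trunc_zero]) (fun z => norm_trunc_le k (v z)) _))
      (h.memLp_cut_exp (h.mem i) hζ i)
  have hi1 := integrable_norm_rpow_ofReal hs0 h.v_memLp_s
  have hi2 := integrable_norm_rpow_ofReal hs0 (h.memLp_diff_s i)
  have hi3 := integrable_norm_sq h.v_memLp
  have hi4 := integrable_norm_sq (h.memLp_diff_two i)
  have hi01 : Integrable fun z => K.indicator (1 : SpaceTime n → ℝ) z + ‖v z‖ ^ s := hi0.add hi1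
  have hi012 : Integrable fun z => K.indicator (1 : SpaceTime n → ℝ) z + ‖v z‖ ^ s +
      ‖vs i z - v z‖ ^ s := hi01.add hi2
  have hi34 : Integrable fun z => ‖vs i z - v z‖ ^ 2 + ‖v z‖ ^ 2 := hi4.add hi3
  have hpt : ∀ z, ‖inner ℝ (vpow (αs i) (v z)) (ζ z • (vs i z - v z)) -
      inner ℝ (vpow (αs i) (trunc k (v z))) (ζ z • (vs i z - v z))‖ ≤
      B * ε * (K.indicator (1 : SpaceTime n → ℝ) z + ‖v z‖ ^ s + ‖vs i z - v z‖ ^ s) +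
        B * C₁ / k * (‖vs i z - v z‖ ^ 2 + ‖v z‖ ^ 2) := by
    intro z
    have h0 : 0 ≤ K.indicator (1 : SpaceTime n → ℝ) z := indicator_nonneg (fun _ _ => zero_le_one) z
    rcases le_or_gt ‖v z‖ k with hvk | hvk
    · have : trunc k (v z) = v z := if_pos hvk
      rw [this, sub_self, norm_zero]
      positivity
    · have ht : trunc k (v z) = 0 := if_neg (not_le.2 hvk)
      have hzK : z ∈ K := by
        by_contra hz
        rw [h.v_eq_zero z hz, norm_zero] at hvk
        linarith
      rw [ht, vpow_zero_right, inner_zero_left, sub_zero]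
      refine (norm_inner_le_norm _ _).trans ?_
      rw [norm_smul, norm_vpow hα0]
      have h1 := hC₁' _ (h.mem i) _ _ (norm_nonneg (v z)) (norm_nonneg (vs i z - v z))
      have h2 : ‖vs i z - v z‖ ≤ 1 / k * (‖vs i z - v z‖ ^ 2 + ‖v z‖ ^ 2) := by
        rw [one_div, ← div_eq_inv_mul, le_div_iff₀ hk0]
        have := mul_le_mul_of_nonneg_left hvk.le (norm_nonneg (vs i z - v z))
        nlinarith [sq_nonneg (‖vs i z - v z‖ - ‖v z‖), sq_nonneg ‖vs i z - v z‖, sq_nonneg ‖v z‖]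
      have hBz : ‖ζ z‖ ≤ B := (hB z).1
      calc ‖v z‖ ^ αs i * (‖ζ z‖ * ‖vs i z - v z‖)
          = ‖ζ z‖ * (‖v z‖ ^ αs i * ‖vs i z - v z‖) := by ring
        _ ≤ B * (ε * (1 + ‖v z‖ ^ s + ‖vs i z - v z‖ ^ s) +
            C₁ * (1 / k * (‖vs i z - v z‖ ^ 2 + ‖v z‖ ^ 2))) := by
            gcongr
            exact h1.trans (by gcongr)
        _ = _ := by simp only [hzK, indicator_of_mem, Pi.one_apply]; ring
  have hdiff : |(∫ z, inner ℝ (vpow (αs i) (v z)) (ζ z • (vs i z - v z))) -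
      ∫ z, inner ℝ (vpow (αs i) (trunc k (v z))) (ζ z • (vs i z - v z))| ≤ η := by
    rw [← integral_sub hil hit]
    refine (norm_integral_le_integral_norm _).trans ((integral_mono (hil.sub hit).norm
      ((hi012.const_mul (B * ε)).add (hi34.const_mul (B * C₁ / k))) hpt).trans ?_)
    simp only [Pi.add_apply]
    rw [integral_add (hi012.const_mul (B * ε)) (hi34.const_mul (B * C₁ / k)), integral_const_mul,
      integral_const_mul, integral_add hi01 hi2, integral_add hi0 hi1, integral_add hi4 hi3, hvol]
    have e1 := h.v_bound_s
    have e2 := h.bound_diff_s i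
    have e3 := h.bound_diff_two i
    have e4 := h.v_bound_two
    calc _ ≤ B * ε * (V + C + 2 ^ s * (2 * C)) + B * C₁ / k * (4 * C + C) := by gcongr
      _ = ε * D + B * C₁ * (5 * C) / k := by rw [hD]; ring
      _ ≤ ε * (D + 1) + η / 2 := by
          rw [div_lt_iff₀ (by positivity)] at hk
          have hk1 : B * C₁ * (5 * C) / k ≤ η / 2 := by
            rw [div_le_iff₀ hk0]
            linarith
          linarith
      _ = η := by rw [hε]; field_simp; ring
  have h3 := abs_sub_abs_le_abs_sub (∫ z, inner ℝ (vpow (αs i) (v z)) (ζ z • (vs i z - v z)))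
    (∫ z, inner ℝ (vpow (αs i) (trunc k (v z))) (ζ z • (vs i z - v z)))
  linarith

theorem IsTestFunction.integrable {φ : SpaceTime n → ℝ} (hφ : IsTestFunction U φ) :
    Integrable φ := hφ.continuous.integrable_of_hasCompactSupport hφ.2.1

/-- Local strong convergence in `L¹`. -/
theorem LocalLim.tendsto_integral_norm (h : LocalLim K U ν L lo hi s C αs α vs v Gs G Fs)
    (hζ : IsTestFunction U ζ) (hζ0 : ∀ z, 0 ≤ ζ z) :
    Tendsto (fun i => ∫ z, ζ z * ‖vs i z - v z‖) atTop (𝓝 0) := by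
  obtain ⟨B, hB0, hB⟩ := hζ.exists_bound
  have hs0 := h.s_pos
  -- The monotonicity gap is the difference of the two pairings already shown to vanish, and its
  -- integrand is nonnegative.
  have hy : Tendsto (fun i => ∫ z, ζ z * inner ℝ (vpow (αs i) (vs i z) - vpow (αs i) (v z))
      (vs i z - v z)) atTop (𝓝 0) := by
    have h1 := (h.tendsto_integral_u hζ).add (h.tendsto_integral_vpow_limit hζ)
    rw [add_zero] at h1
    refine squeeze_zero (fun i => integral_nonneg fun z =>
      mul_nonneg (hζ0 z) (vpow_monotone_aux (h.pos i) _ _)) (fun i => ?_) h1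
    have := holderConjugate_one_add (h.pos i)
    have e : ∫ z, ζ z * inner ℝ (vpow (αs i) (vs i z) - vpow (αs i) (v z)) (vs i z - v z) =
        (∫ z, inner ℝ (vpow (αs i) (vs i z)) (ζ z • (vs i z - v z))) -
          ∫ z, inner ℝ (vpow (αs i) (v z)) (ζ z • (vs i z - v z)) := by
      rw [← integral_sub (integrable_inner_of_memLp ((h.sol i).memLp_u (h.pos i))
        (h.memLp_cut_exp (h.mem i) hζ i)) (h.integrable_pairing (h.mem i) hζ i)]
      refine integral_congr_ae (ae_of_all _ fun z => ?_)
      simp only [inner_smul_right, inner_sub_left]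
      ring
    rw [e]
    exact (le_abs_self _).trans (abs_sub _ _)
  have hi0 := hζ.integrable
  refine tendsto_zero_of_le_mul_add (D := (∫ z, ζ z) + B * (C + C))
    (fun i => integral_nonneg fun z => mul_nonneg (hζ0 z) (norm_nonneg _)) (fun ε hε => ?_) hy
  obtain ⟨C₁, hC₁, hC₁'⟩ := exists_norm_sub_le_vpow (N := N) (hi := hi) h.lo_pos
    (by linarith [h.two_lt] : 1 < s) hε
  refine ⟨C₁, fun i => ?_⟩
  have := holderConjugate_one_add (h.pos i)
  have hi1 := integrable_norm_rpow_ofReal hs0 (h.memLp_s i)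
  have hi2 := integrable_norm_rpow_ofReal hs0 h.v_memLp_s
  have hi12 : Integrable fun z => B * (‖vs i z‖ ^ s + ‖v z‖ ^ s) := (hi1.add hi2).const_mul B
  have hi012 : Integrable fun z => ζ z + B * (‖vs i z‖ ^ s + ‖v z‖ ^ s) := hi0.add hi12
  have hiq : Integrable fun z => ζ z * inner ℝ (vpow (αs i) (vs i z) - vpow (αs i) (v z))
      (vs i z - v z) := by
    refine ((integrable_inner_of_memLp ((h.sol i).memLp_u (h.pos i))
        (h.memLp_cut_exp (h.mem i) hζ i)).sub (h.integrable_pairing (h.mem i) hζ i)).congr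
        (ae_of_all _ fun z => ?_)
    simp only [inner_smul_right, inner_sub_left, Pi.sub_apply]
    ring
  calc ∫ z, ζ z * ‖vs i z - v z‖
      ≤ ∫ z, (ε * (ζ z + B * (‖vs i z‖ ^ s + ‖v z‖ ^ s)) +
          C₁ * (ζ z * inner ℝ (vpow (αs i) (vs i z) - vpow (αs i) (v z)) (vs i z - v z))) := by
        refine integral_mono_of_nonneg (ae_of_all _ fun z => mul_nonneg (hζ0 z) (norm_nonneg _))
          ((hi012.const_mul ε).add (hiq.const_mul C₁)) (ae_of_all _ fun z => ?_)
        have h1 := mul_le_mul_of_nonneg_left (hC₁' _ (h.mem i) (vs i z) (v z)) (hζ0 z)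
        have h2 : ζ z * (‖vs i z‖ ^ s + ‖v z‖ ^ s) ≤ B * (‖vs i z‖ ^ s + ‖v z‖ ^ s) := by
          gcongr
          exact (le_abs_self _).trans (hB z).1
        have h3 := mul_le_mul_of_nonneg_left h2 hε.le
        simp only
        linarith
    _ = ε * ((∫ z, ζ z) + B * ((∫ z, ‖vs i z‖ ^ s) + ∫ z, ‖v z‖ ^ s)) +
        C₁ * ∫ z, ζ z * inner ℝ (vpow (αs i) (vs i z) - vpow (αs i) (v z)) (vs i z - v z) := by
        rw [integral_add (hi012.const_mul ε) (hiq.const_mul C₁), integral_const_mul,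
          integral_const_mul, integral_add hi0 hi12, integral_const_mul, integral_add hi1 hi2]
    _ ≤ _ := by
        have e1 := h.bound_s i
        have e2 := h.v_bound_s
        gcongr

end LocalLim

section LocalLim

variable {K U : Set (SpaceTime n)} {ν L lo hi s C α : ℝ} {αs : ℕ → ℝ}
  {vs : ℕ → SpaceTime n → Vec N} {v : SpaceTime n → Vec N} {Gs : ℕ → SpaceTime n → Grad N n}
  {G : SpaceTime n → Grad N n} {Fs : ℕ → SpaceTime n → Grad N n} {χ ζ : SpaceTime n → ℝ}

/-! ### Consequences of the compactness -/

theorem integrable_nemytskii {H : ℝ × (Vec N × Vec N) → ℝ}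
    (hH : ContinuousOn H (Icc lo hi ×ˢ univ)) {C₀ : ℝ} (hC₀ : 0 ≤ C₀) (hhi : 0 ≤ 1 + hi)
    (hs : 1 + hi < s)
    (hgr : ∀ l ∈ Icc lo hi, ∀ x, ‖H (l, x)‖ ≤ C₀ * (1 + ‖x‖ ^ (1 + hi))) {l : ℝ}
    (hl : l ∈ Icc lo hi) (hχ : IsTestFunction U χ) {x y : SpaceTime n → Vec N}
    (hx : MemLp x (ENNReal.ofReal s)) (hy : MemLp y (ENNReal.ofReal s)) :
    Integrable fun z => χ z * H (l, (x z, y z)) := by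
  obtain ⟨B, hB0, hB⟩ := hχ.exists_bound
  have hs0 : 0 < s := by linarith
  have hHc : Continuous fun p : Vec N × Vec N => H (l, p) := by
    rw [← continuousOn_univ]
    exact hH.comp (by fun_prop) fun p _ => ⟨hl, mem_univ _⟩
  have hi1 := integrable_norm_rpow_ofReal hs0 hx
  have hi2 := integrable_norm_rpow_ofReal hs0 hy
  have hi0 := hχ.integrable.norm
  refine Integrable.mono' (g := fun z => C₀ * 2 * ‖χ z‖ + B * C₀ * (‖x z‖ ^ s + ‖y z‖ ^ s))
    ((hi0.const_mul _).add ((hi1.add hi2).const_mul _))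
    (hχ.continuous.aestronglyMeasurable.mul
      (hHc.comp_aestronglyMeasurable (hx.1.prodMk hy.1))) (ae_of_all _ fun z => ?_)
  have h1 := hgr l hl (x z, y z)
  have h2 := rpow_le_one_add_rpow (norm_nonneg (x z, y z)) hhi hs.le
  have h3 := norm_prod_rpow_le (x z, y z) s
  have h4 : ‖χ z‖ ≤ B := (hB z).1
  have h5 : 0 ≤ ‖x z‖ ^ s + ‖y z‖ ^ s := by positivity
  rw [norm_mul]
  calc ‖χ z‖ * ‖H (l, (x z, y z))‖ ≤ ‖χ z‖ * (C₀ * (2 + (‖x z‖ ^ s + ‖y z‖ ^ s))) := by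
        gcongr
        refine h1.trans (mul_le_mul_of_nonneg_left ?_ hC₀)
        simp only at h3
        linarith
    _ = C₀ * 2 * ‖χ z‖ + ‖χ z‖ * (C₀ * (‖x z‖ ^ s + ‖y z‖ ^ s)) := by ring
    _ ≤ C₀ * 2 * ‖χ z‖ + B * (C₀ * (‖x z‖ ^ s + ‖y z‖ ^ s)) := by gcongr
    _ = _ := by ring

theorem LocalLim.hi_nonneg (h : LocalLim K U ν L lo hi s C αs α vs v Gs G Fs) : 0 ≤ hi :=
  (h.pos 0).le.trans (h.mem 0).2

/-- Combine `exists_norm_sub_le` with strong `L¹` convergence, convergence of the exponents and the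
`L^s` bounds. The second argument `y` is common to both terms, so only `|vᵢ - v|` enters the
distance. -/
theorem LocalLim.tendsto_nemytskii (h : LocalLim K U ν L lo hi s C αs α vs v Gs G Fs)
    (hχ : IsTestFunction U χ) (hχ0 : ∀ z, 0 ≤ χ z) {H : ℝ × (Vec N × Vec N) → ℝ}
    (hH : ContinuousOn H (Icc lo hi ×ˢ univ)) {C₀ : ℝ} (hC₀ : 0 ≤ C₀)
    (hgr : ∀ l ∈ Icc lo hi, ∀ x, ‖H (l, x)‖ ≤ C₀ * (1 + ‖x‖ ^ (1 + hi)))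
    {y : SpaceTime n → Vec N} (hy : MemLp y (ENNReal.ofReal s)) :
    Tendsto (fun i => ∫ z, χ z * H (αs i, (vs i z, y z))) atTop
      (𝓝 (∫ z, χ z * H (α, (v z, y z)))) := by
  obtain ⟨B, hB0, hB⟩ := hχ.exists_bound
  have hhi : 0 ≤ 1 + hi := by linarith [h.hi_nonneg]
  have hs0 := h.s_pos
  have hI1 := fun i => integrable_nemytskii hH hC₀ hhi h.hi_lt hgr (h.mem i) hχ (h.memLp_s i) hy
  have hI2 := integrable_nemytskii hH hC₀ hhi h.hi_lt hgr h.mem_lim hχ h.v_memLp_s hy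
  rw [tendsto_iff_norm_sub_tendsto_zero]
  have hlim : Tendsto (fun i => (∫ z, χ z * ‖vs i z - v z‖) + |αs i - α| * ∫ z, χ z) atTop
      (𝓝 0) := by
    have h1 : Tendsto (fun i => |αs i - α|) atTop (𝓝 0) := by
      simpa using (h.lim.sub_const α).abs
    simpa using (h.tendsto_integral_norm hχ hχ0).add (h1.mul_const (∫ z, χ z))
  refine tendsto_zero_of_le_mul_add
    (D := (∫ z, χ z) + B * (C + C + 2 * ∫ z, ‖y z‖ ^ s)) (fun i => norm_nonneg _)
    (fun ε hε => ?_) hlim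
  obtain ⟨C₁, hC₁, hC₁'⟩ := exists_norm_sub_le isCompact_Icc hH h.mem_lim hhi h.hi_lt hC₀ hgr hε
  refine ⟨C₁, fun i => ?_⟩
  have hi0 := hχ.integrable
  have hi1 := integrable_norm_rpow_ofReal hs0 (h.memLp_s i)
  have hi2 := integrable_norm_rpow_ofReal hs0 h.v_memLp_s
  have hi3 := (integrable_norm_rpow_ofReal hs0 hy).const_mul 2
  have hi12 : Integrable fun z => ‖vs i z‖ ^ s + ‖v z‖ ^ s := hi1.add hi2
  have hi123 : Integrable fun z => ‖vs i z‖ ^ s + ‖v z‖ ^ s + 2 * ‖y z‖ ^ s := hi12.add hi3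
  have hi4 : Integrable fun z => χ z + B * (‖vs i z‖ ^ s + ‖v z‖ ^ s + 2 * ‖y z‖ ^ s) :=
    hi0.add (hi123.const_mul B)
  have hi5 : Integrable fun z => χ z * ‖vs i z - v z‖ := by
    refine (h.integrable_cut hχ i).norm.congr (ae_of_all _ fun z => ?_)
    simp only [norm_smul, Real.norm_of_nonneg (hχ0 z)]
  have hi6 : Integrable fun z => χ z * ‖vs i z - v z‖ + |αs i - α| * χ z :=
    hi5.add (hi0.const_mul _)
  rw [← integral_sub (hI1 i) hI2]
  calc ‖∫ z, (χ z * H (αs i, (vs i z, y z)) - χ z * H (α, (v z, y z)))‖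
      ≤ ∫ z, (ε * (χ z + B * (‖vs i z‖ ^ s + ‖v z‖ ^ s + 2 * ‖y z‖ ^ s)) +
          C₁ * (χ z * ‖vs i z - v z‖ + |αs i - α| * χ z)) := by
        refine (norm_integral_le_integral_norm _).trans (integral_mono ((hI1 i).sub hI2).norm
          ((hi4.const_mul ε).add (hi6.const_mul C₁)) fun z => ?_)
        have h1 := hC₁' _ (h.mem i) (vs i z, y z) (v z, y z)
        have h2 := norm_prod_rpow_le (vs i z, y z) s
        have h3 := norm_prod_rpow_le (v z, y z) s
        simp only [Prod.mk_sub_mk, sub_self] at h1 h2 h3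
        have h4 : ‖((vs i z - v z, 0) : Vec N × Vec N)‖ = ‖vs i z - v z‖ := by
          simp [Prod.norm_def]
        rw [h4] at h1
        have h5 : χ z ≤ B := (le_abs_self _).trans (hB z).1
        have h6 : 0 ≤ ‖vs i z‖ ^ s + ‖v z‖ ^ s + 2 * ‖y z‖ ^ s := by positivity
        simp only
        rw [← mul_sub, norm_mul, Real.norm_of_nonneg (hχ0 z)]
        calc χ z * ‖H (αs i, (vs i z, y z)) - H (α, (v z, y z))‖
            ≤ χ z * (ε * (1 + (‖vs i z‖ ^ s + ‖v z‖ ^ s + 2 * ‖y z‖ ^ s)) +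
              C₁ * (‖vs i z - v z‖ + |αs i - α|)) := by
              have := hχ0 z
              gcongr
              refine h1.trans (add_le_add_left (mul_le_mul_of_nonneg_left ?_ hε.le) _)
              linarith
          _ = ε * (χ z + χ z * (‖vs i z‖ ^ s + ‖v z‖ ^ s + 2 * ‖y z‖ ^ s)) +
              C₁ * (χ z * ‖vs i z - v z‖ + |αs i - α| * χ z) := by ring
          _ ≤ _ := by gcongr
    _ = ε * ((∫ z, χ z) + B * ((∫ z, ‖vs i z‖ ^ s) + (∫ z, ‖v z‖ ^ s) + 2 * ∫ z, ‖y z‖ ^ s)) +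
        C₁ * ((∫ z, χ z * ‖vs i z - v z‖) + |αs i - α| * ∫ z, χ z) := by
        rw [integral_add (hi4.const_mul ε) (hi6.const_mul C₁), integral_const_mul,
          integral_const_mul, integral_add hi0 (hi123.const_mul B), integral_const_mul,
          integral_add hi12 hi3, integral_add hi1 hi2, integral_const_mul,
          integral_add hi5 (hi0.const_mul _), integral_const_mul]
    _ ≤ _ := by
        have e1 := h.bound_s i
        have e2 := h.v_bound_s
        gcongr

/-- Convergence of `∫ |vᵢ|^(1+αᵢ) ∂_t ζ`. -/
theorem LocalLim.tendsto_integral_rpow (h : LocalLim K U ν L lo hi s C αs α vs v Gs G Fs)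
    (hχ : IsTestFunction U χ) (hχ0 : ∀ z, 0 ≤ χ z) :
    Tendsto (fun i => ∫ z, χ z * ‖vs i z‖ ^ (1 + αs i)) atTop
      (𝓝 (∫ z, χ z * ‖v z‖ ^ (1 + α))) := by
  -- The second argument plays no role here and is set to zero.
  refine h.tendsto_nemytskii hχ hχ0 (H := fun p => ‖p.2.1‖ ^ (1 + p.1)) (C₀ := 2) ?_ (by norm_num)
    ?_ (MemLp.zero' (ε := Vec N))
  · refine ContinuousOn.rpow (by fun_prop) (by fun_prop) fun p hp => Or.inr ?_
    have := h.lo_pos.trans_le hp.1.1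
    linarith
  · intro l hl x
    have hl0 := h.lo_pos.trans_le hl.1
    have h1 := rpow_le_one_add_rpow (norm_nonneg x.1) (by linarith : 0 ≤ 1 + l)
      (by linarith [hl.2] : 1 + l ≤ 1 + hi)
    have h2 : ‖x.1‖ ^ (1 + hi) ≤ ‖x‖ ^ (1 + hi) := by
      have := h.hi_nonneg
      have := norm_fst_le x
      gcongr
    have h3 : 0 ≤ ‖x‖ ^ (1 + hi) := by positivity
    simp only
    rw [Real.norm_of_nonneg (by positivity)]
    linarith

/-- Convergence of `∫ uᵢ · y`. -/
theorem LocalLim.tendsto_integral_inner (h : LocalLim K U ν L lo hi s C αs α vs v Gs G Fs)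
    {K' : Set (SpaceTime n)} (hK' : IsCompact K') (hK'U : K' ⊆ U)
    {y : SpaceTime n → Vec N} (hy : MemLp y (ENNReal.ofReal s)) (hy0 : ∀ z ∉ K', y z = 0) :
    Tendsto (fun i => ∫ z, inner ℝ (vpow (αs i) (vs i z)) (y z)) atTop
      (𝓝 (∫ z, inner ℝ (vpow α (v z)) (y z))) := by
  -- As `χ = 1` where `y` may be nonzero, the weight `χ` can be inserted at no cost.
  obtain ⟨Λ, χ, hΛ, hχ, hχ1⟩ := exists_isCutoff hK' (h.sol 0).isOpen hK'U
  have h1 := h.tendsto_nemytskii hχ.test hχ.nonneg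
    (H := fun p => inner ℝ (vpow p.1 p.2.1) p.2.2) (C₀ := 2) ?_ (by norm_num) ?_ hy
  · have e : ∀ (l : ℝ) (x : SpaceTime n → Vec N), ∫ z, χ z * inner ℝ (vpow l (x z)) (y z) =
        ∫ z, inner ℝ (vpow l (x z)) (y z) := fun l x => by
      refine integral_congr_ae (ae_of_all _ fun z => ?_)
      by_cases hz : z ∈ K'
      · simp [hχ1 z hz]
      · simp [hy0 z hz]
    simp only [e] at h1
    exact h1
  · have h2 : ContinuousOn (fun p : ℝ × (Vec N × Vec N) => vpow p.1 p.2.1) (Icc lo hi ×ˢ univ) :=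
      continuousOn_vpow.comp (f := fun p : ℝ × (Vec N × Vec N) => (p.1, p.2.1)) (by fun_prop)
        fun p hp => ⟨h.lo_pos.trans_le hp.1.1, mem_univ _⟩
    exact h2.inner (by fun_prop)
  · intro l hl x
    have hl0 := h.lo_pos.trans_le hl.1
    have hhi := h.hi_nonneg
    refine (norm_inner_le_norm _ _).trans ?_
    rw [norm_vpow hl0]
    have h1 : ‖x.1‖ ^ l ≤ ‖x‖ ^ l := by
      have := norm_fst_le x
      gcongr
    have h2 := norm_snd_le x
    have h3 : ‖x‖ ^ l * ‖x‖ = ‖x‖ ^ (1 + l) := by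
      rw [add_comm, Real.rpow_add_one' (norm_nonneg _) (by linarith)]
    have h4 := rpow_le_one_add_rpow (norm_nonneg x) (by linarith : 0 ≤ 1 + l)
      (by linarith [hl.2] : 1 + l ≤ 1 + hi)
    have h5 : 0 ≤ ‖x‖ ^ (1 + hi) := by positivity
    calc ‖x.1‖ ^ l * ‖x.2‖ ≤ ‖x‖ ^ l * ‖x‖ := by gcongr
      _ ≤ _ := by rw [h3]; linarith

/-- Local strong convergence in `L²`. -/
theorem LocalLim.tendsto_integral_sq (h : LocalLim K U ν L lo hi s C αs α vs v Gs G Fs)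
    (hχ : IsTestFunction U χ) (hχ0 : ∀ z, 0 ≤ χ z) :
    Tendsto (fun i => ∫ z, χ z * ‖vs i z - v z‖ ^ 2) atTop (𝓝 0) := by
  obtain ⟨B, hB0, hB⟩ := hχ.exists_bound
  have hs0 := h.s_pos
  refine tendsto_zero_of_le_mul_add (D := (∫ z, χ z) + 2 * (B * (2 ^ s * (2 * C))))
    (fun i => integral_nonneg fun z => mul_nonneg (hχ0 z) (by positivity)) (fun ε hε => ?_)
    (h.tendsto_integral_norm hχ hχ0)
  -- With exponent one and both factors equal to `|vᵢ - v|`, the product inequality bounds the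
  -- square by `ε` times `L^s` terms plus a multiple of `|vᵢ - v|`; this uses `s > 2`.
  obtain ⟨C₁, hC₁, hC₁'⟩ := exists_rpow_mul_le (lo := 1) (hi := 1) one_pos
    (by linarith [h.two_lt] : 1 + 1 < s) hε
  refine ⟨C₁, fun i => ?_⟩
  have hi0 := hχ.integrable
  have hi1 := (integrable_norm_rpow_ofReal hs0 (h.memLp_diff_s i)).const_mul (2 * B)
  have hi01 : Integrable fun z => χ z + 2 * B * ‖vs i z - v z‖ ^ s := hi0.add hi1
  have hi5 : Integrable fun z => χ z * ‖vs i z - v z‖ := by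
    refine (h.integrable_cut hχ i).norm.congr (ae_of_all _ fun z => ?_)
    simp only [norm_smul, Real.norm_of_nonneg (hχ0 z)]
  calc ∫ z, χ z * ‖vs i z - v z‖ ^ 2
      ≤ ∫ z, (ε * (χ z + 2 * B * ‖vs i z - v z‖ ^ s) + C₁ * (χ z * ‖vs i z - v z‖)) := by
        refine integral_mono_of_nonneg (ae_of_all _ fun z => mul_nonneg (hχ0 z) (by positivity))
          ((hi01.const_mul ε).add (hi5.const_mul C₁)) (ae_of_all _ fun z => ?_)
        have h1 := hC₁' 1 ⟨le_rfl, le_rfl⟩ _ _ (norm_nonneg (vs i z - v z))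
          (norm_nonneg (vs i z - v z))
        rw [Real.rpow_one, ← pow_two] at h1
        have h2 := mul_le_mul_of_nonneg_left h1 (hχ0 z)
        have h5 : χ z ≤ B := (le_abs_self _).trans (hB z).1
        have h3 : χ z * ‖vs i z - v z‖ ^ s ≤ B * ‖vs i z - v z‖ ^ s := by gcongr
        have h4 := mul_le_mul_of_nonneg_left h3 hε.le
        simp only
        linarith
    _ = ε * ((∫ z, χ z) + 2 * B * ∫ z, ‖vs i z - v z‖ ^ s) +
        C₁ * ∫ z, χ z * ‖vs i z - v z‖ := by
        rw [integral_add (hi01.const_mul ε) (hi5.const_mul C₁), integral_const_mul,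
          integral_const_mul, integral_add hi0 hi1, integral_const_mul]
    _ ≤ _ := by
        have e1 := h.bound_diff_s i
        rw [← mul_assoc 2 B]
        gcongr

end LocalLim

theorem integral_norm_sq_eq {X W : Type*} [MeasurableSpace X] {μ : Measure X}
    [NormedAddCommGroup W] {f : X → W} (hf : MemLp f 2 μ) :
    ∫ x, ‖f x‖ ^ 2 ∂μ = (eLpNorm f 2 μ).toReal ^ 2 := by
  have h0 : 0 ≤ ∫ x, ‖f x‖ ^ 2 ∂μ := integral_nonneg fun x => by positivity
  rw [hf.eLpNorm_eq_integral_rpow_norm (by norm_num) (by norm_num)]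
  simp only [ENNReal.toReal_ofNat, Real.rpow_two]
  rw [ENNReal.toReal_ofReal (by positivity), ← Real.rpow_natCast, ← Real.rpow_mul h0]
  norm_num

theorem exists_integral_translate_le {W : Type*} [NormedAddCommGroup W] {g : SpaceTime n → W}
    (hg : MemLp g 2) {δ : ℝ} (hδ : 0 < δ) :
    ∃ r > 0, ∀ w : SpaceTime n, ‖w‖ < r → ∫ z, ‖g (z - w) - g z‖ ^ 2 ≤ δ := by
  have : Fact ((1 : ℝ≥0∞) ≤ 2) := ⟨by norm_num⟩
  have h1 := tendsto_eLpNorm_translate (by norm_num) hg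
  have h2 := h1.eventually_lt_const (u := ENNReal.ofReal (Real.sqrt δ)) (by simpa using hδ)
  obtain ⟨r, hr, hr'⟩ := Metric.eventually_nhds_iff.1 h2
  refine ⟨r, hr, fun w hw => ?_⟩
  have h3 := hr' (y := w) (by simpa using hw)
  have h4 : MemLp (fun z => g (z - w) - g z) 2 := (memLp_translate hg w).sub hg
  rw [integral_norm_sq_eq h4]
  have h5 : (eLpNorm (fun z => g (z - w) - g z) 2).toReal ≤ Real.sqrt δ :=
    ENNReal.toReal_le_of_le_ofReal (Real.sqrt_nonneg _) h3.le
  calc _ ≤ Real.sqrt δ ^ 2 := by gcongr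
    _ = δ := Real.sq_sqrt hδ.le

theorem IsTestFunction.timeDeriv {U : Set (SpaceTime n)} {ζ : SpaceTime n → ℝ}
    (h : IsTestFunction U ζ) : IsTestFunction U (timeDeriv ζ) := by
  have hsub : tsupport (PorousMedium.timeDeriv ζ) ⊆ tsupport ζ := by
    refine closure_minimal (fun z hz => ?_) (isClosed_tsupport ζ)
    by_contra h2
    exact hz (timeDeriv_eq_zero h2)
  refine ⟨?_, HasCompactSupport.intro h.2.1 fun z hz => timeDeriv_eq_zero hz, hsub.trans h.2.2⟩
  exact (h.1.fderiv_right (m := ∞) (by simp)).clm_apply contDiff_const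

theorem IsTestFunction.add_smul {U : Set (SpaceTime n)} {ζ χ : SpaceTime n → ℝ}
    (h : IsTestFunction U ζ) (h' : IsTestFunction U χ) (c : ℝ) :
    IsTestFunction U fun z => ζ z + c * χ z := by
  have h1 : IsTestFunction U fun z => c * χ z :=
    ⟨contDiff_const.mul h'.1, h'.2.1.mul_left, tsupport_mul_subset_right.trans h'.2.2⟩
  exact ⟨h.1.add h1.1, h.2.1.add h1.2.1, (tsupport_add _ _).trans (union_subset h.2.2 h1.2.2)⟩

section LocalLim

variable {K U : Set (SpaceTime n)} {ν L lo hi s C α : ℝ} {αs : ℕ → ℝ}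
  {vs : ℕ → SpaceTime n → Vec N} {v : SpaceTime n → Vec N} {Gs : ℕ → SpaceTime n → Grad N n}
  {G : SpaceTime n → Grad N n} {Fs : ℕ → SpaceTime n → Grad N n} {ζ : SpaceTime n → ℝ}

/-! ### Strong convergence of the gradients -/

/-- The convergence is known for nonnegative weights. The time derivative changes sign, so it is
written as the difference of `timeDeriv ζ + B χ` and `B χ`, both nonnegative. -/
theorem LocalLim.tendsto_integral_timeDeriv (h : LocalLim K U ν L lo hi s C αs α vs v Gs G Fs)
    (hζ : IsTestFunction U ζ) :
    Tendsto (fun i => ∫ z, ‖vs i z‖ ^ (1 + αs i) * timeDeriv ζ z) atTop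
      (𝓝 (∫ z, ‖v z‖ ^ (1 + α) * timeDeriv ζ z)) := by
  obtain ⟨B, hB0, hB⟩ := hζ.exists_bound
  obtain ⟨Λ, χ, -, hχ, hχ1⟩ := exists_isCutoff hζ.2.1 (h.sol 0).isOpen hζ.2.2
  have ht := hζ.timeDeriv.add_smul hχ.test B
  have ht0 : ∀ z, 0 ≤ timeDeriv ζ z + B * χ z := by
    intro z
    by_cases hz : z ∈ tsupport ζ
    · rw [hχ1 z hz, mul_one]
      linarith [(abs_le.1 (hB z).2.1).1]
    · rw [timeDeriv_eq_zero hz, zero_add]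
      exact mul_nonneg hB0 (hχ.nonneg z)
  have h1 := (h.tendsto_integral_rpow ht ht0).sub
    ((h.tendsto_integral_rpow hχ.test hχ.nonneg).const_mul B)
  have hi1 : ∀ (φ : SpaceTime n → ℝ), IsTestFunction U φ → ∀ w : SpaceTime n → ℝ, Integrable w →
      Integrable fun z => φ z * w z := by
    intro φ hφ w hw
    obtain ⟨B', -, hB'⟩ := hφ.exists_bound
    exact hw.bdd_mul (c := B') hφ.continuous.aestronglyMeasurable (ae_of_all _ fun z => (hB' z).1)
  have e : ∀ w : SpaceTime n → ℝ, Integrable w →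
      (∫ z, (timeDeriv ζ z + B * χ z) * w z) - B * ∫ z, χ z * w z = ∫ z, w z * timeDeriv ζ z := by
    intro w hw
    rw [← integral_const_mul, ← integral_sub (hi1 _ ht w hw) ((hi1 _ hχ.test w hw).const_mul B)]
    refine integral_congr_ae (ae_of_all _ fun z => ?_)
    simp only
    ring
  have hwi := fun i => (h.sol i).integrable_rpow (h.pos i)
  have hα0 : 0 < 1 + α := by linarith [h.lo_pos, h.mem_lim.1]
  have hw := integrable_norm_rpow_ofReal hα0 (h.memLp_v_exp h.mem_lim)
  rw [e _ hw] at h1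
  exact h1.congr fun i => e _ (hwi i)

/-- The limit satisfies no equation yet, so its energy identity is unavailable. Instead, the
equation of `uᵢ` is paired with the difference of `ζ v` and its shift by a fixed small time `t`, the
same for all `i`. The pairing converges as `i → ∞`, and convexity bounds its limit below by a
difference quotient of `∫ |v|^(1+α) ζ`. -/
theorem LocalLim.eventually_flux_ge (h : LocalLim K U ν L lo hi s C αs α vs v Gs G Fs)
    (hζ : IsTestFunction U ζ) (hζ0 : ∀ z, 0 ≤ ζ z) {η : ℝ} (hη : 0 < η) :
    ∀ᶠ i in atTop, α / (1 + α) * (∫ z, ‖v z‖ ^ (1 + α) * timeDeriv ζ z) - η ≤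
      ∫ z, inner ℝ (Fs i z) (cutGrad ζ v G z) := by
  obtain ⟨B, hB0, hB⟩ := hζ.exists_bound
  obtain ⟨r₀, hr₀, hrU⟩ := exists_thickening hζ.2.1 (h.sol 0).isOpen hζ.2.2
  have hC0 := h.C_nonneg
  have hα0 : 0 < α := h.lo_pos.trans_le h.mem_lim.1
  set g := cutGrad ζ v G with hg
  set f : SpaceTime n → Vec N := fun z => ζ z • v z with hf
  have hg2 : MemLp g 2 := memLp_cutGrad hζ h.v_memLp h.G_memLp
  have hG1 := integrable_of_memLp (by norm_num) h.isCompact h.G_memLp h.G_eq_zero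
  have hfg : HasSpaceGrad f g := h.grad.hasSpaceGrad h.integrable_v hG1 hζ
  have hg0 : ∀ z ∉ tsupport ζ, g z = 0 := fun z hz => by
    simp [hg, cutGrad, image_eq_zero_of_notMem_tsupport hz, scalarGrad_eq_zero hz, tens]
    rfl
  have hf0 : ∀ z ∉ tsupport ζ, f z = 0 := fun z hz => by
    simp [hf, image_eq_zero_of_notMem_tsupport hz]
  have hg1 := integrable_of_memLp (by norm_num) hζ.2.1 hg2 hg0
  have hfs : MemLp f (ENNReal.ofReal s) :=
    memLp_bdd_smul hζ.continuous.aestronglyMeasurable (fun z => (hB z).1) h.v_memLp_s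
  have hfl : ∀ l ∈ Icc lo hi, MemLp f (ENNReal.ofReal (1 + l)) := fun l hl =>
    memLp_bdd_smul hζ.continuous.aestronglyMeasurable (fun z => (hB z).1) (h.memLp_v_exp hl)
  have hf1 : Integrable f := integrable_of_memLp (by norm_num) hζ.2.1
    (memLp_bdd_smul hζ.continuous.aestronglyMeasurable (fun z => (hB z).1) h.v_memLp) hf0
  -- Young with weight `l` splits the flux error into two parts of at most `η / 8` each: `l` times
  -- the flux bound, and `1 / l` times the squared translation error of `g`.
  set l := η / (8 * (C + 1)) with hl
  have hl0 : 0 < l := by positivity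
  obtain ⟨r₁, hr₁, hr₁'⟩ := exists_integral_translate_le hg2 (δ := l * (η / 8)) (by positivity)
  set r := min r₀ r₁ with hr
  have hr0 : 0 < r := lt_min hr₀ hr₁
  have hsub : tsupport ζ + Metric.closedBall (0 : SpaceTime n) r ⊆ U :=
    (add_subset_add_left (Metric.closedBall_subset_closedBall (min_le_left _ _))).trans hrU
  have hflux : ∀ i, ∀ w : SpaceTime n, ‖w‖ < r →
      |(∫ z, inner ℝ (Fs i z) (g (z - w))) - ∫ z, inner ℝ (Fs i z) (g z)| ≤ η / 4 := by
    intro i w hw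
    have hF2 := (h.sol i).F_memLp
    have hd : MemLp (fun z => g (z - w) - g z) 2 := (memLp_translate hg2 w).sub hg2
    rw [← integral_sub (integrable_inner_of_memLp hF2 (memLp_translate hg2 w))
      (integrable_inner_of_memLp hF2 hg2)]
    simp_rw [← inner_sub_right]
    refine (abs_integral_inner_le hF2 hd hl0).trans ?_
    have h1 := h.bound_F i
    have h2 := hr₁' w (hw.trans_le (min_le_right _ _))
    calc _ ≤ l * (C + 1) + l⁻¹ * (l * (η / 8)) := by
          gcongr
          linarith
      _ = η / 4 := by
          rw [hl]
          field_simp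
          norm_num
  set J : ℝ → ℝ := fun t => ∫ z, ‖v z‖ ^ (1 + α) * ζ (z - (0, t)) with hJ
  have hα1 : 0 < 1 + α := by linarith
  have hw := integrable_norm_rpow_ofReal hα1 (h.memLp_v_exp h.mem_lim)
  have hJd : HasDerivAt J (-∫ z, ‖v z‖ ^ (1 + α) * timeDeriv ζ z) 0 :=
    hasDerivAt_integral_mul_shift hw hζ
  set κ := α / (1 + α) with hκ
  set P := ∫ z, ‖v z‖ ^ (1 + α) * timeDeriv ζ z with hP
  -- A shift so short that the difference quotient of `κ J` is within `η / 4` of its derivative, and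
  -- fixed before `i` is taken large.
  obtain ⟨t, ht0, htr, htJ⟩ : ∃ t, 0 < t ∧ t < r ∧ κ * P - η / 4 ≤ t⁻¹ * (κ * (J 0 - J t)) := by
    have h1 := (hJd.const_mul κ).tendsto_slope_zero_right
    have h2 := h1.eventually_lt_const (u := κ * -P + η / 4) (by linarith)
    have h3 : ∀ᶠ t : ℝ in 𝓝[>] 0, t < r := nhdsWithin_le_nhds (eventually_lt_nhds hr0)
    obtain ⟨t, ⟨h4, h5⟩, h6⟩ := ((h2.and h3).and self_mem_nhdsWithin).exists
    refine ⟨t, h6, h5, ?_⟩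
    simp only [zero_add, smul_eq_mul] at h4
    have : t⁻¹ * (κ * (J 0 - J t)) = -(t⁻¹ * (κ * J t - κ * J 0)) := by ring
    rw [this]
    linarith
  have hnt : ‖((0, t) : SpaceTime n)‖ = t := by simp [Prod.norm_def, abs_of_pos ht0, ht0.le]
  set y : SpaceTime n → Vec N := fun z => f z - f (z - (0, t)) with hy
  have hys : MemLp y (ENNReal.ofReal s) := hfs.sub (memLp_translate hfs _)
  have hK' : IsCompact (tsupport ζ + Metric.closedBall (0 : SpaceTime n) r) :=
    IsCompact.add hζ.2.1 (isCompact_closedBall _ _)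
  have hy0 : ∀ z ∉ tsupport ζ + Metric.closedBall (0 : SpaceTime n) r, y z = 0 := by
    intro z hz
    have h1 : z ∉ tsupport ζ := fun h2 => hz ⟨z, h2, 0, by simp [hr0.le], by simp⟩
    have h2 : z - (0, t) ∉ tsupport ζ := fun h2 =>
      hz ⟨z - (0, t), h2, (0, t), by rw [mem_closedBall_zero_iff, hnt]; exact htr.le, by simp⟩
    simp only [hy, hf0 z h1, hf0 _ h2, sub_zero]
  have hlim := h.tendsto_integral_inner hK' hsub hys hy0
  have hpos : ∀ l ∈ Icc lo hi, 0 < l := fun l hl => h.lo_pos.trans_le hl.1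
  have hsplit : ∀ l ∈ Icc lo hi, ∀ x : SpaceTime n → Vec N, MemLp x (ENNReal.ofReal (1 + l)) →
      ∫ z, inner ℝ (vpow l (x z)) (y z) = (∫ z, inner ℝ (vpow l (x z)) (f z)) -
        ∫ z, inner ℝ (vpow l (x z)) (f (z - (0, t))) := by
    intro l hl x hx
    have := holderConjugate_one_add (hpos l hl)
    rw [← integral_sub (integrable_inner_of_memLp (memLp_vpow (hpos l hl) hx) (hfl l hl))
      (integrable_inner_of_memLp (memLp_vpow (hpos l hl) hx) (memLp_translate (hfl l hl) _))]
    simp only [hy, inner_sub_right]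
  -- One-sided convexity suffices: only a lower bound for the limit pairing is needed.
  have hYoung : κ * (J 0 - J t) ≤ ∫ z, inner ℝ (vpow α (v z)) (y z) := by
    have h1 := shift_inner_vpow_le hα0 (h.memLp_v_exp h.mem_lim)
      (memLp_vpow hα0 (h.memLp_v_exp h.mem_lim)) hζ.continuous hζ0 (fun z => (hB z).1) (0, t)
    rw [hsplit α h.mem_lim v (h.memLp_v_exp h.mem_lim)]
    have h2 : J 0 = ∫ z, ‖v z‖ ^ (1 + α) * ζ z := by
      simp only [hJ, Prod.mk_zero_zero, sub_zero]
    rw [h2]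
    simp only [hf, hJ, hκ]
    linarith
  have hev := hlim.eventually_const_lt
    (u := (∫ z, inner ℝ (vpow α (v z)) (y z)) - t * (η / 4)) (by
      have : 0 < t * (η / 4) := by positivity
      linarith)
  filter_upwards [hev] with i hi
  have hai := h.pos i
  have : Fact ((1 : ℝ≥0∞) ≤ ENNReal.ofReal (1 + αs i)) :=
    ⟨by rw [← ENNReal.ofReal_one]; exact ENNReal.ofReal_le_ofReal (by linarith)⟩
  have : Fact ((1 : ℝ≥0∞) ≤ ENNReal.ofReal (1 + 1 / αs i)) :=
    ⟨by rw [← ENNReal.ofReal_one]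
        exact ENNReal.ofReal_le_ofReal (by linarith [one_div_pos.2 hai])⟩
  have := holderConjugate_one_add hai
  have hF1 := integrable_of_memLp (by norm_num) h.isCompact (h.sol i).F_memLp (h.sol i).F_eq_zero
  have h1 := (h.sol i).eqn.abs_shift_le ENNReal.ofReal_ne_top hfg ((h.sol i).integrable_u hai)
    ((h.sol i).memLp_u hai) hf1 (hfl _ (h.mem i)) hF1 (h.sol i).F_memLp hg1 hg2 hζ.2.1 hf0 hsub
    (c := ∫ z, inner ℝ (Fs i z) (g z)) (M := η / 4) (hflux i) (h := t)
    (by rw [abs_of_pos ht0]; exact htr)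
  rw [abs_of_pos ht0] at h1
  have h2 := (abs_le.1 h1).1
  have h3 := hsplit _ (h.mem i) (vs i) (h.sol i).v_memLp'
  set c := ∫ z, inner ℝ (Fs i z) (g z) with hc
  have h4 : κ * (J 0 - J t) - t * (η / 4) - t * (η / 4) ≤ t * c := by
    rw [h3] at hi
    linarith
  have h5 : t⁻¹ * (κ * (J 0 - J t)) - η / 2 ≤ c := by
    have h6 := mul_le_mul_of_nonneg_left h4 (inv_pos.2 ht0).le
    have e1 : t⁻¹ * (t * c) = c := by field_simp
    have e2 : t⁻¹ * (κ * (J 0 - J t) - t * (η / 4) - t * (η / 4)) =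
        t⁻¹ * (κ * (J 0 - J t)) - (t⁻¹ * t) * (η / 2) := by ring
    rw [e1, e2, inv_mul_cancel₀ ht0.ne', one_mul] at h6
    exact h6
  linarith

/-- Expand the monotonicity inequality. The energy identity turns `∫ Fᵢ · D(ζ vᵢ)` into a convergent
expression, `eventually_flux_ge` bounds `∫ Fᵢ · D(ζ v)` below by the same limit, the term with `vᵢ -
v` vanishes by strong `L²` convergence, and the term with the fixed field `F` by weak convergence of
the gradients. -/
theorem LocalLim.tendsto_integral_grad (h : LocalLim K U ν L lo hi s C αs α vs v Gs G Fs)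
    {F : SpaceTime n → Grad N n} (hF : MemLp F 2) {μ : ℝ} (hμ : 0 < μ)
    (hmono : ∀ i, ∀ᵐ z, μ * ‖Gs i z - G z‖ ^ 2 ≤ inner ℝ (Fs i z - F z) (Gs i z - G z))
    (hζ : IsTestFunction U ζ) (hζ0 : ∀ z, 0 ≤ ζ z) :
    Tendsto (fun i => ∫ z, ζ z * ‖Gs i z - G z‖ ^ 2) atTop (𝓝 0) := by
  obtain ⟨B, hB0, hB⟩ := hζ.exists_bound
  have hζm := hζ.continuous.aestronglyMeasurable (μ := volume)
  have hGd : ∀ i, MemLp (fun z => Gs i z - G z) 2 := fun i => (h.sol i).G_memLp.sub h.G_memLp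
  obtain ⟨Λ, χ, -, hχ, hχ1⟩ := exists_isCutoff hζ.2.1 (h.sol 0).isOpen hζ.2.2
  have hC0 := h.C_nonneg
  set κ : ℝ → ℝ := fun a => a / (1 + a) with hκ
  set P := κ α * ∫ z, ‖v z‖ ^ (1 + α) * timeDeriv ζ z with hP
  have hα0 : 0 < α := h.lo_pos.trans_le h.mem_lim.1
  have hΦ : Tendsto (fun i => κ (αs i) * ∫ z, ‖vs i z‖ ^ (1 + αs i) * timeDeriv ζ z) atTop
      (𝓝 P) := by
    refine Tendsto.mul ?_ (h.tendsto_integral_timeDeriv hζ)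
    exact h.lim.div (h.lim.const_add 1) (by linarith)
  have hweak : Tendsto (fun i => ∫ z, inner ℝ (ζ z • F z) (Gs i z - G z)) atTop (𝓝 0) := by
    have hψ : MemLp (fun z => ζ z • F z) 2 := memLp_bdd_smul hζm (fun z => (hB z).1) hF
    have h1 := (h.weak_G _ hψ).sub_const (∫ z, inner ℝ (G z) (ζ z • F z))
    rw [sub_self] at h1
    refine h1.congr fun i => ?_
    rw [← integral_sub (integrable_inner_of_memLp (h.sol i).G_memLp hψ)
      (integrable_inner_of_memLp h.G_memLp hψ)]
    refine integral_congr_ae (ae_of_all _ fun z => ?_)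
    simp only [← inner_sub_left]
    exact real_inner_comm _ _
  have htm : ∀ i, MemLp (fun z => tens (vs i z - v z) (scalarGrad ζ z)) 2 := fun i =>
    memLp_tens (h.memLp_diff_two i) hζ.continuous_scalarGrad.aestronglyMeasurable
      fun z => (hB z).2.2
  have hcross : Tendsto (fun i => |∫ z, inner ℝ (Fs i z)
      (tens (vs i z - v z) (scalarGrad ζ z))|) atTop (𝓝 0) := by
    refine tendsto_zero_of_le_mul_add (D := C) (fun i => abs_nonneg _) (fun ε hε => ?_)
      (h.tendsto_integral_sq hχ.test hχ.nonneg)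
    refine ⟨ε⁻¹ * B ^ 2, fun i => ?_⟩
    refine (abs_integral_inner_le (h.sol i).F_memLp (htm i) hε).trans ?_
    have h1 : ∫ z, ‖tens (vs i z - v z) (scalarGrad ζ z)‖ ^ 2 ≤
        B ^ 2 * ∫ z, χ z * ‖vs i z - v z‖ ^ 2 := by
      rw [← integral_const_mul]
      have hi : Integrable fun z => χ z * ‖vs i z - v z‖ ^ 2 :=
        (integrable_norm_sq (h.memLp_diff_two i)).bdd_mul (c := 1)
          hχ.test.continuous.aestronglyMeasurable (ae_of_all _ fun z => by
            rw [Real.norm_of_nonneg (hχ.nonneg z)]; exact hχ.le_one z)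
      refine integral_mono (integrable_norm_sq (htm i)) (hi.const_mul _) fun z => ?_
      simp only [norm_tens, mul_pow]
      by_cases hz : z ∈ tsupport ζ
      · rw [hχ1 z hz, one_mul, mul_comm]
        have := (hB z).2.2
        gcongr
      · rw [scalarGrad_eq_zero hz, norm_zero]
        have := hχ.nonneg z
        simp only [ne_eq, OfNat.ofNat_ne_zero, not_false_eq_true, zero_pow, mul_zero]
        positivity
    have h2 := h.bound_F i
    calc _ ≤ ε * C + ε⁻¹ * (B ^ 2 * ∫ z, χ z * ‖vs i z - v z‖ ^ 2) := by gcongr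
      _ = _ := by ring
  -- Uses `ζ (Gᵢ - G) = D(ζ vᵢ) - D(ζ v) - (vᵢ - v) ⊗ Dζ`.
  have hid : ∀ i, μ * ∫ z, ζ z * ‖Gs i z - G z‖ ^ 2 ≤
      κ (αs i) * (∫ z, ‖vs i z‖ ^ (1 + αs i) * timeDeriv ζ z) -
        (∫ z, inner ℝ (Fs i z) (cutGrad ζ v G z)) -
        (∫ z, inner ℝ (Fs i z) (tens (vs i z - v z) (scalarGrad ζ z))) -
        ∫ z, inner ℝ (ζ z • F z) (Gs i z - G z) := by
    intro i
    have hF2 := (h.sol i).F_memLp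
    have hi1 := integrable_inner_of_memLp hF2 (memLp_cutGrad hζ (h.sol i).v_memLp (h.sol i).G_memLp)
    have hi2 := integrable_inner_of_memLp hF2 (memLp_cutGrad hζ h.v_memLp h.G_memLp)
    have hi3 := integrable_inner_of_memLp hF2 (htm i)
    have hi4 := integrable_inner_of_memLp (memLp_bdd_smul hζm (fun z => (hB z).1) hF) (hGd i)
    have hi12 : Integrable fun z => inner ℝ (Fs i z) (cutGrad ζ (vs i) (Gs i) z) -
        inner ℝ (Fs i z) (cutGrad ζ v G z) := hi1.sub hi2
    have hi123 : Integrable fun z => inner ℝ (Fs i z) (cutGrad ζ (vs i) (Gs i) z) -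
        inner ℝ (Fs i z) (cutGrad ζ v G z) -
        inner ℝ (Fs i z) (tens (vs i z - v z) (scalarGrad ζ z)) := hi12.sub hi3
    have hen := (h.sol i).energy (h.pos i) hζ hζ0
    have hen' : ∫ z, inner ℝ (Fs i z) (cutGrad ζ (vs i) (Gs i) z) =
        κ (αs i) * ∫ z, ‖vs i z‖ ^ (1 + αs i) * timeDeriv ζ z := hen
    rw [← hen', ← integral_sub hi1 hi2, ← integral_sub hi12 hi3, ← integral_sub hi123 hi4,
      ← integral_const_mul]
    have hi5 : Integrable fun z => ζ z * ‖Gs i z - G z‖ ^ 2 :=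
      (integrable_norm_sq (hGd i)).bdd_mul (c := B) hζm (ae_of_all _ fun z => (hB z).1)
    refine integral_mono_ae (hi5.const_mul μ) (hi123.sub hi4) ?_
    filter_upwards [hmono i] with z hz
    have h1 := mul_le_mul_of_nonneg_left hz (hζ0 z)
    simp only [cutGrad, tens_sub, inner_add_right, inner_sub_right, inner_smul_right,
      inner_smul_left, conj_trivial]
    simp only [inner_sub_left, inner_sub_right] at h1
    linarith
  have hkey : Tendsto (fun i => μ * ∫ z, ζ z * ‖Gs i z - G z‖ ^ 2) atTop (𝓝 0) := by
    have hnn : ∀ i, 0 ≤ μ * ∫ z, ζ z * ‖Gs i z - G z‖ ^ 2 := fun i =>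
      mul_nonneg hμ.le (integral_nonneg fun z => mul_nonneg (hζ0 z) (by positivity))
    refine tendsto_order.2 ⟨fun a ha => Eventually.of_forall fun i => ha.trans_le (hnn i),
      fun a ha => ?_⟩
    have ha4 : 0 < a / 4 := by positivity
    have hw0 : Tendsto (fun i => |∫ z, inner ℝ (ζ z • F z) (Gs i z - G z)|) atTop (𝓝 0) := by
      simpa using hweak.abs
    filter_upwards [h.eventually_flux_ge hζ hζ0 ha4,
      hΦ.eventually_lt_const (lt_add_of_pos_right P ha4), hcross.eventually_lt_const ha4,
      hw0.eventually_lt_const ha4] with i h1 h2 h3 h4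
    have h5 := hid i
    have h6 := (abs_lt.1 h3).1
    have h7 := (abs_lt.1 h4).1
    linarith
  have := hkey.const_mul μ⁻¹
  rw [mul_zero] at this
  refine this.congr fun i => ?_
  rw [← mul_assoc, inv_mul_cancel₀ hμ.ne', one_mul]

end LocalLim

/-! ### The weak limit of the gradients -/

/-- The pairings converge for every `L²` function; Banach-Steinhaus makes the limit a continuous
functional and the Riesz theorem represents it. No subsequence is extracted. -/
theorem exists_weak_limit {X W : Type*} [MeasurableSpace X] {μ : Measure X} [NormedAddCommGroup W]
    [InnerProductSpace ℝ W] [CompleteSpace W] {fs : ℕ → X → W} (hfs : ∀ i, MemLp (fs i) 2 μ)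
    (h : ∀ ψ : X → W, MemLp ψ 2 μ → CauchySeq fun i => ∫ z, inner ℝ (fs i z) (ψ z) ∂μ) :
    ∃ g : X → W, MemLp g 2 μ ∧ ∀ ψ : X → W, MemLp ψ 2 μ →
      Tendsto (fun i => ∫ z, inner ℝ (fs i z) (ψ z) ∂μ) atTop (𝓝 (∫ z, inner ℝ (g z) (ψ z) ∂μ)) := by
  have e : ∀ i (ψ : Lp W 2 μ), innerSL ℝ ((hfs i).toLp (fs i)) ψ = ∫ z, inner ℝ (fs i z) (ψ z) ∂μ := by
    intro i ψ
    rw [innerSL_apply_apply, L2.inner_def]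
    refine integral_congr_ae ?_
    filter_upwards [(hfs i).coeFn_toLp] with z hz
    rw [hz]
  choose f hf using fun ψ : Lp W 2 μ => cauchySeq_tendsto_of_complete (h ψ (Lp.memLp ψ))
  have hlim : Tendsto (fun i (ψ : Lp W 2 μ) => innerSL ℝ ((hfs i).toLp (fs i)) ψ) atTop (𝓝 f) := by
    rw [tendsto_pi_nhds]
    intro ψ
    simp only [e]
    exact hf ψ
  set ℓ := continuousLinearMapOfTendsto (fun i => innerSL ℝ ((hfs i).toLp (fs i))) hlim with hℓ
  set g := (InnerProductSpace.toDual ℝ (Lp W 2 μ)).symm ℓ with hg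
  refine ⟨g, Lp.memLp g, fun ψ hψ => ?_⟩
  have h1 := hf (hψ.toLp ψ)
  have h2 : f (hψ.toLp ψ) = inner ℝ g (hψ.toLp ψ) := by
    rw [hg, InnerProductSpace.toDual_symm_apply]; rfl
  have h3 : ∀ w : X → W, ∫ z, inner ℝ (w z) (hψ.toLp ψ z) ∂μ = ∫ z, inner ℝ (w z) (ψ z) ∂μ := by
    intro w
    refine integral_congr_ae ?_
    filter_upwards [hψ.coeFn_toLp] with z hz
    rw [hz]
  rw [h2, L2.inner_def, h3] at h1
  simpa only [h3] using h1

theorem ae_eq_of_integral_inner_eq {X W : Type*} [MeasurableSpace X] {μ : Measure X}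
    [NormedAddCommGroup W] [InnerProductSpace ℝ W] {f g : X → W} (hf : MemLp f 2 μ)
    (hg : MemLp g 2 μ)
    (h : ∀ ψ : X → W, MemLp ψ 2 μ → ∫ z, inner ℝ (f z) (ψ z) ∂μ = ∫ z, inner ℝ (g z) (ψ z) ∂μ) :
    ∀ᵐ z ∂μ, f z = g z := by
  have hd : MemLp (fun z => f z - g z) 2 μ := hf.sub hg
  have h2 := h _ hd
  rw [← sub_eq_zero, ← integral_sub (integrable_inner_of_memLp hf hd)
    (integrable_inner_of_memLp hg hd)] at h2
  simp only [← inner_sub_left, real_inner_self_eq_norm_sq] at h2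
  rw [integral_eq_zero_iff_of_nonneg (fun z => by positivity) (integrable_norm_sq hd)] at h2
  filter_upwards [h2] with z hz
  simpa [sub_eq_zero] using hz

theorem cauchySeq_of_approx {x : ℕ → ℝ}
    (h : ∀ ε > 0, ∃ y : ℕ → ℝ, CauchySeq y ∧ ∀ i, |x i - y i| ≤ ε) : CauchySeq x := by
  rw [Metric.cauchySeq_iff']
  intro ε hε
  obtain ⟨y, hy, hxy⟩ := h (ε / 4) (by positivity)
  obtain ⟨M, hM⟩ := Metric.cauchySeq_iff'.1 hy (ε / 4) (by positivity)
  refine ⟨M, fun i hi => ?_⟩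
  have h1 := hM i hi
  have h2 := hxy i
  have h3 := hxy M
  rw [Real.dist_eq] at h1 ⊢
  rw [abs_le] at h2 h3
  rw [abs_lt] at h1 ⊢
  constructor <;> linarith

theorem setIntegral_inner_eq {W : Type*} [NormedAddCommGroup W] [InnerProductSpace ℝ W]
    {K : Set (SpaceTime n)} (hK : MeasurableSet K) (f g : SpaceTime n → W) :
    ∫ z in K, inner ℝ (f z) (g z) = ∫ z, inner ℝ (K.indicator f z) (g z) := by
  rw [← integral_indicator hK]
  congr 1
  funext z
  by_cases hz : z ∈ K <;> simp [hz]

theorem TendstoWeaklyL2Loc.tendsto_integral {U K : Set (SpaceTime n)}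
    {vs : ℕ → SpaceTime n → Vec N} {v : SpaceTime n → Vec N} (h : TendstoWeaklyL2Loc U vs v)
    (hKc : IsCompact K) (hK : K ⊆ U) {ψ : SpaceTime n → Vec N} (hψ : MemLp ψ 2) :
    Tendsto (fun i => ∫ z, inner ℝ (K.indicator (vs i) z) (ψ z)) atTop
      (𝓝 (∫ z, inner ℝ (K.indicator v z) (ψ z))) := by
  have := h.2.2 K hKc hK ψ (hψ.restrict K)
  simpa only [setIntegral_inner_eq hKc.measurableSet] using this

theorem inner_smul_single {ι : Type*} [Fintype ι] [DecidableEq ι] (w : EuclideanSpace ℝ ι) (b : ℝ)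
    (k : ι) : inner ℝ w (b • EuclideanSpace.single k (1 : ℝ)) = w k * b := by
  rw [inner_smul_right, EuclideanSpace.inner_single_right]
  simp [mul_comm]

theorem IsTestFunction.memLp_smul_single {ι : Type*} [Fintype ι] [DecidableEq ι]
    {U : Set (SpaceTime n)} {φ : SpaceTime n → ℝ} (hφ : IsTestFunction U φ) (k : ι) (p : ℝ≥0∞) :
    MemLp (fun z => φ z • EuclideanSpace.single k (1 : ℝ)) p := by
  have hc := hφ.1.continuous
  exact Continuous.memLp_of_hasCompactSupport (by fun_prop) hφ.2.1.smul_right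

theorem IsTestFunction.memLp_spaceDeriv_smul_single {ι : Type*} [Fintype ι] [DecidableEq ι]
    {U : Set (SpaceTime n)} {φ : SpaceTime n → ℝ} (hφ : IsTestFunction U φ) (j : Fin n) (k : ι)
    (p : ℝ≥0∞) : MemLp (fun z => spaceDeriv j φ z • EuclideanSpace.single k (1 : ℝ)) p := by
  have hc := hφ.continuous_spaceDeriv j
  refine Continuous.memLp_of_hasCompactSupport (by fun_prop)
    (HasCompactSupport.intro hφ.2.1 fun z hz => ?_)
  rw [spaceDeriv_eq_zero hz, zero_smul]

theorem integral_inner_indicator_eq {W : Type*} [NormedAddCommGroup W] [InnerProductSpace ℝ W]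
    {K K' : Set (SpaceTime n)} (h : K ⊆ K') (f g : SpaceTime n → W) :
    ∫ z, inner ℝ (K.indicator f z) (g z) = ∫ z, inner ℝ (K'.indicator f z) (K.indicator g z) := by
  congr 1
  funext z
  by_cases hz : z ∈ K
  · simp [hz, h hz]
  · simp [hz]

section

variable {Ω : Set (EuclideanSpace ℝ (Fin n))} {T : ℝ} {vs : ℕ → SpaceTime n → Vec N}
  {v : SpaceTime n → Vec N} {Gs : ℕ → SpaceTime n → Grad N n} {K : Set (SpaceTime n)}

/-- Gradients of a weakly convergent sequence converge against test functions. -/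
theorem cauchySeq_integral_test (hweak : TendstoWeaklyL2Loc (cylinder Ω T) vs v)
    (hG : ∀ i, HasWeakGrad Ω T (vs i) (Gs i)) (hKc : IsCompact K) (hK : K ⊆ cylinder Ω T)
    {θ : SpaceTime n → Grad N n} (hθ : IsTestFunction (interior K) θ) :
    CauchySeq fun i => ∫ z, inner ℝ (K.indicator (Gs i) z) (θ z) := by
  have hθq : ∀ q, IsTestFunction (interior K) fun z => θ z q := by
    intro q
    have h1 : ContDiff ℝ ∞ fun z => θ z q := (EuclideanSpace.proj (𝕜 := ℝ) q).contDiff.comp hθ.1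
    have h2 : tsupport (fun z => θ z q) ⊆ tsupport θ :=
      closure_mono fun z hz h0 => hz (by simp [h0])
    exact ⟨h1, hθ.2.1.of_isClosed_subset (isClosed_tsupport _) h2, h2.trans hθ.2.2⟩
  have hm : ∀ i, MemLp (K.indicator (Gs i)) 2 := fun i =>
    (memLp_indicator_iff_restrict hKc.measurableSet).2 ((hG i).grad_memLp K hKc hK)
  have e : ∀ i, ∫ z, inner ℝ (K.indicator (Gs i) z) (θ z) =
      ∑ q : Fin N × Fin n, -∫ z, inner ℝ (K.indicator (vs i) z)
        (spaceDeriv q.2 (fun z => θ z q) z • EuclideanSpace.single q.1 (1 : ℝ)) := by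
    intro i
    have h1 : ∀ z, inner ℝ (K.indicator (Gs i) z) (θ z) =
        ∑ q, inner ℝ (K.indicator (Gs i) z) (θ z q • EuclideanSpace.single q (1 : ℝ)) := by
      intro z
      simp only [inner_smul_single]
      simp [PiLp.inner_apply, mul_comm]
    simp only [h1]
    rw [integral_finsetSum _ fun q _ =>
      integrable_inner_of_memLp (hm i) ((hθq q).memLp_smul_single q 2)]
    refine Finset.sum_congr rfl fun q _ => ?_
    simp only [inner_smul_single]
    have h2 := (hG i).locGrad hK _ (hθq q) q.1 q.2
    rw [h2, neg_neg]
  simp only [e]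
  exact (tendsto_finsetSum _ fun q _ => (hweak.tendsto_integral hKc hK
    ((hθq q).memLp_spaceDeriv_smul_single q.2 q.1 2)).neg).cauchySeq

theorem exists_compact_between_cylinder (hΩ : IsOpen Ω) (hKc : IsCompact K)
    (hK : K ⊆ cylinder Ω T) :
    ∃ K', IsCompact K' ∧ K ⊆ interior K' ∧ K' ⊆ cylinder Ω T :=
  exists_compact_between hKc (hΩ.prod isOpen_Ioo) hK

/-- Against smooth compactly supported functions the pairings converge after integration by parts;
density and the uniform gradient bound extend this to `L²`. -/
theorem cauchySeq_integral_grad (hΩ : IsOpen Ω) (hweak : TendstoWeaklyL2Loc (cylinder Ω T) vs v)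
    (hG : ∀ i, HasWeakGrad Ω T (vs i) (Gs i))
    (hbound : ∀ K : Set (SpaceTime n), IsCompact K → K ⊆ cylinder Ω T →
      ∃ C, ∀ i, ∫ z, ‖K.indicator (Gs i) z‖ ^ 2 ≤ C)
    (hKc : IsCompact K) (hK : K ⊆ cylinder Ω T) {ψ : SpaceTime n → Grad N n} (hψ : MemLp ψ 2) :
    CauchySeq fun i => ∫ z, inner ℝ (K.indicator (Gs i) z) (ψ z) := by
  obtain ⟨K', hK'c, hKK', hK'⟩ := exists_compact_between_cylinder hΩ hKc hK
  obtain ⟨C, hC⟩ := hbound K' hK'c hK'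
  have hC0 : 0 ≤ C := (integral_nonneg fun z => by positivity).trans (hC 0)
  obtain ⟨Λ, χ, hΛ, hχ, hχ1⟩ := exists_isCutoff hKc isOpen_interior hKK'
  have hm : ∀ i, MemLp (K'.indicator (Gs i)) 2 := fun i =>
    (memLp_indicator_iff_restrict hK'c.measurableSet).2 ((hG i).grad_memLp K' hK'c hK')
  have hψK : MemLp (K.indicator ψ) 2 := hψ.indicator hKc.measurableSet
  refine cauchySeq_of_approx fun ε hε => ?_
  -- The weight `l` and the precision `δ` are matched so that `l` times the gradient bound and `δ² /
  -- l` are each at most `ε / 2`.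
  set l : ℝ := ε / (2 * (C + 1)) with hl
  have hl0 : 0 < l := by positivity
  set δ : ℝ := Real.sqrt (ε * l / 2) with hδ
  have hδ0 : 0 < δ := Real.sqrt_pos.2 (by positivity)
  obtain ⟨φ, hφc, hφ, hφd⟩ := hψK.exist_eLpNorm_sub_le (by simp) (by norm_num) hδ0
  -- Multiplying the approximation by `χ` brings its support into the interior of `K'`; since `χ =
  -- 1` on `K` the error does not grow.
  set θ : SpaceTime n → Grad N n := fun z => χ z • φ z with hθ
  have hθt : IsTestFunction (interior K') θ :=
    ⟨hχ.test.1.smul hφ, hχ.test.2.1.smul_right, (tsupport_smul_subset_left χ φ).trans hχ.test.2.2⟩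
  have hφm : MemLp φ 2 := hφ.continuous.memLp_of_hasCompactSupport hφc
  have hθm : MemLp θ 2 := hθt.1.continuous.memLp_of_hasCompactSupport hθt.2.1
  refine ⟨_, cauchySeq_integral_test hweak hG hK'c hK' hθt, fun i => ?_⟩
  rw [integral_inner_indicator_eq (hKK'.trans interior_subset), ← integral_sub
    (integrable_inner_of_memLp (hm i) hψK) (integrable_inner_of_memLp (hm i) hθm)]
  simp only [← inner_sub_right]
  refine (abs_integral_inner_le (hm i) (hψK.sub hθm) hl0).trans ?_
  have h1 : ∫ z, ‖K.indicator ψ z - θ z‖ ^ 2 ≤ δ ^ 2 := by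
    refine le_trans (integral_mono_of_nonneg_right (g := fun z => ‖K.indicator ψ z - φ z‖ ^ 2)
      (integrable_norm_sq (hψK.sub hφm)) (fun z => by positivity) (ae_of_all _ fun z => ?_)) ?_
    · have : K.indicator ψ z - θ z = χ z • (K.indicator ψ z - φ z) := by
        by_cases hz : z ∈ K
        · simp [hz, hθ, hχ1 z hz]
        · simp [hz, hθ]
      rw [this, norm_smul, Real.norm_of_nonneg (hχ.nonneg z)]
      exact pow_le_pow_left₀ (mul_nonneg (hχ.nonneg z) (norm_nonneg _))
        (mul_le_of_le_one_left (norm_nonneg _) (hχ.le_one z)) 2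
    · have h2 := integral_norm_sq_eq (hψK.sub hφm)
      simp only [Pi.sub_apply] at h2
      rw [h2]
      gcongr
      exact ENNReal.toReal_le_of_le_ofReal hδ0.le hφd
  have h2 : l * ∫ z, ‖K'.indicator (Gs i) z‖ ^ 2 ≤ ε / 2 := by
    have : l * ∫ z, ‖K'.indicator (Gs i) z‖ ^ 2 ≤ l * (C + 1) := by
      gcongr; linarith [hC i]
    refine this.trans (le_of_eq ?_)
    rw [hl]; field_simp
  have h3 : l⁻¹ * ∫ z, ‖K.indicator ψ z - θ z‖ ^ 2 ≤ ε / 2 := by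
    refine (mul_le_mul_of_nonneg_left h1 (by positivity)).trans (le_of_eq ?_)
    rw [hδ, Real.sq_sqrt (by positivity)]; field_simp
  simp only [Pi.sub_apply]
  linarith

/-- Weak limits on the sets of a compact exhaustion agree almost everywhere on overlaps and are
glued to one function. -/
theorem exists_grad_limit (hΩ : IsOpen Ω) (hweak : TendstoWeaklyL2Loc (cylinder Ω T) vs v)
    (hG : ∀ i, HasWeakGrad Ω T (vs i) (Gs i))
    (hbound : ∀ K : Set (SpaceTime n), IsCompact K → K ⊆ cylinder Ω T →
      ∃ C, ∀ i, ∫ z, ‖K.indicator (Gs i) z‖ ^ 2 ≤ C) :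
    ∃ G : SpaceTime n → Grad N n, ∀ K : Set (SpaceTime n), IsCompact K → K ⊆ cylinder Ω T →
      MemLp (K.indicator G) 2 ∧ ∀ ψ : SpaceTime n → Grad N n, MemLp ψ 2 →
        Tendsto (fun i => ∫ z, inner ℝ (K.indicator (Gs i) z) (ψ z)) atTop
          (𝓝 (∫ z, inner ℝ (K.indicator G z) (ψ z))) := by
  have hU : IsOpen (cylinder Ω T) := hΩ.prod isOpen_Ioo
  have hm : ∀ K : Set (SpaceTime n), IsCompact K → K ⊆ cylinder Ω T → ∀ i,
      MemLp (K.indicator (Gs i)) 2 := fun K hKc hK i =>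
    (memLp_indicator_iff_restrict hKc.measurableSet).2 ((hG i).grad_memLp K hKc hK)
  have := hU.locallyCompactSpace
  set E := CompactExhaustion.choice (cylinder Ω T) with hE
  set Ks : ℕ → Set (SpaceTime n) := fun j => Subtype.val '' E j with hKs
  have hKsc : ∀ j, IsCompact (Ks j) := fun j => (E.isCompact j).image continuous_subtype_val
  have hKsU : ∀ j, Ks j ⊆ cylinder Ω T := fun j => by
    rintro _ ⟨z, -, rfl⟩; exact z.2
  have hKsm : ∀ {j k}, j ≤ k → Ks j ⊆ Ks k := fun h => image_mono (E.subset h)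
  choose g hgm hg using fun j => exists_weak_limit (hm _ (hKsc j) (hKsU j)) fun ψ hψ =>
    cauchySeq_integral_grad hΩ hweak hG hbound (hKsc j) (hKsU j) hψ
  have hcons : ∀ j k, j ≤ k → ∀ᵐ z, g j z = (Ks j).indicator (g k) z := by
    intro j k hjk
    have hind := (hgm k).indicator (hKsc j).measurableSet
    refine ae_eq_of_integral_inner_eq (hgm j) hind fun ψ hψ => ?_
    have h1 := hg j ψ hψ
    simp only [integral_inner_indicator_eq (hKsm hjk)] at h1
    rw [tendsto_nhds_unique h1 (hg k _ (hψ.indicator (hKsc j).measurableSet))]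
    congr 1
    funext z
    by_cases hz : z ∈ Ks j <;> simp [hz]
  classical
  -- At each point the limit belonging to the first exhausting set containing it is used.
  set G : SpaceTime n → Grad N n := fun z =>
    if hz : z ∈ cylinder Ω T then g (E.find ⟨z, hz⟩) z else 0 with hGdef
  have hGj : ∀ j, ∀ᵐ z, (Ks j).indicator G z = (Ks j).indicator (g j) z := by
    intro j
    have h1 : ∀ᵐ z, ∀ k, k ≤ j → g k z = (Ks k).indicator (g j) z := by
      rw [ae_all_iff]
      intro k
      by_cases hk : k ≤ j
      · filter_upwards [hcons k j hk] with z hz _ using hz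
      · exact ae_of_all _ fun z h => absurd h hk
    filter_upwards [h1] with z hz
    by_cases hzj : z ∈ Ks j
    · have hzU := hKsU j hzj
      have hfind : E.find ⟨z, hzU⟩ ≤ j := by
        rw [← E.mem_iff_find_le]
        obtain ⟨w, hw, hwz⟩ := hzj
        have : w = ⟨z, hzU⟩ := Subtype.ext hwz
        rwa [← this]
      rw [indicator_of_mem hzj, indicator_of_mem hzj]
      simp only [hGdef, hzU, dif_pos]
      rw [hz _ hfind, indicator_of_mem]
      exact ⟨⟨z, hzU⟩, E.mem_find _, rfl⟩
    · simp [hzj]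
  refine ⟨G, fun K hKc hK => ?_⟩
  obtain ⟨j, hj⟩ : ∃ j, K ⊆ Ks j := by
    have hc : IsCompact ((Subtype.val : cylinder Ω T → SpaceTime n) ⁻¹' K) :=
      Topology.IsInducing.subtypeVal.isCompact_preimage' hKc (by simpa using hK)
    obtain ⟨j, hj⟩ := E.exists_superset_of_isCompact hc
    exact ⟨j, fun z hz => ⟨⟨z, hK hz⟩, hj hz, rfl⟩⟩
  have hKG : ∀ᵐ z, K.indicator G z = K.indicator (g j) z := by
    filter_upwards [hGj j] with z hz
    by_cases hzK : z ∈ K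
    · simpa [hzK, hj hzK] using hz
    · simp [hzK]
  refine ⟨((hgm j).indicator hKc.measurableSet).ae_eq (hKG.mono fun z hz => hz.symm),
    fun ψ hψ => ?_⟩
  have h1 := hg j _ (hψ.indicator hKc.measurableSet)
  simp only [integral_inner_indicator_eq hj]
  convert h1 using 2
  refine integral_congr_ae ?_
  filter_upwards [hGj j] with z hz
  by_cases hzK : z ∈ K
  · rw [hz, indicator_of_mem (hj hzK)]
  · simp [hzK]

/-- Both sides of the integration by parts formula are pairings with fixed `L²` functions on a
compact neighbourhood of the support, so it passes to the weak limits. -/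
theorem exists_hasWeakGrad (hΩ : IsOpen Ω) (hweak : TendstoWeaklyL2Loc (cylinder Ω T) vs v)
    (hG : ∀ i, HasWeakGrad Ω T (vs i) (Gs i))
    (hbound : ∀ K : Set (SpaceTime n), IsCompact K → K ⊆ cylinder Ω T →
      ∃ C, ∀ i, ∫ z, ‖K.indicator (Gs i) z‖ ^ 2 ≤ C) :
    ∃ G : SpaceTime n → Grad N n, HasWeakGrad Ω T v G ∧
      ∀ K : Set (SpaceTime n), IsCompact K → K ⊆ cylinder Ω T →
        ∀ ψ : SpaceTime n → Grad N n, MemLp ψ 2 →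
        Tendsto (fun i => ∫ z, inner ℝ (K.indicator (Gs i) z) (ψ z)) atTop
          (𝓝 (∫ z, inner ℝ (K.indicator G z) (ψ z))) := by
  obtain ⟨G, hGl⟩ := exists_grad_limit hΩ hweak hG hbound
  refine ⟨G, ⟨hweak.2.1, fun K hKc hK => ?_, fun φ hφ k j => ?_⟩, fun K hKc hK => (hGl K hKc hK).2⟩
  · exact (memLp_indicator_iff_restrict hKc.measurableSet).1 (hGl K hKc hK).1
  · obtain ⟨K, hKc, hφK, hK⟩ := exists_compact_between_cylinder hΩ hφ.2.1 hφ.2.2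
    have hφ' : IsTestFunction (interior K) φ := ⟨hφ.1, hφ.2.1, hφK⟩
    have hz : ∀ z ∉ K, z ∉ tsupport φ := fun z hz h => hz (interior_subset (hφK h))
    have e1 : ∀ w : SpaceTime n → Vec N, ∫ z in cylinder Ω T, w z k * spaceDeriv j φ z =
        ∫ z, K.indicator w z k * spaceDeriv j φ z := by
      intro w
      rw [setIntegral_eq_integral_of_forall_compl_eq_zero]
      · congr 1
        funext z
        by_cases hzK : z ∈ K
        · simp [hzK]
        · simp [hzK, spaceDeriv_eq_zero (hz z hzK)]
      · intro z hzc
        simp [spaceDeriv_eq_zero (hz z fun h => hzc (hK h))]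
    have e2 : ∀ w : SpaceTime n → Grad N n, ∫ z in cylinder Ω T, w z (k, j) * φ z =
        ∫ z, K.indicator w z (k, j) * φ z := by
      intro w
      rw [setIntegral_eq_integral_of_forall_compl_eq_zero]
      · congr 1
        funext z
        by_cases hzK : z ∈ K
        · simp [hzK]
        · simp [hzK, image_eq_zero_of_notMem_tsupport (hz z hzK)]
      · intro z hzc
        simp [image_eq_zero_of_notMem_tsupport (hz z fun h => hzc (hK h))]
    rw [e1, e2]
    have h1 := hweak.tendsto_integral hKc hK (hφ.memLp_spaceDeriv_smul_single j k 2)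
    have h2 := ((hGl K hKc hK).2 _ (hφ.memLp_smul_single (k, j) 2)).neg
    simp only [inner_smul_single] at h1 h2
    refine tendsto_nhds_unique h1 ?_
    convert h2 using 2 with i
    exact (hG i).locGrad hK φ hφ' k j

end

/-! ### Strong convergence and the limit equation -/

theorem tendsto_integral_norm_of_eLpNorm_two {X W : Type*} [MeasurableSpace X] {μ : Measure X}
    [IsFiniteMeasure μ] [NormedAddCommGroup W] {fs : ℕ → X → W} (hfs : ∀ i, MemLp (fs i) 2 μ)
    (h : Tendsto (fun i => eLpNorm (fs i) 2 μ) atTop (𝓝 0)) :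
    Tendsto (fun i => ∫ x, ‖fs i x‖ ∂μ) atTop (𝓝 0) := by
  have h1 : Tendsto (fun i => eLpNorm (fs i) 1 μ) atTop (𝓝 0) := by
    have h2 : Tendsto (fun i => eLpNorm (fs i) 2 μ *
        μ univ ^ (1 / (1 : ℝ≥0∞).toReal - 1 / (2 : ℝ≥0∞).toReal)) atTop (𝓝 0) := by
      rw [← zero_mul (μ univ ^ (1 / (1 : ℝ≥0∞).toReal - 1 / (2 : ℝ≥0∞).toReal))]
      refine ENNReal.Tendsto.mul_const h (Or.inr ?_)
      exact ENNReal.rpow_ne_top_of_nonneg (by norm_num) (measure_ne_top _ _)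
    exact tendsto_of_tendsto_of_tendsto_of_le_of_le tendsto_const_nhds h2 (fun i => zero_le)
      fun i => eLpNorm_le_eLpNorm_mul_rpow_measure_univ (by norm_num) (hfs i).1
  have h3 : ∀ i, ∫ x, ‖fs i x‖ ∂μ = (eLpNorm (fs i) 1 μ).toReal := fun i => by
    rw [eLpNorm_one_eq_lintegral_enorm, integral_norm_eq_lintegral_enorm (hfs i).1]
  simp only [h3]
  exact (ENNReal.tendsto_toReal ENNReal.zero_ne_top).comp h1

/-- Continuity of a Nemytskii operator of linear growth. -/
theorem tendsto_integral_inner_comp {X E : Type*} [MeasurableSpace X] {μ : Measure X}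
    [IsFiniteMeasure μ] [NormedAddCommGroup E] [InnerProductSpace ℝ E] {a : X → E → E} {L B : ℝ}
    (hL : 0 ≤ L) (ha : ∀ᵐ x ∂μ, Continuous (a x)) (hgrowth : ∀ᵐ x ∂μ, ∀ ξ, ‖a x ξ‖ ≤ L * ‖ξ‖)
    {gs : ℕ → X → E} {g y : X → E} (hgs : ∀ i, MemLp (gs i) 2 μ) (hg : MemLp g 2 μ)
    (has : ∀ i, AEStronglyMeasurable (fun x => a x (gs i x)) μ)
    (hag : AEStronglyMeasurable (fun x => a x (g x)) μ) (hy : AEStronglyMeasurable y μ)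
    (hyB : ∀ x, ‖y x‖ ≤ B)
    (h : Tendsto (fun i => eLpNorm (fun x => gs i x - g x) 2 μ) atTop (𝓝 0)) :
    Tendsto (fun i => ∫ x, inner ℝ (a x (gs i x)) (y x) ∂μ) atTop
      (𝓝 (∫ x, inner ℝ (a x (g x)) (y x) ∂μ)) := by
  have hd : ∀ i, MemLp (fun x => gs i x - g x) 2 μ := fun i => (hgs i).sub hg
  have h1 := tendsto_integral_norm_of_eLpNorm_two hd h
  have hFs : ∀ i, MemLp (fun x => a x (gs i x)) 2 μ := fun i =>
    (hgs i).of_le_mul (has i) (hgrowth.mono fun x hx => hx _)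
  have hF : MemLp (fun x => a x (g x)) 2 μ := hg.of_le_mul hag (hgrowth.mono fun x hx => hx _)
  have hyL : MemLp y 2 μ := MemLp.of_bound hy B (ae_of_all _ hyB)
  -- Every subsequence has a further one along which the arguments converge almost everywhere; it
  -- suffices to treat that one.
  refine tendsto_of_subseq_tendsto fun ns hns => ?_
  have hmeas : TendstoInMeasure μ (fun i x => gs (ns i) x) atTop g :=
    tendstoInMeasure_of_tendsto_eLpNorm two_ne_zero (fun i => (hgs _).1) hg.1 (h.comp hns)
  obtain ⟨ks, hks, hae⟩ := hmeas.exists_seq_tendsto_ae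
  refine ⟨ks, ?_⟩
  -- The difference `D` of the fields satisfies `D ≤ min D (2 L |g|) + L |gᵢ - g|`. The minimum has
  -- the fixed integrable majorant `2 L |g|`, so dominated convergence applies, and the rest tends
  -- to zero in `L¹`.
  have hlim : Tendsto (fun j => ∫ x, min ‖a x (gs (ns (ks j)) x) - a x (g x)‖ (2 * L * ‖g x‖) ∂μ)
      atTop (𝓝 (∫ _, (0 : ℝ) ∂μ)) := by
    refine tendsto_integral_of_dominated_convergence (fun x => 2 * L * ‖g x‖) (fun j => ?_)
      ((hg.integrable one_le_two).norm.const_mul _) (fun j => ae_of_all _ fun x => ?_) ?_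
    · exact ((has _).sub hag).norm.inf (hg.1.norm.const_mul _)
    · rw [Real.norm_of_nonneg (by positivity)]
      exact min_le_right _ _
    · filter_upwards [hae, ha] with x hx hax
      have h2 : Tendsto (fun j => ‖a x (gs (ns (ks j)) x) - a x (g x)‖) atTop (𝓝 0) := by
        have := ((hax.tendsto (g x)).comp hx).sub_const (a x (g x))
        rw [sub_self] at this
        simpa using this.norm
      refine squeeze_zero (fun j => by positivity) (fun j => min_le_left _ _) h2
  rw [integral_zero] at hlim
  have hsum : Tendsto (fun j => B * (∫ x, min ‖a x (gs (ns (ks j)) x) - a x (g x)‖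
      (2 * L * ‖g x‖) ∂μ) + B * L * ∫ x, ‖gs (ns (ks j)) x - g x‖ ∂μ) atTop (𝓝 0) := by
    have := (hlim.const_mul B).add (((h1.comp hns).comp hks.tendsto_atTop).const_mul (B * L))
    simpa using this
  rw [tendsto_iff_norm_sub_tendsto_zero]
  refine squeeze_zero (fun j => norm_nonneg _) (fun j => ?_) hsum
  have hi1 := integrable_inner_of_memLp (hFs (ns (ks j))) hyL
  have hi2 := integrable_inner_of_memLp hF hyL
  have hi3 : Integrable (fun x => min ‖a x (gs (ns (ks j)) x) - a x (g x)‖ (2 * L * ‖g x‖)) μ :=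
    (((hFs _).sub hF).integrable one_le_two).norm.inf ((hg.integrable one_le_two).norm.const_mul _)
  have hi4 : Integrable (fun x => ‖gs (ns (ks j)) x - g x‖) μ := ((hd _).integrable one_le_two).norm
  rw [← integral_sub hi1 hi2, ← integral_const_mul, ← integral_const_mul,
    ← integral_add (hi3.const_mul _) (hi4.const_mul _)]
  refine norm_integral_le_of_norm_le ((hi3.const_mul _).add (hi4.const_mul _)) ?_
  filter_upwards [hgrowth] with x hx
  rw [← inner_sub_left]
  refine (norm_inner_le_norm _ _).trans ?_
  set D := ‖a x (gs (ns (ks j)) x) - a x (g x)‖ with hD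
  have h3 : D ≤ min D (2 * L * ‖g x‖) + L * ‖gs (ns (ks j)) x - g x‖ := by
    have h4 : D ≤ L * ‖gs (ns (ks j)) x‖ + L * ‖g x‖ :=
      (norm_sub_le _ _).trans (add_le_add (hx _) (hx _))
    have h5 : ‖gs (ns (ks j)) x‖ ≤ ‖g x‖ + ‖gs (ns (ks j)) x - g x‖ := norm_le_insert' _ _
    have h6 := mul_le_mul_of_nonneg_left h5 hL
    rcases min_choice D (2 * L * ‖g x‖) with h7 | h7 <;> rw [h7]
    · have : 0 ≤ L * ‖gs (ns (ks j)) x - g x‖ := by positivity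
      linarith
    · linarith
  have hB0 : 0 ≤ B := (norm_nonneg _).trans (hyB x)
  calc D * ‖y x‖ ≤ D * B := mul_le_mul_of_nonneg_left (hyB x) (norm_nonneg _)
    _ = B * D := mul_comm _ _
    _ ≤ B * (min D (2 * L * ‖g x‖) + L * ‖gs (ns (ks j)) x - g x‖) :=
        mul_le_mul_of_nonneg_left h3 hB0
    _ = _ := by ring

/-- Convergence to zero of a weighted square integral yields convergence in `L²`. -/
theorem tendsto_eLpNorm_of_cutoff {W : Type*} [NormedAddCommGroup W] {K K₀ : Set (SpaceTime n)}
    (hKm : MeasurableSet K) (hK₀ : MeasurableSet K₀) (hKK : K₀ ⊆ K) {fs : ℕ → SpaceTime n → W}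
    {f : SpaceTime n → W} (hfs : ∀ i, MemLp (K.indicator (fs i)) 2) (hf : MemLp (K.indicator f) 2)
    {χ : SpaceTime n → ℝ} {U : Set (SpaceTime n)} (hχ : IsTestFunction U χ) (hχ0 : ∀ z, 0 ≤ χ z)
    (hχ1 : ∀ z ∈ K₀, χ z = 1)
    (h : Tendsto (fun i => ∫ z, χ z * ‖K.indicator (fs i) z - K.indicator f z‖ ^ 2) atTop (𝓝 0)) :
    Tendsto (fun i => eLpNorm (fun z => fs i z - f z) 2 (volume.restrict K₀)) atTop (𝓝 0) := by
  obtain ⟨B, hB0, hB⟩ := hχ.exists_bound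
  have hm : ∀ i, MemLp (fun z => fs i z - f z) 2 (volume.restrict K₀) := fun i =>
    (((memLp_indicator_iff_restrict hKm).1 (hfs i)).sub
      ((memLp_indicator_iff_restrict hKm).1 hf)).mono_measure (Measure.restrict_mono_set _ hKK)
  have h1 : Tendsto (fun i => ∫ z in K₀, ‖fs i z - f z‖ ^ 2) atTop (𝓝 0) := by
    refine squeeze_zero (fun i => integral_nonneg fun z => by positivity) (fun i => ?_) h
    rw [← integral_indicator hK₀]
    have hi : Integrable fun z => χ z * ‖K.indicator (fs i) z - K.indicator f z‖ ^ 2 :=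
      (integrable_norm_sq ((hfs i).sub hf)).bdd_mul (c := B)
        hχ.continuous.aestronglyMeasurable (ae_of_all _ fun z => (hB z).1)
    refine integral_mono_of_nonneg_right hi
      (fun z => mul_nonneg (hχ0 z) (by positivity)) (ae_of_all _ fun z => ?_)
    by_cases hz : z ∈ K₀
    · simp [hz, hKK hz, hχ1 z hz]
    · simpa [hz] using mul_nonneg (hχ0 z) (by positivity)
  simp only [fun i => integral_norm_sq_eq (hm i)] at h1
  have h2 : Tendsto (fun i => (eLpNorm (fun z => fs i z - f z) 2 (volume.restrict K₀)).toReal)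
      atTop (𝓝 0) := by
    have := h1.sqrt
    simpa [Real.sqrt_sq ENNReal.toReal_nonneg] using this
  have h3 := ENNReal.tendsto_ofReal h2
  simpa [ENNReal.ofReal_toReal (hm _).2.ne] using h3

/-! ### Assembling the local limits and passing to the limit in the equation. -/

section

variable {Ω : Set (EuclideanSpace ℝ (Fin n))} {T ν L μ m δ s : ℝ}
  {A : SpaceTime n → Vec N → Grad N n → Grad N n} {ms : ℕ → ℝ} {us : ℕ → SpaceTime n → Vec N}
  {Gs : ℕ → SpaceTime n → Grad N n} {u v : SpaceTime n → Vec N} {G : SpaceTime n → Grad N n}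

/-- Collects the bounds on one compact set. The `L^s` bound for the limit comes from weak lower
semicontinuity, and one constant, the sum of all bounds, serves every estimate. -/
theorem exists_localLim (hA : IsAdmissibleField Ω T ν L μ A) (hμ : 0 < μ)
    (hm : 0 < m) (hδ : δ < 1 / m) (hs : 2 < s) (hδs : 1 + (1 / m + δ) < s) (hm0 : ∀ i, 0 < ms i)
    (hms : ∀ i, |1 / ms i - 1 / m| ≤ δ) (hlim : Tendsto ms atTop (𝓝 m))
    (hsol : ∀ i, IsSolWith Ω T A (ms i) (us i) (Gs i))
    (hweak : TendstoWeaklyL2Loc (cylinder Ω T) (fun i z => vpow (ms i) (us i z)) v)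
    (hG : HasWeakGrad Ω T v G) {K : Set (SpaceTime n)} (hKc : IsCompact K) (hK : K ⊆ cylinder Ω T)
    (hbound : ∃ C, 0 ≤ C ∧ ∀ i, MemLp (K.indicator fun z => vpow (ms i) (us i z)) (ENNReal.ofReal s) ∧
      ∫ z, ‖K.indicator (fun z => vpow (ms i) (us i z)) z‖ ^ s ≤ C ∧
      ∫ z, ‖K.indicator (Gs i) z‖ ^ 2 ≤ C)
    (hGw : ∀ ψ : SpaceTime n → Grad N n, MemLp ψ 2 →
      Tendsto (fun i => ∫ z, inner ℝ (K.indicator (Gs i) z) (ψ z)) atTop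
        (𝓝 (∫ z, inner ℝ (K.indicator G z) (ψ z)))) :
    ∃ C, LocalLim K (interior K) ν L (1 / m - δ) (1 / m + δ) s C (fun i => 1 / ms i) (1 / m)
      (fun i => K.indicator fun z => vpow (ms i) (us i z)) (K.indicator v)
      (fun i => K.indicator (Gs i)) (K.indicator G)
      (fun i => K.indicator fun z => A z 0 (Gs i z)) := by
  obtain ⟨C₁, hC₁, hb⟩ := hbound
  obtain ⟨C₂, hC₂⟩ := hweak.exists_bound hKc hK
  have hloc := fun i => (hsol i).localSol hA hμ (hm0 i) hKc hK
  have hv2 : MemLp (K.indicator v) 2 :=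
    (memLp_indicator_iff_restrict hKc.measurableSet).2 (hG.memLp K hKc hK)
  have hG2 : MemLp (K.indicator G) 2 :=
    (memLp_indicator_iff_restrict hKc.measurableSet).2 (hG.grad_memLp K hKc hK)
  have hwv := fun ψ hψ => hweak.tendsto_integral hKc hK (ψ := ψ) hψ
  have hvs := memLp_of_tendsto_weak hKc (by linarith : 1 < s) (fun i => (hb i).1)
    (fun i => (hb i).2.1) hv2.1 (fun z hz => indicator_of_notMem hz _) hwv
  have hF : ∀ i, ∫ z, ‖K.indicator (fun z => A z 0 (Gs i z)) z‖ ^ 2 ≤ L ^ 2 * C₁ := by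
    intro i
    refine le_trans ?_ (mul_le_mul_of_nonneg_left (hb i).2.2 (sq_nonneg L))
    rw [← integral_const_mul]
    refine integral_mono_of_nonneg_right ((integrable_norm_sq (hloc i).G_memLp).const_mul _)
      (fun z => by positivity) ?_
    filter_upwards [(hloc i).growth] with z hz
    rw [← mul_pow]
    exact pow_le_pow_left₀ (norm_nonneg _) hz 2
  refine ⟨C₁ + |C₂| + L ^ 2 * C₁ + (∫ z, ‖K.indicator v z‖ ^ 2) + ∫ z, ‖K.indicator G z‖ ^ 2, ?_⟩
  have p1 : 0 ≤ |C₂| := abs_nonneg _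
  have p2 : 0 ≤ L ^ 2 * C₁ := by positivity
  have p3 : 0 ≤ ∫ z, ‖K.indicator v z‖ ^ 2 := integral_nonneg fun z => by positivity
  have p4 : 0 ≤ ∫ z, ‖K.indicator G z‖ ^ 2 := integral_nonneg fun z => by positivity
  exact {
    sol := hloc
    lo_pos := by linarith
    hi_lt := hδs
    two_lt := hs
    mem := fun i => by
      have := abs_le.1 (hms i)
      exact ⟨by linarith, by linarith⟩
    lim := by simpa using hlim.inv₀ hm.ne'
    memLp_s := fun i => (hb i).1
    bound_s := fun i => by linarith [(hb i).2.1]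
    bound_two := fun i => by linarith [hC₂ i, le_abs_self C₂]
    bound_G := fun i => by linarith [(hb i).2.2]
    bound_F := fun i => by linarith [hF i]
    v_eq_zero := fun z hz => indicator_of_notMem hz _
    G_eq_zero := fun z hz => indicator_of_notMem hz _
    v_memLp := hv2
    v_memLp_s := hvs.1
    G_memLp := hG2
    v_bound_s := by linarith [hvs.2]
    v_bound_two := by linarith
    G_bound := by linarith
    grad := hG.locGrad hK
    weak_v := hwv
    weak_G := hGw }

/-- The bounds give a weak gradient limit, first on compact sets and then globally; strong
convergence on a compact set is read off on a larger one with a cut-off equal to one on the smaller.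
-/
theorem exists_isSolWith_limit (hn : 2 ≤ n) (hΩ : IsOpen Ω) (hA : IsAdmissibleField Ω T ν L μ A)
    (hμ : 0 < μ) (hν : 0 < ν) (hL : 0 ≤ L) {q : ℝ} (hq : 2 < q)
    (hqn : 1 / 2 - 1 / (n : ℝ) < 1 / q) (hm : 0 < m) (hδ : δ < 1 / m)
    (hδq : δ ≤ (1 + (1 / m - δ)) * (1 - 2 / q) / 16)
    (hsq : s = 2 + (1 + (1 / m - δ)) * (1 - 2 / q)) (hs : 2 < s) (hδs : 1 + (1 / m + δ) < s)
    (hm0 : ∀ i, 0 < ms i) (hms : ∀ i, |1 / ms i - 1 / m| ≤ δ) (hlim : Tendsto ms atTop (𝓝 m))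
    (hsol : ∀ i, IsSolWith Ω T A (ms i) (us i) (Gs i))
    (hweak : TendstoWeaklyL2Loc (cylinder Ω T) (fun i z => vpow (ms i) (us i z))
      fun z => vpow m (u z))
    (hbdd : m < 1 → BoundedL1Loc (cylinder Ω T) (fun i z => vpow (ms i + 1) (us i z))) :
    ∃ G, IsSolWith Ω T A m u G ∧ ∀ K : Set (SpaceTime n), IsCompact K → K ⊆ cylinder Ω T →
      Tendsto (fun i => eLpNorm (fun z => vpow (ms i) (us i z) - vpow m (u z)) 2
        (volume.restrict K)) atTop (𝓝 0) ∧
      Tendsto (fun i => eLpNorm (fun z => Gs i z - G z) 2 (volume.restrict K)) atTop (𝓝 0) := by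
  have hbound := fun K hKc hK => exists_bounds (K₀ := K) hn hΩ hA hμ hν hL hq hqn hm hδ hδq hsq hm0
    hms hsol hweak hbdd hKc hK
  obtain ⟨G, hG, hGw⟩ := exists_hasWeakGrad hΩ hweak (fun i => (hsol i).grad) fun K hKc hK => by
    obtain ⟨C, -, hC⟩ := hbound K hKc hK
    exact ⟨C, fun i => (hC i).2.2⟩
  have hloc := fun K hKc hK => exists_localLim (K := K) hA hμ hm hδ hs hδs hm0 hms hlim hsol hweak hG
    hKc hK (hbound K hKc hK) (hGw K hKc hK)
  have hδ0 : 0 ≤ δ := (abs_nonneg _).trans (hms 0)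
  have hvp : ∀ K : Set (SpaceTime n), IsCompact K → K ⊆ cylinder Ω T →
      MemLp (K.indicator fun z => vpow m (u z)) (ENNReal.ofReal (1 + 1 / m)) := by
    intro K hKc hK
    obtain ⟨C, hC⟩ := hloc K hKc hK
    exact hC.v_memLp_s.mono_exponent_of_measure_support_ne_top
      (fun z hz => indicator_of_notMem hz _) hKc.measure_lt_top.ne
      (ENNReal.ofReal_le_ofReal (by linarith))
  have hstrong : ∀ K : Set (SpaceTime n), IsCompact K → K ⊆ cylinder Ω T →
      Tendsto (fun i => eLpNorm (fun z => vpow (ms i) (us i z) - vpow m (u z)) 2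
        (volume.restrict K)) atTop (𝓝 0) ∧
      Tendsto (fun i => eLpNorm (fun z => Gs i z - G z) 2 (volume.restrict K)) atTop (𝓝 0) := by
    intro K₀ hK₀c hK₀
    obtain ⟨K, hKc, hKK, hK⟩ := exists_compact_between_cylinder hΩ hK₀c hK₀
    obtain ⟨C, hC⟩ := hloc K hKc hK
    obtain ⟨Λ, χ, -, hχ, hχ1⟩ := exists_isCutoff hK₀c isOpen_interior hKK
    have hle : volume.restrict K ≤ volume.restrict (cylinder Ω T) := Measure.restrict_mono_set _ hK
    have hmono : ∀ i, ∀ᵐ z, μ * ‖K.indicator (Gs i) z - K.indicator G z‖ ^ 2 ≤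
        inner ℝ (K.indicator (fun z => A z 0 (Gs i z)) z - K.indicator (fun z => A z 0 (G z)) z)
          (K.indicator (Gs i) z - K.indicator G z) := by
      intro i
      filter_upwards [(ae_restrict_iff' hKc.measurableSet).1 (ae_mono hle hA.monotone)] with z hz
      by_cases hzK : z ∈ K
      · simpa [hzK] using hz hzK 0 0 (Gs i z) (G z)
      · simp [hzK]
    have hF := hA.memLp_indicator hKc hK (hG.grad_memLp K hKc hK)
    exact ⟨tendsto_eLpNorm_of_cutoff hKc.measurableSet hK₀c.measurableSet
        (hKK.trans interior_subset) (fun i => (hC.sol i).v_memLp) hC.v_memLp hχ.test hχ.nonneg hχ1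
        (hC.tendsto_integral_sq hχ.test hχ.nonneg),
      tendsto_eLpNorm_of_cutoff hKc.measurableSet hK₀c.measurableSet
        (hKK.trans interior_subset) (fun i => (hC.sol i).G_memLp) hC.G_memLp hχ.test hχ.nonneg hχ1
        (hC.tendsto_integral_grad hF hμ hmono hχ.test hχ.nonneg)⟩
  refine ⟨G, ⟨fun _ K hKc hK => ?_, hG, fun φ hφ => ?_⟩, hstrong⟩
  · have h1 := memLp_vpow (by positivity : 0 < 1 / m)
      ((memLp_indicator_iff_restrict hKc.measurableSet).1 (hvp K hKc hK))
    simp only [vpow_vpow hm (mul_one_div_cancel hm.ne'), one_div_one_div] at h1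
    rwa [add_comm]
  · obtain ⟨K, hKc, hφK, hK⟩ := exists_compact_between_cylinder hΩ hφ.2.1 hφ.2.2
    obtain ⟨C, hC⟩ := hloc K hKc hK
    have hφ' : IsTestFunction (interior K) φ := ⟨hφ.1, hφ.2.1, hφK⟩
    have hle : volume.restrict K ≤ volume.restrict (cylinder Ω T) := Measure.restrict_mono_set _ hK
    have := isFiniteMeasure_restrict.2 (hKc.measure_lt_top (μ := volume)).ne
    rw [hA.setIntegral_eqn_eq hμ hm hKc hK (hvp K hKc hK) (hG.grad_memLp K hKc hK) hφ']
    have h1 := hC.tendsto_integral_inner hφ.2.1 hφK (hφ.memLp_timeDeriv _)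
      fun z hz => timeDeriv_eq_zero hz
    obtain ⟨B, hB⟩ := hφ.continuous_spaceGrad.bounded_above_of_compact_support
      (HasCompactSupport.intro hφ.2.1 fun _ hz => spaceGrad_eq_zero hz)
    have h2 := tendsto_integral_inner_comp (μ := volume.restrict K) (a := fun z => A z 0)
      (y := spaceGrad φ) hL ?_ ?_ (fun i => (hsol i).grad.grad_memLp K hKc hK)
      (hG.grad_memLp K hKc hK)
      (fun i => hA.aestronglyMeasurable_comp hK ((hsol i).grad.grad_memLp K hKc hK).1)
      (hA.aestronglyMeasurable_comp hK (hG.grad_memLp K hKc hK).1)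
      hφ.continuous_spaceGrad.aestronglyMeasurable hB (hstrong K hKc hK).2
    · simp only [fun f : SpaceTime n → Grad N n =>
        setIntegral_inner_eq hKc.measurableSet f (spaceGrad φ)] at h2
      -- For every `i` the time term equals the flux term; both converge, so their limits agree.
      have h3 := tendsto_nhds_unique h1 (h2.congr fun i => ((hC.sol i).eqn φ hφ').symm)
      rw [h3, neg_add_cancel]
    · filter_upwards [ae_mono hle hA.continuous] with z hc
      exact hc.comp (by fun_prop : Continuous fun ξ => ((0 : Vec N), ξ))
    · filter_upwards [ae_mono hle hA.growth] with z hz ξ using hz 0 ξ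

end

theorem criticalExponent_nonneg (n : ℕ) : 0 ≤ criticalExponent n := by
  unfold criticalExponent; positivity

end PorousMedium


/-! ### The stability theorem. -/

theorem mainTheorem1 {n N : ℕ} (hn : 2 ≤ n)
    (Ω : Set (EuclideanSpace ℝ (Fin n))) (hΩ : IsOpen Ω) (hΩb : Bornology.IsBounded Ω)
    (T : ℝ) (hT : 0 < T)
    (ν L μ : ℝ) (hν : 0 < ν) (hνL : ν ≤ L) (hμ : 0 < μ)
    (A : PorousMedium.SpaceTime n → PorousMedium.Vec N → PorousMedium.Grad N n →
      PorousMedium.Grad N n)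
    (hA : PorousMedium.IsAdmissibleField Ω T ν L μ A)
    (ms : ℕ → ℝ) (m : ℝ)
    (hms : ∀ i, PorousMedium.criticalExponent n < ms i)
    (hm : PorousMedium.criticalExponent n < m)
    (hlim : Tendsto ms atTop (𝓝 m))
    (us : ℕ → PorousMedium.SpaceTime n → PorousMedium.Vec N)
    (hus : ∀ i, PorousMedium.IsWeakSolution Ω T A (ms i) (us i))
    (u : PorousMedium.SpaceTime n → PorousMedium.Vec N)
    (hu : AEMeasurable u (volume.restrict (PorousMedium.cylinder Ω T)))
    (hweak : PorousMedium.TendstoWeaklyL2Loc (PorousMedium.cylinder Ω T)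
      (fun i z => PorousMedium.vpow (ms i) (us i z)) (fun z => PorousMedium.vpow m (u z)))
    (hbdd : m < 1 → PorousMedium.BoundedL1Loc (PorousMedium.cylinder Ω T)
      (fun i z => PorousMedium.vpow (ms i + 1) (us i z))) :
    PorousMedium.MemL2W12Loc Ω T (fun z => PorousMedium.vpow m (u z)) ∧
    PorousMedium.TendstoL2W12Loc Ω T
      (fun i z => PorousMedium.vpow (ms i) (us i z)) (fun z => PorousMedium.vpow m (u z)) ∧
    PorousMedium.IsWeakSolution Ω T A m u := by
  have hm0 : 0 < m := (PorousMedium.criticalExponent_nonneg n).trans_lt hm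
  have hms0 : ∀ i, 0 < ms i := fun i => (PorousMedium.criticalExponent_nonneg n).trans_lt (hms i)
  obtain ⟨q, δ, s, hq, hqn, hδ0, hδ, hδq, hsq, hs, hδs⟩ := PorousMedium.exists_exponents hn hm
  choose hum hump Gs hGs heqn using hus
  have hinv : Tendsto (fun i => 1 / ms i) atTop (𝓝 (1 / m)) := by
    simpa using hlim.inv₀ hm0.ne'
  -- The exponents `1 / mᵢ` lie in the admissible window of width `δ` only from some index on, so
  -- the sequence is shifted by `i₀`; convergence statements are insensitive to this.
  obtain ⟨i₀, hi₀⟩ := Metric.tendsto_atTop.1 hinv δ hδ0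
  obtain ⟨G, hG, hstrong⟩ := PorousMedium.exists_isSolWith_limit (ms := fun i => ms (i + i₀))
    (us := fun i => us (i + i₀)) (Gs := fun i => Gs (i + i₀)) (u := u)
    hn hΩ hA hμ hν (hν.le.trans hνL) hq hqn hm0 hδ hδq hsq hs hδs (fun i => hms0 _)
    (fun i => (hi₀ _ (Nat.le_add_left _ _)).le) ((tendsto_add_atTop_iff_nat i₀).2 hlim)
    (fun i => ⟨hump _, hGs _, heqn _⟩)
    ⟨fun i => hweak.1 _, hweak.2.1, fun K hKc hK ψ hψ =>
      (tendsto_add_atTop_iff_nat i₀).2 (hweak.2.2 K hKc hK ψ hψ)⟩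
    (fun h K hKc hK => (hbdd h K hKc hK).imp fun C hC i => hC _)
  refine ⟨⟨G, hG.grad⟩, ⟨Gs, G, hGs, hG.grad, fun K hKc hK => ?_⟩, hu, hG.memLp, G, hG.grad, hG.eqn⟩
  exact ⟨(tendsto_add_atTop_iff_nat i₀).1 (hstrong K hKc hK).1,
    (tendsto_add_atTop_iff_nat i₀).1 (hstrong K hKc hK).2⟩
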